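/- Let $\mathbb F_q$ be a finite field, $X$ a smooth projective geometrically connected curve over $\mathbb F_q$, and $E$ a field over $\mathbb F_q$. Products are taken over $\mathbb F_q$. For a scheme $S$ over $\mathbb F_q$ let $\mathrm{Fr}_S$ be its $q$-Frobenius, $\Phi_S=\mathrm{id}_X\times \mathrm{Fr}_S$ on $X\times S$, and let $\Gamma_a\subset X\times S$ be the graph of a morphism $a:S\to X$. A shtuka of rank $d$ over $S$ with zero $\alpha:S\to X$ and pole $\beta:S\to X$ is a diagram $\Phi_S^*\mathscr F\xrightarrow{f}\mathscr F'\xleftarrow{g}\mathscr F$ of injective morphisms of locally free sheaves of rank $d$ on $X\times S$ such that $\operatorname{coker} f$ is an invertible sheaf on $\Gamma_\alpha$ and $\operatorname{coker} g$ is an invertible sheaf on $\Gamma_\beta$. Let $\alpha,\beta:\operatorname{Spec}E\to X$ be morphisms over $\mathbb F_q$ satisfying $(*)$ the graphs $\Gamma_{\mathrm{Fr}_X^i\circ\alpha}$, $\Gamma_{\mathrm{Fr}_X^j\circ\beta}$ $(i,j\ge 0)$ are mutually disjoint subsets of $X\times\operatorname{Spec}E$, and let $\mathscr F$ be a shtuka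 of rank $d$ over $\operatorname{Spec}E$ with zero $\alpha$ and pole $\beta$. Put ${}^{\tau^i}\mathscr F=(\Phi_E^*)^i\mathscr F$ and ${}^\tau\mathscr F=\Phi_E^*\mathscr F$. Let $P^\sharp$ be the projective space over $E$ of lines in ${}^\tau\mathscr F(\alpha)/{}^\tau\mathscr F$, let $P^\flat$ be the projective space over $E$ of one-dimensional quotients of ${}^\tau\mathscr F/{}^\tau\mathscr F(-\beta)$, and put $P^\natural=P^\sharp\times_E P^\flat$. The upper modification ${}^\tau\mathscr F\subset\mathscr F'$ at $\alpha$ gives the line $\mathscr F'/{}^\tau\mathscr F\subset{}^\tau\mathscr F(\alpha)/{}^\tau\mathscr F$, and the lower modification ${}^\tau\mathscr F\cap\mathscr F\subset{}^\tau\mathscr F$ at $\beta$ gives the quotient ${}^\tau\mathscr F/({}^\tau\mathscr F\cap\mathscr F)\cong\mathscr F'/\mathscr F$; let $p^\natural\in P^\natural(E)$ be the point that they define. Let $\mathrm{ArtAlg}_E$ be the category of local Artinian $E$-algebras with residue field identified with $E$ as an $E$-algebra; its morphisms are the local homomorphisms of $E$-algebras that induce the identity on the residue field. For $A\in\mathrm{ArtAlg}_E$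 let $\mathsf p_A:\operatorname{Spec}A\to\operatorname{Spec}E$ be the structure morphism and $e_A:\operatorname{Spec}E\to\operatorname{Spec}A$ the closed point. Let $G_1(A)$ be the set of isomorphism classes of deformations of $\mathscr F$ to $\operatorname{Spec} A$, that is, of shtukas $\widetilde{\mathscr F}$ over $\operatorname{Spec}A$ of rank $d$ with zero $\alpha\circ\mathsf p_A$ and pole $\beta\circ\mathsf p_A$, together with an isomorphism $e_A^*\widetilde{\mathscr F}\cong\mathscr F$. Let $G_2(A)$ be the set of $E$-morphisms $h:\operatorname{Spec}A\to P^\natural$ with $h\circ e_A=p^\natural$. Base change makes $G_1$ a functor $\mathrm{ArtAlg}_E\to\mathrm{Sets}$, and composition makes $G_2$ one. Let $\widetilde{\mathscr F}$ be a deformation of $\mathscr F$ to $\operatorname{Spec}A$ and let $n\ge 1$ be such that $x^{q^n}=0$ for all $x$ in the maximal ideal of $A$; such $n$ exist. Then $(\Phi_A^*)^n\widetilde{\mathscr F}\cong(\mathrm{id}_X\times\mathsf p_A)^*({}^{\tau^n}\mathscr F)$ canonically. By $(*)$, for $1\le i<n$ the maps $(\Phi_A^*)^{i+1}\widetilde{\mathscr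 F}\to(\Phi_A^*)^i\widetilde{\mathscr F}'\leftarrow(\Phi_A^*)^i\widetilde{\mathscr F}$, and the analogous maps for $\mathscr F$ over $E$, are isomorphisms along the graphs of $\alpha\circ\mathsf p_A$ and $\beta\circ\mathsf p_A$ (respectively of $\alpha$ and $\beta$), so that along these graphs $\Phi_A^*\widetilde{\mathscr F}$ is identified with $(\mathrm{id}_X\times\mathsf p_A)^*({}^\tau\mathscr F)$. With this identification the upper modification $\Phi_A^*\widetilde{\mathscr F}\subset\widetilde{\mathscr F}'$ at $\alpha\circ\mathsf p_A$ and the lower modification $\Phi_A^*\widetilde{\mathscr F}\cap\widetilde{\mathscr F}\subset\Phi_A^*\widetilde{\mathscr F}$ at $\beta\circ\mathsf p_A$ define a morphism $h:\operatorname{Spec}A\to P^\natural$. Proposition. The morphism $h$ lies in $G_2(A)$, depends neither on $n$ nor on the choice of $\widetilde{\mathscr F}$ in its isomorphism class, and $[\widetilde{\mathscr F}]\mapsto h$ is an isomorphism of functors $\xi:G_1\to G_2$. -/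

import Mathlib

open CategoryTheory CategoryTheory.Limits AlgebraicGeometry

universe u

noncomputable section

namespace Sht

/-! ### Frobenius of a scheme over a finite field -/

section Frobenius

variable (Fq : Type u) [Field Fq] [Fintype Fq]

/-- The `q`-th power map of a commutative ring that receives a ring homomorphism from the field
with `q` elements. -/
def qPow {R : Type u} [CommRing R] (ψ : Fq →+* R) : R →+* R :=
  letI := ψ.toAlgebra
  (FiniteField.frobeniusAlgHom Fq R).toRingHom

theorem qPow_apply {R : Type u} [CommRing R] (ψ : Fq →+* R) (x : R) :
    qPow Fq ψ x = x ^ Fintype.card Fq := rfl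

/-- The scalars of a ring of sections of a scheme over `Spec Fq`. -/
def sectionScalars {Y : Scheme.{u}} (h : Y ⟶ Spec (.of Fq)) (U : Y.Opens) : Fq →+* Γ(Y, U) :=
  ((Scheme.ΓSpecIso (.of Fq)).inv ≫ h.appTop ≫ Y.presheaf.map (homOfLE le_top).op).hom

/-- The Frobenius as a morphism of ringed spaces: the identity on points, `x ↦ x ^ q` on
sections. -/
def frobPre {Y : Scheme.{u}} (h : Y ⟶ Spec (.of Fq)) :
    Y.toPresheafedSpace.Hom Y.toPresheafedSpace where
  base := 𝟙 _
  c :=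
    { app := fun U => CommRingCat.ofHom (qPow Fq (sectionScalars Fq h U.unop))
      naturality := fun U V i => by
        ext x
        exact (map_pow (Y.presheaf.map i).hom x (Fintype.card Fq)).symm }

theorem frobPre_local {Y : Scheme.{u}} (h : Y ⟶ Spec (.of Fq)) (y : Y) :
    IsLocalHom ((frobPre Fq h).stalkMap y).hom := by
  refine ⟨fun a ha => ?_⟩
  obtain ⟨U, hU, s, rfl⟩ := TopCat.Presheaf.exists_germ_eq (F := Y.presheaf) (x := y) a
  have : ((frobPre Fq h).stalkMap y).hom (Y.presheaf.germ U y hU s)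
      = (Y.presheaf.germ U y hU s) ^ Fintype.card Fq := by
    rw [← map_pow]
    exact PresheafedSpace.stalkMap_germ_apply (frobPre Fq h) U y hU s
  rw [this] at ha
  exact (isUnit_pow_iff Fintype.card_ne_zero).mp ha

/-- The Frobenius endomorphism, relative to `Fq`, of a scheme over `Spec Fq`. -/
def frobHom {Y : Scheme.{u}} (h : Y ⟶ Spec (.of Fq)) : Y ⟶ Y :=
  ⟨⟨frobPre Fq h, frobPre_local Fq h⟩⟩

theorem frobHom_appTop {Y : Scheme.{u}} (h : Y ⟶ Spec (.of Fq)) (x : Γ(Y, ⊤)) :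
    (frobHom Fq h).appTop x = x ^ Fintype.card Fq := rfl

theorem frobHom_comp {Y : Scheme.{u}} (h : Y ⟶ Spec (.of Fq)) : frobHom Fq h ≫ h = h := by
  refine ext_of_isAffine ?_
  ext x
  rw [Scheme.Hom.comp_appTop]
  change (h.appTop x) ^ Fintype.card Fq = h.appTop x
  rw [← map_pow]
  congr 1
  apply (Scheme.ΓSpecIso (.of Fq)).commRingCatIsoToRingEquiv.injective
  rw [map_pow]
  exact FiniteField.pow_card _

theorem frobHom_naturality {Y Z : Scheme.{u}} (h : Y ⟶ Spec (.of Fq)) (k : Z ⟶ Spec (.of Fq))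
    (t : Y ⟶ Z) : frobHom Fq h ≫ t = t ≫ frobHom Fq k := by
  have h0 : (frobHom Fq h ≫ t).base = (t ≫ frobHom Fq k).base := rfl
  refine Scheme.Hom.ext h0 fun U => ?_
  ext x
  change Y.presheaf.map (𝟙 _) ((t.app U x) ^ Fintype.card Fq) = t.app U (x ^ Fintype.card Fq)
  rw [CategoryTheory.Functor.map_id]
  exact (map_pow (t.app U).hom x _).symm

/-- The Frobenius of `S`, as an endomorphism over `Fq`. -/
def frob {Fq : Type u} [Field Fq] [Fintype Fq] (S : Over (Spec (CommRingCat.of Fq))) : S ⟶ S :=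
  Over.homMk (frobHom Fq S.hom) (frobHom_comp Fq S.hom)

/-- The iterated Frobenius of `S`. -/
def frobPow {Fq : Type u} [Field Fq] [Fintype Fq] (S : Over (Spec (CommRingCat.of Fq))) :
    ℕ → (S ⟶ S)
  | 0 => 𝟙 S
  | n + 1 => frobPow S n ≫ frob S

theorem frob_naturality {Fq : Type u} [Field Fq] [Fintype Fq]
    {S T : Over (Spec (CommRingCat.of Fq))} (t : T ⟶ S) : frob T ≫ t = t ≫ frob S :=
  Over.OverMorphism.ext (frobHom_naturality Fq T.hom S.hom t.left)

end Frobenius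

/-! ### Projective spaces -/

section ProjectiveSpace

open scoped DirectSum

variable (K : Type u) [Field K] (V : Type u) [AddCommGroup V] [Module K V]

/-- The degree `n` part of the symmetric algebra. -/
abbrev symDeg (n : ℕ) : Submodule K (SymmetricAlgebra K V) :=
  LinearMap.range (SymmetricAlgebra.ι K V) ^ n

/-- The inclusion of `V` in degree one. -/
def symDegι : V →ₗ[K] ⨁ i : ℕ, symDeg K V i :=
  DirectSum.lof K ℕ (fun i => symDeg K V i) 1 ∘ₗ
    (SymmetricAlgebra.ι K V).codRestrict _ fun m => by
      simpa only [pow_one] using LinearMap.mem_range_self _ m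

theorem symDegι_apply (v : V) :
    symDegι K V v = DirectSum.of (fun i : ℕ => symDeg K V i) 1
      ⟨SymmetricAlgebra.ι K V v, by simpa only [pow_one] using LinearMap.mem_range_self _ v⟩ :=
  rfl

instance symGraded : GradedAlgebra (symDeg K V) :=
  GradedAlgebra.ofAlgHom _ (SymmetricAlgebra.lift (symDegι K V))
    (by
      apply SymmetricAlgebra.algHom_ext
      ext m
      change DirectSum.coeAlgHom (symDeg K V) (SymmetricAlgebra.lift (symDegι K V)
        (SymmetricAlgebra.ι K V m)) = SymmetricAlgebra.ι K V m
      rw [SymmetricAlgebra.lift_ι_apply, symDegι_apply, DirectSum.coeAlgHom_of, Subtype.coe_mk])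
    fun i x => by
    obtain ⟨x, hx⟩ := x
    dsimp only [Subtype.coe_mk, DirectSum.lof_eq_of]
    induction hx using Submodule.pow_induction_on_left' with
    | algebraMap r =>
      rw [AlgHom.commutes, DirectSum.algebraMap_apply]; rfl
    | add x y i hx hy ihx ihy =>
      rw [map_add, ihx, ihy, ← map_add]
      rfl
    | mem_mul m hm i x hx ih =>
      obtain ⟨_, rfl⟩ := hm
      rw [map_mul, ih, SymmetricAlgebra.lift_ι_apply, symDegι_apply, DirectSum.of_mul_of]
      exact DirectSum.of_eq_of_gradedMonoid_eq (Sigma.subtype_ext (add_comm _ _) rfl)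

/-- The projective space `ℙ(V) = Proj (Sym V)` of one-dimensional quotients of `V`. -/
def projSpace : Scheme.{u} := Proj (symDeg K V)

/-- The structure morphism `ℙ(V) ⟶ Spec K`. -/
def projSpaceHom : projSpace K V ⟶ Spec (.of K) :=
  Proj.toSpecZero (symDeg K V) ≫ Spec.map (CommRingCat.ofHom (algebraMap K (symDeg K V 0)))

/-- The projective space `ℙᵛ(V) = ℙ(Vᵛ)` of lines in a finite-dimensional space `V`. -/
abbrev dualProjSpace : Scheme.{u} := projSpace K (Module.Dual K V)

variable {K V}

/-- A `K`-linear map from `V` to a `K`-algebra `A`, the values of which generate the unit ideal,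
that is, a surjection `A ⊗ V ⟶ A`, defines a morphism `Spec A ⟶ ℙ(V)`. -/
def projPoint {A : Type u} [CommRing A] [Algebra K A] (φ : V →ₗ[K] A)
    (hφ : Ideal.span (Set.range φ) = ⊤) : Spec (.of A) ⟶ projSpace K V :=
  Proj.fromOfGlobalSections (symDeg K V)
    ((Scheme.ΓSpecIso (.of A)).inv.hom.comp (SymmetricAlgebra.lift φ).toRingHom) (by
      have h1 : (HomogeneousIdeal.irrelevant (symDeg K V)).toIdeal.map
          (SymmetricAlgebra.lift φ).toRingHom = ⊤ := by
        rw [eq_top_iff, ← hφ, Ideal.span_le]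
        rintro _ ⟨v, rfl⟩
        have hv : SymmetricAlgebra.ι K V v ∈
            (HomogeneousIdeal.irrelevant (symDeg K V)).toIdeal := by
          have h2 : SymmetricAlgebra.ι K V v ∈ symDeg K V 1 := by simp [symDeg]
          change (SymmetricAlgebra.ι K V v) ∈ HomogeneousIdeal.irrelevant (symDeg K V)
          rw [HomogeneousIdeal.mem_irrelevant_iff, GradedRing.proj_apply,
            DirectSum.decompose_of_mem_ne (symDeg K V) h2 one_ne_zero]
        have := Ideal.mem_map_of_mem (SymmetricAlgebra.lift φ).toRingHom hv
        simpa using this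
      rw [← Ideal.map_map, h1, Ideal.map_top])

/-- `Y` is projective over the field `K`: a closed subscheme of a projective space. -/
def IsProjective {Y : Scheme.{u}} (h : Y ⟶ Spec (.of K)) : Prop :=
  ∃ (n : ℕ) (i : Y ⟶ projSpace K (ULift.{u} (Fin (n + 1)) → K)),
    IsClosedImmersion i ∧ i ≫ projSpaceHom K _ = h

end ProjectiveSpace

/-! ### Products with the curve, graphs, and sheaves -/

section Product

variable {Fq : Type u} [Field Fq] (X : Over (Spec (CommRingCat.of Fq)))

/-- The fibre product `X × S` over `Fq`. -/
abbrev prodS (S : Over (Spec (CommRingCat.of Fq))) : Scheme.{u} := pullback X.hom S.hom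

/-- The morphism `id × t : X × T ⟶ X × S`. -/
def prodMap {S T : Over (Spec (CommRingCat.of Fq))} (t : T ⟶ S) : prodS X T ⟶ prodS X S :=
  pullback.lift (pullback.fst X.hom T.hom) (pullback.snd X.hom T.hom ≫ t.left)
    (by simp [pullback.condition])

theorem prodMap_fst {S T : Over (Spec (CommRingCat.of Fq))} (t : T ⟶ S) :
    prodMap X t ≫ pullback.fst X.hom S.hom = pullback.fst X.hom T.hom :=
  pullback.lift_fst _ _ _

theorem prodMap_snd {S T : Over (Spec (CommRingCat.of Fq))} (t : T ⟶ S) :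
    prodMap X t ≫ pullback.snd X.hom S.hom = pullback.snd X.hom T.hom ≫ t.left :=
  pullback.lift_snd _ _ _

theorem prodMap_comp {S T U : Over (Spec (CommRingCat.of Fq))} (r : U ⟶ T) (t : T ⟶ S) :
    prodMap X (r ≫ t) = prodMap X r ≫ prodMap X t := by
  apply pullback.hom_ext
  · rw [Category.assoc, prodMap_fst, prodMap_fst, prodMap_fst]
  · rw [Category.assoc, prodMap_snd, prodMap_snd, ← Category.assoc, prodMap_snd, Category.assoc,
      Over.comp_left]

theorem prodMap_id (S : Over (Spec (CommRingCat.of Fq))) : prodMap X (𝟙 S) = 𝟙 _ := by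
  apply pullback.hom_ext <;> simp [prodMap]

/-- The morphism `Φ = id × Fr` of `X × S`. -/
def Phi [Fintype Fq] (S : Over (Spec (CommRingCat.of Fq))) : prodS X S ⟶ prodS X S := prodMap X (frob S)

theorem prodMap_Phi [Fintype Fq] {S T : Over (Spec (CommRingCat.of Fq))} (t : T ⟶ S) :
    prodMap X t ≫ Phi X S = Phi X T ≫ prodMap X t := by
  rw [Phi, Phi, ← prodMap_comp, ← prodMap_comp, frob_naturality]

variable {X}

/-- The graph `(a, id) : S ⟶ X × S` of `a : S ⟶ X`. -/
def graph {S : Over (Spec (CommRingCat.of Fq))} (a : S ⟶ X) : S.left ⟶ prodS X S :=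
  pullback.lift a.left (𝟙 S.left) (by simp)

theorem graph_fst {S : Over (Spec (CommRingCat.of Fq))} (a : S ⟶ X) :
    graph a ≫ pullback.fst X.hom S.hom = a.left :=
  pullback.lift_fst _ _ _

theorem graph_snd {S : Over (Spec (CommRingCat.of Fq))} (a : S ⟶ X) :
    graph a ≫ pullback.snd X.hom S.hom = 𝟙 S.left :=
  pullback.lift_snd _ _ _

theorem graph_prodMap {S T : Over (Spec (CommRingCat.of Fq))} (t : T ⟶ S) (a : S ⟶ X) :
    graph (t ≫ a) ≫ prodMap X t = t.left ≫ graph a := by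
  apply pullback.hom_ext
  · rw [Category.assoc, prodMap_fst, graph_fst, Category.assoc, graph_fst, Over.comp_left]
  · rw [Category.assoc, prodMap_snd, ← Category.assoc, graph_snd, Category.assoc, graph_snd,
      Category.id_comp, Category.comp_id]

/-- The graphs of all `Fr_X ^ i ∘ α` and `Fr_X ^ j ∘ β`, for `i, j ≥ 0`, are mutually disjoint
subsets of `X × S`. -/
def DisjointFrobeniusGraphs [Fintype Fq] {S : Over (Spec (CommRingCat.of Fq))} (α β : S ⟶ X) : Prop :=
  Pairwise fun k l : Bool × ℕ =>
    Disjoint (Set.range (graph ((if k.1 then α else β) ≫ frobPow X k.2)))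
      (Set.range (graph ((if l.1 then α else β) ≫ frobPow X l.2)))

/-- The sheaf of modules `M` is locally free of rank `d`. -/
def IsLocallyFreeOfRank {Y : Scheme.{u}} (M : Y.Modules) (d : ℕ) : Prop :=
  ∀ y : Y, ∃ U : Y.Opens, y ∈ U ∧
    Nonempty (M.restrict U.ι ≅
      (SheafOfModules.free (R := U.toScheme.ringCatSheaf) (ULift.{u} (Fin d)) :
        U.toScheme.Modules))

/-- The sheaf `C` on `X × S` is (the direct image of) an invertible sheaf on the graph of `a`. -/
def IsInvertibleOnGraph {S : Over (Spec (CommRingCat.of Fq))} (a : S ⟶ X)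
    (C : (prodS X S).Modules) : Prop :=
  ∃ L : S.left.Modules, IsLocallyFreeOfRank L 1 ∧
    Nonempty (C ≅ (Scheme.Modules.pushforward (graph a)).obj L)

end Product

/-! ### Shtukas -/

section Shtuka

variable {Fq : Type u} [Field Fq] [Fintype Fq]

/-- A diagram `Φ^* F ⟶ F' ⟵ F` of sheaves of modules on `X × S`. -/
structure ShtukaDiagram (X S : Over (Spec (CommRingCat.of Fq))) where
  F : (prodS X S).Modules
  F' : (prodS X S).Modules
  f : (Scheme.Modules.pullback (Phi X S)).obj F ⟶ F'
  g : F ⟶ F'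

/-- The diagram `Φ^* F ⟶ F' ⟵ F` is a (right) shtuka of rank `d` with zero `α` and pole `β`. -/
structure IsShtuka {X S : Over (Spec (CommRingCat.of Fq))} (D : ShtukaDiagram X S) (d : ℕ)
    (α β : S ⟶ X) : Prop where
  locallyFree : IsLocallyFreeOfRank D.F d
  locallyFree' : IsLocallyFreeOfRank D.F' d
  mono_f : Mono D.f
  mono_g : Mono D.g
  zero : IsInvertibleOnGraph α (cokernel D.f)
  pole : IsInvertibleOnGraph β (cokernel D.g)

/-- The canonical isomorphism `(id × t)^* Φ_S^* ≅ Φ_T^* (id × t)^*`. -/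
def pullbackPhi (X : Over (Spec (CommRingCat.of Fq))) {S T : Over (Spec (CommRingCat.of Fq))}
    (t : T ⟶ S) :
    Scheme.Modules.pullback (Phi X S) ⋙ Scheme.Modules.pullback (prodMap X t) ≅
      Scheme.Modules.pullback (prodMap X t) ⋙ Scheme.Modules.pullback (Phi X T) :=
  Scheme.Modules.pullbackComp (prodMap X t) (Phi X S) ≪≫
    Scheme.Modules.pullbackCongr (prodMap_Phi X t) ≪≫
    (Scheme.Modules.pullbackComp (Phi X T) (prodMap X t)).symm

/-- An isomorphism of diagrams `t^* D ≅ D'`, for `t : T ⟶ S`. -/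
structure PullbackIso {X S T : Over (Spec (CommRingCat.of Fq))} (t : T ⟶ S)
    (D : ShtukaDiagram X S) (D' : ShtukaDiagram X T) where
  iso : (Scheme.Modules.pullback (prodMap X t)).obj D.F ≅ D'.F
  iso' : (Scheme.Modules.pullback (prodMap X t)).obj D.F' ≅ D'.F'
  comm_f : (Scheme.Modules.pullback (prodMap X t)).map D.f ≫ iso'.hom =
    (pullbackPhi X t).hom.app D.F ≫ (Scheme.Modules.pullback (Phi X T)).map iso.hom ≫ D'.f
  comm_g : (Scheme.Modules.pullback (prodMap X t)).map D.g ≫ iso'.hom = iso.hom ≫ D'.g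

/-- The functor `(Φ^*)^n`. -/
def tau (X S : Over (Spec (CommRingCat.of Fq))) : ℕ → ((prodS X S).Modules ⥤ (prodS X S).Modules)
  | 0 => 𝟭 _
  | n + 1 => Scheme.Modules.pullback (Phi X S) ⋙ tau X S n

/-- The morphism `Φ^n`. -/
def PhiPow (X S : Over (Spec (CommRingCat.of Fq))) : ℕ → (prodS X S ⟶ prodS X S)
  | 0 => 𝟙 _
  | n + 1 => PhiPow X S n ≫ Phi X S

theorem PhiPow_eq (X S : Over (Spec (CommRingCat.of Fq))) (n : ℕ) :
    PhiPow X S n = prodMap X (frobPow S n) := by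
  induction n with
  | zero => exact (prodMap_id X S).symm
  | succ n ih => rw [PhiPow, frobPow, prodMap_comp, ih, Phi]

/-- The canonical isomorphism `(Φ^*)^n ≅ (Φ^n)^*`. -/
def tauIso (X S : Over (Spec (CommRingCat.of Fq))) :
    ∀ n : ℕ, tau X S n ≅ Scheme.Modules.pullback (PhiPow X S n)
  | 0 => (Scheme.Modules.pullbackId _).symm
  | n + 1 => Functor.isoWhiskerLeft (Scheme.Modules.pullback (Phi X S)) (tauIso X S n) ≪≫
      Scheme.Modules.pullbackComp (PhiPow X S n) (Phi X S)

/-- Restriction of sheaves on `X × S` to the graph of `a : S ⟶ X`. -/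
abbrev fib {X S : Over (Spec (CommRingCat.of Fq))} (a : S ⟶ X) :
    (prodS X S).Modules ⥤ S.left.Modules :=
  Scheme.Modules.pullback (graph a)

open scoped Classical in
/-- The inverse of `m` if `m` is an isomorphism, and `0` otherwise. -/
def invOrZero {Y : Scheme.{u}} {M N : Y.Modules} (m : M ⟶ N) : N ⟶ M :=
  if _h : IsIso m then inv m else 0

variable {X S : Over (Spec (CommRingCat.of Fq))}

/-- The identification, along the graph of `a`, of `(Φ^*)^(i+1) F` with `(Φ^*)^i F` through
`(Φ^*)^(i+1) F ⟶ (Φ^*)^i F' ⟵ (Φ^*)^i F`. It is used only where the graph of `a` does not meet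
the loci where these two maps fail to be isomorphisms. -/
def stepDown (D : ShtukaDiagram X S) (a : S ⟶ X) (i : ℕ) :
    (fib a).obj ((tau X S (i + 1)).obj D.F) ⟶ (fib a).obj ((tau X S i).obj D.F) :=
  (fib a).map ((tau X S i).map D.f) ≫ invOrZero ((fib a).map ((tau X S i).map D.g))

/-- The identification inverse to `stepDown`. -/
def stepUp (D : ShtukaDiagram X S) (a : S ⟶ X) (i : ℕ) :
    (fib a).obj ((tau X S i).obj D.F) ⟶ (fib a).obj ((tau X S (i + 1)).obj D.F) :=
  (fib a).map ((tau X S i).map D.g) ≫ invOrZero ((fib a).map ((tau X S i).map D.f))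

/-- The identification along the graph of `a` of `(Φ^*)^(n+1) F` with `Φ^* F`. -/
def toOne (D : ShtukaDiagram X S) (a : S ⟶ X) : ∀ n : ℕ,
    (fib a).obj ((tau X S (n + 1)).obj D.F) ⟶ (fib a).obj ((tau X S 1).obj D.F)
  | 0 => 𝟙 _
  | n + 1 => stepDown D a (n + 1) ≫ toOne D a n

/-- The identification along the graph of `a` of `Φ^* F` with `(Φ^*)^(n+1) F`. -/
def fromOne (D : ShtukaDiagram X S) (a : S ⟶ X) : ∀ n : ℕ,
    (fib a).obj ((tau X S 1).obj D.F) ⟶ (fib a).obj ((tau X S (n + 1)).obj D.F)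
  | 0 => 𝟙 _
  | n + 1 => fromOne D a n ≫ stepUp D a (n + 1)

end Shtuka

/-! ### Local Artinian algebras -/

section Artinian

/-- A local Artinian `E`-algebra whose residue field is identified with `E`; the
identification is given by the augmentation, the kernel of which is the maximal ideal. -/
structure ArtAlg (E : Type u) [Field E] where
  carrier : Type u
  [commRing : CommRing carrier]
  [algebra : Algebra E carrier]
  [isLocalRing : IsLocalRing carrier]
  [isArtinianRing : IsArtinianRing carrier]
  aug : carrier →ₐ[E] E

attribute [instance] ArtAlg.commRing ArtAlg.algebra ArtAlg.isLocalRing ArtAlg.isArtinianRing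

variable {E : Type u} [Field E]

theorem ArtAlg.ker_aug (A : ArtAlg E) :
    RingHom.ker A.aug = IsLocalRing.maximalIdeal A.carrier :=
  IsLocalRing.eq_maximalIdeal (RingHom.ker_isMaximal_of_surjective A.aug
    fun c => ⟨algebraMap E A.carrier c, by simp⟩)

/-- Morphisms are the homomorphisms of `E`-algebras that induce the identity on the residue
field; they are automatically local. -/
instance : Category (ArtAlg E) where
  Hom A B := { φ : A.carrier →ₐ[E] B.carrier // B.aug.comp φ = A.aug }
  id A := ⟨AlgHom.id E A.carrier, AlgHom.comp_id _⟩
  comp φ ψ := ⟨ψ.1.comp φ.1, by rw [← AlgHom.comp_assoc, ψ.2, φ.2]⟩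

/-- Every element of the maximal ideal satisfies `x ^ (q ^ n) = 0`. -/
def ArtAlg.FrobNilpotent (A : ArtAlg E) (q n : ℕ) : Prop :=
  ∀ x ∈ IsLocalRing.maximalIdeal A.carrier, x ^ q ^ n = 0

variable (Fq : Type u) [Field Fq] [Algebra Fq E]

variable (E) in
/-- `Spec E` over `Fq`. -/
abbrev specE : Over (Spec (CommRingCat.of Fq)) :=
  Over.mk (Spec.map (CommRingCat.ofHom (algebraMap Fq E)))

/-- `Spec A` over `Fq`. -/
abbrev specA (A : ArtAlg E) : Over (Spec (CommRingCat.of Fq)) :=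
  Over.mk (Spec.map (CommRingCat.ofHom (algebraMap E A.carrier)) ≫ (specE E Fq).hom)

/-- The structure morphism `Spec A ⟶ Spec E`. -/
def structMor (A : ArtAlg E) : specA Fq A ⟶ specE E Fq :=
  Over.homMk (Spec.map (CommRingCat.ofHom (algebraMap E A.carrier))) rfl

/-- The closed point `Spec E ⟶ Spec A`. -/
def closedPt (A : ArtAlg E) : specE E Fq ⟶ specA Fq A :=
  Over.homMk (Spec.map (CommRingCat.ofHom A.aug.toRingHom)) (by
    simp only [Over.mk_hom, Over.mk_left]
    rw [← Category.assoc, ← Spec.map_comp, ← CommRingCat.ofHom_comp]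
    have : A.aug.toRingHom.comp (algebraMap E A.carrier) = RingHom.id E := by
      ext x; simp
    rw [this]
    simp)

/-- The morphism `Spec B ⟶ Spec A` given by a morphism `A ⟶ B`. -/
def specMap {A B : ArtAlg E} (φ : A ⟶ B) : specA Fq B ⟶ specA Fq A :=
  Over.homMk (Spec.map (CommRingCat.ofHom φ.1.toRingHom)) (by
    simp only [Over.mk_hom, Over.mk_left]
    rw [← Category.assoc, ← Spec.map_comp, ← CommRingCat.ofHom_comp]
    congr 4
    ext x
    exact φ.1.commutes x)

theorem specMap_structMor {A B : ArtAlg E} (φ : A ⟶ B) :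
    specMap Fq φ ≫ structMor Fq A = structMor Fq B := by
  ext1
  simp only [specMap, structMor, Over.comp_left, Over.homMk_left]
  rw [← Spec.map_comp, ← CommRingCat.ofHom_comp]
  congr 2
  ext x
  exact φ.1.commutes x

theorem closedPt_specMap {A B : ArtAlg E} (φ : A ⟶ B) :
    closedPt Fq B ≫ specMap Fq φ = closedPt Fq A := by
  ext1
  simp only [specMap, closedPt, Over.comp_left, Over.homMk_left]
  rw [← Spec.map_comp, ← CommRingCat.ofHom_comp]
  congr 2
  exact congrArg AlgHom.toRingHom φ.2

end Artinian

/-! ### Comparison of a deformation with the original shtuka -/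

section Comparison

variable {Fq : Type u} [Field Fq] [Fintype Fq] {E : Type u} [Field E] [Algebra Fq E]

theorem qPow_iter_eq (A : ArtAlg E) {n : ℕ} (hn : A.FrobNilpotent (Fintype.card Fq) n)
    (x : A.carrier) :
    x ^ Fintype.card Fq ^ n = algebraMap E A.carrier (A.aug x) ^ Fintype.card Fq ^ n := by
  obtain ⟨p, hp⟩ := CharP.exists Fq
  obtain ⟨k, hpr, hk⟩ := FiniteField.card Fq p
  have : Fact p.Prime := ⟨hpr⟩
  have : ExpChar A.carrier p := by
    have : ExpChar Fq p := ExpChar.prime hpr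
    exact expChar_of_injective_ringHom
      (((algebraMap E A.carrier).comp (algebraMap Fq E)).injective) p
  have h1 : x - algebraMap E A.carrier (A.aug x) ∈ IsLocalRing.maximalIdeal A.carrier := by
    rw [← A.ker_aug, RingHom.mem_ker]
    simp
  have h2 := hn _ h1
  rw [hk, ← pow_mul, sub_pow_expChar_pow, sub_eq_zero] at h2
  rw [hk, ← pow_mul, h2]

theorem frobPow_naturality {S T : Over (Spec (CommRingCat.of Fq))} (t : T ⟶ S) (n : ℕ) :
    frobPow T n ≫ t = t ≫ frobPow S n := by
  induction n with
  | zero => simp [frobPow]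
  | succ n ih =>
    rw [frobPow, frobPow, Category.assoc, frob_naturality, ← Category.assoc, ih, Category.assoc]

theorem frobPow_appTop (S : Over (Spec (CommRingCat.of Fq))) (n : ℕ) (x : Γ(S.left, ⊤)) :
    (frobPow S n).left.appTop x = x ^ Fintype.card Fq ^ n := by
  induction n generalizing x with
  | zero => simp [frobPow]
  | succ n ih =>
    rw [frobPow, Over.comp_left, Scheme.Hom.comp_appTop, CommRingCat.comp_apply, ih, pow_succ,
      pow_mul']
    rfl

theorem frobPow_specA (A : ArtAlg E) {n : ℕ} (hn : A.FrobNilpotent (Fintype.card Fq) n) :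
    frobPow (specA Fq A) n = structMor Fq A ≫ frobPow (specE E Fq) n ≫ closedPt Fq A := by
  have key : frobPow (specA Fq A) n =
      structMor Fq A ≫ closedPt Fq A ≫ frobPow (specA Fq A) n := by
    have h0 : (structMor Fq A ≫ closedPt Fq A).left = Spec.map (CommRingCat.ofHom
        ((algebraMap E A.carrier).comp A.aug.toRingHom)) := by
      rw [CommRingCat.ofHom_comp, Spec.map_comp]
      rfl
    rw [← Category.assoc]
    ext1
    have : IsAffine (specA Fq A).left := inferInstanceAs (IsAffine (Spec (.of A.carrier)))
    refine ext_of_isAffine ?_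
    rw [Over.comp_left, h0, Scheme.Hom.comp_appTop]
    ext x
    obtain ⟨y, rfl⟩ := (Scheme.ΓSpecIso (.of A.carrier)).commRingCatIsoToRingEquiv.symm.surjective x
    rw [CommRingCat.comp_apply, frobPow_appTop, map_pow]
    have h1 := congrArg (fun m => m.hom y) (Scheme.ΓSpecIso_inv_naturality (CommRingCat.ofHom
      ((algebraMap E A.carrier).comp A.aug.toRingHom)))
    have h2 : (Scheme.ΓSpecIso (.of A.carrier)).inv.hom (algebraMap E A.carrier (A.aug y)) =
        (Spec.map (CommRingCat.ofHom ((algebraMap E A.carrier).comp A.aug.toRingHom))).appTop.hom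
          ((Scheme.ΓSpecIso (.of A.carrier)).inv.hom y) := h1
    refine Eq.trans ?_ (congrArg (· ^ Fintype.card Fq ^ n) h2)
    change (Scheme.ΓSpecIso (.of A.carrier)).inv.hom y ^ _ = _
    rw [← map_pow, ← map_pow]
    exact congrArg _ (qPow_iter_eq A hn y)
  rw [frobPow_naturality, ← key]

theorem PhiPow_specA (X : Over (Spec (CommRingCat.of Fq))) (A : ArtAlg E) {n : ℕ}
    (hn : A.FrobNilpotent (Fintype.card Fq) n) :
    PhiPow X (specA Fq A) n = prodMap X (structMor Fq A) ≫ PhiPow X (specE E Fq) n ≫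
      prodMap X (closedPt Fq A) := by
  rw [PhiPow_eq, PhiPow_eq, ← prodMap_comp, ← prodMap_comp, frobPow_specA A hn]

variable {X : Over (Spec (CommRingCat.of Fq))}

/-- Let `F` be the sheaf over `Spec E`, `G` a sheaf over `Spec A` that restricts to `F` over the
closed point, and assume that `x ^ (q ^ n) = 0` on the maximal ideal of `A`. This is the canonical
isomorphism of `(id × p_A)^* (Φ_E^*)^n F` with `(Φ_A^*)^n G`, obtained from the factorization
`Φ_A^n = (id × e_A) ∘ Φ_E^n ∘ (id × p_A)`. -/
def compareIso (A : ArtAlg E) {n : ℕ} (hn : A.FrobNilpotent (Fintype.card Fq) n)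
    {F : (prodS X (specE E Fq)).Modules} {G : (prodS X (specA Fq A)).Modules}
    (e : (Scheme.Modules.pullback (prodMap X (closedPt Fq A))).obj G ≅ F) :
    (Scheme.Modules.pullback (prodMap X (structMor Fq A))).obj ((tau X (specE E Fq) n).obj F) ≅
      (tau X (specA Fq A) n).obj G :=
  (Scheme.Modules.pullback (prodMap X (structMor Fq A))).mapIso
      ((tauIso X (specE E Fq) n).app F ≪≫
        (Scheme.Modules.pullback (PhiPow X (specE E Fq) n)).mapIso e.symm ≪≫
        (Scheme.Modules.pullbackComp (PhiPow X (specE E Fq) n)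
          (prodMap X (closedPt Fq A))).app G) ≪≫
    (Scheme.Modules.pullbackComp (prodMap X (structMor Fq A))
      (PhiPow X (specE E Fq) n ≫ prodMap X (closedPt Fq A))).app G ≪≫
    (Scheme.Modules.pullbackCongr (PhiPow_specA X A hn).symm).app G ≪≫
    ((tauIso X (specA Fq A) n).app G).symm

/-- The restriction of the pullback to `X × Spec A` is the pullback of the restriction: the
canonical isomorphism along the graph of `a ∘ p_A`. -/
def fibPullback (A : ArtAlg E) (a : specE E Fq ⟶ X) :
    fib a ⋙ Scheme.Modules.pullback (structMor Fq A).left ≅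
      Scheme.Modules.pullback (prodMap X (structMor Fq A)) ⋙ fib (structMor Fq A ≫ a) :=
  Scheme.Modules.pullbackComp (structMor Fq A).left (graph a) ≪≫
    Scheme.Modules.pullbackCongr (graph_prodMap (structMor Fq A) a).symm ≪≫
    (Scheme.Modules.pullbackComp (graph (structMor Fq A ≫ a))
      (prodMap X (structMor Fq A))).symm

/-- The comparison, along the graph of `a`, of `p_A^* (Φ_E^* F)` with `Φ_A^* G`: both are
identified with `p_A^* (Φ_E^*)^(n+1) F ≅ (Φ_A^*)^(n+1) G`. -/
def compareFib (A : ArtAlg E) {n : ℕ} (hn : A.FrobNilpotent (Fintype.card Fq) (n + 1))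
    (D : ShtukaDiagram X (specE E Fq)) (D' : ShtukaDiagram X (specA Fq A))
    (r : PullbackIso (closedPt Fq A) D' D) (a : specE E Fq ⟶ X) :
    (Scheme.Modules.pullback (structMor Fq A).left).obj
        ((fib a).obj ((tau X (specE E Fq) 1).obj D.F)) ⟶
      (fib (structMor Fq A ≫ a)).obj ((tau X (specA Fq A) 1).obj D'.F) :=
  (Scheme.Modules.pullback (structMor Fq A).left).map (fromOne D a n) ≫
    (fibPullback A a).hom.app ((tau X (specE E Fq) (n + 1)).obj D.F) ≫
    (fib (structMor Fq A ≫ a)).map (compareIso A hn r.iso).hom ≫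
    toOne D' (structMor Fq A ≫ a) n

end Comparison

/-! ### The projective spaces of modifications -/

section Modifications

/-- Global sections of a sheaf of modules on `Spec R`. -/
abbrev gsec {R : Type u} [CommRing R] (M : (Spec (CommRingCat.of R)).Modules) : ModuleCat.{u} R :=
  (moduleSpecΓFunctor (R := CommRingCat.of R)).obj M

/-- The map on global sections. -/
abbrev gmap {R : Type u} [CommRing R] {M N : (Spec (CommRingCat.of R)).Modules} (m : M ⟶ N) :
    gsec M →ₗ[R] gsec N :=
  ((moduleSpecΓFunctor (R := CommRingCat.of R)).map m).hom

/-- Pullback of global sections. -/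
def pullSec {R R' : Type u} [CommRing R] [CommRing R']
    (t : Spec (CommRingCat.of R') ⟶ Spec (CommRingCat.of R))
    (M : (Spec (CommRingCat.of R)).Modules) (v : gsec M) :
    gsec ((Scheme.Modules.pullback t).obj M) :=
  (ConcreteCategory.hom (((Scheme.Modules.pullbackPushforwardAdjunction t).unit.app M).app ⊤) :
    Γ(M, ⊤) → Γ((Scheme.Modules.pullback t).obj M, ⊤)) v

variable {Fq : Type u} [Field Fq] [Fintype Fq] {E : Type u} [Field E] [Algebra Fq E]
  {X : Over (Spec (CommRingCat.of Fq))}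

/-- The ideal sheaf `O(-Γ)` of the graph `Γ` of `a`: the kernel of the restriction of the
structure sheaf to `Γ`. -/
def graphIdeal {S : Over (Spec (CommRingCat.of Fq))} (a : S ⟶ X) : (prodS X S).Modules :=
  kernel ((Scheme.Modules.pullbackPushforwardAdjunction (graph a)).unit.app
    (SheafOfModules.unit (prodS X S).ringCatSheaf : (prodS X S).Modules))

/-- The conormal line of the graph of `a`: the fibre of `O(-a)` at `a`. -/
def conormal (a : specE E Fq ⟶ X) : ModuleCat.{u} E := gsec ((fib a).obj (graphIdeal a))

/-- The fibre of `Φ^* F` at `a`, that is, `Φ^* F / (Φ^* F)(-a)`. -/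
def fibreTau (D : ShtukaDiagram X (specE E Fq)) (a : specE E Fq ⟶ X) : ModuleCat.{u} E :=
  gsec ((fib a).obj ((tau X (specE E Fq) 1).obj D.F))

/-- The space `(Φ^* F)(a) / Φ^* F`: the tensor product of the fibre of `Φ^* F` at `a` with the
dual of the conormal line. -/
abbrev fibreTauTwist (D : ShtukaDiagram X (specE E Fq)) (a : specE E Fq ⟶ X) : Type u :=
  conormal a →ₗ[E] fibreTau D a

/-- The projective space of lines in `(Φ^* F)(α) / Φ^* F`. -/
abbrev Psharp (D : ShtukaDiagram X (specE E Fq)) (α : specE E Fq ⟶ X) : Scheme.{u} :=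
  dualProjSpace E (fibreTauTwist D α)

/-- The projective space of one-dimensional quotients of `Φ^* F / (Φ^* F)(-β)`. -/
abbrev Pflat (D : ShtukaDiagram X (specE E Fq)) (β : specE E Fq ⟶ X) : Scheme.{u} :=
  projSpace E (fibreTau D β)

/-- The product of the two projective spaces over `E`. -/
abbrev Pnat (D : ShtukaDiagram X (specE E Fq)) (α β : specE E Fq ⟶ X) : Scheme.{u} :=
  pullback (projSpaceHom E (Module.Dual E (fibreTauTwist D α))) (projSpaceHom E (fibreTau D β))

/-- The structure morphism to `Spec E`. -/
def PnatHom (D : ShtukaDiagram X (specE E Fq)) (α β : specE E Fq ⟶ X) :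
    Pnat D α β ⟶ Spec (CommRingCat.of E) :=
  pullback.fst _ _ ≫ projSpaceHom E (Module.Dual E (fibreTauTwist D α))

/-- Let `s` be the map from `V` to an `A`-module `W` identified with `A ⊗ V`, let `N` be
one-dimensional, and let `L` be a submodule of `W`. The morphism `h` from `Spec A` to the space of
lines in `Hom(N, V)` classifies the line of those `u` with values in `L`: there is an element
`∑ a_u ⊗ u` of `A ⊗ Hom(N, V)` that defines the morphism `h` and the values of which, at the
elements of `N`, span `L`. -/
def ClassifiesLine {A : Type u} [CommRing A] [Algebra E A] {N V : Type u} [AddCommGroup N]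
    [Module E N] [AddCommGroup V] [Module E V] {W : Type u} [AddCommGroup W] [Module A W]
    (s : V → W) (L : Submodule A W)
    (h : Spec (CommRingCat.of A) ⟶ dualProjSpace E (N →ₗ[E] V)) : Prop :=
  ∃ (w : (N →ₗ[E] V) →₀ A) (φ : Module.Dual E (N →ₗ[E] V) →ₗ[E] A)
    (hφ : Ideal.span (Set.range φ) = ⊤),
    (∀ l, φ l = w.sum fun u c => c * algebraMap E A (l u)) ∧
    Submodule.span A (Set.range fun x : N => w.sum fun u c => c • s (u x)) = L ∧
    h = projPoint φ hφ

/-- Let `χ` be a map from `V` to an `A`-module `Q`. The morphism `h` from `Spec A` to the space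
of one-dimensional quotients of `V` classifies the quotient `A ⊗ V ⟶ Q` given by `χ`. -/
def ClassifiesQuotient {A : Type u} [CommRing A] [Algebra E A] {V : Type u} [AddCommGroup V]
    [Module E V] {Q : Type u} [AddCommGroup Q] [Module A Q] (χ : V → Q)
    (h : Spec (CommRingCat.of A) ⟶ projSpace E V) : Prop :=
  ∃ (t : Q ≃ₗ[A] A) (φ : V →ₗ[E] A) (hφ : Ideal.span (Set.range φ) = ⊤),
    (∀ v, φ v = t (χ v)) ∧ h = projPoint φ hφ

/-- The `E`-point of `P^♮` given by the shtuka `Φ^* F ⟶ F' ⟵ F` over `E`. The upper modification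
`Φ^* F ⟶ F'` at `α` gives the line of those `u : O(-α)|_α ⟶ (Φ^* F)|_α` with values in the
kernel of `(Φ^* F)|_α ⟶ F'|_α`, which is the line `F' / Φ^* F` in `(Φ^* F)(α) / Φ^* F`. The lower
modification at `β` is the kernel of `Φ^* F ⟶ F' / F`, and gives the quotient `F' / F` of
`(Φ^* F)|_β`. -/
def IsModificationPoint (D : ShtukaDiagram X (specE E Fq)) (α β : specE E Fq ⟶ X)
    (p : Spec (CommRingCat.of E) ⟶ Pnat D α β) : Prop :=
  p ≫ PnatHom D α β = 𝟙 _ ∧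
  ClassifiesLine (N := conormal α) (V := fibreTau D α) id
    (LinearMap.ker (gmap ((fib α).map D.f))) (p ≫ pullback.fst _ _) ∧
  ClassifiesQuotient (V := fibreTau D β)
    (gmap ((fib β).map (D.f ≫ cokernel.π D.g))) (p ≫ pullback.snd _ _)

end Modifications

/-! ### The two functors -/

section Functors

variable {Fq : Type u} [Field Fq] [Fintype Fq] {E : Type u} [Field E] [Algebra Fq E]
  {X : Over (Spec (CommRingCat.of Fq))}

/-- A deformation to `Spec A`, with zero `α ∘ p_A` and pole `β ∘ p_A`, of a shtuka `D` of rank `d`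
over `Spec E`: a shtuka over `Spec A` with an isomorphism of its restriction to the closed point
with `D`. -/
structure Deformation (D : ShtukaDiagram X (specE E Fq)) (d : ℕ) (α β : specE E Fq ⟶ X)
    (A : ArtAlg E) where
  diagram : ShtukaDiagram X (specA Fq A)
  isShtuka : IsShtuka diagram d (structMor Fq A ≫ α) (structMor Fq A ≫ β)
  res : PullbackIso (closedPt Fq A) diagram D

variable {D : ShtukaDiagram X (specE E Fq)} {d : ℕ} {α β : specE E Fq ⟶ X}

/-- Two deformations are isomorphic: there is an isomorphism of shtukas compatible with the
isomorphisms of the restrictions to the closed point with `D`. -/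
def Deformation.IsIsomorphic {A : ArtAlg E} (G H : Deformation D d α β A) : Prop :=
  ∃ (m : G.diagram.F ≅ H.diagram.F) (m' : G.diagram.F' ≅ H.diagram.F'),
    (Scheme.Modules.pullback (Phi X (specA Fq A))).map m.hom ≫ H.diagram.f =
      G.diagram.f ≫ m'.hom ∧
    m.hom ≫ H.diagram.g = G.diagram.g ≫ m'.hom ∧
    (Scheme.Modules.pullback (prodMap X (closedPt Fq A))).map m.hom ≫ H.res.iso.hom =
      G.res.iso.hom ∧
    (Scheme.Modules.pullback (prodMap X (closedPt Fq A))).map m'.hom ≫ H.res.iso'.hom =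
      G.res.iso'.hom

instance deformationSetoid (D : ShtukaDiagram X (specE E Fq)) (d : ℕ) (α β : specE E Fq ⟶ X)
    (A : ArtAlg E) : Setoid (Deformation D d α β A) where
  r := Deformation.IsIsomorphic
  iseqv :=
    { refl := fun G => ⟨Iso.refl _, Iso.refl _, by simp, by simp, by simp, by simp⟩
      symm := by
        rintro G H ⟨m, m', h1, h2, h3, h4⟩
        refine ⟨m.symm, m'.symm, ?_, ?_, ?_, ?_⟩
        · rw [Iso.symm_hom, Iso.symm_hom, Iso.eq_comp_inv, Category.assoc, ← h1, ← Category.assoc,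
            ← CategoryTheory.Functor.map_comp, m.inv_hom_id, CategoryTheory.Functor.map_id,
            Category.id_comp]
        · rw [Iso.symm_hom, Iso.symm_hom, Iso.eq_comp_inv, Category.assoc, ← h2,
            Iso.inv_hom_id_assoc]
        · rw [← h3, ← Category.assoc, ← CategoryTheory.Functor.map_comp, Iso.symm_hom,
            m.inv_hom_id, CategoryTheory.Functor.map_id, Category.id_comp]
        · rw [← h4, ← Category.assoc, ← CategoryTheory.Functor.map_comp, Iso.symm_hom,
            m'.inv_hom_id, CategoryTheory.Functor.map_id, Category.id_comp]
      trans := by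
        rintro G H K ⟨m, m', h1, h2, h3, h4⟩ ⟨n, n', k1, k2, k3, k4⟩
        refine ⟨m ≪≫ n, m' ≪≫ n', ?_, ?_, ?_, ?_⟩
        · rw [Iso.trans_hom, Iso.trans_hom, CategoryTheory.Functor.map_comp, Category.assoc, k1,
            ← Category.assoc, h1, Category.assoc]
        · rw [Iso.trans_hom, Iso.trans_hom, Category.assoc, k2, ← Category.assoc, h2,
            Category.assoc]
        · rw [Iso.trans_hom, CategoryTheory.Functor.map_comp, Category.assoc, k3, h3]
        · rw [Iso.trans_hom, CategoryTheory.Functor.map_comp, Category.assoc, k4, h4] }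

/-- The set of isomorphism classes of deformations. -/
def DeformationClass (D : ShtukaDiagram X (specE E Fq)) (d : ℕ) (α β : specE E Fq ⟶ X)
    (A : ArtAlg E) : Type (u + 1) :=
  Quotient (deformationSetoid D d α β A)

/-- The isomorphism class of a deformation. -/
def Deformation.cls {A : ArtAlg E} (G : Deformation D d α β A) : DeformationClass D d α β A :=
  Quotient.mk (deformationSetoid D d α β A) G

/-- The canonical isomorphism `e_B^* (id × φ)^* ≅ e_A^*` for a morphism `φ : A ⟶ B`. -/
def pullbackClosedPt (X : Over (Spec (CommRingCat.of Fq))) {A B : ArtAlg E} (φ : A ⟶ B) :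
    Scheme.Modules.pullback (prodMap X (specMap Fq φ)) ⋙
        Scheme.Modules.pullback (prodMap X (closedPt Fq B)) ≅
      Scheme.Modules.pullback (prodMap X (closedPt Fq A)) :=
  Scheme.Modules.pullbackComp (prodMap X (closedPt Fq B)) (prodMap X (specMap Fq φ)) ≪≫
    Scheme.Modules.pullbackCongr (by rw [← prodMap_comp, closedPt_specMap])

/-- The deformation `H` over `B` is the base change of the deformation `G` over `A` along
`φ : A ⟶ B`: the pullback of `G` is isomorphic to `H`, compatibly with the isomorphisms of the
restrictions to the closed point with `D`. -/
def Deformation.IsBaseChange {A B : ArtAlg E} (φ : A ⟶ B) (G : Deformation D d α β A)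
    (H : Deformation D d α β B) : Prop :=
  ∃ r : PullbackIso (specMap Fq φ) G.diagram H.diagram,
    (Scheme.Modules.pullback (prodMap X (closedPt Fq B))).map r.iso.hom ≫ H.res.iso.hom =
      (pullbackClosedPt X φ).hom.app G.diagram.F ≫ G.res.iso.hom ∧
    (Scheme.Modules.pullback (prodMap X (closedPt Fq B))).map r.iso'.hom ≫ H.res.iso'.hom =
      (pullbackClosedPt X φ).hom.app G.diagram.F' ≫ G.res.iso'.hom

/-- The set of `E`-morphisms `Spec A ⟶ P^♮` that send the closed point to `p`. -/
def PointsAt (D : ShtukaDiagram X (specE E Fq)) (α β : specE E Fq ⟶ X)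
    (p : Spec (CommRingCat.of E) ⟶ Pnat D α β) (A : ArtAlg E) : Type u :=
  { h : Spec (CommRingCat.of A.carrier) ⟶ Pnat D α β //
    h ≫ PnatHom D α β = Spec.map (CommRingCat.ofHom (algebraMap E A.carrier)) ∧
    Spec.map (CommRingCat.ofHom A.aug.toRingHom) ≫ h = p }

/-- Composition of a point with `Spec B ⟶ Spec A`. -/
def PointsAt.map {p : Spec (CommRingCat.of E) ⟶ Pnat D α β} {A B : ArtAlg E} (φ : A ⟶ B)
    (h : PointsAt D α β p A) : PointsAt D α β p B :=
  ⟨Spec.map (CommRingCat.ofHom φ.1.toRingHom) ≫ h.1, by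
    rw [Category.assoc, h.2.1, ← Spec.map_comp, ← CommRingCat.ofHom_comp]
    congr 2
    ext x
    exact φ.1.commutes x, by
    rw [← Category.assoc, ← Spec.map_comp, ← CommRingCat.ofHom_comp]
    refine Eq.trans ?_ h.2.2
    congr 3
    exact congrArg AlgHom.toRingHom φ.2⟩

/-- The functor that sends `A` to the set of `E`-morphisms `Spec A ⟶ P^♮` that send the closed
point to `p`. -/
def pointFunctor (D : ShtukaDiagram X (specE E Fq)) (α β : specE E Fq ⟶ X)
    (p : Spec (CommRingCat.of E) ⟶ Pnat D α β) : ArtAlg E ⥤ Type u where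
  obj A := PointsAt D α β p A
  map φ := ↾(PointsAt.map φ)
  map_id A := by
    ext h
    refine Subtype.ext ?_
    change Spec.map (𝟙 (CommRingCat.of A.carrier)) ≫ h.1 = h.1
    rw [Spec.map_id, Category.id_comp]
  map_comp φ ψ := by
    ext h
    refine Subtype.ext ?_
    change Spec.map (CommRingCat.ofHom φ.1.toRingHom ≫ CommRingCat.ofHom ψ.1.toRingHom) ≫ h.1 =
      Spec.map (CommRingCat.ofHom ψ.1.toRingHom) ≫
        Spec.map (CommRingCat.ofHom φ.1.toRingHom) ≫ h.1
    rw [Spec.map_comp, Category.assoc]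

/-- The map from the fibre `(Φ_E^* F)|_a` to the sections of `Φ_A^* G` along the graph of
`a ∘ p_A`, for a deformation `G`. -/
def Deformation.fibreMap {A : ArtAlg E} (G : Deformation D d α β A) {n : ℕ}
    (hn : A.FrobNilpotent (Fintype.card Fq) (n + 1)) (a : specE E Fq ⟶ X) (v : fibreTau D a) :
    gsec (R := A.carrier)
      ((fib (structMor Fq A ≫ a)).obj ((tau X (specA Fq A) 1).obj G.diagram.F)) :=
  gmap (R := A.carrier) (compareFib A hn D G.diagram G.res a)
    (pullSec (R := E) (R' := A.carrier) (structMor Fq A).left _ v)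

/-- The morphism `h : Spec A ⟶ P^♮` is given by the modifications in the deformation
`Φ_A^* G ⟶ G' ⟵ G`: the upper modification at `α ∘ p_A` gives the line `G' / Φ_A^* G` and the
lower modification at `β ∘ p_A` gives the quotient `G' / G`, where `Φ_A^* G` is identified with
`p_A^* Φ_E^* F` along the graphs through `(Φ_A^*)^(n+1) G ≅ p_A^* (Φ_E^*)^(n+1) F`. -/
def Deformation.IsModificationMorphism {A : ArtAlg E} (G : Deformation D d α β A) {n : ℕ}
    (hn : A.FrobNilpotent (Fintype.card Fq) (n + 1))
    (h : Spec (CommRingCat.of A.carrier) ⟶ Pnat D α β) : Prop :=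
  h ≫ PnatHom D α β = Spec.map (CommRingCat.ofHom (algebraMap E A.carrier)) ∧
  ClassifiesLine (N := conormal α) (V := fibreTau D α) (G.fibreMap hn α)
    (LinearMap.ker (gmap (R := A.carrier) ((fib (structMor Fq A ≫ α)).map G.diagram.f)))
    (h ≫ pullback.fst _ _) ∧
  ClassifiesQuotient (V := fibreTau D β)
    (fun v => gmap (R := A.carrier)
      ((fib (structMor Fq A ≫ β)).map (G.diagram.f ≫ cokernel.π G.diagram.g))
      (G.fibreMap hn β v))
    (h ≫ pullback.snd _ _)

end Functors

end Sht

end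

/-!
A shtuka over `A` can be reconstructed from its Frobenius pullback and its two modifications, and
the Frobenius pullback depends only on the restriction of the shtuka to a smaller algebra. Let `A₀`
be the quotient of `A` by the kernel of the `q`-Frobenius. The Frobenius of `Spec A` factors as
`Spec A ⟶ Spec A₀ ⟶ Spec A` (`exists_frobFactor`), so that `Φ_A^* G` is the pullback of the
restriction `G₀` of `G` to `A₀`, and the maximal ideal of `A₀` is killed by a smaller power of the
Frobenius. By induction on this power, starting from `A = E`, the deformations with a given point of
`P^♮` exist (`exists_deformation`) and are isomorphic (`exists_hom_of_modifAt`): the upper and the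
lower modifications of a sheaf with given line and quotient exist and are unique, and they are
compatible with base change along `Spec A₀ ⟶ Spec A`. The isomorphisms and the shtukas so obtained
restrict to the given ones over `A₀`, since a morphism to a locally free sheaf is determined by its
composition with a modification (`IsElem.hom_ext`).

Sheaves over varying bases are handled in the category `QMod` of pairs of a scheme and a sheaf of
modules, in which the pullback is a cartesian arrow and `Φ^* F ⟶ F'` is an arrow `F ⟶ F'`. An arrow
from `F` to a sheaf on a base the images of which under the powers of `Φ` avoid the zero and the
pole can be moved along `F ⟶ F' ⟵ F` without loss (`Lk`, `Corresponds`). As a power of the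
Frobenius of `A` factors through `E`, this gives the identification of the fibres of `Φ_A^* G` and
`Φ_E^* F` at the zero and the pole, its independence of the power of the Frobenius, and its
naturality (`IsFibreComparison`); it agrees with the comparison isomorphism of the definition of
`h` by `corresponds_compareFib`.

As `Spec A` is a point, modifications are studied in a neighbourhood of the graph. The graph has a
local equation `t` there, which remains one after base change (`exists_locEq`), as the curve is
étale over a line. A morphism of locally free sheaves with cokernel an invertible sheaf on the graph
is the diagonal matrix with entries `t, 1, …, 1` in suitable frames (`isElem_of_cokernel`), and all
facts on modifications are read off from such frames. Points of projective spaces with values in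
local rings are unimodular vectors up to units (`exists_projPoint`, `projPoint_eq_iff`), which
correspond to lines and quotients (`classifiesLine_iff`, `classifiesQuotient_iff`).
-/

noncomputable section

namespace Sht

open Category (assoc id_comp comp_id)
open CommRingCat (of ofHom)
open Function (Bijective Injective Surjective)
open Scheme.Modules (pushforward pullbackComp pullbackCongr)

/-! ### Sheaves of modules over varying schemes -/

section Total

open scoped Classical in
/-- Restriction of sections of a sheaf of modules, extended by `0` to pairs of open sets that
are not included in each other. -/
def rs {Y : Scheme.{u}} (M : Y.Modules) (U V : Y.Opens) : Γ(M, U) →+ Γ(M, V) :=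
  if h : V ≤ U then (M.presheaf.map (homOfLE h).op).hom else 0

open scoped Classical in
/-- The pullback of functions from `U` to an open set `W` that maps to `U`, extended by `0` to all
pairs of open sets. -/
def pl {Y Z : Scheme.{u}} (f : Z ⟶ Y) (U : Y.Opens) (W : Z.Opens) : Γ(Y, U) →+ Γ(Z, W) :=
  if h : W ≤ f ⁻¹ᵁ U then (f.appLE U W h).hom.toAddMonoidHom else 0

/-- Restriction of functions. -/
def rsO {Y : Scheme.{u}} (U V : Y.Opens) : Γ(Y, U) →+ Γ(Y, V) := pl (𝟙 Y) U V

/-- The sections of a direct image. -/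
def unpf {Y Z : Scheme.{u}} (f : Z ⟶ Y) (M : Z.Modules) (U : Y.Opens) :
    Γ((pushforward f).obj M, U) →+ Γ(M, f ⁻¹ᵁ U) :=
  AddMonoidHom.id Γ(M, f ⁻¹ᵁ U)

section

variable {Y Z T : Scheme.{u}} (M : Y.Modules)

theorem rs_of_le {U V : Y.Opens} (h : V ≤ U) :
    rs M U V = (M.presheaf.map (homOfLE h).op).hom := dif_pos h

theorem pl_of_le (f : Z ⟶ Y) {U : Y.Opens} {W : Z.Opens} (h : W ≤ f ⁻¹ᵁ U) :
    pl f U W = (f.appLE U W h).hom.toAddMonoidHom := dif_pos h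

theorem rs_rs {U V W : Y.Opens} (h : V ≤ U) (h' : W ≤ V) (x : Γ(M, U)) :
    rs M V W (rs M U V x) = rs M U W x := by
  rw [rs_of_le M h, rs_of_le M h', rs_of_le M (h'.trans h)]
  have := M.presheaf.map_comp (homOfLE h).op (homOfLE h').op
  exact congrArg (fun m => m.hom x) this.symm

@[simp]
theorem rs_self (U : Y.Opens) (x : Γ(M, U)) : rs M U U x = x := by
  rw [rs_of_le M le_rfl]
  have := M.presheaf.map_id (.op U)
  exact congrArg (fun m => m.hom x) this

theorem rsO_of_le {U V : Y.Opens} (h : V ≤ U) :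
    rsO U V = (Y.presheaf.map (homOfLE h).op).hom.toAddMonoidHom := by
  have h' : V ≤ (𝟙 Y : Y ⟶ Y) ⁻¹ᵁ U := h
  rw [rsO, pl_of_le _ h', Scheme.Hom.appLE, Scheme.Hom.id_app]
  rfl

theorem rs_smul {U V : Y.Opens} (h : V ≤ U) (a : Γ(Y, U)) (x : Γ(M, U)) :
    rs M U V (a • x) = rsO U V a • rs M U V x := by
  rw [rsO_of_le h, rs_of_le M h]
  exact M.map_smul _ _ _

theorem pl_mul (f : Z ⟶ Y) {U : Y.Opens} {W : Z.Opens} (h : W ≤ f ⁻¹ᵁ U) (a b : Γ(Y, U)) :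
    pl f U W (a * b) = pl f U W a * pl f U W b := by
  rw [pl_of_le f h]
  exact map_mul (f.appLE U W h).hom a b

theorem pl_one (f : Z ⟶ Y) {U : Y.Opens} {W : Z.Opens} (h : W ≤ f ⁻¹ᵁ U) :
    pl f U W 1 = 1 := by
  rw [pl_of_le f h]
  exact map_one (f.appLE U W h).hom

theorem rsO_mul {U V : Y.Opens} (h : V ≤ U) (a b : Γ(Y, U)) :
    rsO U V (a * b) = rsO U V a * rsO U V b := pl_mul _ h a b

theorem rsO_one {U V : Y.Opens} (h : V ≤ U) : rsO U V 1 = 1 := pl_one _ h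

theorem pl_pl (f : Z ⟶ Y) (g : T ⟶ Z) {U : Y.Opens} {W : Z.Opens} {O : T.Opens}
    (h : W ≤ f ⁻¹ᵁ U) (h' : O ≤ g ⁻¹ᵁ W) (a : Γ(Y, U)) :
    pl g W O (pl f U W a) = pl (g ≫ f) U O a := by
  have h'' : O ≤ (g ≫ f) ⁻¹ᵁ U := h'.trans (g.preimage_mono h)
  rw [pl_of_le f h, pl_of_le g h', pl_of_le _ h'']
  have := Scheme.Hom.appLE_comp_appLE g f U W O h h'
  exact congrArg (fun m => m.hom a) this

theorem rsO_pl (f : Z ⟶ Y) {U : Y.Opens} {W W' : Z.Opens} (h : W ≤ f ⁻¹ᵁ U) (h' : W' ≤ W)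
    (a : Γ(Y, U)) : rsO W W' (pl f U W a) = pl f U W' a := by
  rw [rsO, pl_pl f _ h h', id_comp]

theorem pl_rsO (f : Z ⟶ Y) {U U' : Y.Opens} {W : Z.Opens} (h : U' ≤ U) (h' : W ≤ f ⁻¹ᵁ U')
    (a : Γ(Y, U)) : pl f U' W (rsO U U' a) = pl f U W a := by
  rw [rsO, pl_pl _ f h h', comp_id]

@[simp]
theorem rsO_self (U : Y.Opens) (a : Γ(Y, U)) : rsO U U a = a := by
  rw [rsO_of_le le_rfl]
  exact congrArg (fun m => m.hom a) (Y.presheaf.map_id (.op U))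

theorem rsO_rsO {U V W : Y.Opens} (h : V ≤ U) (h' : W ≤ V) (a : Γ(Y, U)) :
    rsO V W (rsO U V a) = rsO U W a := rsO_pl _ h h' _

variable {M} in
theorem app_rs {N : Y.Modules} (m : M ⟶ N) {U V : Y.Opens} (h : V ≤ U) (x : Γ(M, U)) :
    (m.app V).hom (rs M U V x) = rs N U V ((m.app U).hom x) := by
  rw [rs_of_le M h, rs_of_le N h]
  exact congrArg (fun k => k.hom x) (m.mapPresheaf.naturality (homOfLE h).op)

theorem unpf_smul (f : Y ⟶ Z) (U : Z.Opens) (a : Γ(Z, U))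
    (x : Γ((pushforward f).obj M, U)) :
    unpf f M U (a • x) = (f.app U).hom a • unpf f M U x := rfl

theorem unpf_rs (f : Y ⟶ Z) {U V : Z.Opens} (h : V ≤ U)
    (x : Γ((pushforward f).obj M, U)) :
    unpf f M V (rs _ U V x) = rs M (f ⁻¹ᵁ U) (f ⁻¹ᵁ V) (unpf f M U x) := by
  rw [rs_of_le _ h, rs_of_le _ (f.preimage_mono h)]
  rfl

end

/-- A scheme together with a sheaf of modules. -/
structure QMod where
  Y : Scheme.{u}
  M : Y.Modules

/-- A morphism from `(Y, M)` to `(Z, N)` is a morphism `f : Z ⟶ Y` with a morphism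
`M ⟶ f_* N`. -/
structure QMod.Hom (A B : QMod.{u}) where
  base : B.Y ⟶ A.Y
  map : A.M ⟶ (pushforward base).obj B.M

/-- The map on sections given by a morphism of `QMod`, from `U` to an open set `W` that maps
to `U`; it is `0` for other pairs of open sets. -/
def QMod.Hom.on' {A B : QMod.{u}} (φ : QMod.Hom A B) (U : A.Y.Opens) (W : B.Y.Opens) :
    Γ(A.M, U) →+ Γ(B.M, W) :=
  (rs B.M (φ.base ⁻¹ᵁ U) W).comp ((unpf φ.base B.M U).comp (φ.map.app U).hom)

theorem QMod.Hom.on'_apply {A B : QMod.{u}} (φ : QMod.Hom A B) (U : A.Y.Opens) (W : B.Y.Opens)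
    (x : Γ(A.M, U)) : φ.on' U W x =
      rs B.M (φ.base ⁻¹ᵁ U) W (unpf φ.base B.M U ((φ.map.app U).hom x)) := rfl

theorem QMod.Hom.ext' {A B : QMod.{u}} {φ ψ : QMod.Hom A B} (hb : φ.base = ψ.base)
    (h : ∀ U W, W ≤ φ.base ⁻¹ᵁ U → ∀ x, φ.on' U W x = ψ.on' U W x) : φ = ψ := by
  obtain ⟨f, m⟩ := φ
  obtain ⟨g, n⟩ := ψ
  obtain rfl : f = g := hb
  congr 1
  ext U x
  have := h U (f ⁻¹ᵁ U) le_rfl x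
  rw [QMod.Hom.on'_apply, QMod.Hom.on'_apply, rs_self, rs_self] at this
  exact this

theorem QMod.Hom.on'_smul {A B : QMod.{u}} (φ : QMod.Hom A B) {U : A.Y.Opens} {W : B.Y.Opens}
    (h : W ≤ φ.base ⁻¹ᵁ U) (a : Γ(A.Y, U)) (x : Γ(A.M, U)) :
    φ.on' U W (a • x) = pl φ.base U W a • φ.on' U W x := by
  have h1 : (φ.map.app U).hom (a • x) = a • (φ.map.app U).hom x := φ.map.app_smul a x
  rw [QMod.Hom.on'_apply, h1, unpf_smul, rs_smul _ h, rsO_of_le h, pl_of_le _ h]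
  rfl

theorem QMod.Hom.rs_on' {A B : QMod.{u}} (φ : QMod.Hom A B) {U : A.Y.Opens} {W W' : B.Y.Opens}
    (h : W ≤ φ.base ⁻¹ᵁ U) (h' : W' ≤ W) (x : Γ(A.M, U)) :
    rs B.M W W' (φ.on' U W x) = φ.on' U W' x :=
  rs_rs _ h h' _

theorem QMod.Hom.on'_rs {A B : QMod.{u}} (φ : QMod.Hom A B) {U U' : A.Y.Opens} {W : B.Y.Opens}
    (h : U' ≤ U) (h' : W ≤ φ.base ⁻¹ᵁ U') (x : Γ(A.M, U)) :
    φ.on' U' W (rs A.M U U' x) = φ.on' U W x := by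
  rw [QMod.Hom.on'_apply, QMod.Hom.on'_apply, app_rs _ h, unpf_rs _ _ h,
    rs_rs _ (φ.base.preimage_mono h) h']

/-- The composition of morphisms of `QMod`. -/
def QMod.Hom.comp' {A B C : QMod.{u}} (φ : QMod.Hom A B) (ψ : QMod.Hom B C) : QMod.Hom A C where
  base := ψ.base ≫ φ.base
  map := φ.map ≫ (pushforward φ.base).map ψ.map ≫
    (Scheme.Modules.pushforwardComp ψ.base φ.base).hom.app C.M

theorem QMod.Hom.comp'_on' {A B C : QMod.{u}} (φ : QMod.Hom A B) (ψ : QMod.Hom B C)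
    {U : A.Y.Opens} (V : B.Y.Opens) {W : C.Y.Opens} (h : V ≤ φ.base ⁻¹ᵁ U)
    (h' : W ≤ ψ.base ⁻¹ᵁ V) (x : Γ(A.M, U)) :
    (φ.comp' ψ).on' U W x = ψ.on' V W (φ.on' U V x) := by
  have h0 : (φ.comp' ψ).on' U W x =
      ψ.on' (φ.base ⁻¹ᵁ U) W (φ.on' U (φ.base ⁻¹ᵁ U) x) := by
    rw [φ.on'_apply, rs_self]
    rfl
  rw [h0, ← φ.rs_on' le_rfl h, ψ.on'_rs h h']

/-- The identity of `(Y, M)`. -/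
def QMod.Hom.id' (A : QMod.{u}) : QMod.Hom A A where
  base := 𝟙 A.Y
  map := (Scheme.Modules.pushforwardId A.Y).inv.app A.M

theorem QMod.Hom.id'_on' (A : QMod.{u}) (U W : A.Y.Opens) (x : Γ(A.M, U)) :
    (QMod.Hom.id' A).on' U W x = rs A.M U W x := rfl

instance : Category QMod.{u} where
  Hom := QMod.Hom
  id := QMod.Hom.id'
  comp := QMod.Hom.comp'
  id_comp φ := by
    refine QMod.Hom.ext' (comp_id _) fun U W hW x => ?_
    rw [QMod.Hom.comp'_on' (QMod.Hom.id' _) φ U (le_refl U) hW, QMod.Hom.id'_on', rs_self]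
  comp_id φ := by
    refine QMod.Hom.ext' (id_comp _) fun U W hW x => ?_
    rw [QMod.Hom.comp'_on' φ (QMod.Hom.id' _) W hW (le_refl W), QMod.Hom.id'_on', rs_self]
  assoc φ ψ χ := by
    refine QMod.Hom.ext' (assoc _ _ _).symm fun U W hW x => ?_
    rw [QMod.Hom.comp'_on' (φ.comp' ψ) χ (ψ.base ⁻¹ᵁ φ.base ⁻¹ᵁ U) le_rfl hW,
      QMod.Hom.comp'_on' φ ψ (φ.base ⁻¹ᵁ U) le_rfl le_rfl,
      QMod.Hom.comp'_on' φ (ψ.comp' χ) (φ.base ⁻¹ᵁ U) le_rfl hW,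
      QMod.Hom.comp'_on' ψ χ (ψ.base ⁻¹ᵁ φ.base ⁻¹ᵁ U) le_rfl hW]

/-- The underlying morphism of schemes of a morphism of `QMod`. -/
def bs {A B : QMod.{u}} (φ : A ⟶ B) : B.Y ⟶ A.Y := QMod.Hom.base φ

/-- The map on sections given by a morphism of `QMod`, from `U` to an open set `W` that maps
to `U`; it is `0` for other pairs of open sets. -/
def on {A B : QMod.{u}} (φ : A ⟶ B) (U : A.Y.Opens) (W : B.Y.Opens) :
    Γ(A.M, U) →+ Γ(B.M, W) := QMod.Hom.on' φ U W

section

variable {A B C : QMod.{u}}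

@[simp] theorem bs_id (A : QMod.{u}) : bs (𝟙 A) = 𝟙 A.Y := rfl

@[simp] theorem bs_comp (φ : A ⟶ B) (ψ : B ⟶ C) : bs (φ ≫ ψ) = bs ψ ≫ bs φ := rfl

theorem on_comp (φ : A ⟶ B) (ψ : B ⟶ C) {U : A.Y.Opens} (V : B.Y.Opens) {W : C.Y.Opens}
    (h : V ≤ bs φ ⁻¹ᵁ U) (h' : W ≤ bs ψ ⁻¹ᵁ V) (x : Γ(A.M, U)) :
    on (φ ≫ ψ) U W x = on ψ V W (on φ U V x) :=
  QMod.Hom.comp'_on' φ ψ V h h' x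

theorem qext {φ ψ : A ⟶ B} (hb : bs φ = bs ψ)
    (h : ∀ U W, W ≤ bs φ ⁻¹ᵁ U → ∀ x, on φ U W x = on ψ U W x) : φ = ψ := QMod.Hom.ext' hb h

theorem on_smul (φ : A ⟶ B) {U : A.Y.Opens} {W : B.Y.Opens} (h : W ≤ bs φ ⁻¹ᵁ U)
    (a : Γ(A.Y, U)) (x : Γ(A.M, U)) :
    on φ U W (a • x) = pl (bs φ) U W a • on φ U W x := QMod.Hom.on'_smul φ h a x

theorem rs_on (φ : A ⟶ B) {U : A.Y.Opens} {W W' : B.Y.Opens} (h : W ≤ bs φ ⁻¹ᵁ U) (h' : W' ≤ W)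
    (x : Γ(A.M, U)) : rs B.M W W' (on φ U W x) = on φ U W' x :=
  QMod.Hom.rs_on' φ h h' x

theorem on_rs (φ : A ⟶ B) {U U' : A.Y.Opens} {W : B.Y.Opens} (h : U' ≤ U)
    (h' : W ≤ bs φ ⁻¹ᵁ U') (x : Γ(A.M, U)) :
    on φ U' W (rs A.M U U' x) = on φ U W x :=
  QMod.Hom.on'_rs φ h h' x

end

/-- A morphism to a direct image, as a morphism of `QMod`. -/
def mkArr {Y Z : Scheme.{u}} (f : Z ⟶ Y) {M : Y.Modules} {N : Z.Modules}
    (m : M ⟶ (pushforward f).obj N) : (⟨Y, M⟩ : QMod.{u}) ⟶ ⟨Z, N⟩ :=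
  QMod.Hom.mk (A := ⟨Y, M⟩) (B := ⟨Z, N⟩) f m

theorem on_mkArr {Y Z : Scheme.{u}} (f : Z ⟶ Y) {M : Y.Modules} {N : Z.Modules}
    (m : M ⟶ (pushforward f).obj N) (U : Y.Opens) (W : Z.Opens) (x : Γ(M, U)) :
    on (mkArr f m) U W x = rs N (f ⁻¹ᵁ U) W (unpf f N U ((m.app U).hom x)) := rfl

theorem mkArr_injective {Y Z : Scheme.{u}} (f : Z ⟶ Y) {M : Y.Modules} {N : Z.Modules}
    {m n : M ⟶ (pushforward f).obj N} (h : mkArr f m = mkArr f n) : m = n := by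
  have h' : QMod.Hom.mk (A := ⟨Y, M⟩) (B := ⟨Z, N⟩) f m = QMod.Hom.mk f n := h
  exact eq_of_heq (QMod.Hom.mk.inj h').2

/-- A morphism of sheaves of modules on `Y`, as a morphism of `QMod`. -/
def vert {Y : Scheme.{u}} {M N : Y.Modules} (m : M ⟶ N) : (⟨Y, M⟩ : QMod.{u}) ⟶ ⟨Y, N⟩ :=
  mkArr (𝟙 Y) (m ≫ (Scheme.Modules.pushforwardId Y).inv.app N)

section

variable {Y : Scheme.{u}} {M N P : Y.Modules}

@[simp] theorem bs_vert (m : M ⟶ N) : bs (vert m) = 𝟙 Y := rfl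

theorem on_vert (m : M ⟶ N) (U W : Y.Opens) (x : Γ(M, U)) :
    on (vert m) U W x = rs N U W ((m.app U).hom x) := rfl

theorem on_vert_self (m : M ⟶ N) (U : Y.Opens) (x : Γ(M, U)) :
    on (vert m) U U x = (m.app U).hom x := by rw [on_vert, rs_self]

@[simp] theorem vert_id (M : Y.Modules) : vert (𝟙 M) = 𝟙 _ := rfl

theorem vert_comp (m : M ⟶ N) (n : N ⟶ P) : vert (m ≫ n) = vert m ≫ vert n := by
  refine qext (comp_id (𝟙 Y)).symm fun U W (hW : W ≤ U) x => ?_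
  rw [on_comp (vert m) (vert n) W hW (le_refl W), on_vert, on_vert, on_vert, rs_self, app_rs _ hW]
  rfl

theorem vert_injective {m n : M ⟶ N} (h : vert m = vert n) : m = n := by
  ext U x
  have := on_vert_self m U x
  rw [h, on_vert_self] at this
  exact this.symm

/-- A morphism of `QMod` over the identity is a morphism of sheaves of modules. -/
theorem exists_vert (φ : (⟨Y, M⟩ : QMod.{u}) ⟶ ⟨Y, N⟩) (h : bs φ = 𝟙 Y) :
    ∃ m : M ⟶ N, vert m = φ := by
  obtain ⟨f, m⟩ := φ
  obtain rfl : f = 𝟙 Y := h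
  exact ⟨m ≫ (Scheme.Modules.pushforwardId Y).hom.app N, rfl⟩

end

/-- A morphism `(Y, M) ⟶ (Z, N)` over `f : Z ⟶ Y` is cartesian if it identifies `N` with the
pullback of `M`: every morphism from `(Y, M)` over `f ∘ g` factors uniquely through it. -/
def IsCart {A B : QMod.{u}} (φ : A ⟶ B) : Prop :=
  ∀ ⦃C : QMod.{u}⦄ (ψ : A ⟶ C) (g : C.Y ⟶ B.Y), g ≫ bs φ = bs ψ →
    ∃! χ : B ⟶ C, bs χ = g ∧ φ ≫ χ = ψ

section

variable {A B C : QMod.{u}}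

theorem IsCart.hom_ext {φ : A ⟶ B} (hφ : IsCart φ) {χ χ' : B ⟶ C} (hb : bs χ = bs χ')
    (h : φ ≫ χ = φ ≫ χ') : χ = χ' :=
  (hφ (φ ≫ χ') (bs χ') rfl).unique ⟨hb, h⟩ ⟨rfl, rfl⟩

theorem IsCart.comp {φ : A ⟶ B} {ψ : B ⟶ C} (hφ : IsCart φ) (hψ : IsCart ψ) :
    IsCart (φ ≫ ψ) := by
  intro D k g hg
  rw [bs_comp, ← assoc] at hg
  obtain ⟨χ, ⟨h1, h2⟩, h3⟩ := hφ k _ hg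
  obtain ⟨χ', ⟨h1', h2'⟩, h3'⟩ := hψ χ g h1.symm
  refine ⟨χ', ⟨h1', by rw [assoc, h2', h2]⟩, ?_⟩
  rintro χ'' ⟨h4, h5⟩
  exact h3' _ ⟨h4, h3 _ ⟨by rw [bs_comp, h4], by rw [← assoc, h5]⟩⟩

theorem IsCart.of_comp {φ : A ⟶ B} {ψ : B ⟶ C} (hφ : IsCart φ) (h : IsCart (φ ≫ ψ)) :
    IsCart ψ := by
  intro D k g hg
  obtain ⟨χ, ⟨h1, h2⟩, h3⟩ := h (φ ≫ k) g (by rw [bs_comp, bs_comp, ← hg, assoc])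
  refine ⟨χ, ⟨h1, hφ.hom_ext (by rw [bs_comp, h1, hg]) (by rw [← h2, assoc])⟩, ?_⟩
  rintro χ' ⟨h4, h5⟩
  exact h3 _ ⟨h4, by rw [assoc, h5]⟩

theorem isCart_of_isIso (φ : A ⟶ B) [IsIso φ] : IsCart φ := by
  intro C ψ g hg
  have h0 : bs (inv φ) ≫ bs φ = 𝟙 A.Y ∨ True := Or.inr trivial
  have h1 : bs φ ≫ bs (inv φ) = 𝟙 _ := by rw [← bs_comp, IsIso.inv_hom_id, bs_id]
  refine ⟨inv φ ≫ ψ, ⟨?_, by simp⟩, ?_⟩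
  · rw [bs_comp, ← hg, assoc, h1, comp_id]
  · rintro χ ⟨-, h3⟩
    rw [← h3, IsIso.inv_hom_id_assoc]

theorem isCart_vert_of_isIso {Y : Scheme.{u}} {M N : Y.Modules} (m : M ⟶ N) [IsIso m] :
    IsCart (vert m) := by
  have : IsIso (vert m) := ⟨vert (inv m), by rw [← vert_comp, IsIso.hom_inv_id, vert_id],
    by rw [← vert_comp, IsIso.inv_hom_id, vert_id]⟩
  exact isCart_of_isIso _

theorem isIso_of_isCart_vert {Y : Scheme.{u}} {M N : Y.Modules} {m : M ⟶ N}
    (h : IsCart (vert m)) : IsIso m := by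
  obtain ⟨χ, ⟨h1, h2⟩, -⟩ := h (𝟙 _) (𝟙 Y) rfl
  obtain ⟨n, rfl⟩ := exists_vert χ h1
  refine ⟨n, vert_injective (by rw [vert_comp, h2, vert_id]), vert_injective ?_⟩
  exact h.hom_ext (by simp) (by rw [vert_comp, vert_id, ← assoc, h2]; simp)

theorem mk_comp_mk {Y Z T : Scheme.{u}} (f : Z ⟶ Y) (g : T ⟶ Z) {M : Y.Modules} {N : Z.Modules}
    {P : T.Modules} (m : M ⟶ (pushforward f).obj N)
    (n : N ⟶ (pushforward g).obj P) :
    mkArr f m ≫ mkArr g n = mkArr (g ≫ f) (m ≫ (pushforward f).map n ≫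
      (Scheme.Modules.pushforwardComp g f).hom.app P) := rfl

theorem mk_comp_vert {Y Z : Scheme.{u}} (f : Z ⟶ Y) {M : Y.Modules} {N P : Z.Modules}
    (m : M ⟶ (pushforward f).obj N) (n : N ⟶ P) :
    mkArr f m ≫ vert n = mkArr f (m ≫ (pushforward f).map n) := by
  refine qext (id_comp f) fun U W (hW : W ≤ f ⁻¹ᵁ U) x => ?_
  rw [on_comp (mkArr f m) (vert n) (f ⁻¹ᵁ U) le_rfl hW, on_vert, on_mkArr, rs_self]
  rfl

theorem vert_comp_mk {Y Z : Scheme.{u}} (f : Z ⟶ Y) {M N : Y.Modules} {P : Z.Modules}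
    (m : M ⟶ N) (n : N ⟶ (pushforward f).obj P) :
    vert m ≫ mkArr f n = mkArr f (m ≫ n) := by
  refine qext (comp_id f) fun U W (hW : W ≤ f ⁻¹ᵁ U) x => ?_
  rw [on_comp (vert m) (mkArr f n) U (le_refl U) hW, on_vert_self]
  rfl

/-- The morphism `(Y, M) ⟶ (Z, f^* M)`. -/
def pbArr {Y Z : Scheme.{u}} (f : Z ⟶ Y) (M : Y.Modules) :
    (⟨Y, M⟩ : QMod.{u}) ⟶ ⟨Z, (Scheme.Modules.pullback f).obj M⟩ :=
  mkArr f ((Scheme.Modules.pullbackPushforwardAdjunction f).unit.app M)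

@[simp] theorem bs_pbArr {Y Z : Scheme.{u}} (f : Z ⟶ Y) (M : Y.Modules) : bs (pbArr f M) = f := rfl

/-- The unit of an adjunction between a functor and the direct image is cartesian. -/
theorem isCart_unit {Y Z : Scheme.{u}} (f : Z ⟶ Y) {L : Y.Modules ⥤ Z.Modules}
    (adj : L ⊣ pushforward f) (M : Y.Modules) :
    IsCart (mkArr f (adj.unit.app M : M ⟶ (pushforward f).obj (L.obj M))) := by
  rintro ⟨T, P⟩ ⟨k, m⟩ g hg
  obtain rfl : g ≫ f = k := hg
  let m' : M ⟶ (pushforward f).obj ((pushforward g).obj P) :=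
    m ≫ (Scheme.Modules.pushforwardComp g f).inv.app P
  have key : ∀ n : L.obj M ⟶ (pushforward g).obj P,
      adj.unit.app M ≫ (pushforward f).map n = m' ↔
      adj.unit.app M ≫ (pushforward f).map n ≫
        (Scheme.Modules.pushforwardComp g f).hom.app P = m := by
    intro n
    rw [← assoc]
    constructor
    · intro h
      rw [h]
      simp [m']
    · intro h
      simp only [m', ← h]
      simp
  refine ⟨mkArr g ((adj.homEquiv _ _).symm m'), ⟨rfl, ?_⟩, ?_⟩
  · rw [mk_comp_mk]
    refine congrArg (mkArr (g ≫ f)) ?_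
    refine (key ((adj.homEquiv _ _).symm m')).1 ?_
    exact (adj.homEquiv_unit _ _ _).symm.trans (Equiv.apply_symm_apply _ _)
  · rintro ⟨g', n⟩ ⟨h1, h2⟩
    obtain rfl : g' = g := h1
    refine congrArg (mkArr g') ?_
    refine (Equiv.eq_symm_apply _).2 ?_
    rw [Adjunction.homEquiv_unit]
    refine (key _).2 ?_
    exact mkArr_injective _ ((mk_comp_mk f g' _ n).symm.trans h2)

theorem isCart_pbArr {Y Z : Scheme.{u}} (f : Z ⟶ Y) (M : Y.Modules) : IsCart (pbArr f M) :=
  isCart_unit f (Scheme.Modules.pullbackPushforwardAdjunction f) M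

/-- The morphism `(Y, M) ⟶ (X, M|_X)` for an open immersion `X ⟶ Y`. -/
def resArr {Y Z : Scheme.{u}} (f : Z ⟶ Y) [IsOpenImmersion f] (M : Y.Modules) :
    (⟨Y, M⟩ : QMod.{u}) ⟶ ⟨Z, M.restrict f⟩ :=
  mkArr f ((Scheme.Modules.restrictAdjunction f).unit.app M)

@[simp] theorem bs_resArr {Y Z : Scheme.{u}} (f : Z ⟶ Y) [IsOpenImmersion f] (M : Y.Modules) :
    bs (resArr f M) = f := rfl

theorem isCart_resArr {Y Z : Scheme.{u}} (f : Z ⟶ Y) [IsOpenImmersion f] (M : Y.Modules) :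
    IsCart (resArr f M) :=
  isCart_unit f (Scheme.Modules.restrictAdjunction f) M

theorem pbArr_map {Y Z : Scheme.{u}} (f : Z ⟶ Y) {M N : Y.Modules} (m : M ⟶ N) :
    pbArr f M ≫ vert ((Scheme.Modules.pullback f).map m) = vert m ≫ pbArr f N := by
  have h := (Scheme.Modules.pullbackPushforwardAdjunction f).unit.naturality m
  exact (mk_comp_vert f _ _).trans ((congrArg (mkArr f) h.symm).trans (vert_comp_mk f _ _).symm)

theorem pbArr_pullbackCongr {Y Z : Scheme.{u}} {f g : Z ⟶ Y} (e : f = g) (M : Y.Modules) :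
    pbArr f M ≫ vert ((pullbackCongr e).hom.app M) = pbArr g M := by
  subst e
  have : (pullbackCongr (rfl : f = f)).hom.app M = 𝟙 _ := rfl
  rw [this, vert_id, comp_id]

theorem pbArr_pullbackId {Y : Scheme.{u}} (M : Y.Modules) :
    pbArr (𝟙 Y) M ≫ vert ((Scheme.Modules.pullbackId Y).hom.app M) = 𝟙 _ := by
  have h := congrArg (fun k => k.app M) (Scheme.Modules.conjugateEquiv_pullbackId_hom Y)
  have h' : (Scheme.Modules.pullbackPushforwardAdjunction (𝟙 Y)).unit.app M ≫
      (pushforward (𝟙 Y)).map ((Scheme.Modules.pullbackId Y).hom.app M) =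
    (Scheme.Modules.pushforwardId Y).inv.app M := by
    rw [← h]
    simp [conjugateEquiv_apply_app]
  exact (mk_comp_vert (𝟙 Y) _ _).trans (congrArg (mkArr (𝟙 Y)) h')

theorem pbArr_pullbackComp_inv {Y Z T : Scheme.{u}} (f : T ⟶ Z) (g : Z ⟶ Y) (M : Y.Modules) :
    pbArr (f ≫ g) M ≫ vert ((pullbackComp f g).inv.app M) =
      pbArr g M ≫ pbArr f _ := by
  have h := unit_conjugateEquiv ((Scheme.Modules.pullbackPushforwardAdjunction g).comp
    (Scheme.Modules.pullbackPushforwardAdjunction f))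
    (Scheme.Modules.pullbackPushforwardAdjunction (f ≫ g)) (pullbackComp f g).inv M
  rw [Scheme.Modules.conjugateEquiv_pullbackComp_inv, Adjunction.comp_unit_app] at h
  refine (mk_comp_vert (f ≫ g) _ _).trans ((congrArg (mkArr (f ≫ g)) h.symm).trans ?_)
  rw [assoc]
  rfl

theorem pbArr_pullbackComp {Y Z T : Scheme.{u}} (f : T ⟶ Z) (g : Z ⟶ Y) (M : Y.Modules) :
    pbArr g M ≫ pbArr f _ ≫ vert ((pullbackComp f g).hom.app M) =
      pbArr (f ≫ g) M := by
  rw [← assoc, ← pbArr_pullbackComp_inv, assoc, ← vert_comp, Iso.inv_hom_id_app, vert_id, comp_id]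

end

end Total

/-! ### Gluing sections and frames of sheaves of modules -/

section Frames

section Glue

variable {Y : Scheme.{u}}

theorem existsUnique_glue (M : Y.Modules) {ι : Type*} (U : ι → Y.Opens) {W : Y.Opens}
    (hU : ∀ i, U i ≤ W) (hW : W ≤ iSup U) (s : ∀ i, Γ(M, U i))
    (hs : ∀ i j, rs M (U i) (U i ⊓ U j) (s i) = rs M (U j) (U i ⊓ U j) (s j)) :
    ∃! x : Γ(M, W), ∀ i, rs M W (U i) x = s i := by
  have h := TopCat.Sheaf.existsUnique_gluing' (⟨M.presheaf, M.isSheaf⟩ : TopCat.Sheaf Ab Y) U W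
    (fun i => homOfLE (hU i)) hW s (by
      intro i j
      have := hs i j
      rw [rs_of_le M inf_le_left, rs_of_le M inf_le_right] at this
      exact this)
  obtain ⟨x, hx, hx'⟩ := h
  refine ⟨x, fun i => ?_, fun y hy => hx' y fun i => ?_⟩
  · rw [rs_of_le M (hU i)]; exact hx i
  · have := hy i
    rw [rs_of_le M (hU i)] at this
    exact this

theorem eq_of_rs_eq (M : Y.Modules) {ι : Type*} (U : ι → Y.Opens) {W : Y.Opens}
    (hU : ∀ i, U i ≤ W) (hW : W ≤ iSup U) {x y : Γ(M, W)}
    (h : ∀ i, rs M W (U i) x = rs M W (U i) y) : x = y := by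
  refine (existsUnique_glue M U hU hW (fun i => rs M W (U i) x) fun i j => ?_).unique
    (fun i => rfl) fun i => (h i).symm
  rw [rs_rs _ (hU i) inf_le_left, rs_rs _ (hU j) inf_le_right]

theorem eq_of_rs_eq_of_mem (M : Y.Modules) {W : Y.Opens} {x y : Γ(M, W)}
    (h : ∀ p ∈ W, ∃ V : Y.Opens, p ∈ V ∧ V ≤ W ∧ rs M W V x = rs M W V y) : x = y := by
  choose! V h1 h2 h3 using h
  refine eq_of_rs_eq M (fun p : W => V p) (fun p => h2 p p.2) (fun p hp => ?_) fun p => h3 p p.2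
  exact TopologicalSpace.Opens.mem_iSup.2 ⟨⟨p, hp⟩, h1 p hp⟩

/-- A morphism of sheaves of modules from its maps on sections. -/
def homOfSections {M N : Y.Modules} (a : ∀ U, Γ(M, U) →+ Γ(N, U))
    (hrs : ∀ U V, V ≤ U → ∀ x, a V (rs M U V x) = rs N U V (a U x))
    (hsmul : ∀ U (r : Γ(Y, U)) x, a U (r • x) = r • a U x) : M ⟶ N :=
  SheafOfModules.Hom.mk (PresheafOfModules.homMk
    { app := fun U => AddCommGrpCat.ofHom (a U.unop)
      naturality := fun U V i => by
        have h : V.unop ≤ U.unop := i.unop.le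
        ext x
        have := hrs _ _ h x
        rw [rs_of_le M h, rs_of_le N h] at this
        exact this } fun U r x => hsmul U.unop r x)

theorem app_smul' {M N : Y.Modules} (m : M ⟶ N) {U : Y.Opens} (r : Γ(Y, U)) (x : Γ(M, U)) :
    (m.app U).hom (r • x) = r • (m.app U).hom x := m.app_smul r x

theorem comp_app' {M N P : Y.Modules} (m : M ⟶ N) (n : N ⟶ P) (U : Y.Opens) (x : Γ(M, U)) :
    ((m ≫ n).app U).hom x = (n.app U).hom ((m.app U).hom x) := rfl

theorem isIso_of_bijective {M N : Y.Modules} (m : M ⟶ N)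
    (h : ∀ U, Bijective (m.app U).hom) : IsIso m := by
  rw [Scheme.Modules.Hom.isIso_iff_isIso_app]
  intro U
  rw [ConcreteCategory.isIso_iff_bijective]
  exact h U

theorem bijective_of_isIso {M N : Y.Modules} (m : M ⟶ N) [IsIso m] (U : Y.Opens) :
    Bijective (m.app U).hom := by
  have : IsIso (m.app U) := inferInstance
  rw [ConcreteCategory.isIso_iff_bijective] at this
  exact this

/-- A morphism that is bijective on the sections over all open sets included in a small
neighbourhood of a given point is an isomorphism. -/
theorem bijective_of_locally_bijective {M N : Y.Modules} (m : M ⟶ N) {W : Y.Opens}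
    (h : ∀ y ∈ W, ∃ U : Y.Opens, y ∈ U ∧ ∀ V ≤ U, Bijective (m.app V).hom) :
    Bijective (m.app W).hom := by
  choose! U hU hb using h
  let U' : W → Y.Opens := fun y => U y ⊓ W
  have h1 : ∀ y, U' y ≤ W := fun y => inf_le_right
  have h2 : W ≤ iSup U' := fun y hy =>
    TopologicalSpace.Opens.mem_iSup.2 ⟨⟨y, hy⟩, hU y hy, hy⟩
  have hb' : ∀ (y : W) (V : Y.Opens), V ≤ U' y → Bijective (m.app V).hom :=
    fun y V hV => hb y y.2 V (hV.trans inf_le_left)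
  constructor
  · intro x x' hx
    refine eq_of_rs_eq M U' h1 h2 fun i => (hb' i _ le_rfl).1 ?_
    rw [app_rs m (h1 i), app_rs m (h1 i)]
    exact congrArg _ hx
  · intro z
    choose s hs using fun i => (hb' i _ le_rfl).2 (rs N W (U' i) z)
    obtain ⟨x, hx, -⟩ := existsUnique_glue M U' h1 h2 s fun i j => by
      refine (hb' i _ inf_le_left).1 ?_
      rw [app_rs m inf_le_left, app_rs m inf_le_right, hs, hs, rs_rs _ (h1 i) inf_le_left,
        rs_rs _ (h1 j) inf_le_right]
    refine ⟨x, eq_of_rs_eq N U' h1 h2 fun i => ?_⟩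
    have := app_rs m (h1 i) x
    rw [hx, hs] at this
    exact this.symm

theorem rs_bijective_of_eq (M : Y.Modules) {U V : Y.Opens} (h : U = V) :
    Bijective (rs M U V) := by
  subst h
  exact ⟨fun x y hxy => by simpa using hxy, fun x => ⟨x, rs_self M U x⟩⟩

end Glue

section

variable {Y : Scheme.{u}} {ι : Type} [Fintype ι]

/-- The linear combination of the restrictions to `V` of sections `e` over `U`. -/
def lc (M : Y.Modules) (U V : Y.Opens) (e : ι → Γ(M, U)) (c : ι → Γ(Y, V)) : Γ(M, V) :=
  ∑ i, c i • rs M U V (e i)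

/-- The sections `e` over `U` are a basis of the restriction of the sheaf `M` to `U`. -/
def IsFrame (M : Y.Modules) (U : Y.Opens) (e : ι → Γ(M, U)) : Prop :=
  ∀ V ≤ U, Bijective (lc M U V e)

theorem IsFrame.rs {M : Y.Modules} {U : Y.Opens} {e : ι → Γ(M, U)} (h : IsFrame M U e)
    {V : Y.Opens} (hV : V ≤ U) : IsFrame M V fun i => rs M U V (e i) := by
  intro W hW
  have := h W (hW.trans hV)
  unfold lc at this ⊢
  simp_rw [rs_rs M hV hW]
  exact this

theorem on_lc {A B : QMod.{u}} (φ : A ⟶ B) {U V : A.Y.Opens} {W W' : B.Y.Opens} (hV : V ≤ U)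
    (hW : W ≤ bs φ ⁻¹ᵁ U) (h : W' ≤ bs φ ⁻¹ᵁ V) (h' : W' ≤ W)
    (e : ι → Γ(A.M, U)) (c : ι → Γ(A.Y, V)) :
    on φ V W' (lc A.M U V e c) = lc B.M W W' (fun i => on φ U W (e i))
      fun i => pl (bs φ) V W' (c i) := by
  unfold lc
  rw [map_sum]
  refine Finset.sum_congr rfl fun i _ => ?_
  rw [on_smul φ h, on_rs φ hV h, rs_on φ hW h']

theorem app_lc {M N : Y.Modules} (m : M ⟶ N) {U V : Y.Opens} (hV : V ≤ U) (e : ι → Γ(M, U))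
    (c : ι → Γ(Y, V)) :
    (m.app V).hom (lc M U V e c) = lc N U V (fun i => (m.app U).hom (e i)) c := by
  unfold lc
  rw [map_sum]
  refine Finset.sum_congr rfl fun i _ => ?_
  rw [app_smul', app_rs m hV]

theorem rs_lc (M : Y.Modules) {U V W : Y.Opens} (hV : V ≤ U) (hW : W ≤ V) (e : ι → Γ(M, U))
    (c : ι → Γ(Y, V)) :
    Sht.rs M V W (lc M U V e c) = lc M U W e fun i => rsO V W (c i) := by
  unfold lc
  rw [map_sum]
  refine Finset.sum_congr rfl fun i _ => ?_
  rw [rs_smul _ hW, rs_rs M hV hW]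

theorem lc_smul (M : Y.Modules) (U V : Y.Opens) (e : ι → Γ(M, U)) (a : Γ(Y, V))
    (c : ι → Γ(Y, V)) : lc M U V e (a • c) = a • lc M U V e c := by
  simp [lc, mul_smul, Finset.smul_sum]

theorem lc_single [DecidableEq ι] (M : Y.Modules) {U V : Y.Opens} (e : ι → Γ(M, U)) (i : ι)
    (a : Γ(Y, V)) :
    lc M U V e (Pi.single i a) = a • Sht.rs M U V (e i) := by
  unfold lc
  rw [Finset.sum_eq_single i]
  · simp
  · intro j _ hj
    simp [hj]
  · simp

theorem IsFrame.iso {M N : Y.Modules} (m : M ⟶ N) [IsIso m] {U : Y.Opens} {e : ι → Γ(M, U)}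
    (h : IsFrame M U e) : IsFrame N U fun i => (m.app U).hom (e i) := by
  intro V hV
  have := (bijective_of_isIso m V).comp (h V hV)
  refine (Function.Bijective.of_comp_iff' Function.bijective_id _).1 ?_
  convert! this using 1
  funext c
  exact (app_lc m hV e c).symm

/-- A morphism that sends a frame to a frame is bijective on sections. -/
theorem IsFrame.bijective_app {M N : Y.Modules} (m : M ⟶ N) {U : Y.Opens} {e : ι → Γ(M, U)}
    (h : IsFrame M U e) (h' : IsFrame N U fun i => (m.app U).hom (e i)) {V : Y.Opens}
    (hV : V ≤ U) : Bijective (m.app V).hom := by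
  refine (Function.Bijective.of_comp_iff _ (h V hV)).1 ?_
  have : (m.app V).hom ∘ lc M U V e = lc N U V fun i => (m.app U).hom (e i) := by
    funext c
    exact app_lc m hV e c
  rw [this]
  exact h' V hV

end

section Free

variable {Z : Scheme.{u}} {ι : Type}

/-- The free sheaf of modules with basis `ι`. -/
def freeMod (Z : Scheme.{u}) (ι : Type) : Z.Modules :=
  (SheafOfModules.free (R := Z.ringCatSheaf) (ULift.{u} ι) : Z.Modules)

/-- The section of a sheaf of modules over the whole space, as a compatible family. -/
def sectionsOfTop (P : Z.Modules) (s : Γ(P, ⊤)) : SheafOfModules.sections (R := Z.ringCatSheaf) P :=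
  PresheafOfModules.sectionsMk (fun U => rs P ⊤ U.unop s) fun U V i => by
    have h : V.unop ≤ U.unop := i.unop.le
    have := rs_rs P (le_top : U.unop ≤ ⊤) h s
    rw [rs_of_le P h] at this
    exact this

/-- The basis of the free sheaf. -/
def freeStd (Z : Scheme.{u}) {ι : Type} (i : ι) : Γ(freeMod Z ι, ⊤) :=
  (SheafOfModules.freeSection (R := Z.ringCatSheaf) (I := ULift.{u} ι) ⟨i⟩).eval (.op ⊤)

theorem existsUnique_freeMod_hom (P : Z.Modules) (s : ι → Γ(P, ⊤)) :
    ∃! m : freeMod Z ι ⟶ P, ∀ i, (m.app ⊤).hom (freeStd Z i) = s i := by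
  let E := SheafOfModules.freeHomEquiv (R := Z.ringCatSheaf) (I := ULift.{u} ι) P
  have hE : ∀ (m : freeMod Z ι ⟶ P) (i : ι),
      (m.app ⊤).hom (freeStd Z i) = (E m ⟨i⟩).eval (.op ⊤) := fun m i => rfl
  refine ⟨E.symm fun i => sectionsOfTop P (s i.down), fun i => ?_, fun m hm => ?_⟩
  · refine (hE _ i).trans ?_
    rw [Equiv.apply_symm_apply]
    exact rs_self P ⊤ (s i)
  · refine E.injective ?_
    rw [Equiv.apply_symm_apply]
    funext ⟨i⟩
    refine PresheafOfModules.sections_ext _ _ fun U => ?_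
    have h1 := (hE m i).symm.trans (hm i)
    have h2 := PresheafOfModules.sections_property (E m ⟨i⟩) (homOfLE (le_top : U.unop ≤ ⊤)).op
    refine h2.symm.trans ?_
    have h3 : rs P ⊤ U.unop (s i) = (P.presheaf.map (homOfLE (le_top : U.unop ≤ ⊤)).op).hom (s i) := by
      rw [rs_of_le P le_top]
    refine Eq.trans ?_ h3.symm
    rw [← h1]
    rfl

theorem freeMod_hom_ext {P : Z.Modules} {m n : freeMod Z ι ⟶ P}
    (h : ∀ i, (m.app ⊤).hom (freeStd Z i) = (n.app ⊤).hom (freeStd Z i)) : m = n :=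
  (existsUnique_freeMod_hom P fun i => (n.app ⊤).hom (freeStd Z i)).unique h fun _ => rfl

/-- The structure sheaf. -/
def unitMod (Z : Scheme.{u}) : Z.Modules := (SheafOfModules.unit Z.ringCatSheaf : Z.Modules)

/-- The sections of the structure sheaf. -/
def unitSec (Z : Scheme.{u}) (U : Z.Opens) : Γ(unitMod Z, U) ≃+ Γ(Z, U) := AddEquiv.refl Γ(Z, U)

theorem unitSec_smul {U : Z.Opens} (a : Γ(Z, U)) (x : Γ(unitMod Z, U)) :
    unitSec Z U (a • x) = a * unitSec Z U x := rfl

theorem unitSec_rs {U V : Z.Opens} (h : V ≤ U) (x : Γ(unitMod Z, U)) :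
    unitSec Z V (rs _ U V x) = rsO U V (unitSec Z U x) := by
  rw [rsO_of_le h, rs_of_le _ h]
  rfl

theorem existsUnique_unitMod_hom (P : Z.Modules) (s : Γ(P, ⊤)) :
    ∃! m : unitMod Z ⟶ P, (m.app ⊤).hom ((unitSec Z ⊤).symm 1) = s := by
  let E := SheafOfModules.unitHomEquiv (R := Z.ringCatSheaf) P
  have hE : ∀ (m : unitMod Z ⟶ P),
      (m.app ⊤).hom ((unitSec Z ⊤).symm 1) = (E m).eval (.op ⊤) := fun m => rfl
  refine ⟨E.symm (sectionsOfTop P s), ?_, fun m hm => ?_⟩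
  · refine (hE _).trans ?_
    rw [Equiv.apply_symm_apply]
    exact rs_self P ⊤ s
  · refine E.injective ?_
    rw [Equiv.apply_symm_apply]
    refine PresheafOfModules.sections_ext _ _ fun U => ?_
    have h1 := (hE m).symm.trans hm
    have h2 := PresheafOfModules.sections_property (E m) (homOfLE (le_top : U.unop ≤ ⊤)).op
    refine h2.symm.trans ?_
    have h3 : rs P ⊤ U.unop s = (P.presheaf.map (homOfLE (le_top : U.unop ≤ ⊤)).op).hom s := by
      rw [rs_of_le P le_top]
    refine Eq.trans ?_ h3.symm
    rw [← h1]
    rfl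

theorem isFrame_freeStd (Z : Scheme.{u}) (ι : Type) [Fintype ι] :
    IsFrame (freeMod Z ι) ⊤ (freeStd Z (ι := ι)) := by
  classical
  intro V hV
  choose inc hinc _ using fun i : ι => existsUnique_unitMod_hom (freeMod Z ι) (freeStd Z i)
  choose pr hpr _ using fun i : ι => existsUnique_freeMod_hom (unitMod Z)
    fun j => (unitSec Z ⊤).symm (if i = j then 1 else 0)
  have hinc' : ∀ i (a : Γ(unitMod Z, V)),
      ((inc i).app V).hom a = unitSec Z V a • rs _ ⊤ V (freeStd Z i) := by
    intro i a
    have : a = unitSec Z V a • rs _ ⊤ V ((unitSec Z ⊤).symm 1) := by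
      apply (unitSec Z V).injective
      rw [unitSec_smul, unitSec_rs hV, AddEquiv.apply_symm_apply, rsO_one hV, mul_one]
    conv_lhs => rw [this]
    rw [app_smul', app_rs _ hV]
    exact congrArg (fun z => unitSec Z V a • rs _ ⊤ V z) (hinc i)
  have hpr' : ∀ i j, unitSec Z V (((pr i).app V).hom (rs _ ⊤ V (freeStd Z j))) =
      if i = j then 1 else 0 := by
    intro i j
    rw [app_rs _ hV, unitSec_rs hV]
    rw [hpr i j, AddEquiv.apply_symm_apply]
    split_ifs
    · exact rsO_one hV
    · exact map_zero _
  have hid : ∑ i, pr i ≫ inc i = 𝟙 (freeMod Z ι) := by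
    refine freeMod_hom_ext fun j => ?_
    have hsum : ∀ s : Finset ι, ((∑ i ∈ s, pr i ≫ inc i : freeMod Z ι ⟶ freeMod Z ι).app ⊤).hom
        (freeStd Z j) = ∑ i ∈ s, if i = j then freeStd Z i else 0 := by
      intro s
      induction s using Finset.induction_on with
      | empty => simp
      | insert i s hi ih =>
        rw [Finset.sum_insert hi, Finset.sum_insert hi, Scheme.Modules.Hom.add_app]
        refine congrArg₂ (· + ·) ?_ ih
        rw [comp_app', hpr i j]
        split_ifs
        · exact hinc i
        · rw [map_zero, map_zero]
    rw [hsum]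
    simp
  constructor
  · intro c c' h
    funext j
    have h2 := congrArg (fun z => unitSec Z V (((pr j).app V).hom z)) h
    have h3 : ∀ c : ι → Γ(Z, V),
        unitSec Z V (((pr j).app V).hom (lc (freeMod Z ι) ⊤ V (freeStd Z) c)) = c j := by
      intro c
      unfold lc
      rw [map_sum, map_sum]
      simp_rw [app_smul', unitSec_smul, hpr']
      simp
    simpa only [h3] using h2
  · intro x
    refine ⟨fun i => unitSec Z V (((pr i).app V).hom x), ?_⟩
    have h2 := congrArg (fun m => (m.app V).hom x) hid
    refine Eq.trans ?_ h2
    unfold lc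
    simp_rw [← hinc']
    have hsum : ∀ s : Finset ι, ((∑ i ∈ s, pr i ≫ inc i : freeMod Z ι ⟶ freeMod Z ι).app V).hom
        x = ∑ i ∈ s, ((inc i).app V).hom (((pr i).app V).hom x) := by
      intro s
      induction s using Finset.induction_on with
      | empty => simp
      | insert i s hi ih =>
        rw [Finset.sum_insert hi, Finset.sum_insert hi, Scheme.Modules.Hom.add_app]
        exact congrArg₂ (· + ·) rfl ih
    exact (hsum _).symm

variable [Fintype ι]

/-- A frame over the whole space gives an isomorphism with the free sheaf. -/
theorem IsFrame.exists_iso {Q : Z.Modules} {e : ι → Γ(Q, ⊤)} (h : IsFrame Q ⊤ e) :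
    ∃ m : freeMod Z ι ⟶ Q, IsIso m ∧ ∀ i, (m.app ⊤).hom (freeStd Z i) = e i := by
  obtain ⟨m, hm, -⟩ := existsUnique_freeMod_hom Q e
  refine ⟨m, isIso_of_bijective m fun U => ?_, hm⟩
  refine (isFrame_freeStd Z ι).bijective_app m ?_ (le_top : U ≤ ⊤)
  simp_rw [hm]
  exact h

theorem IsFrame.existsUnique_hom {Q : Z.Modules} {e : ι → Γ(Q, ⊤)} (h : IsFrame Q ⊤ e)
    (P : Z.Modules) (s : ι → Γ(P, ⊤)) :
    ∃! m : Q ⟶ P, ∀ i, (m.app ⊤).hom (e i) = s i := by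
  obtain ⟨k, hk, hk'⟩ := h.exists_iso
  obtain ⟨m, hm, hm'⟩ := existsUnique_freeMod_hom P s
  refine ⟨inv k ≫ m, fun i => ?_, fun n hn => ?_⟩
  · rw [← hm, ← hk', ← comp_app', IsIso.hom_inv_id_assoc]
  · rw [← hm' (k ≫ n) fun i => ?_, IsIso.inv_hom_id_assoc]
    rw [comp_app', hk', hn]

/-- Sections with the universal property of a basis are a basis. -/
theorem isFrame_of_existsUnique {Q : Z.Modules} {e : ι → Γ(Q, ⊤)}
    (h : ∀ (P : Z.Modules) (s : ι → Γ(P, ⊤)), ∃! m : Q ⟶ P, ∀ i, (m.app ⊤).hom (e i) = s i) :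
    IsFrame Q ⊤ e := by
  obtain ⟨m, hm, -⟩ := existsUnique_freeMod_hom Q e
  obtain ⟨n, hn, -⟩ := h (freeMod Z ι) (freeStd Z)
  have h1 : m ≫ n = 𝟙 _ := freeMod_hom_ext fun i => by
    rw [comp_app', hm, hn]; rfl
  have h2 : n ≫ m = 𝟙 _ := (h Q e).unique (fun i => by rw [comp_app', hn, hm]) fun i => rfl
  have : IsIso m := ⟨n, h1, h2⟩
  have := (isFrame_freeStd Z ι).iso m
  simp_rw [hm] at this
  exact this

theorem IsFrame.existsUnique_arrow {A C : QMod.{u}} {e : ι → Γ(A.M, ⊤)} (h : IsFrame A.M ⊤ e)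
    (g : C.Y ⟶ A.Y) (s : ι → Γ(C.M, ⊤)) :
    ∃! ψ : A ⟶ C, bs ψ = g ∧ ∀ i, on ψ ⊤ ⊤ (e i) = s i := by
  obtain ⟨m, hm, hm'⟩ := h.existsUnique_hom ((pushforward g).obj C.M)
    fun i => (show Γ(C.M, g ⁻¹ᵁ ⊤) from s i)
  refine ⟨mkArr g m, ⟨rfl, fun i => ?_⟩, ?_⟩
  · rw [on_mkArr, hm]
    exact rs_self C.M ⊤ (s i)
  · rintro ⟨g', n⟩ ⟨h1, h2⟩
    obtain rfl : g' = g := h1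
    refine congrArg (mkArr g') (hm' n fun i => ?_)
    have := h2 i
    have h3 : on (mkArr g' n) ⊤ ⊤ (e i) = (n.app ⊤).hom (e i) := rs_self C.M ⊤ _
    exact h3.symm.trans this

/-- Frames and restriction to open subschemes. -/
theorem isFrame_restrict_iff {Y : Scheme.{u}} (M : Y.Modules) (U : Y.Opens) (e : ι → Γ(M, U)) :
    IsFrame (M.restrict U.ι) ⊤ (fun i => on (resArr U.ι M) U ⊤ (e i)) ↔ IsFrame M U e := by
  have hbij : ∀ V : U.toScheme.Opens,
      Bijective (on (resArr U.ι M) (U.ι ''ᵁ V) V) := by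
    intro V
    have h0 : U.ι ⁻¹ᵁ U.ι ''ᵁ V = V := U.ι.preimage_image_eq V
    have h1 := rs_bijective_of_eq (M.restrict U.ι) h0
    have h2 : Bijective (rs M (U.ι ''ᵁ V) (U.ι ''ᵁ U.ι ⁻¹ᵁ U.ι ''ᵁ V)) :=
      rs_bijective_of_eq M (by rw [h0])
    rw [rs_of_le M (U.ι.image_preimage_le _)] at h2
    exact h1.comp h2
  have hpl : ∀ V : U.toScheme.Opens, Bijective (pl U.ι (U.ι ''ᵁ V) V) := by
    intro V
    rw [pl_of_le _ (U.ι.preimage_image_eq V).ge]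
    have : U.ι.appLE (U.ι ''ᵁ V) V (U.ι.preimage_image_eq V).ge = (U.ι.appIso V).hom :=
      (U.ι.appIso_hom' V).symm
    rw [this]
    exact ConcreteCategory.bijective_of_isIso (U.ι.appIso V).hom
  have key : ∀ V : U.toScheme.Opens,
      Bijective (lc (M.restrict U.ι) ⊤ V (fun i => on (resArr U.ι M) U ⊤ (e i))) ↔
      Bijective (lc M U (U.ι ''ᵁ V) e) := by
    intro V
    have h : V ≤ U.ι ⁻¹ᵁ U.ι ''ᵁ V := (U.ι.preimage_image_eq V).ge
    have h1 : U.ι ''ᵁ V ≤ U := (U.ι.image_le_opensRange V).trans U.opensRange_ι.le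
    have h2 : (⊤ : U.toScheme.Opens) ≤ U.ι ⁻¹ᵁ U := U.ι_preimage_self.ge
    have : on (resArr U.ι M) (U.ι ''ᵁ V) V ∘ lc M U (U.ι ''ᵁ V) e =
      lc (M.restrict U.ι) ⊤ V (fun i => on (resArr U.ι M) U ⊤ (e i)) ∘
        fun c i => pl U.ι (U.ι ''ᵁ V) V (c i) := by
      funext c
      exact on_lc (resArr U.ι M) h1 h2 h le_top e c
    have h3 : Bijective fun (c : ι → Γ(Y, U.ι ''ᵁ V)) i => pl U.ι (U.ι ''ᵁ V) V (c i) :=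
      Function.Bijective.piMap fun _ => hpl V
    rw [← Function.Bijective.of_comp_iff' (hbij V), this, Function.Bijective.of_comp_iff _ h3]
  constructor
  · intro h V hV
    obtain ⟨W, rfl⟩ : ∃ W : U.toScheme.Opens, U.ι ''ᵁ W = V := ⟨U.ι ⁻¹ᵁ V, by
      rw [U.ι.image_preimage_eq_opensRange_inf, U.opensRange_ι, inf_eq_right.2 hV]⟩
    exact (key W).1 (h W le_top)
  · intro h V hV
    exact (key V).2 (h _ ((U.ι.image_le_opensRange V).trans U.opensRange_ι.le))

theorem IsFrame.of_cart_top {A : QMod.{u}} {N : Z.Modules} {χ : A ⟶ ⟨Z, N⟩} (hχ : IsCart χ)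
    {e : ι → Γ(A.M, ⊤)} (h : IsFrame A.M ⊤ e) :
    IsFrame N ⊤ fun i => on χ ⊤ ⊤ (e i) := by
  refine isFrame_of_existsUnique fun P s => ?_
  obtain ⟨ψ, ⟨h3, h4⟩, h5⟩ := h.existsUnique_arrow (C := ⟨Z, P⟩) (show Z ⟶ A.Y from bs χ) s
  obtain ⟨k, ⟨h6, h7⟩, h8⟩ := hχ ψ (𝟙 Z) ((id_comp (bs χ)).trans h3.symm)
  obtain ⟨m, rfl⟩ := exists_vert k h6
  refine ⟨m, fun i => ?_, fun n hn => ?_⟩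
  · rw [← on_vert_self, ← on_comp χ (vert m) ⊤ le_top le_top, h7, h4]
  · refine vert_injective (h8 _ ⟨rfl, h5 _ ⟨id_comp (bs χ), fun i => ?_⟩⟩)
    rw [on_comp χ (vert n) ⊤ le_top le_top, on_vert_self, hn]

theorem IsCart.exists_lift {A B A' B' : QMod.{u}} {φ : A ⟶ B} (hφ : IsCart φ) {ρ : A ⟶ A'}
    (hρ : IsCart ρ) {σ : B ⟶ B'} (hσ : IsCart σ) (g : B'.Y ⟶ A'.Y)
    (hg : g ≫ bs ρ = bs σ ≫ bs φ) : ∃ χ : A' ⟶ B', bs χ = g ∧ IsCart χ ∧ ρ ≫ χ = φ ≫ σ := by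
  obtain ⟨χ, ⟨h1, h2⟩, -⟩ := hρ (φ ≫ σ) g hg
  exact ⟨χ, h1, hρ.of_comp (h2 ▸ hφ.comp hσ), h2⟩

/-- A cartesian morphism sends frames to frames. -/
theorem IsFrame.cart {A B : QMod.{u}} {φ : A ⟶ B} (hφ : IsCart φ) {U : A.Y.Opens}
    {e : ι → Γ(A.M, U)} (h : IsFrame A.M U e) {W : B.Y.Opens} (hW : W ≤ bs φ ⁻¹ᵁ U) :
    IsFrame B.M W fun i => on φ U W (e i) := by
  obtain ⟨χ, h1, hχ, h2⟩ := hφ.exists_lift (isCart_resArr U.ι A.M) (isCart_resArr W.ι B.M)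
    ((bs φ).resLE U W hW) ((bs φ).resLE_comp_ι hW)
  have h3 := IsFrame.of_cart_top hχ ((isFrame_restrict_iff A.M U e).2 h)
  refine (isFrame_restrict_iff B.M W _).1 ?_
  have hs : ∀ i, on χ ⊤ ⊤ (on (resArr U.ι A.M) U ⊤ (e i)) =
      on (resArr W.ι B.M) W ⊤ (on φ U W (e i)) := by
    intro i
    rw [← on_comp (resArr U.ι A.M) χ ⊤ U.ι_preimage_self.ge le_top, h2,
      on_comp φ (resArr W.ι B.M) W hW W.ι_preimage_self.ge]
  exact (congrArg (IsFrame (B.M.restrict W.ι) ⊤) (funext hs)).mp h3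

theorem isLocallyFreeOfRank_iff {Y : Scheme.{u}} (M : Y.Modules) (d : ℕ) :
    IsLocallyFreeOfRank M d ↔
      ∀ y : Y, ∃ (U : Y.Opens) (e : Fin d → Γ(M, U)), y ∈ U ∧ IsFrame M U e := by
  refine forall_congr' fun y => exists_congr fun U => ?_
  constructor
  · rintro ⟨hy, ⟨k⟩⟩
    let k' : M.restrict U.ι ≅ freeMod U.toScheme (Fin d) := k
    have h1 := (isFrame_freeStd U.toScheme (Fin d)).iso k'.inv
    have h2 : Bijective (on (resArr U.ι M) U ⊤) := by
      have h3 := rs_bijective_of_eq (M.restrict U.ι) U.ι_preimage_self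
      have h4 : Bijective (rs M U (U.ι ''ᵁ U.ι ⁻¹ᵁ U)) := rs_bijective_of_eq M (by
        rw [U.ι.image_preimage_eq_opensRange_inf, U.opensRange_ι, inf_idem])
      rw [rs_of_le M (U.ι.image_preimage_le _)] at h4
      exact h3.comp h4
    choose e he using fun i => h2.2
      ((k'.inv.app ⊤).hom (freeStd _ i))
    refine ⟨e, hy, (isFrame_restrict_iff M U e).1 ?_⟩
    simp_rw [he]
    exact h1
  · rintro ⟨e, hy, he⟩
    obtain ⟨m, hm, -⟩ := ((isFrame_restrict_iff M U e).2 he).exists_iso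
    exact ⟨hy, ⟨(asIso m).symm⟩⟩

end Free

end Frames

/-! ### Kernels on sections, and sheaves on one-point schemes -/

section Kernels

variable {Y : Scheme.{u}} {M N P : Y.Modules}

/-- Sections over `U`, as a functor. -/
def secF (U : Y.Opens) : Y.Modules ⥤ Ab.{u} :=
  Scheme.Modules.toPresheaf Y ⋙ (evaluation _ _).obj (.op U)

instance (U : Y.Opens) : PreservesFiniteLimits (secF U) := by
  have : PreservesLimits (Scheme.Modules.toPresheaf Y) := inferInstance
  have : PreservesFiniteLimits (Scheme.Modules.toPresheaf Y) :=
    PreservesLimits.preservesFiniteLimits _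
  have : PreservesFiniteLimits ((evaluation (TopologicalSpace.Opens Y)ᵒᵖ Ab.{u}).obj (.op U)) :=
    ⟨fun _ _ _ => inferInstance⟩
  exact comp_preservesFiniteLimits _ _

instance (U : Y.Opens) : (secF U).PreservesZeroMorphisms := ⟨fun _ _ => rfl⟩

theorem app_injective (f : M ⟶ N) [Mono f] (U : Y.Opens) : Injective (f.app U).hom := by
  have : Mono ((secF U).map f) := inferInstance
  rw [AddCommGrpCat.mono_iff_injective] at this
  exact this

theorem mono_of_app_injective (f : M ⟶ N) (h : ∀ U, Injective (f.app U).hom) :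
    Mono f := by
  refine ⟨fun a b hab => ?_⟩
  ext U x
  refine h U ?_
  rw [← comp_app', hab, comp_app']

/-- Taking sections is left exact. -/
theorem exists_app_eq_of_isLimit (f : M ⟶ N) (g : N ⟶ P) (w : f ≫ g = 0)
    (h : IsLimit (KernelFork.ofι f w)) (U : Y.Opens) (x : Γ(N, U)) (hx : (g.app U).hom x = 0) :
    ∃ y, (f.app U).hom y = x := by
  have h1 := KernelFork.mapIsLimit (KernelFork.ofι f w) h (secF U)
  let S : ShortComplex Ab := ShortComplex.mk ((secF U).map f) ((secF U).map g) (by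
    rw [← Functor.map_comp, w, Functor.map_zero])
  have h2 : S.Exact := S.exact_of_f_is_kernel h1
  rw [ShortComplex.ab_exact_iff] at h2
  exact h2 x hx

theorem exists_app_eq_of_cokernel (f : M ⟶ N) [Mono f] (U : Y.Opens) (x : Γ(N, U))
    (hx : ((cokernel.π f).app U).hom x = 0) : ∃ y, (f.app U).hom y = x :=
  exists_app_eq_of_isLimit f (cokernel.π f) (cokernel.condition f)
    (Abelian.monoIsKernelOfCokernel _ (colimit.isColimit _)) U x hx

theorem exists_kernel_app_eq (g : N ⟶ P) (U : Y.Opens) (x : Γ(N, U))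
    (hx : (g.app U).hom x = 0) : ∃ y, ((kernel.ι g).app U).hom y = x :=
  exists_app_eq_of_isLimit (kernel.ι g) g (kernel.condition g) (kernelIsKernel g) U x hx

theorem subsingleton_bot (M : Y.Modules) : Subsingleton Γ(M, (⊥ : Y.Opens)) :=
  ⟨fun _ _ => eq_of_rs_eq_of_mem M fun p hp => absurd hp (by simp)⟩

theorem subsingleton_of_isEmpty (M : Y.Modules) {U : Y.Opens} (h : ∀ y, y ∉ U) :
    Subsingleton Γ(M, U) :=
  ⟨fun _ _ => eq_of_rs_eq_of_mem M fun p hp => absurd hp (h p)⟩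

theorem subsingleton_functions {U : Y.Opens} (h : ∀ y, y ∉ U) : Subsingleton Γ(Y, U) := by
  have := subsingleton_of_isEmpty (unitMod Y) h
  exact (unitSec Y U).symm.injective.subsingleton

/-- If `f` is injective on sections, then whether a section is in the image of `f` is a local
question. -/
theorem exists_app_eq_of_locally (f : M ⟶ N) (hf : ∀ U, Injective (f.app U).hom)
    {W : Y.Opens} (x : Γ(N, W))
    (h : ∀ y ∈ W, ∃ V : Y.Opens, y ∈ V ∧ V ≤ W ∧ ∃ z, (f.app V).hom z = rs N W V x) :
    ∃ z, (f.app W).hom z = x := by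
  choose! V h1 h2 s hs using h
  have hc : W ≤ iSup fun p : W => V p := fun p hp =>
    TopologicalSpace.Opens.mem_iSup.2 ⟨⟨p, hp⟩, h1 p hp⟩
  obtain ⟨z, hz, -⟩ := existsUnique_glue M (fun p : W => V p) (fun p => h2 p p.2) hc
    (fun p => s p) fun i j => by
      refine hf _ ?_
      rw [app_rs f inf_le_left, app_rs f inf_le_right, hs i i.2, hs j j.2,
        rs_rs N (h2 i i.2) inf_le_left, rs_rs N (h2 j j.2) inf_le_right]
  refine ⟨z, eq_of_rs_eq N _ (fun p : W => h2 p p.2) hc fun p => ?_⟩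
  rw [← app_rs f (h2 p p.2), hz, hs p p.2]

/-- A morphism factors uniquely through a morphism that is injective on sections if it does so on
sections. -/
theorem exists_lift_of_app (f : M ⟶ N) (hf : ∀ U, Injective (f.app U).hom)
    {K : Y.Modules} (k : K ⟶ N) (h : ∀ U x, ∃ z, (f.app U).hom z = (k.app U).hom x) :
    ∃! l : K ⟶ M, l ≫ f = k := by
  choose s hs using h
  have hs1 : ∀ U x y, s U (x + y) = s U x + s U y := fun U x y => hf U (by
    rw [map_add, hs, hs, hs, map_add])
  have hs2 : ∀ U V, V ≤ U → ∀ x, s V (rs K U V x) = rs M U V (s U x) := fun U V h x => hf V (by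
    rw [hs, app_rs k h, app_rs f h, hs])
  have hs3 : ∀ U (r : Γ(Y, U)) x, s U (r • x) = r • s U x := fun U r x => hf U (by
    rw [hs, app_smul', app_smul', hs])
  obtain ⟨l, hl⟩ : ∃ l : K ⟶ M, ∀ U x, (l.app U).hom x = s U x :=
    ⟨homOfSections (fun U => AddMonoidHom.mk' (s U) (hs1 U)) hs2 hs3, fun U x => rfl⟩
  refine ⟨l, ?_, fun l' hl' => ?_⟩
  · ext U x
    exact (congrArg (f.app U).hom (hl U x)).trans (hs U x)
  · ext U x
    refine hf U ?_
    rw [hl, hs, ← hl', comp_app']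

theorem frame_of_bijective (f : M ⟶ N) {U : Y.Opens} {ι : Type} [Fintype ι] {e : ι → Γ(M, U)}
    (he : IsFrame M U e) (h : ∀ V ≤ U, Bijective (f.app V).hom) :
    IsFrame N U fun i => (f.app U).hom (e i) := by
  intro V hV
  have := (h V hV).comp (he V hV)
  have h1 : (f.app V).hom ∘ lc M U V e = lc N U V fun i => (f.app U).hom (e i) := by
    funext c
    exact app_lc f hV e c
  rwa [h1] at this

theorem frame_of_bijective_symm (f : M ⟶ N) {U : Y.Opens} {ι : Type} [Fintype ι]
    {e : ι → Γ(M, U)} (he : IsFrame N U fun i => (f.app U).hom (e i))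
    (h : ∀ V ≤ U, Bijective (f.app V).hom) : IsFrame M U e := by
  intro V hV
  have h1 : (f.app V).hom ∘ lc M U V e = lc N U V fun i => (f.app U).hom (e i) := by
    funext c
    exact app_lc f hV e c
  refine (Function.Bijective.of_comp_iff' (h V hV) _).1 ?_
  rw [h1]
  exact he V hV

theorem lc_lc {ι κ : Type} [Fintype ι] [Fintype κ] (M : Y.Modules) {U V : Y.Opens} (h : V ≤ U)
    (e : ι → Γ(M, U)) (c : κ → ι → Γ(Y, U)) (a : κ → Γ(Y, V)) :
    lc M U V (fun k => lc M U U e (c k)) a = lc M U V e fun i => ∑ k, a k * rsO U V (c k i) := by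
  conv_lhs => unfold lc
  change ∑ k, a k • rs M U V (lc M U U e (c k)) = _
  simp_rw [rs_lc M le_rfl h]
  unfold lc
  simp_rw [Finset.smul_sum, Finset.sum_smul, smul_smul]
  exact Finset.sum_comm

/-- An invertible matrix transforms a frame into a frame. -/
theorem IsFrame.of_matrix {ι : Type} [Fintype ι] [DecidableEq ι] {U : Y.Opens} {e : ι → Γ(M, U)}
    (he : IsFrame M U e) (A : Matrix ι ι Γ(Y, U)) (hA : IsUnit A.det) :
    IsFrame M U fun j => lc M U U e (A j) := by
  intro V hV
  let r : Γ(Y, U) →+* Γ(Y, V) :=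
    { rsO U V with map_one' := rsO_one hV, map_mul' := rsO_mul hV }
  have h1 : lc M U V (fun j => lc M U U e (A j)) =
      lc M U V e ∘ fun a => Matrix.vecMul a (A.map r) := by
    funext a
    exact lc_lc M hV e A a
  rw [h1]
  refine (he V hV).comp ?_
  have h2 : IsUnit (A.map r) := by
    rw [Matrix.isUnit_iff_isUnit_det]
    have := hA.map r
    rwa [RingHom.map_det] at this
  obtain ⟨B, hB⟩ := h2
  refine Function.bijective_iff_has_inverse.2 ⟨fun a => Matrix.vecMul a ((B⁻¹ : (Matrix ι ι _)ˣ) : Matrix ι ι _), fun a => ?_, fun a => ?_⟩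
  · change Matrix.vecMul (Matrix.vecMul a (A.map r)) _ = a
    rw [Matrix.vecMul_vecMul, ← hB, Units.mul_inv, Matrix.vecMul_one]
  · change Matrix.vecMul (Matrix.vecMul a _) (A.map r) = a
    rw [Matrix.vecMul_vecMul, ← hB, Units.inv_mul, Matrix.vecMul_one]

end Kernels

section OnePoint

variable {T : Scheme.{u}} [Subsingleton T]

theorem eq_bot_or_eq_top (U : T.Opens) : U = ⊥ ∨ U = ⊤ := by
  by_cases h : ∃ x, x ∈ U
  · right
    obtain ⟨x, hx⟩ := h
    ext y
    rw [Subsingleton.elim y x]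
    simpa using hx
  · left
    ext y
    simp only [not_exists] at h
    simpa using h y

theorem isFrame_top_of_bijective {M : T.Modules} {ι : Type} [Fintype ι] {e : ι → Γ(M, ⊤)}
    (h : Bijective (lc M ⊤ ⊤ e)) : IsFrame M ⊤ e := by
  intro V hV
  obtain rfl | rfl := eq_bot_or_eq_top V
  · have := subsingleton_bot M
    have : Subsingleton Γ(T, (⊥ : T.Opens)) := subsingleton_functions (by simp)
    exact ⟨fun x y _ => Subsingleton.elim _ _, fun x => ⟨0, Subsingleton.elim _ _⟩⟩
  · exact h

theorem exists_frame_top [Nonempty T] {M : T.Modules} {d : ℕ} (h : IsLocallyFreeOfRank M d) :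
    ∃ e : Fin d → Γ(M, ⊤), IsFrame M ⊤ e := by
  rw [isLocallyFreeOfRank_iff] at h
  obtain ⟨U, e, hU, he⟩ := h (Classical.arbitrary T)
  obtain rfl | rfl := eq_bot_or_eq_top U
  · simp at hU
  · exact ⟨e, he⟩

/-- A morphism of direct images, as a map on sections over inverse images. -/
def pfMap {T Y : Scheme.{u}} {i : T ⟶ Y} {L L' : T.Modules}
    (ψ : (pushforward i).obj L ⟶ (pushforward i).obj L')
    (U : Y.Opens) : Γ(L, i ⁻¹ᵁ U) →+ Γ(L', i ⁻¹ᵁ U) := (ψ.app U).hom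

section

variable {T Y : Scheme.{u}} {i : T ⟶ Y} {L L' : T.Modules}
    (ψ : (pushforward i).obj L ⟶ (pushforward i).obj L')

/-- A morphism of direct images, as a map on global sections. -/
def pfTop : Γ(L, ⊤) →+ Γ(L', ⊤) := pfMap ψ ⊤

theorem unpf_app (U : Y.Opens) (x : Γ((pushforward i).obj L, U)) :
    unpf i L' U ((ψ.app U).hom x) = pfMap ψ U (unpf i L U x) := rfl

theorem pfMap_rs {U V : Y.Opens} (h : V ≤ U) (x : Γ(L, i ⁻¹ᵁ U)) :
    pfMap ψ V (rs L (i ⁻¹ᵁ U) (i ⁻¹ᵁ V) x) = rs L' (i ⁻¹ᵁ U) (i ⁻¹ᵁ V) (pfMap ψ U x) := by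
  obtain ⟨y, rfl⟩ : ∃ y, unpf i L U y = x := ⟨x, rfl⟩
  rw [← unpf_rs L i h, ← unpf_app, ← unpf_app, ← unpf_rs L' i h, app_rs ψ h]

theorem pfMap_smul (U : Y.Opens) (r : Γ(Y, U)) (x : Γ(L, i ⁻¹ᵁ U)) :
    pfMap ψ U ((i.app U).hom r • x) = (i.app U).hom r • pfMap ψ U x := by
  obtain ⟨y, rfl⟩ : ∃ y, unpf i L U y = x := ⟨x, rfl⟩
  rw [← unpf_smul, ← unpf_app, ← unpf_app, ← unpf_smul, app_smul' ψ]

end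

/-- The direct image along a section of a morphism to a one-point scheme is fully faithful. -/
theorem existsUnique_of_pushforward {Y : Scheme.{u}} (i : T ⟶ Y) (p : Y ⟶ T) (hip : i ≫ p = 𝟙 T)
    {L L' : T.Modules}
    (ψ : (pushforward i).obj L ⟶ (pushforward i).obj L') :
    ∃! χ : L ⟶ L', (pushforward i).map χ = ψ := by
  -- Linearity over `Γ(T, ⊤)`: the scalars extend to `Y` along `p`.
  have htop : ∀ (r : Γ(T, ⊤)) (x : Γ(L, ⊤)), pfTop ψ (r • x) = r • pfTop ψ x := by
    intro r x
    have h1 : (i.app ⊤).hom ((p.app ⊤).hom r) = r := by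
      have := congrArg (fun m => m.hom r) (Scheme.Hom.comp_app i p ⊤)
      refine this.symm.trans ?_
      rw [hip]
      rfl
    rw [← h1]
    exact pfMap_smul ψ ⊤ ((p.app ⊤).hom r) x
  let χ : L ⟶ L' := homOfSections
    (fun U => (rs L' ⊤ U).comp ((pfTop ψ).comp (rs L U ⊤)))
    (by
      intro U V h x
      obtain rfl | rfl := eq_bot_or_eq_top V
      · have := subsingleton_bot L'
        exact Subsingleton.elim _ _
      · obtain rfl : U = ⊤ := top_le_iff.1 h
        simp only [AddMonoidHom.comp_apply, rs_self])
    (by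
      intro U r x
      obtain rfl | rfl := eq_bot_or_eq_top U
      · have := subsingleton_bot L'
        exact Subsingleton.elim _ _
      · simp only [AddMonoidHom.comp_apply, rs_self]
        exact htop r x)
  have hχ : ∀ x, (χ.app ⊤).hom x = pfTop ψ x := by
    intro x
    change rs L' ⊤ ⊤ (pfTop ψ (rs L ⊤ ⊤ x)) = _
    rw [rs_self, rs_self]
  refine ⟨χ, ?_, ?_⟩
  · ext U x
    obtain h | h := eq_bot_or_eq_top (i ⁻¹ᵁ U)
    · have : Subsingleton Γ(L', i ⁻¹ᵁ U) := subsingleton_of_isEmpty L' (by simp [h])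
      exact Subsingleton.elim (α := Γ(L', i ⁻¹ᵁ U)) _ _
    · have hb := rs_bijective_of_eq L (show i ⁻¹ᵁ ⊤ = i ⁻¹ᵁ U from h.symm)
      obtain ⟨y, hy⟩ := hb.2 x
      change (χ.app (i ⁻¹ᵁ U)).hom (unpf i L U x) = pfMap ψ U (unpf i L U x)
      have hy' : unpf i L U x = rs L (i ⁻¹ᵁ ⊤) (i ⁻¹ᵁ U) y := hy.symm
      rw [hy', pfMap_rs ψ le_top]
      refine (app_rs χ (i.preimage_mono le_top) y).trans ?_
      exact congrArg (rs L' ⊤ (i ⁻¹ᵁ U)) (hχ y)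
  · intro χ' h'
    ext U x
    obtain rfl | rfl := eq_bot_or_eq_top U
    · have := subsingleton_bot L'
      exact Subsingleton.elim _ _
    · refine Eq.trans ?_ (hχ x).symm
      rw [← h']
      rfl

theorem isCart_pushforward {Y : Scheme.{u}} (i : T ⟶ Y) (p : Y ⟶ T) (hip : i ≫ p = 𝟙 T)
    (L : T.Modules) : IsCart (mkArr i (𝟙 ((pushforward i).obj L))) := by
  rintro ⟨Z, P⟩ ⟨k, m⟩ g hg
  obtain rfl : g ≫ i = k := hg
  obtain ⟨χ, h1, h2⟩ := existsUnique_of_pushforward i p hip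
    (L' := (pushforward g).obj P)
    (m ≫ (Scheme.Modules.pushforwardComp g i).inv.app P)
  have key : ∀ χ : L ⟶ (pushforward g).obj P,
      (pushforward i).map χ = m ≫ (Scheme.Modules.pushforwardComp g i).inv.app P ↔
      𝟙 _ ≫ (pushforward i).map χ ≫
        (Scheme.Modules.pushforwardComp g i).hom.app P = m := by
    intro χ
    rw [id_comp]
    constructor
    · intro h
      rw [h]
      simp
    · intro h
      rw [← h]
      simp
  refine ⟨mkArr g χ, ⟨rfl, (mk_comp_mk i g _ χ).trans (congrArg (mkArr (g ≫ i)) ((key χ).1 h1))⟩,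
    ?_⟩
  rintro ⟨g', χ'⟩ ⟨h3, h4⟩
  obtain rfl : g' = g := h3
  exact congrArg (mkArr g') (h2 _ ((key χ').2
    (mkArr_injective _ ((mk_comp_mk i g' _ χ').symm.trans h4))))

end OnePoint

/-! ### Local equations of a section and extension from its complement -/

section LocalEquation

/-- `t` is an equation, over the open set `V`, of the image of the section `i : T ⟶ Y`, the
complement of which is the open set `U`: a function over an open subset of `V` is divisible by `t`
if it vanishes on `T`, and it is determined by its restriction to `U`. -/
structure LocEq {T Y : Scheme.{u}} (i : T ⟶ Y) (U V : Y.Opens) (t : Γ(Y, V)) : Prop where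
  mem_U : ∀ y, y ∈ U ↔ y ∉ Set.range i
  mem_V : ∀ x, i x ∈ V
  zero : pl i V (i ⁻¹ᵁ V) t = 0
  dvd : ∀ W ≤ V, ∀ x : Γ(Y, W), pl i W (i ⁻¹ᵁ W) x = 0 → ∃ z, x = rsO V W t * z
  inj : ∀ W ≤ V, ∀ x : Γ(Y, W), rsO W (W ⊓ U) x = 0 → x = 0

variable {T Y : Scheme.{u}} {i : T ⟶ Y} {U V : Y.Opens} {t : Γ(Y, V)}

theorem LocEq.isUnit (h : LocEq i U V t) {W : Y.Opens} (hV : W ≤ V) (hU : W ≤ U) :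
    ∃ z, rsO V W t * z = 1 := by
  have : Subsingleton Γ(T, i ⁻¹ᵁ W) := subsingleton_functions fun x hx =>
    (h.mem_U _).1 (hU hx) ⟨x, rfl⟩
  obtain ⟨z, hz⟩ := h.dvd W hV 1 (Subsingleton.elim _ _)
  exact ⟨z, hz.symm⟩

theorem LocEq.regular (h : LocEq i U V t) {W : Y.Opens} (hV : W ≤ V) {x y : Γ(Y, W)}
    (hxy : rsO V W t * x = rsO V W t * y) : x = y := by
  rw [← sub_eq_zero, ← mul_sub] at hxy
  rw [← sub_eq_zero]
  refine h.inj W hV _ ?_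
  obtain ⟨z, hz⟩ := h.isUnit (W := W ⊓ U) (inf_le_left.trans hV) inf_le_right
  have h1 := congrArg (rsO W (W ⊓ U)) hxy
  rw [rsO_mul inf_le_left, rsO_rsO hV inf_le_left, map_zero] at h1
  calc _ = (rsO V (W ⊓ U) t * z) * rsO W (W ⊓ U) (x - y) := by rw [hz, one_mul]
    _ = z * (rsO V (W ⊓ U) t * rsO W (W ⊓ U) (x - y)) := by ring
    _ = 0 := by rw [h1, mul_zero]

theorem LocEq.pl_mul_zero (h : LocEq i U V t) {W : Y.Opens} (hV : W ≤ V) (z : Γ(Y, W))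
    {O : T.Opens} (hO : O ≤ i ⁻¹ᵁ W) :
    pl i W O (rsO V W t * z) = 0 := by
  rw [pl_mul _ hO, pl_rsO _ hV hO, ← rsO_pl i (le_refl (i ⁻¹ᵁ V)) (hO.trans (i.preimage_mono hV)),
    h.zero, map_zero, zero_mul]

/-- A function with vanishing restriction to a section of a one-point scheme is divisible by the
local equation. -/
theorem LocEq.dvd_top (h : LocEq i U V t) {W : Y.Opens} (hV : W ≤ V) (hW : ∀ x, i x ∈ W)
    (x : Γ(Y, W)) (hx : pl i W ⊤ x = 0) : ∃ z, x = rsO V W t * z := by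
  refine h.dvd W hV x ?_
  have : (⊤ : T.Opens) ≤ i ⁻¹ᵁ W := fun x _ => hW x
  rw [← rsO_pl i this le_top, hx, map_zero]

theorem LocEq.rs_injective (h : LocEq i U V t) {N : Y.Modules} {d : ℕ}
    (hN : IsLocallyFreeOfRank N d) {W : Y.Opens} {x : Γ(N, W)} (hx : rs N W (W ⊓ U) x = 0) :
    x = 0 := by
  rw [isLocallyFreeOfRank_iff] at hN
  refine eq_of_rs_eq_of_mem N fun y hy => ?_
  by_cases hyU : y ∈ U
  · exact ⟨W ⊓ U, ⟨hy, hyU⟩, inf_le_left, by rw [hx, map_zero]⟩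
  · obtain ⟨O, b, hO, hb⟩ := hN y
    have hyV : y ∈ V := by
      rw [h.mem_U, not_not] at hyU
      obtain ⟨x, rfl⟩ := hyU
      exact h.mem_V x
    let W' := W ⊓ (O ⊓ V)
    refine ⟨W', ⟨hy, hO, hyV⟩, inf_le_left, ?_⟩
    have h1 : W' ≤ O := inf_le_right.trans inf_le_left
    have h2 : W' ≤ V := inf_le_right.trans inf_le_right
    have h3 : W' ⊓ U ≤ W ⊓ U := inf_le_inf_right _ inf_le_left
    obtain ⟨c, hc⟩ := (hb W' h1).2 (rs N W W' x)
    rw [map_zero, ← hc]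
    have h4 : rs N W' (W' ⊓ U) (lc N O W' b c) = 0 := by
      rw [hc, rs_rs N inf_le_left inf_le_left, ← rs_rs N inf_le_left h3, hx, map_zero]
    rw [rs_lc N h1 inf_le_left] at h4
    have h5 : (fun j => rsO W' (W' ⊓ U) (c j)) = 0 :=
      (hb (W' ⊓ U) (inf_le_left.trans h1)).1 (h4.trans (by simp [lc]))
    have h6 : c = 0 := funext fun j => h.inj W' h2 _ (congrFun h5 j)
    rw [h6]
    simp [lc]

/-! ### Direct images of restrictions to an open set -/

/-- The direct image of the restriction of `M` to `U`. -/
def jU (U : Y.Opens) (M : Y.Modules) : Y.Modules :=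
  (pushforward U.ι).obj (M.restrict U.ι)

/-- The functoriality of `jU`. -/
def jMap (U : Y.Opens) {M N : Y.Modules} (m : M ⟶ N) : jU U M ⟶ jU U N :=
  (pushforward U.ι).map ((Scheme.Modules.restrictFunctor U.ι).map m)

/-- The restriction of sections, as a morphism from `M` to `jU U M`. -/
def aU (U : Y.Opens) (M : Y.Modules) : M ⟶ jU U M := (Scheme.Modules.restrictAdjunction U.ι).unit.app M

theorem aU_naturality (U : Y.Opens) {M N : Y.Modules} (m : M ⟶ N) :
    aU U M ≫ jMap U m = m ≫ aU U N :=
  ((Scheme.Modules.restrictAdjunction U.ι).unit.naturality m).symm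

/-- The sections of `jU U M`. -/
def unJ (U : Y.Opens) (M : Y.Modules) (W : Y.Opens) :
    Γ(jU U M, W) ≃+ Γ(M, U.ι ''ᵁ (U.ι ⁻¹ᵁ W)) := AddEquiv.refl Γ(M, U.ι ''ᵁ (U.ι ⁻¹ᵁ W))

theorem image_preimage_ι (U W : Y.Opens) : U.ι ''ᵁ (U.ι ⁻¹ᵁ W) = W ⊓ U := by
  rw [U.ι.image_preimage_eq_opensRange_inf, U.opensRange_ι, inf_comm]

theorem unJ_aU (U : Y.Opens) (M : Y.Modules) (W : Y.Opens) (x : Γ(M, W)) :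
    unJ U M W (((aU U M).app W).hom x) = rs M W _ x := by
  rw [rs_of_le M (U.ι.image_preimage_le W)]
  rfl

theorem unJ_rs (U : Y.Opens) (M : Y.Modules) {W W' : Y.Opens} (h : W' ≤ W) (x : Γ(jU U M, W)) :
    unJ U M W' (rs (jU U M) W W' x) = rs M _ _ (unJ U M W x) := by
  have h' : U.ι ''ᵁ (U.ι ⁻¹ᵁ W') ≤ U.ι ''ᵁ (U.ι ⁻¹ᵁ W) := by
    rw [image_preimage_ι, image_preimage_ι]
    exact inf_le_inf_right _ h
  rw [rs_of_le _ h, rs_of_le _ h']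
  rfl

theorem aU_bijective (U : Y.Opens) (M : Y.Modules) {W : Y.Opens} (h : W ≤ U) :
    Bijective ((aU U M).app W).hom := by
  refine ((unJ U M W).bijective.of_comp_iff' _).1 ?_
  have : unJ U M W ∘ ((aU U M).app W).hom = rs M W (U.ι ''ᵁ (U.ι ⁻¹ᵁ W)) :=
    funext fun x => unJ_aU U M W x
  rw [this]
  exact rs_bijective_of_eq M (by rw [image_preimage_ι, inf_eq_left.2 h])

theorem jU_rs_bijective (U : Y.Opens) (M : Y.Modules) (W : Y.Opens) :
    Bijective (rs (jU U M) W (W ⊓ U)) := by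
  refine ((unJ U M (W ⊓ U)).bijective.of_comp_iff' _).1 ?_
  have : unJ U M (W ⊓ U) ∘ rs (jU U M) W (W ⊓ U) = rs M _ _ ∘ unJ U M W :=
    funext fun x => unJ_rs U M inf_le_left x
  rw [this]
  exact (rs_bijective_of_eq M (by
    rw [image_preimage_ι, image_preimage_ι, inf_assoc, inf_idem])).comp (unJ U M W).bijective

/-- A morphism that is bijective over the open subsets of `U` induces an isomorphism of
the direct images of the restrictions to `U`. -/
theorem isIso_jMap {M N : Y.Modules} (m : M ⟶ N)
    (h : ∀ W ≤ U, Bijective (m.app W).hom) : IsIso (jMap U m) := by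
  let m' : M.restrict U.ι ⟶ N.restrict U.ι := (Scheme.Modules.restrictFunctor U.ι).map m
  have h1 : IsIso m' := isIso_of_bijective _ fun W =>
    h (U.ι ''ᵁ W) ((U.ι.image_le_opensRange W).trans U.opensRange_ι.le)
  exact (pushforward U.ι).map_isIso m'

theorem LocEq.aU_injective (h : LocEq i U V t) {N : Y.Modules} {d : ℕ}
    (hN : IsLocallyFreeOfRank N d) (W : Y.Opens) :
    Injective ((aU U N).app W).hom := by
  rw [injective_iff_map_eq_zero]
  intro x hx
  refine h.rs_injective hN ((aU_bijective U N (inf_le_right : W ⊓ U ≤ U)).1 ?_)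
  rw [app_rs _ inf_le_left, hx, map_zero, map_zero]

/-- The local equation acts injectively on sections over `U`. -/
theorem LocEq.jU_smul_injective (h : LocEq i U V t) {N : Y.Modules} {W : Y.Opens} (hW : W ≤ V)
    {x y : Γ(jU U N, W)} (hxy : rsO V W t • x = rsO V W t • y) : x = y := by
  refine (jU_rs_bijective U N W).1 ?_
  obtain ⟨z, hz⟩ := h.isUnit (W := W ⊓ U) (inf_le_left.trans hW) inf_le_right
  have h1 := congrArg (rs (jU U N) W (W ⊓ U)) hxy
  rw [rs_smul _ inf_le_left, rs_smul _ inf_le_left, rsO_rsO hW inf_le_left] at h1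
  have h2 := congrArg (z • ·) h1
  simp only [smul_smul, mul_comm z, hz, one_smul] at h2
  exact h2

theorem LocEq.exists_jU_smul (h : LocEq i U V t) {N : Y.Modules} {W : Y.Opens} (hW : W ≤ V)
    (x : Γ(jU U N, W)) : ∃ y, rsO V W t • y = x := by
  obtain ⟨z, hz⟩ := h.isUnit (W := W ⊓ U) (inf_le_left.trans hW) inf_le_right
  obtain ⟨y, hy⟩ := (jU_rs_bijective U N W).2 (z • rs _ W (W ⊓ U) x)
  refine ⟨y, (jU_rs_bijective U N W).1 ?_⟩
  rw [rs_smul _ inf_le_left, rsO_rsO hW inf_le_left, hy, smul_smul, hz, one_smul]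

end LocalEquation

/-! ### Elementary modifications -/

section Elementary

variable {T Y : Scheme.{u}} {i : T ⟶ Y} {U V : Y.Opens} {t : Γ(Y, V)} {d : ℕ}

/-- Frames `e` of `M` and `b` of `N`, near the image of `T`, in which the morphism `f : M ⟶ N`
is the diagonal matrix with entry `t` at `j₀` and all other entries `1`. -/
structure ElemFrame (i : T ⟶ Y) {V : Y.Opens} (t : Γ(Y, V)) {M N : Y.Modules} (f : M ⟶ N)
    (O : Y.Opens) (j₀ : Fin d) (e : Fin d → Γ(M, O)) (b : Fin d → Γ(N, O)) : Prop where
  le : O ≤ V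
  mem : ∀ x, i x ∈ O
  frame_e : IsFrame M O e
  frame_b : IsFrame N O b
  app_self : (f.app O).hom (e j₀) = rsO V O t • b j₀
  app_of_ne : ∀ j ≠ j₀, (f.app O).hom (e j) = b j

/-- The morphism `f : M ⟶ N` is an elementary modification, of rank `d`, along the image of `T`. -/
structure IsElem (i : T ⟶ Y) (U : Y.Opens) {V : Y.Opens} (t : Γ(Y, V)) (d : ℕ) {M N : Y.Modules}
    (f : M ⟶ N) : Prop where
  bij : ∀ W ≤ U, Bijective (f.app W).hom
  frame : ∃ (O : Y.Opens) (j₀ : Fin d) (e : Fin d → Γ(M, O)) (b : Fin d → Γ(N, O)),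
    ElemFrame i t f O j₀ e b

variable {M N : Y.Modules} {f : M ⟶ N} {O : Y.Opens} {j₀ : Fin d} {e : Fin d → Γ(M, O)}
  {b : Fin d → Γ(N, O)}

theorem ElemFrame.app_lc (h : ElemFrame i t f O j₀ e b) {W : Y.Opens} (hW : W ≤ O)
    (c : Fin d → Γ(Y, W)) : (f.app W).hom (lc M O W e c) =
      lc N O W b fun j => if j = j₀ then rsO V W t * c j else c j := by
  rw [Sht.app_lc f hW]
  unfold lc
  refine Finset.sum_congr rfl fun j _ => ?_
  dsimp only
  split_ifs with hj
  · subst hj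
    rw [h.app_self, rs_smul _ hW, rsO_rsO h.le hW, smul_smul, mul_comm]
  · rw [h.app_of_ne j hj]

theorem IsElem.injective (hl : LocEq i U V t) (h : IsElem i U t d f) (W : Y.Opens) :
    Injective (f.app W).hom := by
  rw [injective_iff_map_eq_zero]
  intro x hx
  obtain ⟨O, j₀, e, b, hf⟩ := h.frame
  refine eq_of_rs_eq_of_mem M fun y hy => ?_
  by_cases hyU : y ∈ U
  · refine ⟨W ⊓ U, ⟨hy, hyU⟩, inf_le_left, (h.bij _ inf_le_right).1 ?_⟩
    rw [app_rs f inf_le_left, hx, map_zero, map_zero, map_zero]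
  · have hyO : y ∈ O := by
      rw [hl.mem_U, not_not] at hyU
      obtain ⟨x, rfl⟩ := hyU
      exact hf.mem x
    refine ⟨W ⊓ O, ⟨hy, hyO⟩, inf_le_left, ?_⟩
    obtain ⟨c, hc⟩ := (hf.frame_e (W ⊓ O) inf_le_right).2 (rs M W (W ⊓ O) x)
    have h1 : lc N O (W ⊓ O) b (fun j => if j = j₀ then rsO V (W ⊓ O) t * c j else c j) =
        lc N O (W ⊓ O) b 0 := by
      rw [← hf.app_lc inf_le_right, hc, app_rs f inf_le_left, hx, map_zero]
      simp [lc]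
    have h2 := (hf.frame_b _ inf_le_right).1 h1
    have h3 : c = 0 := by
      funext j
      have := congrFun h2 j
      by_cases hj : j = j₀
      · simp only [hj, if_true] at this
        rw [hj]
        exact hl.regular (inf_le_right.trans hf.le) (this.trans (mul_zero _).symm)
      · simpa only [hj, if_false] using this
    rw [← hc, h3, map_zero]
    simp [lc]

theorem IsElem.mono (hl : LocEq i U V t) (h : IsElem i U t d f) : Mono f :=
  mono_of_app_injective f (h.injective hl)

/-- Locally free sheaves and elementary modifications. -/
theorem IsElem.isLocallyFree (hl : LocEq i U V t) (h : IsElem i U t d f)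
    (hN : IsLocallyFreeOfRank N d) : IsLocallyFreeOfRank M d := by
  rw [isLocallyFreeOfRank_iff] at hN ⊢
  intro y
  by_cases hyU : y ∈ U
  · obtain ⟨W, b, hy, hb⟩ := hN y
    have hb' := hb.rs (V := W ⊓ U) inf_le_left
    choose e he using fun j => (h.bij (W ⊓ U) inf_le_right).2 (rs N W (W ⊓ U) (b j))
    refine ⟨W ⊓ U, e, ⟨hy, hyU⟩, frame_of_bijective_symm f ?_
      fun V hV => h.bij V (hV.trans inf_le_right)⟩
    simp_rw [he]
    exact hb'
  · obtain ⟨O, j₀, e, b, hf⟩ := h.frame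
    refine ⟨O, e, ?_, hf.frame_e⟩
    rw [hl.mem_U, not_not] at hyU
    obtain ⟨x, rfl⟩ := hyU
    exact hf.mem x

theorem IsElem.isLocallyFree' (hl : LocEq i U V t) (h : IsElem i U t d f)
    (hM : IsLocallyFreeOfRank M d) : IsLocallyFreeOfRank N d := by
  rw [isLocallyFreeOfRank_iff] at hM ⊢
  intro y
  by_cases hyU : y ∈ U
  · obtain ⟨W, e, hy, he⟩ := hM y
    exact ⟨W ⊓ U, _, ⟨hy, hyU⟩, frame_of_bijective f (he.rs (V := W ⊓ U) inf_le_left)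
      fun V hV => h.bij V (hV.trans inf_le_right)⟩
  · obtain ⟨O, j₀, e, b, hf⟩ := h.frame
    refine ⟨O, b, ?_, hf.frame_b⟩
    rw [hl.mem_U, not_not] at hyU
    obtain ⟨x, rfl⟩ := hyU
    exact hf.mem x

/-- A morphism to a locally free sheaf is determined by its composition with an elementary
modification. -/
theorem IsElem.hom_ext (hl : LocEq i U V t) (h : IsElem i U t d f) {P : Y.Modules} {d' : ℕ}
    (hP : IsLocallyFreeOfRank P d') {n n' : N ⟶ P} (hn : f ≫ n = f ≫ n') : n = n' := by
  ext W x
  rw [← sub_eq_zero]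
  refine hl.rs_injective hP ?_
  obtain ⟨y, hy⟩ := (h.bij (W ⊓ U) inf_le_right).2 (rs N W (W ⊓ U) x)
  rw [map_sub, ← app_rs n inf_le_left, ← app_rs n' inf_le_left, ← hy, ← comp_app', ← comp_app', hn,
    sub_self]

end Elementary

/-! ### Cokernels and fibres of elementary modifications -/

section Cokernel

/-- The value along `i : T ⟶ Y` of a section over a neighbourhood of the image. -/
def ev {T Y : Scheme.{u}} (i : T ⟶ Y) (M : Y.Modules) (O : Y.Opens) :
    Γ(M, O) →+ Γ((Scheme.Modules.pullback i).obj M, (⊤ : T.Opens)) := on (pbArr i M) O ⊤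

variable {T Y : Scheme.{u}} {i : T ⟶ Y} {U V : Y.Opens} {t : Γ(Y, V)} {d : ℕ}
variable {M N : Y.Modules} {f : M ⟶ N} {O : Y.Opens} {j₀ : Fin d} {e : Fin d → Γ(M, O)}
  {b : Fin d → Γ(N, O)}

theorem ev_app (f : M ⟶ N) (hO : ∀ x, i x ∈ O) (x : Γ(M, O)) :
    (((Scheme.Modules.pullback i).map f).app ⊤).hom (ev i M O x) =
      ev i N O ((f.app O).hom x) := by
  have hle : (⊤ : T.Opens) ≤ i ⁻¹ᵁ O := fun x _ => hO x
  have h := congrArg (fun k => on k O ⊤ x) (pbArr_map i f)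
  simp only at h
  rw [on_comp (pbArr i M) (vert ((Scheme.Modules.pullback i).map f)) ⊤ hle le_top,
    on_comp (vert f) (pbArr i N) O (le_refl O) hle, on_vert_self, on_vert_self] at h
  exact h

theorem ev_rs {O' : Y.Opens} (h : O' ≤ O) (hO : ∀ x, i x ∈ O') (x : Γ(M, O)) :
    ev i M O' (rs M O O' x) = ev i M O x :=
  on_rs (pbArr i M) h (fun x _ => hO x) x

theorem ev_smul (hO : ∀ x, i x ∈ O) (a : Γ(Y, O)) (x : Γ(M, O)) :
    ev i M O (a • x) = pl i O ⊤ a • ev i M O x :=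
  on_smul (pbArr i M) (fun x _ => hO x) a x

theorem ev_lc {ι : Type} [Fintype ι] (hO : ∀ x, i x ∈ O) (e c) :
    ev i M O (lc (ι := ι) M O O e c) = lc _ ⊤ ⊤ (fun j => ev i M O (e j)) fun j => pl i O ⊤ (c j) :=
  on_lc (pbArr i M) le_rfl (fun x _ => hO x) (fun x _ => hO x) le_top e c

theorem ev_frame {ι : Type} [Fintype ι] (hO : ∀ x, i x ∈ O) {e : ι → Γ(M, O)} (he : IsFrame M O e) :
    IsFrame _ ⊤ fun j => ev i M O (e j) :=
  he.cart (isCart_pbArr i M) fun x _ => hO x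

theorem unitSec_lc {ι : Type} [Fintype ι] {W : T.Opens} (s : ι → Γ(unitMod T, ⊤)) (c : ι → Γ(T, W)) :
    unitSec T W (lc (unitMod T) ⊤ W s c) = ∑ j, c j * rsO ⊤ W (unitSec T ⊤ (s j)) := by
  unfold lc
  rw [map_sum]
  refine Finset.sum_congr rfl fun j _ => ?_
  rw [unitSec_smul, unitSec_rs le_top]

theorem isFrame_unit (T : Scheme.{u}) :
    IsFrame (unitMod T) ⊤ fun _ : Fin 1 => (unitSec T ⊤).symm 1 := by
  intro V hV
  refine ((unitSec T V).bijective.of_comp_iff' _).1 ?_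
  have : unitSec T V ∘ lc (unitMod T) ⊤ V (fun _ : Fin 1 => (unitSec T ⊤).symm 1) =
      fun c => c 0 := by
    funext c
    refine (unitSec_lc _ c).trans ?_
    simp [rsO_one hV]
  rw [this]
  exact ⟨fun x y h => funext fun j => by rw [Subsingleton.elim j 0]; exact h,
    fun x => ⟨fun _ => x, rfl⟩⟩

/-- The composition of linear combinations with a morphism over `i` to the structure sheaf that
takes the values `δ` on the basis. -/
theorem unitSec_on_lc (w : (⟨Y, N⟩ : QMod) ⟶ ⟨T, unitMod T⟩) (hw : bs w = i) (hO : ∀ x, i x ∈ O)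
    (hb : ∀ j, unitSec T ⊤ (on w O ⊤ (b j)) = if j = j₀ then 1 else 0) {W : Y.Opens} (hW : W ≤ O)
    (c : Fin d → Γ(Y, W)) :
    unitSec T (i ⁻¹ᵁ W) (on w W (i ⁻¹ᵁ W) (lc N O W b c)) = pl i W (i ⁻¹ᵁ W) (c j₀) := by
  subst hw
  have h1 : (⊤ : T.Opens) ≤ bs w ⁻¹ᵁ O := fun x _ => hO x
  refine (congrArg _ (on_lc w hW h1 le_rfl le_top b c)).trans ((unitSec_lc _ _).trans ?_)
  rw [Finset.sum_eq_single j₀]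
  · rw [hb, if_pos rfl, rsO_one le_top, mul_one]
  · intro j _ hj
    rw [hb, if_neg hj, map_zero, mul_zero]
  · simp

/-- `pl` as a homomorphism of rings. -/
def plHom {T Y : Scheme.{u}} (f : T ⟶ Y) {W : Y.Opens} {W' : T.Opens} (h : W' ≤ f ⁻¹ᵁ W) :
    Γ(Y, W) →+* Γ(T, W') :=
  { pl f W W' with map_one' := pl_one f h, map_mul' := pl_mul f h }

variable {p : Y ⟶ T} (hip : i ≫ p = 𝟙 T)

include hip in
theorem pl_const (hO : ∀ x, i x ∈ O) (a : Γ(T, ⊤)) : pl i O ⊤ (pl p ⊤ O a) = a := by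
  have h : (⊤ : T.Opens) ≤ i ⁻¹ᵁ O := fun x _ => hO x
  rw [pl_pl p i le_top h, hip]
  exact rsO_self ⊤ a

variable [Subsingleton T] [Nonempty T]

include hip in
/-- A frame of the restriction to a section lifts to a frame. -/
theorem exists_lift_frame (hN : IsLocallyFreeOfRank N d)
    {β : Fin d → Γ((Scheme.Modules.pullback i).obj N, ⊤)} (hβ : IsFrame _ ⊤ β) :
    ∃ (O : Y.Opens) (b : Fin d → Γ(N, O)), (∀ x, i x ∈ O) ∧ IsFrame N O b ∧
      ∀ j, ev i N O (b j) = β j := by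
  rw [isLocallyFreeOfRank_iff] at hN
  obtain ⟨O, b', hO, hb'⟩ := hN (i (Classical.arbitrary T))
  have hO : ∀ x, i x ∈ O := fun x => by rwa [Subsingleton.elim x (Classical.arbitrary T)]
  have h' := ev_frame hO hb'
  choose A hA using fun j => (h' ⊤ le_rfl).2 (β j)
  choose B hB using fun j => (hβ ⊤ le_rfl).2 (ev i N O (b' j))
  have hAB : (Matrix.of B) * (Matrix.of A) = 1 := by
    have h2 : ∀ j, lc _ ⊤ ⊤ (fun j => ev i N O (b' j)) ((Matrix.of B * Matrix.of A) j) =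
        lc _ ⊤ ⊤ (fun j => ev i N O (b' j)) ((1 : Matrix _ _ Γ(T, ⊤)) j) := by
      intro j
      have h3 := lc_lc _ (le_refl (⊤ : T.Opens)) (fun j => ev i N O (b' j)) A (B j)
      simp only [rsO_self] at h3
      refine h3.symm.trans ?_
      rw [funext hA, hB]
      have : (1 : Matrix (Fin d) (Fin d) Γ(T, ⊤)) j = Pi.single j 1 := by
        ext k
        rw [Matrix.one_apply, Pi.single_apply]
        simp [eq_comm]
      rw [this, lc_single, rs_self, one_smul]
    exact funext fun j => (h' ⊤ le_rfl).1 (h2 j)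
  let r := plHom p (W := ⊤) (W' := O) le_top
  refine ⟨O, fun j => lc N O O b' ((Matrix.of A).map r j), hO, hb'.of_matrix _ ?_, fun j => ?_⟩
  · have h4 : IsUnit (Matrix.of A).det := by
      have := congrArg Matrix.det hAB
      rw [Matrix.det_mul, Matrix.det_one] at this
      exact IsUnit.of_mul_eq_one_right _ this
    have := h4.map r
    rwa [RingHom.map_det] at this
  · rw [ev_lc hO, ← hA]
    congr 1
    funext k
    exact pl_const hip hO _

include hip in
/-- A morphism that is injective on sections, with image the kernel of a surjection to an
invertible sheaf on the section, is an elementary modification. -/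
theorem exists_elemFrame_of_kernel (hl : LocEq i U V t)
    (hf : ∀ W, Injective (f.app W).hom) (hN : IsLocallyFreeOfRank N d)
    (w : (⟨Y, N⟩ : QMod) ⟶ ⟨T, unitMod T⟩) (hw : bs w = i)
    (hker : ∀ W (x : Γ(N, W)), on w W (i ⁻¹ᵁ W) x = 0 ↔ ∃ y, (f.app W).hom y = x)
    {q : (Scheme.Modules.pullback i).obj N ⟶ unitMod T} (hq : pbArr i N ≫ vert q = w)
    {β : Fin d → Γ((Scheme.Modules.pullback i).obj N, ⊤)} (hβ : IsFrame _ ⊤ β)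
    (hqβ : ∀ j, unitSec T ⊤ ((q.app ⊤).hom (β j)) = if j = j₀ then 1 else 0) :
    IsElem i U t d f ∧ ∃ (O : Y.Opens) (e : Fin d → Γ(M, O)) (b : Fin d → Γ(N, O)),
      ElemFrame i t f O j₀ e b ∧ ∀ j, ev i N O (b j) = β j := by
  obtain ⟨O', b', hO', hb', hbβ'⟩ := exists_lift_frame hip hN hβ
  let O := O' ⊓ V
  have hO : ∀ x, i x ∈ O := fun x => ⟨hO' x, hl.mem_V x⟩
  let b : Fin d → Γ(N, O) := fun j => rs N O' O (b' j)
  have hb : IsFrame N O b := hb'.rs inf_le_left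
  have hOV : O ≤ V := inf_le_right
  have hbβ : ∀ j, ev i N O (b j) = β j := fun j => by rw [ev_rs inf_le_left hO, hbβ']
  have hwb : ∀ j, unitSec T ⊤ (on w O ⊤ (b j)) = if j = j₀ then 1 else 0 := by
    intro j
    rw [← hqβ, ← hbβ, ← hq, on_comp (pbArr i N) (vert q) ⊤
      (show (⊤ : T.Opens) ≤ bs (pbArr i N) ⁻¹ᵁ O from fun x _ => hO x) le_top, on_vert_self]
    rfl
  have hwlc : ∀ {W : Y.Opens} (hW : W ≤ O) (c : Fin d → Γ(Y, W)),
      on w W (i ⁻¹ᵁ W) (lc N O W b c) = 0 ↔ ∃ z, c j₀ = rsO V W t * z := by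
    intro W hW c
    rw [← (unitSec T (i ⁻¹ᵁ W)).map_eq_zero_iff, unitSec_on_lc w hw hO hwb hW]
    refine ⟨hl.dvd W (hW.trans hOV) _, ?_⟩
    rintro ⟨z, hz⟩
    rw [hz]
    exact hl.pl_mul_zero (hW.trans hOV) z le_rfl
  have hlcs : ∀ j (a : Γ(Y, O)), lc N O O b (Pi.single j a) = a • b j := fun j a => by
    rw [lc_single, rs_self]
  have he : ∀ j, ∃ y, (f.app O).hom y = if j = j₀ then rsO V O t • b j else b j := by
    intro j
    split_ifs with hj
    · rw [← hker, ← hlcs, hwlc le_rfl]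
      exact ⟨1, by rw [hj, Pi.single_eq_same, mul_one]⟩
    · rw [← hker, ← one_smul Γ(Y, O) (b j), ← hlcs, hwlc le_rfl]
      exact ⟨0, by rw [Pi.single_eq_of_ne (Ne.symm hj), mul_zero]⟩
  choose e he using he
  have happ : ∀ {W : Y.Opens} (hW : W ≤ O) (c : Fin d → Γ(Y, W)), (f.app W).hom (lc M O W e c) =
      lc N O W b fun j => if j = j₀ then rsO V W t * c j else c j := by
    intro W hW c
    rw [Sht.app_lc f hW]
    unfold lc
    refine Finset.sum_congr rfl fun j _ => ?_
    simp only [he]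
    split_ifs with hj
    · rw [rs_smul _ hW, rsO_rsO hOV hW, smul_smul, mul_comm]
    · rfl
  have hfe : IsFrame M O e := by
    intro W hW
    constructor
    · intro c c' hc
      have h1 := congrArg (f.app W).hom hc
      rw [happ hW, happ hW] at h1
      have h2 := (hb W hW).1 h1
      funext j
      have h3 := congrFun h2 j
      by_cases hj : j = j₀
      · simp only [hj, if_true] at h3
        rw [hj]
        exact hl.regular (hW.trans hOV) h3
      · simpa only [hj, if_false] using h3
    · intro x
      obtain ⟨c, hc⟩ := (hb W hW).2 ((f.app W).hom x)
      obtain ⟨z, hz⟩ := (hwlc hW c).1 (hc ▸ (hker W _).2 ⟨x, rfl⟩)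
      refine ⟨fun j => if j = j₀ then z else c j, hf W ?_⟩
      rw [happ hW, ← hc]
      congr 1
      funext j
      by_cases hj : j = j₀
      · simp only [hj, if_true, hz]
      · simp only [hj, if_false]
  have hE : ElemFrame i t f O j₀ e b :=
    ⟨hOV, hO, hfe, hb, by rw [he, if_pos rfl], fun j hj => by rw [he, if_neg hj]⟩
  refine ⟨⟨fun W hW => ⟨hf W, fun x => ?_⟩, O, j₀, e, b, hE⟩, O, e, b, hE, hbβ⟩
  rw [← hker]
  have : Subsingleton Γ(unitMod T, i ⁻¹ᵁ W) := subsingleton_of_isEmpty _ fun x hx =>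
    (hl.mem_U _).1 (hW hx) ⟨x, rfl⟩
  exact Subsingleton.elim _ _

omit [Subsingleton T] [Nonempty T] in
/-- The image of an elementary modification is the kernel of a morphism to the structure
sheaf of the section. -/
theorem ElemFrame.kernel (hl : LocEq i U V t) (h : IsElem i U t d f)
    (hf : ElemFrame i t f O j₀ e b) (w : (⟨Y, N⟩ : QMod) ⟶ ⟨T, unitMod T⟩) (hw : bs w = i)
    (hb : ∀ j, unitSec T ⊤ (on w O ⊤ (b j)) = if j = j₀ then 1 else 0)
    (W : Y.Opens) (x : Γ(N, W)) : on w W (i ⁻¹ᵁ W) x = 0 ↔ ∃ y, (f.app W).hom y = x := by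
  have hw' : ∀ {W W' : Y.Opens} (h : W' ≤ W) (x : Γ(N, W)),
      on w W' (i ⁻¹ᵁ W') (rs N W W' x) = rs _ (i ⁻¹ᵁ W) (i ⁻¹ᵁ W') (on w W (i ⁻¹ᵁ W) x) := by
    subst hw
    intro W W' h x
    exact (on_rs w h le_rfl x).trans (rs_on w le_rfl ((bs w).preimage_mono h) x).symm
  have hemp : ∀ {W : Y.Opens}, W ≤ U → Subsingleton Γ(unitMod T, i ⁻¹ᵁ W) := fun hW =>
    subsingleton_of_isEmpty _ fun x hx => (hl.mem_U _).1 (hW hx) ⟨x, rfl⟩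
  have hmem : ∀ y, y ∉ U → y ∈ O := by
    intro y hyU
    rw [hl.mem_U, not_not] at hyU
    obtain ⟨x, rfl⟩ := hyU
    exact hf.mem x
  constructor
  · intro hx
    refine exists_app_eq_of_locally f (h.injective hl) x fun y hy => ?_
    by_cases hyU : y ∈ U
    · exact ⟨W ⊓ U, ⟨hy, hyU⟩, inf_le_left, (h.bij _ inf_le_right).2 _⟩
    · refine ⟨W ⊓ O, ⟨hy, hmem y hyU⟩, inf_le_left, ?_⟩
      obtain ⟨c, hc⟩ := (hf.frame_b (W ⊓ O) inf_le_right).2 (rs N W (W ⊓ O) x)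
      have h1 := hw' (inf_le_left : W ⊓ O ≤ W) x
      rw [hx, map_zero, ← hc] at h1
      have h2 := unitSec_on_lc w hw hf.mem hb inf_le_right c
      rw [h1, map_zero] at h2
      obtain ⟨z, hz⟩ := hl.dvd _ (inf_le_right.trans hf.le) _ h2.symm
      refine ⟨lc M O (W ⊓ O) e fun j => if j = j₀ then z else c j, ?_⟩
      rw [hf.app_lc inf_le_right, ← hc]
      congr 1
      funext j
      by_cases hj : j = j₀
      · simp only [hj, if_true, hz]
      · simp only [hj, if_false]
  · rintro ⟨z, rfl⟩
    refine eq_of_rs_eq_of_mem (unitMod T) fun x hx =>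
      ⟨i ⁻¹ᵁ (W ⊓ O), ⟨hx, hf.mem x⟩, i.preimage_mono inf_le_left, ?_⟩
    rw [map_zero]
    obtain ⟨c, hc⟩ := (hf.frame_e (W ⊓ O) inf_le_right).2 (rs M W (W ⊓ O) z)
    refine (hw' (inf_le_left : W ⊓ O ≤ W) _).symm.trans ?_
    rw [← app_rs f inf_le_left, ← hc, hf.app_lc inf_le_right]
    refine (unitSec T _).injective ?_
    rw [unitSec_on_lc w hw hf.mem hb inf_le_right, if_pos rfl, map_zero]
    exact hl.pl_mul_zero (inf_le_right.trans hf.le) _ le_rfl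

omit [Nonempty T] in
include hip in
/-- The cokernel of an elementary modification is an invertible sheaf on the section. -/
theorem ElemFrame.exists_cokernel_iso (hl : LocEq i U V t) (h : IsElem i U t d f)
    (hf : ElemFrame i t f O j₀ e b) (w : (⟨Y, N⟩ : QMod) ⟶ ⟨T, unitMod T⟩) (hw : bs w = i)
    (hb : ∀ j, unitSec T ⊤ (on w O ⊤ (b j)) = if j = j₀ then 1 else 0) :
    ∃ ε : cokernel f ≅ (pushforward i).obj (unitMod T),
      vert (cokernel.π f ≫ ε.hom) ≫ mkArr i (𝟙 _) = w := by
  have hk := hf.kernel hl h w hw hb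
  have hlc := fun {W : Y.Opens} (hW : W ≤ O) c => unitSec_on_lc w hw hf.mem hb hW c
  obtain ⟨g, π⟩ := w
  obtain rfl : g = i := hw
  change N ⟶ (pushforward g).obj (unitMod T) at π
  have hπ : ∀ W x, on (mkArr g π) W (g ⁻¹ᵁ W) x = unpf g (unitMod T) W ((π.app W).hom x) :=
    fun W x => rs_self (unitMod T) _ _
  have hun : ∀ W, Bijective (unpf g (unitMod T) W) := fun W => Function.bijective_id
  have hker : ∀ W x, (π.app W).hom x = 0 ↔ ∃ y, (f.app W).hom y = x := by
    intro W x
    refine ((map_eq_zero_iff _ (hun W).1).symm.trans ?_).trans (hk W x)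
    rw [← hπ W x]
    exact Iff.rfl
  have h0 : f ≫ π = 0 := by
    ext W x
    exact (hker W _).2 ⟨x, rfl⟩
  have hepi : Epi π := by
    refine ⟨fun {P} a c hac => ?_⟩
    ext W s
    refine eq_of_rs_eq_of_mem P fun y hy => ?_
    by_cases hyU : y ∈ U
    · refine ⟨W ⊓ U, ⟨hy, hyU⟩, inf_le_left, ?_⟩
      rw [← app_rs a inf_le_left, ← app_rs c inf_le_left]
      have : Subsingleton Γ(unitMod T, g ⁻¹ᵁ (W ⊓ U)) := subsingleton_of_isEmpty _ fun x hx =>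
        (hl.mem_U _).1 hx.2 ⟨x, rfl⟩
      have hs := (hun (W ⊓ U)).1.subsingleton
      rw [Subsingleton.elim (rs _ W (W ⊓ U) s) 0, map_zero, map_zero]
    · have hyO : y ∈ O := by
        rw [hl.mem_U, not_not] at hyU
        obtain ⟨x, rfl⟩ := hyU
        exact hf.mem x
      refine ⟨W ⊓ O, ⟨hy, hyO⟩, inf_le_left, ?_⟩
      rw [← app_rs a inf_le_left, ← app_rs c inf_le_left]
      set s' := rs ((pushforward g).obj (unitMod T)) W (W ⊓ O) s
      let r : Γ(T, ⊤) := rsO (g ⁻¹ᵁ (W ⊓ O)) ⊤ (unitSec T _ (unpf g (unitMod T) _ s'))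
      obtain ⟨n, hn⟩ : ∃ n, (π.app (W ⊓ O)).hom n = s' := by
        refine ⟨lc N O (W ⊓ O) b (Pi.single j₀ (pl p ⊤ (W ⊓ O) r)),
          (hun _).1 ((unitSec T _).injective ?_)⟩
        refine (congrArg (unitSec T _) (hπ _ _).symm).trans
          ((hlc inf_le_right (Pi.single j₀ (pl p ⊤ (W ⊓ O) r))).trans ?_)
        rw [Pi.single_eq_same, pl_pl p g le_top le_rfl, hip]
        change rsO ⊤ (g ⁻¹ᵁ (W ⊓ O)) r = _
        obtain h1 | h1 := eq_bot_or_eq_top (g ⁻¹ᵁ (W ⊓ O))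
        · have : Subsingleton Γ(T, g ⁻¹ᵁ (W ⊓ O)) := subsingleton_functions (by simp [h1])
          exact Subsingleton.elim _ _
        · rw [rsO_rsO h1.ge le_top, rsO_self]
      rw [← hn, ← comp_app', ← comp_app', hac]
  have hinj := h.injective hl
  have hmono : Mono f := h.mono hl
  have hlim : IsLimit (KernelFork.ofι f h0) := by
    refine KernelFork.IsLimit.ofι' f h0 fun {K} k hk0 => ?_
    have := exists_lift_of_app f hinj k fun W x => by
      rw [← hker W]
      have := congrArg (fun m => (m.app W).hom x) hk0
      exact this
    exact ⟨this.choose, this.choose_spec.1⟩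
  have hcol := Abelian.epiIsCokernelOfKernel _ hlim
  refine ⟨(cokernelIsCokernel f).coconePointUniqueUpToIso hcol, ?_⟩
  have h1 : cokernel.π f ≫ ((cokernelIsCokernel f).coconePointUniqueUpToIso hcol).hom = π :=
    (cokernelIsCokernel f).comp_coconePointUniqueUpToIso_hom hcol WalkingParallelPair.one
  rw [h1]
  refine qext (comp_id g) fun W W' (hW : W' ≤ g ⁻¹ᵁ W) x => ?_
  rw [on_comp (vert π) (mkArr g (𝟙 _)) W (le_refl W) hW, on_vert_self]
  rfl

end Cokernel

section Modification

variable {T Y : Scheme.{u}} {i : T ⟶ Y} {U V : Y.Opens} {t : Γ(Y, V)} {d : ℕ}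
variable {M N : Y.Modules} {f : M ⟶ N} {O : Y.Opens} {j₀ : Fin d} {e : Fin d → Γ(M, O)}
  {b : Fin d → Γ(N, O)}

/-- The coordinate function `j₀` of a frame. -/
theorem exists_coord {Q : T.Modules} {β : Fin d → Γ(Q, ⊤)} (hβ : IsFrame Q ⊤ β) (j₀ : Fin d) :
    ∃ q : Q ⟶ unitMod T, ∀ j, unitSec T ⊤ ((q.app ⊤).hom (β j)) = if j = j₀ then 1 else 0 := by
  obtain ⟨q, hq, -⟩ := hβ.existsUnique_hom (unitMod T)
    fun j => (unitSec T ⊤).symm (if j = j₀ then 1 else 0)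
  exact ⟨q, fun j => by rw [hq, AddEquiv.apply_symm_apply]⟩

theorem on_pbArr_vert {Q : T.Modules} (q : (Scheme.Modules.pullback i).obj N ⟶ Q)
    (hO : ∀ x, i x ∈ O) (x : Γ(N, O)) :
    on (pbArr i N ≫ vert q) O ⊤ x = (q.app ⊤).hom (ev i N O x) := by
  rw [on_comp (pbArr i N) (vert q) ⊤
      (show (⊤ : T.Opens) ≤ bs (pbArr i N) ⁻¹ᵁ O from fun x _ => hO x) le_top, on_vert_self]
  rfl

theorem hom_eq_zero_of_top [Subsingleton T] {P Q : T.Modules} (a : P ⟶ Q)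
    (h : ∀ x, (a.app ⊤).hom x = 0) : a = 0 := by
  ext W x
  obtain rfl | rfl := eq_bot_or_eq_top W
  · have := subsingleton_bot Q
    exact Subsingleton.elim _ _
  · exact h x

theorem lc_coord {Q : T.Modules} {β : Fin d → Γ(Q, ⊤)} (q : Q ⟶ unitMod T)
    (c : Fin d → Γ(T, ⊤)) : unitSec T ⊤ ((q.app ⊤).hom (lc Q ⊤ ⊤ β c)) =
      ∑ j, c j * unitSec T ⊤ ((q.app ⊤).hom (β j)) := by
  rw [app_lc q le_rfl]
  refine (unitSec_lc _ c).trans ?_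
  simp_rw [rsO_self]

theorem isUnit_det_updateCol {R : Type*} [CommRing R] (v : Fin d → R) (j₀ : Fin d)
    (h : IsUnit (v j₀)) : IsUnit ((1 : Matrix (Fin d) (Fin d) R).updateCol j₀ v).det := by
  rw [← Matrix.cramer_apply, Matrix.cramer_one]
  exact h

theorem isUnit_det_updateRow {R : Type*} [CommRing R] (v : Fin d → R) (j₀ : Fin d)
    (h : IsUnit (v j₀)) : IsUnit ((1 : Matrix (Fin d) (Fin d) R).updateRow j₀ v).det := by
  rw [← Matrix.det_transpose, ← Matrix.updateCol_transpose, Matrix.transpose_one]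
  exact isUnit_det_updateCol v j₀ h

/-- If a linear form takes a unit value on a member of a frame, then it is a coordinate function
of some frame. -/
theorem exists_frame_of_isUnit {Q : T.Modules} {β : Fin d → Γ(Q, ⊤)} (hβ : IsFrame Q ⊤ β)
    (q : Q ⟶ unitMod T) (j₀ : Fin d) (h : IsUnit (unitSec T ⊤ ((q.app ⊤).hom (β j₀)))) :
    ∃ β' : Fin d → Γ(Q, ⊤), IsFrame Q ⊤ β' ∧
      ∀ j, unitSec T ⊤ ((q.app ⊤).hom (β' j)) = if j = j₀ then 1 else 0 := by
  obtain ⟨u, hu⟩ := h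
  let v : Fin d → Γ(T, ⊤) := fun j => if j = j₀ then ((u⁻¹ : Γ(T, ⊤)ˣ) : Γ(T, ⊤)) else
    - (unitSec T ⊤ ((q.app ⊤).hom (β j)) * ((u⁻¹ : Γ(T, ⊤)ˣ) : Γ(T, ⊤)))
  refine ⟨_, hβ.of_matrix _ (isUnit_det_updateCol v j₀ (by simp [v])), fun j => ?_⟩
  rw [lc_coord, ← Finset.add_sum_erase _ _ (Finset.mem_univ j₀), ← hu]
  have h1 : ∑ k ∈ Finset.univ.erase j₀, (1 : Matrix (Fin d) (Fin d) Γ(T, ⊤)).updateCol j₀ v j k *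
      unitSec T ⊤ ((q.app ⊤).hom (β k)) = if j = j₀ then 0 else
        unitSec T ⊤ ((q.app ⊤).hom (β j)) := by
    have h2 : ∀ k ∈ Finset.univ.erase j₀, (1 : Matrix (Fin d) (Fin d) Γ(T, ⊤)).updateCol j₀ v j k *
        unitSec T ⊤ ((q.app ⊤).hom (β k)) =
          if j = k then unitSec T ⊤ ((q.app ⊤).hom (β j)) else 0 := by
      intro k hk
      rw [Matrix.updateCol_ne (Finset.ne_of_mem_erase hk), Matrix.one_apply]
      split_ifs with h
      · rw [h, one_mul]
      · rw [zero_mul]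
    rw [Finset.sum_congr rfl h2, Finset.sum_ite_eq]
    by_cases hj : j = j₀ <;> simp [hj]
  rw [h1, Matrix.updateCol_self]
  by_cases hj : j = j₀
  · simp [hj, v]
  · simp only [v, hj, if_false]
    rw [neg_mul, mul_assoc, Units.inv_mul, mul_one, neg_add_cancel]

/-- The socle of a local Artinian ring is not zero. -/
theorem exists_socle (R : Type*) [CommRing R] [IsLocalRing R] [IsArtinianRing R] :
    ∃ s : R, s ≠ 0 ∧ ∀ x, ¬ IsUnit x → x * s = 0 := by
  have h : ∃ n, IsLocalRing.maximalIdeal R ^ n = ⊥ := by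
    obtain ⟨n, hn⟩ := IsArtinianRing.isNilpotent_jacobson_bot (R := R)
    exact ⟨n, by rwa [IsLocalRing.jacobson_eq_maximalIdeal ⊥ bot_ne_top] at hn⟩
  classical
  have h0 := Nat.find_spec h
  obtain hn | hn := Nat.eq_zero_or_pos (Nat.find h)
  · rw [hn, pow_zero, Ideal.one_eq_top] at h0
    exact absurd h0.symm bot_ne_top
  · have h1 := Nat.find_min h (Nat.sub_lt hn one_pos)
    obtain ⟨s, hs, hs0⟩ := Submodule.exists_mem_ne_zero_of_ne_bot h1
    refine ⟨s, hs0, fun x hx => ?_⟩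
    have h2 : x * s ∈ IsLocalRing.maximalIdeal R * IsLocalRing.maximalIdeal R ^ (Nat.find h - 1) :=
      Ideal.mul_mem_mul ((IsLocalRing.mem_maximalIdeal x).2 hx) hs
    rw [← pow_succ', Nat.sub_add_cancel hn, h0] at h2
    exact h2

/-- A linear form that is an epimorphism takes a unit value on a member of a given frame:
otherwise its composition with the multiplication by an element of the socle would be zero. -/
theorem exists_isUnit_of_epi [Subsingleton T] [IsLocalRing Γ(T, ⊤)] [IsArtinianRing Γ(T, ⊤)]
    {Q : T.Modules} {β : Fin d → Γ(Q, ⊤)} (hβ : IsFrame Q ⊤ β) (q : Q ⟶ unitMod T) [Epi q] :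
    ∃ j, IsUnit (unitSec T ⊤ ((q.app ⊤).hom (β j))) := by
  by_contra! hcon
  obtain ⟨s, hs0, hs⟩ := exists_socle Γ(T, ⊤)
  obtain ⟨a, ha, -⟩ := existsUnique_unitMod_hom (unitMod T) ((unitSec T ⊤).symm s)
  have ha' : ∀ x, unitSec T ⊤ ((a.app ⊤).hom x) = unitSec T ⊤ x * s := by
    intro x
    have : x = unitSec T ⊤ x • (unitSec T ⊤).symm 1 := by
      apply (unitSec T ⊤).injective
      rw [unitSec_smul, AddEquiv.apply_symm_apply, mul_one]
    conv_lhs => rw [this]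
    rw [app_smul', unitSec_smul, ha, AddEquiv.apply_symm_apply]
  have h0 : q ≫ a = q ≫ 0 := by
    rw [comp_zero]
    refine hom_eq_zero_of_top _ fun x => ?_
    obtain ⟨c, rfl⟩ := (hβ ⊤ le_rfl).2 x
    apply (unitSec T ⊤).injective
    rw [comp_app', ha', lc_coord, Finset.sum_mul, map_zero]
    exact Finset.sum_eq_zero fun j _ => by rw [mul_assoc, hs _ (hcon j), mul_zero]
  have h1 : a = 0 := (cancel_epi q).1 h0
  apply hs0
  have h2 := ha' ((unitSec T ⊤).symm 1)
  rw [AddEquiv.apply_symm_apply, one_mul, h1] at h2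
  exact h2.symm.trans (map_zero _)

theorem exists_pbArr_comp {Q : T.Modules} (w : (⟨Y, N⟩ : QMod) ⟶ ⟨T, Q⟩) (hw : bs w = i) :
    ∃ q : (Scheme.Modules.pullback i).obj N ⟶ Q, pbArr i N ≫ vert q = w := by
  obtain ⟨χ, ⟨h1, h2⟩, -⟩ := isCart_pbArr i N w (𝟙 T) (by rw [hw]; exact (id_comp _))
  obtain ⟨q, rfl⟩ := exists_vert χ h1
  exact ⟨q, h2⟩

theorem pbArr_hom_ext {Q : T.Modules} {q q' : (Scheme.Modules.pullback i).obj N ⟶ Q}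
    (h : pbArr i N ≫ vert q = pbArr i N ≫ vert q') : q = q' :=
  vert_injective ((isCart_pbArr i N).hom_ext rfl h)

variable {p : Y ⟶ T} (hip : i ≫ p = 𝟙 T)

include hip in
/-- The restriction to the section of a sheaf on the section. -/
theorem exists_pullback_iso [Subsingleton T] {C : Y.Modules} {L : T.Modules}
    (ε : C ≅ (pushforward i).obj L) :
    ∃ κ : (Scheme.Modules.pullback i).obj C ≅ L,
      pbArr i C ≫ vert κ.hom = vert ε.hom ≫ mkArr i (𝟙 _) := by
  have hc : IsCart (vert ε.hom ≫ mkArr i (𝟙 _)) :=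
    (isCart_vert_of_isIso ε.hom).comp (isCart_pushforward i p hip L)
  obtain ⟨κ, hκ⟩ := exists_pbArr_comp (vert ε.hom ≫ mkArr i (𝟙 _)) (comp_id i)
  have : IsIso κ := isIso_of_isCart_vert ((isCart_pbArr i C).of_comp (hκ ▸ hc))
  exact ⟨asIso κ, hκ⟩

variable [Subsingleton T] [Nonempty T]

include hip in
/-- A monomorphism to a locally free sheaf, the cokernel of which is an invertible sheaf on the
section, is an elementary modification. -/
theorem isElem_of_cokernel [IsLocalRing Γ(T, ⊤)] [IsArtinianRing Γ(T, ⊤)] (hl : LocEq i U V t)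
    (f : M ⟶ N) [Mono f] (hN : IsLocallyFreeOfRank N d) {L : T.Modules}
    (hL : IsLocallyFreeOfRank L 1) (ε : cokernel f ≅ (pushforward i).obj L) :
    IsElem i U t d f := by
  obtain ⟨ℓ, hℓ⟩ := exists_frame_top hL
  obtain ⟨a, ha, -⟩ := hℓ.exists_iso
  obtain ⟨b, hb, -⟩ := (isFrame_unit T).exists_iso
  let ε' : cokernel f ≅ (pushforward i).obj (unitMod T) :=
    ε ≪≫ (pushforward i).mapIso ((asIso a).symm ≪≫ asIso b)
  let π := cokernel.π f ≫ ε'.hom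
  have hπ : Epi π := epi_comp _ _
  let w := mkArr i π
  obtain ⟨q, hq⟩ := exists_pbArr_comp (i := i) w rfl
  have hqe : Epi q := by
    refine ⟨fun {P} a b hab => ?_⟩
    have h1 : w ≫ vert a = w ≫ vert b := by
      rw [← hq, assoc, assoc, ← vert_comp, ← vert_comp, hab]
    rw [mk_comp_vert, mk_comp_vert] at h1
    have h2 := (cancel_epi π).1 (mkArr_injective _ h1)
    exact (existsUnique_of_pushforward i p hip _).unique rfl h2.symm
  have hker : ∀ W (x : Γ(N, W)), on w W (i ⁻¹ᵁ W) x = 0 ↔ ∃ y, (f.app W).hom y = x := by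
    intro W x
    have h1 : on w W (i ⁻¹ᵁ W) x = unpf i (unitMod T) W ((π.app W).hom x) := rs_self (unitMod T) _ _
    have h2 : Injective (unpf i (unitMod T) W) := Function.injective_id
    rw [h1, map_eq_zero_iff _ h2, comp_app', map_eq_zero_iff _ (bijective_of_isIso ε'.hom W).1]
    refine ⟨exists_app_eq_of_cokernel f W x, ?_⟩
    rintro ⟨y, rfl⟩
    rw [← comp_app', cokernel.condition]
    rfl
  obtain ⟨O, b, hbO, hb⟩ := (isLocallyFreeOfRank_iff N d).1 hN (i (Classical.arbitrary T))
  have hO : ∀ x, i x ∈ O := fun x => by rwa [Subsingleton.elim x (Classical.arbitrary T)]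
  obtain ⟨j₀, hj₀⟩ := exists_isUnit_of_epi (ev_frame hO hb) q
  obtain ⟨β, hβ, hqβ⟩ := exists_frame_of_isUnit (ev_frame hO hb) q j₀ hj₀
  exact (exists_elemFrame_of_kernel hip hl (app_injective f) hN w rfl hker hq hβ hqβ).1

omit [Nonempty T] in
include hip in
/-- The cokernel of an elementary modification, and its restriction to the section. -/
theorem ElemFrame.exists_quotient (hl : LocEq i U V t) (h : IsElem i U t d f)
    (hf : ElemFrame i t f O j₀ e b) :
    ∃ (_ : cokernel f ≅ (pushforward i).obj (unitMod T))
      (κ : (Scheme.Modules.pullback i).obj (cokernel f) ≅ unitMod T),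
      ∀ j, unitSec T ⊤ ((((Scheme.Modules.pullback i).map (cokernel.π f) ≫ κ.hom).app ⊤).hom
        (ev i N O (b j))) = if j = j₀ then 1 else 0 := by
  obtain ⟨q, hq⟩ := exists_coord (ev_frame hf.mem hf.frame_b) j₀
  obtain ⟨ε, hε⟩ := hf.exists_cokernel_iso hip hl h (pbArr i N ≫ vert q) (id_comp i)
    fun j => by rw [on_pbArr_vert q hf.mem, hq]
  obtain ⟨κ, hκ⟩ := exists_pullback_iso hip ε
  refine ⟨ε, κ, fun j => ?_⟩
  have : (Scheme.Modules.pullback i).map (cokernel.π f) ≫ κ.hom = q := by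
    apply pbArr_hom_ext
    rw [vert_comp, ← assoc, pbArr_map, assoc, hκ, ← hε, vert_comp, assoc]
  rw [this, hq]

omit [Subsingleton T] [Nonempty T] in
/-- The kernel on the fibres of an elementary modification. -/
theorem ElemFrame.ker_fibre (hl : LocEq i U V t) (hf : ElemFrame i t f O j₀ e b)
    (y : Γ((Scheme.Modules.pullback i).obj M, ⊤)) :
    (((Scheme.Modules.pullback i).map f).app ⊤).hom y = 0 ↔
      ∃ a : Γ(T, ⊤), y = a • ev i M O (e j₀) := by
  have hle : (⊤ : T.Opens) ≤ i ⁻¹ᵁ O := fun x _ => hf.mem x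
  have h0 : (((Scheme.Modules.pullback i).map f).app ⊤).hom (ev i M O (e j₀)) = 0 := by
    rw [ev_app f hf.mem, hf.app_self, ev_smul hf.mem]
    have : pl i O ⊤ (rsO V O t) = 0 := by
      have := hl.pl_mul_zero hf.le 1 hle
      rwa [mul_one] at this
    rw [this, zero_smul]
  constructor
  · intro hy
    obtain ⟨c, rfl⟩ := (ev_frame hf.mem hf.frame_e ⊤ le_rfl).2 y
    refine ⟨c j₀, ?_⟩
    have h1 : lc _ ⊤ ⊤ (fun j => ev i N O (b j)) (fun j => if j = j₀ then 0 else c j) =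
        lc _ ⊤ ⊤ (fun j => ev i N O (b j)) 0 := by
      refine Eq.trans ?_ (hy.trans (by simp [lc]))
      rw [Sht.app_lc _ le_rfl]
      refine Finset.sum_congr rfl fun j _ => ?_
      dsimp only
      split_ifs with hj
      · rw [hj, h0, map_zero, smul_zero, zero_smul]
      · rw [ev_app f hf.mem, hf.app_of_ne j hj]
    have h2 := (ev_frame hf.mem hf.frame_b ⊤ le_rfl).1 h1
    have h3 : c = Pi.single j₀ (c j₀) := by
      funext j
      by_cases hj : j = j₀
      · rw [hj, Pi.single_eq_same]
      · have := congrFun h2 j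
        simp only [hj, if_false] at this
        rw [Pi.single_eq_of_ne hj, this]
        rfl
    conv_lhs => rw [h3]
    rw [lc_single, rs_self]
  · rintro ⟨a, rfl⟩
    rw [app_smul', h0, smul_zero]

omit [Subsingleton T] [Nonempty T] in
/-- Functoriality of upper modifications: a morphism that respects the kernels on the fibres
extends to the modified sheaves. -/
theorem IsElem.exists_upper (hl : LocEq i U V t) (hf : IsElem i U t d f) {M' N' : Y.Modules}
    {f' : M' ⟶ N'} (hN' : IsLocallyFreeOfRank N' d) (m : M ⟶ M')
    (hf' : IsElem i U t d f')
    (h : ∀ y, (((Scheme.Modules.pullback i).map f).app ⊤).hom y = 0 →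
      (((Scheme.Modules.pullback i).map f').app ⊤).hom
        ((((Scheme.Modules.pullback i).map m).app ⊤).hom y) = 0) :
    ∃ n : N ⟶ N', f ≫ n = m ≫ f' := by
  obtain ⟨O, j₀, e, b, hE⟩ := hf.frame
  obtain ⟨O', j₀', e', b', hE'⟩ := hf'.frame
  have : IsIso (jMap U f) := isIso_jMap f hf.bij
  -- The extension exists over `U`; what has to be shown is that it is regular along `T`.
  let k : N ⟶ jU U N' := aU U N ≫ inv (jMap U f) ≫ jMap U m ≫ jMap U f'
  have hk : f ≫ k = (m ≫ f') ≫ aU U N' := by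
    rw [← assoc, ← aU_naturality, assoc, IsIso.hom_inv_id_assoc, ← assoc, aU_naturality, assoc,
      aU_naturality, assoc]
  have hk' : ∀ W x, (k.app W).hom ((f.app W).hom x) =
      ((aU U N').app W).hom ((f'.app W).hom ((m.app W).hom x)) := fun W x => by
    rw [← comp_app', hk, comp_app', comp_app']
  have hinj := hl.aU_injective hN'
  let P := O ⊓ O'
  have hP : ∀ x, i x ∈ P := fun x => ⟨hE.mem x, hE'.mem x⟩
  have hPV : P ≤ V := inf_le_left.trans hE.le
  have hPO : P ≤ O := inf_le_left
  have hb : ∀ j, ∃ n, ((aU U N').app P).hom n = (k.app P).hom (rs N O P (b j)) := by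
    intro j
    by_cases hj : j = j₀
    · subst hj
      let z := rs M O P (e j)
      obtain ⟨c, hc⟩ := (hE'.frame_b P inf_le_right).2 ((f'.app P).hom ((m.app P).hom z))
      have h1 := h (ev i M O (e j)) ((hE.ker_fibre hl _).2 ⟨1, (one_smul _ _).symm⟩)
      rw [← ev_rs hPO hP, ev_app m hP, ev_app f' hP, ← hc] at h1
      have hle : (⊤ : T.Opens) ≤ i ⁻¹ᵁ P := fun x _ => hP x
      have h2 := (on_lc (pbArr i N') (inf_le_right : P ≤ O') (W := ⊤) (W' := ⊤)
        (show (⊤ : T.Opens) ≤ bs (pbArr i N') ⁻¹ᵁ O' from fun x _ => hE'.mem x)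
        (show (⊤ : T.Opens) ≤ bs (pbArr i N') ⁻¹ᵁ P from fun x _ => hP x) le_top b' c)
      have h3 : (fun j => pl i P ⊤ (c j)) = 0 :=
        (ev_frame hE'.mem hE'.frame_b ⊤ le_rfl).1 ((h2.symm.trans h1).trans (by simp [lc]))
      -- The value at the generator of the kernel vanishes along `T`, hence is divisible by `t`.
      choose a ha using fun j => hl.dvd_top hPV hP (c j) (congrFun h3 j)
      refine ⟨lc N' O' P b' a, hl.jU_smul_injective hPV ?_⟩
      rw [← app_smul', ← app_smul', ← lc_smul]
      have h4 : rsO V P t • a = c := funext fun j => (ha j).symm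
      rw [h4, hc, ← hk', app_rs f hPO, hE.app_self, rs_smul _ hPO, rsO_rsO hE.le hPO]
    · refine ⟨(f'.app P).hom ((m.app P).hom (rs M O P (e j))), ?_⟩
      rw [← hk', app_rs f hPO, hE.app_of_ne j hj]
  choose n hn using hb
  obtain ⟨l, hl1, -⟩ := exists_lift_of_app (aU U N') hinj k fun W x => by
    refine exists_app_eq_of_locally (aU U N') hinj _ fun y hy => ?_
    by_cases hyU : y ∈ U
    · exact ⟨W ⊓ U, ⟨hy, hyU⟩, inf_le_left, (aU_bijective U N' inf_le_right).2 _⟩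
    · have hyP : y ∈ P := by
        rw [hl.mem_U, not_not] at hyU
        obtain ⟨x, rfl⟩ := hyU
        exact hP x
      refine ⟨W ⊓ P, ⟨hy, hyP⟩, inf_le_left, ?_⟩
      obtain ⟨c, hc⟩ := (hE.frame_b.rs hPO (W ⊓ P) inf_le_right).2 (rs N W (W ⊓ P) x)
      refine ⟨lc N' P (W ⊓ P) n c, ?_⟩
      rw [Sht.app_lc _ inf_le_right, ← app_rs k inf_le_left, ← hc, Sht.app_lc _ inf_le_right]
      simp_rw [hn]
  refine ⟨l, ?_⟩
  have : Mono (aU U N') := mono_of_app_injective _ hinj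
  rw [← cancel_mono (aU U N'), assoc, hl1, hk]

omit [Nonempty T] in
include hip in
/-- Functoriality of lower modifications. -/
theorem IsElem.exists_lower (hl : LocEq i U V t) {M' N' : Y.Modules} {f' : M' ⟶ N'}
    (hf' : IsElem i U t d f') {P : Y.Modules} (n : P ⟶ N')
    (h : (Scheme.Modules.pullback i).map (n ≫ cokernel.π f') = 0) :
    ∃ m : P ⟶ M', m ≫ f' = n := by
  obtain ⟨O', j₀', e', b', hE'⟩ := hf'.frame
  obtain ⟨ε, -⟩ := hE'.exists_quotient hip hl hf'
  have : Mono f' := hf'.mono hl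
  have h0 : n ≫ cokernel.π f' = 0 := by
    rw [← cancel_mono ε.hom, zero_comp]
    refine mkArr_injective i ?_
    have h1 : mkArr i ((n ≫ cokernel.π f') ≫ ε.hom) =
        vert (n ≫ cokernel.π f') ≫ mkArr i ε.hom := (vert_comp_mk _ _ _).symm
    have h2 : mkArr i (0 : P ⟶ (pushforward i).obj (unitMod T)) =
        vert (0 : P ⟶ cokernel f') ≫ mkArr i ε.hom := by rw [vert_comp_mk, zero_comp]
    obtain ⟨r, hr⟩ := exists_pbArr_comp (i := i) (mkArr i ε.hom) rfl
    rw [h1, h2, ← hr, ← assoc, ← assoc, ← pbArr_map, ← pbArr_map, h,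
      (Scheme.Modules.pullback i).map_zero]
  exact ⟨_, (Abelian.monoLift_comp f' n h0)⟩

end Modification

/-! ### Existence and base change of elementary modifications -/

section Existence

variable {T Y : Scheme.{u}} {i : T ⟶ Y} {U V : Y.Opens} {t : Γ(Y, V)} {d : ℕ}

theorem on_resArr_bijective (M : Y.Modules) {O A : Y.Opens} {B : O.toScheme.Opens} (hA : A ≤ O)
    (hB : B = O.ι ⁻¹ᵁ A) : Bijective (on (resArr O.ι M) A B) := by
  obtain rfl : O.ι ''ᵁ B = A := by rw [hB, image_preimage_ι, inf_eq_left.2 hA]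
  have h0 : O.ι ⁻¹ᵁ O.ι ''ᵁ B = B := O.ι.preimage_image_eq B
  have h1 := rs_bijective_of_eq (M.restrict O.ι) h0
  have h2 : Bijective (rs M (O.ι ''ᵁ B) (O.ι ''ᵁ O.ι ⁻¹ᵁ O.ι ''ᵁ B)) :=
    rs_bijective_of_eq M (by rw [h0])
  rw [rs_of_le M (O.ι.image_preimage_le _)] at h2
  exact h1.comp h2

theorem pl_ι_bijective {O A : Y.Opens} {B : O.toScheme.Opens} (hA : A ≤ O)
    (hB : B = O.ι ⁻¹ᵁ A) : Bijective (pl O.ι A B) := by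
  obtain rfl : O.ι ''ᵁ B = A := by rw [hB, image_preimage_ι, inf_eq_left.2 hA]
  rw [pl_of_le _ (O.ι.preimage_image_eq B).ge]
  have : O.ι.appLE (O.ι ''ᵁ B) B (O.ι.preimage_image_eq B).ge = (O.ι.appIso B).hom :=
    (O.ι.appIso_hom' B).symm
  rw [this]
  exact ConcreteCategory.bijective_of_isIso (O.ι.appIso B).hom

/-- The subsheaf of `P` of the sections that, over `O`, are combinations of given
independent sections. -/
theorem exists_subsheaf_of_sections (P : Y.Modules) (O : Y.Opens) (s : Fin d → Γ(P, O))
    (hs : ∀ W ≤ O, Injective (lc P O W s)) :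
    ∃ (N : Y.Modules) (ι : N ⟶ P), (∀ W, Injective (ι.app W).hom) ∧
      ∀ W (x : Γ(P, W)), (∃ y, (ι.app W).hom y = x) ↔
        ∃ c, lc P O (W ⊓ O) s c = rs P W (W ⊓ O) x := by
  let R := P.restrict O.ι
  let σ : Fin d → Γ(R, ⊤) := fun j => on (resArr O.ι P) O ⊤ (s j)
  obtain ⟨φ, hφ, -⟩ := existsUnique_freeMod_hom R σ
  have hW : ∀ W : Y.Opens, O.ι ⁻¹ᵁ W = O.ι ⁻¹ᵁ (W ⊓ O) := fun W => by
    rw [← image_preimage_ι, O.ι.preimage_image_eq]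
  have hlc : ∀ (A : Y.Opens) (B : O.toScheme.Opens), A ≤ O → B = O.ι ⁻¹ᵁ A →
      ∀ c : Fin d → Γ(Y, A), (φ.app B).hom (lc _ ⊤ B (freeStd _) fun j => pl O.ι A B (c j)) =
        on (resArr O.ι P) A B (lc P O A s c) := by
    intro A B hA hB c
    rw [app_lc φ le_top]
    simp_rw [hφ]
    exact (on_lc (resArr O.ι P) hA O.ι_preimage_self.ge hB.le le_top s c).symm
  have hpl : ∀ (A : Y.Opens) (B : O.toScheme.Opens), A ≤ O → B = O.ι ⁻¹ᵁ A →
      Bijective fun (c : Fin d → Γ(Y, A)) j => pl O.ι A B (c j) :=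
    fun A B hA hB => Function.Bijective.piMap fun _ => pl_ι_bijective hA hB
  have hfree : ∀ B : O.toScheme.Opens, Bijective (lc _ ⊤ B (freeStd O.toScheme (ι := Fin d))) :=
    fun B => isFrame_freeStd _ _ B le_top
  have hφi : ∀ B, Injective (φ.app B).hom := by
    intro B x y hxy
    have hA : O.ι ''ᵁ B ≤ O := (O.ι.image_le_opensRange B).trans O.opensRange_ι.le
    have hB : B = O.ι ⁻¹ᵁ O.ι ''ᵁ B := (O.ι.preimage_image_eq B).symm
    obtain ⟨c, rfl⟩ := (hfree B).2 x
    obtain ⟨c, rfl⟩ := (hpl _ B hA hB).2 c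
    obtain ⟨c', rfl⟩ := (hfree B).2 y
    obtain ⟨c', rfl⟩ := (hpl _ B hA hB).2 c'
    rw [hlc _ B hA hB, hlc _ B hA hB] at hxy
    rw [hs _ hA ((on_resArr_bijective P hA hB).1 hxy)]
  have : Mono φ := mono_of_app_injective φ hφi
  -- The subsheaf is the kernel of the morphism to the direct image of the quotient over `O`.
  let g : P ⟶ (pushforward O.ι).obj (cokernel φ) :=
    aU O P ≫ (pushforward O.ι).map (cokernel.π φ)
  have hg : ∀ W (x : Γ(P, W)), (g.app W).hom x = 0 ↔
      ((cokernel.π φ).app (O.ι ⁻¹ᵁ W)).hom (on (resArr O.ι P) W (O.ι ⁻¹ᵁ W) x) = 0 := by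
    intro W x
    have h1 : on (resArr O.ι P) W (O.ι ⁻¹ᵁ W) x =
        unpf O.ι R W (((Scheme.Modules.restrictAdjunction O.ι).unit.app P).app W |>.hom x) :=
      rs_self R _ _
    rw [h1]
    exact Iff.rfl
  refine ⟨kernel g, kernel.ι g, app_injective _, fun W x => ?_⟩
  have h1 : (∃ y, ((kernel.ι g).app W).hom y = x) ↔ (g.app W).hom x = 0 := by
    refine ⟨?_, exists_kernel_app_eq g W x⟩
    rintro ⟨y, rfl⟩
    rw [← comp_app', kernel.condition]
    rfl
  have h2 : on (resArr O.ι P) W (O.ι ⁻¹ᵁ W) x =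
      on (resArr O.ι P) (W ⊓ O) (O.ι ⁻¹ᵁ W) (rs P W (W ⊓ O) x) :=
    (on_rs (resArr O.ι P) inf_le_left (hW W).le x).symm
  rw [h1, hg, h2]
  constructor
  · intro h3
    obtain ⟨y, hy⟩ := exists_app_eq_of_cokernel φ _ _ h3
    obtain ⟨c, rfl⟩ := (hfree _).2 y
    obtain ⟨c, rfl⟩ := (hpl (W ⊓ O) _ inf_le_right (hW W)).2 c
    rw [hlc _ _ inf_le_right (hW W)] at hy
    exact ⟨c, (on_resArr_bijective P inf_le_right (hW W)).1 hy⟩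
  · rintro ⟨c, hc⟩
    rw [← hc, ← hlc _ _ inf_le_right (hW W), ← comp_app', cokernel.condition]
    rfl

variable {M N : Y.Modules} {f : M ⟶ N} {O : Y.Opens} {j₀ : Fin d} {e : Fin d → Γ(M, O)}
  {b : Fin d → Γ(N, O)}

/-- Existence of upper modifications. -/
theorem exists_upperModification (hl : LocEq i U V t) (hM : IsLocallyFreeOfRank M d)
    (hO : ∀ x, i x ∈ O) (hOV : O ≤ V) (he : IsFrame M O e) (j₀ : Fin d) :
    ∃ (N : Y.Modules) (f : M ⟶ N) (b : Fin d → Γ(N, O)), IsElem i U t d f ∧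
      ElemFrame i t f O j₀ e b := by
  let P := jU U M
  have hinj := hl.aU_injective hM
  -- Near `T`, the sheaf `N` is generated in `j_* M|_U` by `t⁻¹ e_{j₀}` and the other `e_j`.
  obtain ⟨s₀, hs₀⟩ := hl.exists_jU_smul hOV (((aU U M).app O).hom (e j₀))
  let s : Fin d → Γ(P, O) := fun j => if j = j₀ then s₀ else ((aU U M).app O).hom (e j)
  have hslc : ∀ {W : Y.Opens} (hW : W ≤ O) (c : Fin d → Γ(Y, W)), ((aU U M).app W).hom
      (lc M O W e c) = lc P O W s fun j => if j = j₀ then rsO V W t * c j else c j := by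
    intro W hW c
    rw [app_lc _ hW]
    unfold lc
    refine Finset.sum_congr rfl fun j _ => ?_
    simp only [s]
    split_ifs with hj
    · rw [hj, ← hs₀, rs_smul _ hW, rsO_rsO hOV hW, smul_smul, mul_comm]
    · rfl
  have hsinj : ∀ W ≤ O, Injective (lc P O W s) := by
    intro W hW c c' hcc
    have h1 := congrArg (rsO V W t • ·) hcc
    simp only [← lc_smul] at h1
    have h2 : ∀ c : Fin d → Γ(Y, W), rsO V W t • c = fun j => if j = j₀ then rsO V W t * c j else
        (if j = j₀ then c j else rsO V W t * c j) := by
      intro c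
      funext j
      by_cases hj : j = j₀ <;> simp [hj]
    have h3 : ∀ c : Fin d → Γ(Y, W), lc P O W s (rsO V W t • c) = ((aU U M).app W).hom
        (lc M O W e fun j => if j = j₀ then c j else rsO V W t * c j) := by
      intro c
      rw [hslc hW, h2]
      congr 1
      funext j
      by_cases hj : j = j₀ <;> simp [hj]
    rw [h3, h3] at h1
    have h4 := (he W hW).1 (hinj W h1)
    funext j
    have h5 := congrFun h4 j
    by_cases hj : j = j₀
    · simpa only [hj, if_true] using h5
    · simp only [hj, if_false] at h5
      exact hl.regular (hW.trans hOV) h5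
  obtain ⟨N, ι, hι, hN⟩ := exists_subsheaf_of_sections P O s hsinj
  have hNO : ∀ {W : Y.Opens}, W ≤ O → ∀ x : Γ(P, W), (∃ y, (ι.app W).hom y = x) ↔
      ∃ c, lc P O W s c = x := by
    intro W hW x
    rw [hN]
    have hb := rs_bijective_of_eq P (inf_eq_left.2 hW).symm
    constructor
    · rintro ⟨c, hc⟩
      refine ⟨fun j => rsO (W ⊓ O) W (c j), ?_⟩
      have h1 := congrArg (rs P (W ⊓ O) W) hc
      rwa [rs_lc P inf_le_right (le_inf le_rfl hW), rs_rs P inf_le_left (le_inf le_rfl hW),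
        rs_self] at h1
    · rintro ⟨c, rfl⟩
      exact ⟨fun j => rsO W (W ⊓ O) (c j), (rs_lc P hW inf_le_left s c).symm⟩
  obtain ⟨f, hf, -⟩ := exists_lift_of_app ι hι (aU U M) fun W x => by
    rw [hN]
    obtain ⟨c, hc⟩ := (he (W ⊓ O) inf_le_right).2 (rs M W (W ⊓ O) x)
    exact ⟨_, by rw [← app_rs _ inf_le_left, ← hc]; exact (hslc inf_le_right c).symm⟩
  have hf' : ∀ W x, (ι.app W).hom ((f.app W).hom x) = ((aU U M).app W).hom x := fun W x => by
    rw [← comp_app', hf]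
  choose b hb using fun j => (hNO le_rfl (s j)).2 ⟨Pi.single j 1, by
    rw [lc_single, rs_self, one_smul]⟩
  have hιlc : ∀ {W : Y.Opens} (hW : W ≤ O) (c : Fin d → Γ(Y, W)),
      (ι.app W).hom (lc N O W b c) = lc P O W s c := by
    intro W hW c
    rw [app_lc ι hW]
    simp_rw [hb]
  have hbf : IsFrame N O b := by
    intro W hW
    refine ⟨fun c c' h => hsinj W hW ?_, fun x => ?_⟩
    · rw [← hιlc hW, ← hιlc hW, h]
    · obtain ⟨c, hc⟩ := (hNO hW _).1 ⟨x, rfl⟩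
      exact ⟨c, hι W (by rw [hιlc hW, hc])⟩
  have hE : ElemFrame i t f O j₀ e b := by
    refine ⟨hOV, hO, he, hbf, hι O ?_, fun j hj => hι O ?_⟩
    · rw [hf', app_smul', hb, ← hs₀]
      simp [s]
    · rw [hf', hb]
      simp [s, hj]
  refine ⟨N, f, b, ⟨fun W hW => ⟨fun x y hxy => hinj W ?_, fun x => ?_⟩, O, j₀, e, b, hE⟩, hE⟩
  · rw [← hf', ← hf', hxy]
  · obtain ⟨y, hy⟩ := (aU_bijective U M hW).2 ((ι.app W).hom x)
    exact ⟨y, hι W (by rw [hf', hy])⟩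

variable {p : Y ⟶ T} (hip : i ≫ p = 𝟙 T)

include hip in
/-- Existence of lower modifications. -/
theorem exists_lowerModification [Subsingleton T] [Nonempty T] (hl : LocEq i U V t)
    (hN : IsLocallyFreeOfRank N d) (q : (Scheme.Modules.pullback i).obj N ⟶ unitMod T)
    {β : Fin d → Γ((Scheme.Modules.pullback i).obj N, ⊤)} (hβ : IsFrame _ ⊤ β)
    (hqβ : ∀ j, unitSec T ⊤ ((q.app ⊤).hom (β j)) = if j = j₀ then 1 else 0) :
    ∃ (M : Y.Modules) (f : M ⟶ N), IsElem i U t d f ∧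
      ∃ κ : (Scheme.Modules.pullback i).obj (cokernel f) ≅ unitMod T,
        (Scheme.Modules.pullback i).map (cokernel.π f) ≫ κ.hom = q := by
  let w := pbArr i N ≫ vert q
  have hw : bs w = i := id_comp i
  obtain ⟨π, hπ⟩ : ∃ π : N ⟶ (pushforward i).obj (unitMod T), mkArr i π = w :=
    ⟨_, (mk_comp_vert i _ q).symm⟩
  have hker : ∀ W (x : Γ(N, W)), on w W (i ⁻¹ᵁ W) x = 0 ↔
      ∃ y, ((kernel.ι π).app W).hom y = x := by
    intro W x
    have h1 : on (mkArr i π) W (i ⁻¹ᵁ W) x = unpf i (unitMod T) W ((π.app W).hom x) :=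
      rs_self (unitMod T) _ _
    have h2 : Injective (unpf i (unitMod T) W) := Function.injective_id
    rw [← hπ, h1, map_eq_zero_iff _ h2]
    refine ⟨exists_kernel_app_eq π W x, ?_⟩
    rintro ⟨y, rfl⟩
    rw [← comp_app', kernel.condition]
    rfl
  obtain ⟨hel, O, e, b, hE, hbβ⟩ := exists_elemFrame_of_kernel hip hl
    (app_injective (kernel.ι π)) hN w hw hker rfl hβ hqβ
  refine ⟨_, kernel.ι π, hel, ?_⟩
  obtain ⟨ε, hε⟩ := hE.exists_cokernel_iso hip hl hel w hw
    fun j => by rw [on_pbArr_vert q hE.mem, hbβ, hqβ]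
  obtain ⟨κ, hκ⟩ := exists_pullback_iso hip ε
  refine ⟨κ, pbArr_hom_ext ?_⟩
  rw [vert_comp, ← assoc, pbArr_map, assoc, hκ]
  refine Eq.trans ?_ hε
  rw [vert_comp, assoc]

/-- Base change of elementary modifications. -/
theorem IsElem.baseChange {T' Y' : Scheme.{u}} {i' : T' ⟶ Y'} {P : Y' ⟶ Y} {τ : T' ⟶ T}
    (hP : i' ≫ P = τ ≫ i) (hf : IsElem i U t d f)
    (hM : IsLocallyFreeOfRank M d) {M' N' : Y'.Modules} {f' : M' ⟶ N'}
    {ρ : (⟨Y, M⟩ : QMod) ⟶ ⟨Y', M'⟩} {ρ' : (⟨Y, N⟩ : QMod) ⟶ ⟨Y', N'⟩} (hρ : IsCart ρ)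
    (hρ' : IsCart ρ') (hb : bs ρ = P)
    (hb' : bs ρ' = P) (h : vert f ≫ ρ' = ρ ≫ vert f') :
    IsElem i' (P ⁻¹ᵁ U) (pl P V (P ⁻¹ᵁ V) t) d f' := by
  subst hb
  have hle : ∀ O : Y.Opens, bs ρ ⁻¹ᵁ O ≤ bs ρ' ⁻¹ᵁ O := fun O => by rw [hb']
  have hon : ∀ (O : Y.Opens) (x : Γ(M, O)), on ρ' O (bs ρ ⁻¹ᵁ O) ((f.app O).hom x) =
      (f'.app _).hom (on ρ O (bs ρ ⁻¹ᵁ O) x) := by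
    intro O x
    have h1 : on (vert f ≫ ρ') O (bs ρ ⁻¹ᵁ O) x = on (ρ ≫ vert f') O (bs ρ ⁻¹ᵁ O) x := by rw [h]
    have h2 := on_comp (vert f) ρ' O (le_refl O) (hle O) x
    have h3 := on_comp ρ (vert f') (bs ρ ⁻¹ᵁ O) le_rfl (le_refl (bs ρ ⁻¹ᵁ O)) x
    rw [on_vert_self] at h2 h3
    exact h2.symm.trans (h1.trans h3)
  constructor
  · intro W hW
    refine bijective_of_locally_bijective f' fun y hy => ?_
    obtain ⟨O, e, hyO, he⟩ := (isLocallyFreeOfRank_iff M d).1 hM (bs ρ y)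
    let A := O ⊓ U
    have he1 : IsFrame M A _ := he.rs inf_le_left
    have he2 := frame_of_bijective f he1 fun V hV => hf.bij V (hV.trans inf_le_right)
    refine ⟨bs ρ ⁻¹ᵁ A, ⟨hyO, hW hy⟩, fun V' hV' => ?_⟩
    refine IsFrame.bijective_app f' (he1.cart hρ le_rfl) ?_ hV'
    have he3 := he2.cart hρ' (hle A)
    simp_rw [hon] at he3
    exact he3
  · obtain ⟨O, j₀, e, b, hE⟩ := hf.frame
    refine ⟨bs ρ ⁻¹ᵁ O, j₀, fun j => on ρ O _ (e j), fun j => on ρ' O _ (b j),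
      (bs ρ).preimage_mono hE.le, fun x => ?_, hE.frame_e.cart hρ le_rfl,
      hE.frame_b.cart hρ' (hle O), ?_, fun j hj => ?_⟩
    · have : bs ρ (i' x) = i (τ x) := by
        rw [← Scheme.Hom.comp_apply, hP, Scheme.Hom.comp_apply]
      change bs ρ (i' x) ∈ O
      rw [this]
      exact hE.mem _
    · dsimp only
      rw [← hon, hE.app_self, on_smul ρ' (hle O), hb',
        rsO_pl (bs ρ) le_rfl ((bs ρ).preimage_mono hE.le), pl_rsO (bs ρ) hE.le le_rfl]
    · rw [← hon, hE.app_of_ne j hj]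

end Existence

/-! ### The ideal of a section of a smooth algebra of relative dimension one -/

section SmoothAlgebra

open scoped TensorProduct

variable {k R : Type u} [CommRing k] [CommRing R] [Algebra k R]

/-- The homomorphism `R ⊗ A ⟶ A` given by a homomorphism `R ⟶ A`. -/
def sect {A : Type u} [CommRing A] [Algebra k A] (ψ : R →ₐ[k] A) : R ⊗[k] A →ₐ[k] A :=
  Algebra.TensorProduct.productMap ψ (AlgHom.id k A)

theorem sect_tmul {A : Type u} [CommRing A] [Algebra k A] (ψ : R →ₐ[k] A) (r : R) (a : A) :
    sect ψ (r ⊗ₜ a) = ψ r * a := by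
  simp [sect]

theorem sub_sect_mem {A : Type u} [CommRing A] [Algebra k A] (ψ : R →ₐ[k] A)
    (I : Ideal (R ⊗[k] A)) (h : ∀ r, r ⊗ₜ 1 - 1 ⊗ₜ ψ r ∈ I) (y : R ⊗[k] A) :
    y - 1 ⊗ₜ sect ψ y ∈ I := by
  induction y with
  | zero => simp
  | tmul r a =>
    have := I.mul_mem_right (1 ⊗ₜ a) (h r)
    rwa [sub_mul, Algebra.TensorProduct.tmul_mul_tmul, Algebra.TensorProduct.tmul_mul_tmul, mul_one,
      one_mul, mul_one, ← sect_tmul] at this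
  | add x y hx hy =>
    rw [map_add, TensorProduct.tmul_add, add_sub_add_comm]
    exact add_mem hx hy

theorem mem_of_sect_eq_zero {A : Type u} [CommRing A] [Algebra k A] (ψ : R →ₐ[k] A)
    (I : Ideal (R ⊗[k] A)) (h : ∀ r, r ⊗ₜ 1 - 1 ⊗ₜ ψ r ∈ I) (y : R ⊗[k] A) (hy : sect ψ y = 0) :
    y ∈ I := by
  have := sub_sect_mem ψ I h y
  rwa [hy, TensorProduct.tmul_zero, sub_zero] at this

theorem mul_left_injective_X_sub (A : Type u) [CommRing A] [Algebra k A] (c : A)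
    (x y : MvPolynomial (Fin 1) k ⊗[k] A)
    (h : (MvPolynomial.X 0 ⊗ₜ 1 - 1 ⊗ₜ c) * x = (MvPolynomial.X 0 ⊗ₜ 1 - 1 ⊗ₜ c) * y) : x = y := by
  let e : MvPolynomial (Fin 1) k ⊗[k] A ≃+* Polynomial A :=
    ((Algebra.TensorProduct.comm k _ A).toRingEquiv.trans
      (MvPolynomial.algebraTensorAlgEquiv k A).toRingEquiv).trans
      (MvPolynomial.uniqueAlgEquiv A (Fin 1)).toRingEquiv
  have he : e (MvPolynomial.X 0 ⊗ₜ 1 - 1 ⊗ₜ c) = Polynomial.X - Polynomial.C c := by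
    rw [map_sub]
    congr 1
    · simp [e, MvPolynomial.uniqueAlgEquiv]
    · simp [e, MvPolynomial.uniqueAlgEquiv, Algebra.smul_def, MvPolynomial.algebraMap_eq]
  apply e.injective
  have h1 := congrArg e h
  rw [map_mul, map_mul, he] at h1
  exact (Polynomial.monic_X_sub_C c).isRegular.left h1

variable [Algebra (MvPolynomial (Fin 1) k) R] [IsScalarTower k (MvPolynomial (Fin 1) k) R]

/-- The image in `R` of the variable of the polynomial ring. -/
abbrev coordX : R := algebraMap (MvPolynomial (Fin 1) k) R (MvPolynomial.X 0)

theorem mul_left_injective_coordX [Module.Flat (MvPolynomial (Fin 1) k) R]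
    (A : Type u) [CommRing A] [Algebra k A] (c : A) (x y : R ⊗[k] A)
    (h : ((coordX (k := k) : R) ⊗ₜ 1 - 1 ⊗ₜ c) * x = ((coordX (k := k) : R) ⊗ₜ 1 - 1 ⊗ₜ c) * y) :
    x = y := by
  let P := MvPolynomial (Fin 1) k
  let s : P ⊗[k] A := MvPolynomial.X 0 ⊗ₜ 1 - 1 ⊗ₜ c
  let e := Algebra.TensorProduct.cancelBaseChange k P P R A
  let m : P ⊗[k] A →ₗ[P] P ⊗[k] A := LinearMap.mulLeft P s
  have hm : Injective m := fun x y h => mul_left_injective_X_sub A c x y h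
  have h2 := Module.Flat.lTensor_preserves_injective_linearMap (M := R) m hm
  have h3 : ∀ z : R ⊗[P] (P ⊗[k] A), e (m.lTensor R z) =
      ((coordX (k := k) : R) ⊗ₜ 1 - 1 ⊗ₜ c) * e z := by
    intro z
    induction z with
    | zero => simp only [map_zero, mul_zero]
    | add x y hx hy => rw [map_add, map_add, hx, hy, map_add, mul_add]
    | tmul r w =>
      induction w with
      | zero => simp only [TensorProduct.tmul_zero, map_zero, mul_zero]
      | add x y hx hy =>
        rw [TensorProduct.tmul_add, map_add, map_add, hx, hy, map_add, mul_add]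
      | tmul p a =>
        have h4 : m.lTensor R (r ⊗ₜ (p ⊗ₜ a)) =
            r ⊗ₜ ((MvPolynomial.X 0 * p) ⊗ₜ a) - r ⊗ₜ (p ⊗ₜ (c * a)) := by
          rw [LinearMap.lTensor_tmul, ← TensorProduct.tmul_sub]
          congr 1
          simp [m, s, sub_mul]
        rw [h4, map_sub]
        simp only [e, Algebra.TensorProduct.cancelBaseChange_tmul]
        rw [sub_mul, Algebra.TensorProduct.tmul_mul_tmul, Algebra.TensorProduct.tmul_mul_tmul,
          one_mul, one_mul, mul_smul, Algebra.smul_def]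
  obtain ⟨x, rfl⟩ := e.surjective x
  obtain ⟨y, rfl⟩ := e.surjective y
  rw [← h3, ← h3] at h
  rw [h2 (e.injective h)]

/-- Let `R` be étale over the polynomial ring `k[x]`, and let `ψ : R ⟶ E` be a point with
`x ↦ c`. Up to localization, the kernel of `R ⊗ E ⟶ E` is generated by `x ⊗ 1 - 1 ⊗ c`: by
the infinitesimal criterion it is generated by this element and its own square. -/
theorem exists_mul_mem_span {E : Type u} [CommRing E] [Algebra k E] [IsNoetherianRing (R ⊗[k] E)]
    [Algebra.FormallyUnramified (MvPolynomial (Fin 1) k) R] (ψ : R →ₐ[k] E) :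
    ∃ b : R ⊗[k] E, sect ψ b = 1 ∧ ∀ y, sect ψ y = 0 →
      ∃ z, b * y = ((coordX (k := k) : R) ⊗ₜ 1 - 1 ⊗ₜ ψ (coordX (k := k))) * z := by
  let P := MvPolynomial (Fin 1) k
  let B := R ⊗[k] E
  let t : B := (coordX (k := k) : R) ⊗ₜ 1 - 1 ⊗ₜ ψ (coordX (k := k))
  let J : Ideal B := RingHom.ker (sect ψ)
  have htJ : t ∈ J := by
    rw [RingHom.mem_ker, map_sub, sect_tmul, sect_tmul, map_one, one_mul, mul_one, sub_self]
  let K : Ideal B := Ideal.span {t} ⊔ J • J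
  have hKJ : K ≤ J := sup_le ((Ideal.span_singleton_le_iff_mem _).2 htJ) Ideal.mul_le_right
  let f : B ⧸ K →+* B ⧸ J := Ideal.Quotient.factor hKJ
  have hf : IsNilpotent (RingHom.ker f) := by
    refine ⟨2, ?_⟩
    refine (pow_two (RingHom.ker f)).trans (le_bot_iff.1 (Ideal.mul_le.2 ?_))
    intro x hx y hy
    obtain ⟨x, rfl⟩ := Ideal.Quotient.mk_surjective x
    obtain ⟨y, rfl⟩ := Ideal.Quotient.mk_surjective y
    rw [RingHom.mem_ker, Ideal.Quotient.factor_mk, Ideal.Quotient.eq_zero_iff_mem] at hx hy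
    rw [Ideal.mem_bot, ← map_mul, Ideal.Quotient.eq_zero_iff_mem]
    exact Ideal.mem_sup_right (Ideal.mul_mem_mul hx hy)
  let g₁ : R →+* B ⧸ K := (Ideal.Quotient.mk K).comp Algebra.TensorProduct.includeLeftRingHom
  let g₂ : R →+* B ⧸ K := ((Ideal.Quotient.mk K).comp
    (Algebra.TensorProduct.includeRight : E →ₐ[k] B).toRingHom).comp ψ.toRingHom
  let _ : Algebra P (B ⧸ K) := (g₁.comp (algebraMap P R)).toAlgebra
  have hg : g₂.comp (algebraMap P R) = g₁.comp (algebraMap P R) := by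
    refine MvPolynomial.ringHom_ext (fun a => ?_) fun j => ?_
    · have h1 : algebraMap P R (MvPolynomial.C a) = algebraMap k R a :=
        (IsScalarTower.algebraMap_apply k P R a).symm
      rw [RingHom.comp_apply, h1]
      refine Eq.trans ?_ (congrArg g₁ h1).symm
      change Ideal.Quotient.mk K (1 ⊗ₜ ψ (algebraMap k R a)) =
        Ideal.Quotient.mk K (algebraMap k R a ⊗ₜ 1)
      rw [ψ.commutes, Algebra.algebraMap_eq_smul_one, Algebra.algebraMap_eq_smul_one,
        TensorProduct.smul_tmul]
    · rw [Subsingleton.elim j 0]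
      refine (Ideal.Quotient.eq.2 ?_).symm
      exact Ideal.mem_sup_left (Ideal.mem_span_singleton_self t)
  -- `r ↦ r ⊗ 1` and `r ↦ 1 ⊗ ψ r` agree modulo the nilpotent ideal `J / K`, hence in `B / K`.
  have hgg := Algebra.FormallyUnramified.ext' (R := P) (A := R) (B := B ⧸ K) f hf
    { g₁ with commutes' := fun _ => rfl }
    { g₂ with commutes' := fun p => RingHom.congr_fun hg p } fun r => by
      refine Ideal.Quotient.eq.2 ?_
      rw [RingHom.mem_ker]
      change sect ψ (r ⊗ₜ 1 - 1 ⊗ₜ ψ r) = 0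
      rw [map_sub, sect_tmul, sect_tmul, map_one, one_mul, mul_one, sub_self]
  have hJK : J ≤ K := fun y hy => mem_of_sect_eq_zero ψ K (fun r => by
    exact Ideal.Quotient.eq.1 (AlgHom.congr_fun hgg r)) y hy
  -- Nakayama's lemma, as `J ≤ (t) + J²`.
  obtain ⟨b, hb, hbJ⟩ := Submodule.exists_sub_one_mem_and_smul_le_of_fg_of_le_sup (I := J)
    (N := Ideal.span {t}) (N' := J) (IsNoetherian.noetherian J) le_rfl hJK
  refine ⟨b, ?_, fun y hy => ?_⟩
  · rw [RingHom.mem_ker, map_sub, map_one, sub_eq_zero] at hb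
    exact hb
  · obtain ⟨z, hz⟩ := Ideal.mem_span_singleton.1 (hbJ (Submodule.smul_mem_pointwise_smul y b J hy))
    exact ⟨z, hz⟩

omit [Algebra (MvPolynomial (Fin 1) k) R] [IsScalarTower k (MvPolynomial (Fin 1) k) R] in
/-- The base change of `exists_mul_mem_span`. -/
theorem exists_mul_eq_of_sect_eq_zero {E A : Type u} [CommRing E] [Algebra k E] [CommRing A]
    [Algebra k A] (φ : E →ₐ[k] A) (ψ : R →ₐ[k] E) {b t : R ⊗[k] E}
    (h : ∀ y, sect ψ y = 0 → ∃ z, b * y = t * z) (y : R ⊗[k] A) (hy : sect (φ.comp ψ) y = 0) :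
    ∃ z, Algebra.TensorProduct.map (AlgHom.id k R) φ b * y =
      Algebra.TensorProduct.map (AlgHom.id k R) φ t * z := by
  let F := Algebra.TensorProduct.map (AlgHom.id k R) φ
  have h1 : y ∈ (Ideal.span {F t}).colon (Ideal.span {F b}) := by
    refine mem_of_sect_eq_zero (φ.comp ψ) _ (fun r => ?_) y hy
    obtain ⟨z, hz⟩ := h (r ⊗ₜ 1 - 1 ⊗ₜ ψ r) (by
      rw [map_sub, sect_tmul, sect_tmul, map_one, one_mul, mul_one, sub_self])
    rw [Ideal.mem_colon_span_singleton, Ideal.mem_span_singleton]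
    refine ⟨F z, ?_⟩
    rw [← map_mul, ← hz, map_mul, mul_comm]
    congr 1
    simp [F]
  rw [Ideal.mem_colon_span_singleton, Ideal.mem_span_singleton] at h1
  obtain ⟨z, hz⟩ := h1
  exact ⟨z, by rw [mul_comm]; exact hz⟩

end SmoothAlgebra

/-! ### Local equations from affine charts -/

section AffineChart

theorem basicOpen_pl {Y T : Scheme.{u}} (i : T ⟶ Y) {V : Y.Opens} {W : T.Opens} (h : W ≤ i ⁻¹ᵁ V)
    (b : Γ(Y, V)) : T.basicOpen (pl i V W b) = i ⁻¹ᵁ (Y.basicOpen b) ⊓ W := by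
  rw [pl_of_le i h]
  have : (i.appLE V W h).hom b = (T.presheaf.map (homOfLE h).op).hom ((i.app V).hom b) := rfl
  change T.basicOpen ((i.appLE V W h).hom b) = _
  rw [this, Scheme.basicOpen_res, inf_comm, ← Scheme.preimage_basicOpen]

theorem LocEq.of_eq {T Y : Scheme.{u}} {i : T ⟶ Y} {U V V' : Y.Opens} {t : Γ(Y, V)}
    (h : LocEq i U V t) (hV : V' = V) (t' : Γ(Y, V')) (ht : t' = rsO V V' t) : LocEq i U V' t' := by
  subst hV
  rw [rsO_self] at ht
  rwa [ht]

variable {Y : Scheme.{u}} {V₀ : Y.Opens} (hV : IsAffineOpen V₀)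

include hV in
theorem exists_pow_mul_eq (h : Γ(Y, V₀)) (x : Γ(Y, Y.basicOpen h)) :
    ∃ (n : ℕ) (β : Γ(Y, V₀)), rsO V₀ (Y.basicOpen h) h ^ n * x = rsO V₀ (Y.basicOpen h) β := by
  have := hV.isLocalization_basicOpen h
  obtain ⟨n, β, hβ⟩ := IsLocalization.Away.surj h x
  refine ⟨n, β, ?_⟩
  rw [rsO_of_le (Y.basicOpen_le h), mul_comm]
  exact hβ

include hV in
theorem exists_pow_mul_eq_zero (h : Γ(Y, V₀)) (β : Γ(Y, V₀))
    (hβ : rsO V₀ (Y.basicOpen h) β = 0) : ∃ n : ℕ, h ^ n * β = 0 := by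
  have := hV.isLocalization_basicOpen h
  rw [rsO_of_le (Y.basicOpen_le h)] at hβ
  obtain ⟨⟨_, n, rfl⟩, hc⟩ := (IsLocalization.map_eq_zero_iff (Submonoid.powers h)
    Γ(Y, Y.basicOpen h) β).1 hβ
  exact ⟨n, hc⟩

theorem rsO_pow {U W : Y.Opens} (h : W ≤ U) (a : Γ(Y, U)) (n : ℕ) :
    rsO U W (a ^ n) = rsO U W a ^ n := map_pow (plHom (𝟙 Y) (show W ≤ (𝟙 Y) ⁻¹ᵁ U from h)) a n

include hV in
theorem exists_inv_basicOpen (h : Γ(Y, V₀)) {W : Y.Opens} (hW : W ≤ Y.basicOpen h) :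
    ∃ u, rsO V₀ W h * u = 1 := by
  have := hV.isLocalization_basicOpen h
  obtain ⟨u, hu⟩ := (IsLocalization.Away.algebraMap_isUnit (S := Γ(Y, Y.basicOpen h)) h).exists_right_inv
  have h1 : rsO V₀ (Y.basicOpen h) h * u = 1 := by
    rw [rsO_of_le (Y.basicOpen_le h)]
    exact hu
  refine ⟨rsO _ W u, ?_⟩
  rw [← rsO_rsO (Y.basicOpen_le h) hW, ← rsO_mul hW, h1, rsO_one hW]

include hV in
theorem rsO_mul_injective {t : Γ(Y, V₀)} (ht : ∀ x, t * x = 0 → x = 0) {W : Y.Opens} (hW : W ≤ V₀)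
    (x : Γ(Y, W)) (hx : rsO V₀ W t * x = 0) : x = 0 := by
  apply (unitSec Y W).symm.injective
  refine eq_of_rs_eq_of_mem (unitMod Y) fun y hy => ?_
  obtain ⟨h, hW', hy'⟩ := hV.exists_basicOpen_le (V := W) ⟨y, hy⟩ (hW hy)
  refine ⟨Y.basicOpen h, hy', hW', ?_⟩
  rw [map_zero, map_zero]
  apply (unitSec Y _).injective
  rw [unitSec_rs hW', AddEquiv.apply_symm_apply, map_zero]
  obtain ⟨n, β, hβ⟩ := exists_pow_mul_eq hV h (rsO W _ x)
  obtain ⟨u, hu⟩ := exists_inv_basicOpen hV h le_rfl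
  have h1 : rsO V₀ (Y.basicOpen h) (t * β) = 0 := by
    rw [rsO_mul (Y.basicOpen_le h), ← hβ, mul_left_comm, ← rsO_rsO hW hW' t, ← rsO_mul hW', hx,
      map_zero, mul_zero]
  obtain ⟨m, hm⟩ := exists_pow_mul_eq_zero hV h _ h1
  have h2 := ht (h ^ m * β) (by rw [← hm]; ring)
  have h3 := congrArg (rsO V₀ (Y.basicOpen h)) h2
  rw [rsO_mul (Y.basicOpen_le h), rsO_pow (Y.basicOpen_le h), map_zero, ← hβ] at h3
  calc rsO W _ x = (rsO V₀ (Y.basicOpen h) h * u) ^ m * (rsO V₀ (Y.basicOpen h) h * u) ^ n *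
        rsO W _ x := by rw [hu]; simp
    _ = u ^ m * u ^ n * (rsO V₀ (Y.basicOpen h) h ^ m * (rsO V₀ (Y.basicOpen h) h ^ n *
        rsO W _ x)) := by ring
    _ = 0 := by rw [h3, mul_zero]

variable {T : Scheme.{u}} [Subsingleton T] {i : T ⟶ Y}

include hV in
/-- In an affine open set, an element that generates the kernel of the restriction to a section up
to a unit near the section, and is not a zero divisor, is a local equation. -/
theorem locEq_of_affine (hi : ∀ x, i x ∈ V₀) {U : Y.Opens} (hU : ∀ y, y ∈ U ↔ y ∉ Set.range i)
    (b t : Γ(Y, V₀)) (hb : pl i V₀ ⊤ b = 1) (ht : pl i V₀ ⊤ t = 0)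
    (hdvd : ∀ y, pl i V₀ ⊤ y = 0 → ∃ z, b * y = t * z) (hreg : ∀ x, t * x = 0 → x = 0) :
    LocEq i U (Y.basicOpen b) (rsO V₀ (Y.basicOpen b) t) := by
  have hT : (⊤ : T.Opens) ≤ i ⁻¹ᵁ V₀ := fun x _ => hi x
  have hbV := Y.basicOpen_le b
  -- Divisibility over principal open sets; the quotients, being unique, can be glued.
  have hbas : ∀ (h : Γ(Y, V₀)) (x : Γ(Y, Y.basicOpen h)), Y.basicOpen h ≤ Y.basicOpen b →
      pl i (Y.basicOpen h) (i ⁻¹ᵁ (Y.basicOpen h)) x = 0 →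
      ∃ z, x = rsO V₀ (Y.basicOpen h) t * z := by
    intro h x hhb hx
    have hhV := Y.basicOpen_le h
    obtain ⟨u, hu⟩ := exists_inv_basicOpen hV h le_rfl
    obtain ⟨v, hv⟩ := exists_inv_basicOpen hV b hhb
    -- Either a power of `h` vanishes along `T`, or `T` is mapped into `D(h)`.
    obtain hbot | htop := eq_bot_or_eq_top (i ⁻¹ᵁ (Y.basicOpen h))
    · have h1 : T.basicOpen (pl i V₀ ⊤ h) = ⊥ := by
        rw [basicOpen_pl i hT, hbot, bot_inf_eq]
      obtain ⟨m, hm⟩ := (T.isNilpotent_iff_basicOpen_eq_bot _).2 h1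
      obtain ⟨z, hz⟩ := hdvd (h ^ m) (by
        have := map_pow (plHom i hT) h m
        exact this.trans hm)
      have h2 := congrArg (rsO V₀ (Y.basicOpen h)) hz
      rw [rsO_mul hhV, rsO_mul hhV, rsO_pow hhV] at h2
      refine ⟨rsO V₀ (Y.basicOpen h) z * v * u ^ m * x, ?_⟩
      calc x = (rsO V₀ _ b * v) * (rsO V₀ (Y.basicOpen h) h * u) ^ m * x := by rw [hu, hv]; simp
        _ = (rsO V₀ _ b * rsO V₀ (Y.basicOpen h) h ^ m) * v * u ^ m * x := by ring
        _ = _ := by rw [h2]; ring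
    · obtain ⟨n, β, hβ⟩ := exists_pow_mul_eq hV h x
      have hT' : (⊤ : T.Opens) ≤ i ⁻¹ᵁ (Y.basicOpen h) := htop.ge
      obtain ⟨z, hz⟩ := hdvd β (by
        rw [← pl_rsO i hhV hT', ← hβ, pl_mul i hT', ← rsO_pl i le_rfl hT' x, hx, map_zero, mul_zero])
      have h2 := congrArg (rsO V₀ (Y.basicOpen h)) hz
      rw [rsO_mul hhV, rsO_mul hhV, ← hβ] at h2
      refine ⟨rsO V₀ (Y.basicOpen h) z * v * u ^ n, ?_⟩
      calc x = (rsO V₀ _ b * v) * (rsO V₀ (Y.basicOpen h) h * u) ^ n * x := by rw [hu, hv]; simp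
        _ = (rsO V₀ _ b * (rsO V₀ (Y.basicOpen h) h ^ n * x)) * v * u ^ n := by ring
        _ = _ := by rw [h2]; ring
  refine ⟨hU, fun x => ?_, ?_, fun W hW x hx => ?_, fun W hW x hx => ?_⟩
  · have h1 : x ∈ T.basicOpen (pl i V₀ ⊤ b) := by
      rw [hb, Scheme.basicOpen_of_isUnit _ isUnit_one]
      exact Set.mem_univ _
    rw [basicOpen_pl i hT] at h1
    exact h1.1
  · rw [pl_rsO i hbV le_rfl, ← rsO_pl i hT le_top, ht, map_zero]
  · have hWV := hW.trans hbV
    choose! h hh1 hh2 using fun (y : Y) (hy : y ∈ W) =>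
      hV.exists_basicOpen_le (V := W) ⟨y, hy⟩ (hWV hy)
    have hz : ∀ y : W, ∃ z, rsO W (Y.basicOpen (h y)) x = rsO V₀ (Y.basicOpen (h y)) t * z := by
      intro y
      refine hbas _ _ ((hh1 y y.2).trans hW) ?_
      rw [pl_rsO i (hh1 y y.2) le_rfl, ← rsO_pl i le_rfl (i.preimage_mono (hh1 y y.2)), hx, map_zero]
    choose z hz using hz
    have hle := fun y : W => hh1 y y.2
    obtain ⟨w, hw, -⟩ := existsUnique_glue (unitMod Y) (fun y : W => Y.basicOpen (h y)) (W := W)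
      hle (fun y hy => TopologicalSpace.Opens.mem_iSup.2 ⟨⟨y, hy⟩, hh2 y hy⟩)
      (fun y => (unitSec Y _).symm (z y)) fun y y' => by
        apply (unitSec Y _).injective
        rw [unitSec_rs inf_le_left, unitSec_rs inf_le_right, AddEquiv.apply_symm_apply,
          AddEquiv.apply_symm_apply]
        set A := Y.basicOpen (h y) ⊓ Y.basicOpen (h y')
        have hA : A ≤ V₀ := inf_le_left.trans (Y.basicOpen_le _)
        rw [← sub_eq_zero]
        refine rsO_mul_injective hV hreg hA _ ?_
        have h1 := congrArg (rsO _ A) (hz y)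
        have h2 := congrArg (rsO _ A) (hz y')
        rw [rsO_rsO (hle y) inf_le_left, rsO_mul inf_le_left,
          rsO_rsO (Y.basicOpen_le _) inf_le_left] at h1
        rw [rsO_rsO (hle y') inf_le_right, rsO_mul inf_le_right,
          rsO_rsO (Y.basicOpen_le _) inf_le_right] at h2
        rw [mul_sub, ← h1, ← h2, sub_self]
    refine ⟨unitSec Y W w, ?_⟩
    rw [rsO_rsO hbV hW]
    apply (unitSec Y W).symm.injective
    refine eq_of_rs_eq_of_mem (unitMod Y) fun y hy => ⟨_, hh2 y hy, hh1 y hy, ?_⟩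
    apply (unitSec Y _).injective
    have h1 := congrArg (unitSec Y _) (hw ⟨y, hy⟩)
    rw [unitSec_rs (hh1 y hy), AddEquiv.apply_symm_apply] at h1
    rw [unitSec_rs (hh1 y hy), unitSec_rs (hh1 y hy), AddEquiv.apply_symm_apply,
      AddEquiv.apply_symm_apply, rsO_mul (hh1 y hy), rsO_rsO hWV (hh1 y hy), h1]
    exact hz ⟨y, hy⟩
  · have hWV := hW.trans hbV
    apply (unitSec Y W).symm.injective
    refine eq_of_rs_eq_of_mem (unitMod Y) fun y hy => ?_
    obtain ⟨h, hW', hy'⟩ := hV.exists_basicOpen_le (V := W) ⟨y, hy⟩ (hWV hy)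
    refine ⟨Y.basicOpen h, hy', hW', ?_⟩
    rw [map_zero, map_zero]
    apply (unitSec Y _).injective
    rw [unitSec_rs hW', AddEquiv.apply_symm_apply, map_zero]
    obtain ⟨n, β, hβ⟩ := exists_pow_mul_eq hV h (rsO W _ x)
    have hhV := Y.basicOpen_le h
    -- the equation is invertible on the complement of the section
    have htU : ∀ y, y ∈ Y.basicOpen t → y ∈ U := by
      intro y hy
      rw [hU]
      rintro ⟨x, rfl⟩
      have h1 : x ∈ T.basicOpen (pl i V₀ ⊤ t) := by
        rw [basicOpen_pl i hT]
        exact ⟨hy, Set.mem_univ _⟩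
      rw [ht, Scheme.basicOpen_zero] at h1
      exact h1
    have hht : Y.basicOpen (h * t) ≤ W ⊓ U := by
      rw [Scheme.basicOpen_mul]
      exact fun y hy => ⟨hW' hy.1, htU y hy.2⟩
    have hht' : Y.basicOpen (h * t) ≤ Y.basicOpen h := by
      rw [Scheme.basicOpen_mul]
      exact inf_le_left
    have h1 : rsO V₀ (Y.basicOpen (h * t)) β = 0 := by
      rw [← rsO_rsO hhV hht', ← hβ, rsO_mul hht', rsO_rsO hW' hht', ← rsO_rsO inf_le_left hht, hx,
        map_zero, mul_zero]
    obtain ⟨m, hm⟩ := exists_pow_mul_eq_zero hV _ _ h1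
    have h2 : ∀ m : ℕ, ∀ z, t ^ m * z = 0 → z = 0 := by
      intro m
      induction m with
      | zero => intro z hz; rwa [pow_zero, one_mul] at hz
      | succ m ih => intro z hz; exact hreg z (ih _ (by rw [← hz]; ring))
    have h3 := h2 m (h ^ m * β) (by rw [← hm]; ring)
    have h4 := congrArg (rsO V₀ (Y.basicOpen h)) h3
    rw [rsO_mul hhV, rsO_pow hhV, map_zero, ← hβ] at h4
    obtain ⟨u, hu⟩ := exists_inv_basicOpen hV h le_rfl
    calc rsO W _ x = (rsO V₀ (Y.basicOpen h) h * u) ^ m * (rsO V₀ (Y.basicOpen h) h * u) ^ n *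
          rsO W _ x := by rw [hu]; simp
      _ = u ^ m * u ^ n * (rsO V₀ (Y.basicOpen h) h ^ m * (rsO V₀ (Y.basicOpen h) h ^ n *
          rsO W _ x)) := by ring
      _ = 0 := by rw [h4, mul_zero]

end AffineChart

/-! ### The graph of a point of a smooth curve -/

section Graph

open scoped TensorProduct

theorem pl_eq_appLE {Y Z : Scheme.{u}} (f : Z ⟶ Y) {U : Y.Opens} {W : Z.Opens} (h : W ≤ f ⁻¹ᵁ U)
    (x : Γ(Y, U)) : pl f U W x = (f.appLE U W h).hom x := by
  rw [pl_of_le f h]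
  rfl

theorem appLE_appLE_apply {Y Z T : Scheme.{u}} {f : Z ⟶ Y} {g : T ⟶ Z} {k : T ⟶ Y} (hk : g ≫ f = k)
    {U : Y.Opens} {V : Z.Opens} {W : T.Opens} (h : V ≤ f ⁻¹ᵁ U) (h' : W ≤ g ⁻¹ᵁ V)
    (h'' : W ≤ k ⁻¹ᵁ U) (c : Γ(Y, U)) :
    (g.appLE V W h').hom ((f.appLE U V h).hom c) = (k.appLE U W h'').hom c := by
  subst hk
  rw [← pl_eq_appLE f h, ← pl_eq_appLE g h', ← pl_eq_appLE (g ≫ f) h'']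
  exact pl_pl f g h h' c

variable {Fq : Type u} [Field Fq] {X : Over (Spec (of Fq))}

/-- The sections of a product of affine schemes. -/
theorem exists_chart (S : Over (Spec (of Fq))) [IsAffine S.left]
    {O : (Spec (of Fq)).Opens} (hO : IsAffineOpen O) {W : X.left.Opens}
    (hW : IsAffineOpen W) (eW : W ≤ X.hom ⁻¹ᵁ O) (eS : ⊤ ≤ S.hom ⁻¹ᵁ O)
    [Algebra Γ(Spec (of Fq), O) Γ(X.left, W)]
    [Algebra Γ(Spec (of Fq), O) Γ(S.left, ⊤)]
    (hR : algebraMap Γ(Spec (of Fq), O) Γ(X.left, W) = (X.hom.appLE O W eW).hom)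
    (hA : algebraMap Γ(Spec (of Fq), O) Γ(S.left, ⊤) = (S.hom.appLE O ⊤ eS).hom) :
    ∃ θ : Γ(X.left, W) ⊗[Γ(Spec (of Fq), O)] Γ(S.left, ⊤) ≃+*
        Γ(prodS X S, pullback.fst X.hom S.hom ⁻¹ᵁ W),
      ∀ r a, θ (r ⊗ₜ a) = pl (pullback.fst X.hom S.hom) W _ r *
        pl (pullback.snd X.hom S.hom) ⊤ _ a := by
  have hUY : pullback.fst X.hom S.hom ⁻¹ᵁ W =
      pullback.fst X.hom S.hom ⁻¹ᵁ W ⊓ pullback.snd X.hom S.hom ⁻¹ᵁ ⊤ := by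
    exact (inf_top_eq _).symm
  have H : IsPullback (pullback.fst X.hom S.hom) (pullback.snd X.hom S.hom) X.hom S.hom :=
    IsPullback.of_hasPullback _ _
  have h1 := (isIso_pushoutSection_iff H eS eW hUY).1
    (isIso_pushoutSection_of_isAffineOpen H eS eW hUY hO (isAffineOpen_top _) hW)
  have h2 := CommRingCat.isPushout_tensorProduct Γ(Spec (of Fq), O) Γ(X.left, W)
    Γ(S.left, ⊤)
  rw [hR, hA] at h2
  change IsPushout (X.hom.appLE O W eW) (S.hom.appLE O ⊤ eS) _ _ at h2
  let e := h2.isoIsPushout _ _ h1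
  refine ⟨e.commRingCatIsoToRingEquiv, fun r a => ?_⟩
  have h3 : (r ⊗ₜ a : Γ(X.left, W) ⊗[Γ(Spec (of Fq), O)] Γ(S.left, ⊤)) =
      (r ⊗ₜ 1) * (1 ⊗ₜ a) := by
    rw [Algebra.TensorProduct.tmul_mul_tmul, mul_one, one_mul]
  rw [h3, map_mul]
  congr 1
  · rw [pl_eq_appLE _ le_rfl]
    exact congrArg (fun m => CommRingCat.Hom.hom m r) (h2.inl_isoIsPushout_hom _ _ h1)
  · rw [pl_eq_appLE _ (by exact le_top)]
    exact congrArg (fun m => CommRingCat.Hom.hom m a) (h2.inr_isoIsPushout_hom _ _ h1)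

theorem isAffineOpen_fst_preimage (S : Over (Spec (of Fq))) [IsAffine S.left]
    {O : (Spec (of Fq)).Opens} (hO : IsAffineOpen O) {W : X.left.Opens}
    (hW : IsAffineOpen W) (eW : W ≤ X.hom ⁻¹ᵁ O) (eS : ⊤ ≤ S.hom ⁻¹ᵁ O) :
    IsAffineOpen (pullback.fst X.hom S.hom ⁻¹ᵁ W) := by
  have H : IsPullback (pullback.fst X.hom S.hom) (pullback.snd X.hom S.hom) X.hom S.hom :=
    IsPullback.of_hasPullback _ _
  have hUY : pullback.fst X.hom S.hom ⁻¹ᵁ W =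
      pullback.fst X.hom S.hom ⁻¹ᵁ W ⊓ pullback.snd X.hom S.hom ⁻¹ᵁ ⊤ := by
    exact (inf_top_eq _).symm
  have : IsAffine _ := hO
  have : IsAffine _ := hW
  have : IsAffine (⊤ : S.left.Opens) := isAffineOpen_top _
  exact .of_isIso (Scheme.Hom.isPullback_resLE H eS eW hUY).isoPullback.hom

set_option maxHeartbeats 1000000 in
/-- Near the graph of a point of a smooth curve there is a local equation, the base changes of
which are also local equations. -/
theorem exists_locEq (hX : SmoothOfRelativeDimension 1 X.hom)
    {S : Over (Spec (of Fq))} [Subsingleton S.left] [Nonempty S.left] [IsAffine S.left]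
    [IsNoetherianRing Γ(S.left, ⊤)] (a : S ⟶ X) :
    ∃ (V : (prodS X S).Opens) (t : Γ(prodS X S, V)),
      ∀ (S' : Over (Spec (of Fq))) [Subsingleton S'.left] [Nonempty S'.left]
        [IsAffine S'.left] (s : S' ⟶ S) (U : (prodS X S').Opens),
        (∀ y, y ∈ U ↔ y ∉ Set.range (graph (s ≫ a))) →
        LocEq (graph (s ≫ a)) U (prodMap X s ⁻¹ᵁ V) (pl (prodMap X s) V _ t) := by
  obtain ⟨O, hO, W, hW, haW, eW, hstd⟩ :=
    hX.exists_isStandardSmoothOfRelativeDimension (a.left (Classical.arbitrary S.left))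
  have hsub : Subsingleton (Spec (of Fq)) :=
    inferInstanceAs (Subsingleton (PrimeSpectrum Fq))
  have hOtop : O = ⊤ := by
    obtain h | h := eq_bot_or_eq_top O
    · have := eW haW
      rw [h] at this
      exact this.elim
    · exact h
  have eS : ∀ S' : Over (Spec (of Fq)), ⊤ ≤ S'.hom ⁻¹ᵁ O := fun S' => by
    rw [hOtop]
    exact le_top
  have hON : IsNoetherianRing Γ(Spec (of Fq), O) := by
    rw [hOtop]
    exact isNoetherianRing_of_ringEquiv Fq
      (Scheme.ΓSpecIso (.of Fq)).symm.commRingCatIsoToRingEquiv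
  let _ := (X.hom.appLE O W eW).hom.toAlgebra
  let _ (S' : Over (Spec (of Fq))) := (S'.hom.appLE O ⊤ (eS S')).hom.toAlgebra
  obtain ⟨g, hgC, hg⟩ := hstd.exists_etale_mvPolynomial
  let _ := g.toAlgebra
  have hsm : Algebra.Etale (MvPolynomial (Fin 1) Γ(Spec (of Fq), O)) Γ(X.left, W) := hg
  have htower : IsScalarTower Γ(Spec (of Fq), O)
      (MvPolynomial (Fin 1) Γ(Spec (of Fq), O)) Γ(X.left, W) :=
    IsScalarTower.of_algebraMap_eq' hgC.symm
  -- The point of `S` is mapped into the chart `W`.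
  have haW' : ∀ (S' : Over (Spec (of Fq))) (s : S' ⟶ S),
      ⊤ ≤ (s ≫ a).left ⁻¹ᵁ W := by
    intro S' s x _
    change (s.left ≫ a.left) x ∈ W
    rw [Scheme.Hom.comp_apply, Subsingleton.elim (s.left x) (Classical.arbitrary S.left)]
    exact haW
  have hcomm : ∀ {S' S'' : Over (Spec (of Fq))} (s : S' ⟶ S'') (c),
      (s.left.appLE ⊤ ⊤ le_top).hom (algebraMap Γ(Spec (of Fq), O) Γ(S''.left, ⊤) c) =
        algebraMap Γ(Spec (of Fq), O) Γ(S'.left, ⊤) c := by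
    intro S' S'' s c
    exact appLE_appLE_apply (Over.w s) (eS S'') le_top (eS S') c
  let φ (S' : Over (Spec (of Fq))) (s : S' ⟶ S) :
      Γ(S.left, ⊤) →ₐ[Γ(Spec (of Fq), O)] Γ(S'.left, ⊤) :=
    { (s.left.appLE ⊤ ⊤ le_top).hom with commutes' := hcomm s }
  let ψ : Γ(X.left, W) →ₐ[Γ(Spec (of Fq), O)] Γ(S.left, ⊤) :=
    { (a.left.appLE W ⊤ (haW' S (𝟙 S))).hom with
      commutes' := fun c =>
        appLE_appLE_apply (Over.w a) eW (haW' S (𝟙 S)) (eS S) c }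
  -- The functions over `W × S'` form a tensor product.
  choose θ hθ using fun (S' : Over (Spec (of Fq))) (_ : IsAffine S'.left) =>
    exists_chart (X := X) S' hO hW eW (eS S') rfl rfl
  have hnoeth : IsNoetherianRing (Γ(X.left, W) ⊗[Γ(Spec (of Fq), O)] Γ(S.left, ⊤)) := by
    have h1 : Algebra.FiniteType (MvPolynomial (Fin 1) Γ(Spec (of Fq), O))
      Γ(X.left, W) := inferInstance
    have h2 : Algebra.FiniteType Γ(Spec (of Fq), O) Γ(X.left, W) :=
      Algebra.FiniteType.trans (S := MvPolynomial (Fin 1) Γ(Spec (of Fq), O))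
        inferInstance h1
    have h3 : Algebra.FiniteType Γ(S.left, ⊤)
        (Γ(S.left, ⊤) ⊗[Γ(Spec (of Fq), O)] Γ(X.left, W)) := inferInstance
    have h4 := Algebra.FiniteType.isNoetherianRing Γ(S.left, ⊤)
        (Γ(S.left, ⊤) ⊗[Γ(Spec (of Fq), O)] Γ(X.left, W))
    exact isNoetherianRing_of_ringEquiv _ (Algebra.TensorProduct.comm _ _ _).toRingEquiv
  obtain ⟨b, hb, hbJ⟩ := exists_mul_mem_span ψ
  -- The local equation is `x ⊗ 1 - 1 ⊗ ψ x` for an étale coordinate `x` of `W`.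
  let t : Γ(X.left, W) ⊗[Γ(Spec (of Fq), O)] Γ(S.left, ⊤) :=
    (coordX (k := Γ(Spec (of Fq), O)) : Γ(X.left, W)) ⊗ₜ 1 -
      1 ⊗ₜ ψ (coordX (k := Γ(Spec (of Fq), O)))
  have hle := (prodS X S).basicOpen_le (θ S ‹_› b)
  refine ⟨(prodS X S).basicOpen (θ S ‹_› b), rsO _ _ (θ S ‹_› t), fun S' _ _ _ s U hU => ?_⟩
  let F := Algebra.TensorProduct.map (AlgHom.id Γ(Spec (of Fq), O) Γ(X.left, W)) (φ S' s)
  have hpre : pullback.fst X.hom S'.hom ⁻¹ᵁ W =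
      prodMap X s ⁻¹ᵁ pullback.fst X.hom S.hom ⁻¹ᵁ W := by
    rw [← Scheme.Hom.comp_preimage, prodMap_fst]
  have hpl : ∀ y, pl (prodMap X s) (pullback.fst X.hom S.hom ⁻¹ᵁ W)
      (pullback.fst X.hom S'.hom ⁻¹ᵁ W) (θ S ‹_› y) = θ S' ‹_› (F y) := by
    intro y
    induction y with
    | zero => simp only [map_zero]
    | add x y hx hy => simp only [map_add, hx, hy]
    | tmul r c =>
      rw [hθ, pl_mul _ hpre.le, pl_pl _ _ le_rfl hpre.le, pl_pl _ _ le_top hpre.le, prodMap_fst,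
        prodMap_snd]
      have h1 : F (r ⊗ₜ c) = r ⊗ₜ φ S' s c := Algebra.TensorProduct.map_tmul _ _ _ _
      have h2 := pl_pl s.left (pullback.snd X.hom S'.hom) (U := ⊤) (W := ⊤)
        (O := pullback.fst X.hom S'.hom ⁻¹ᵁ W) le_top le_top c
      rw [h1, hθ, ← h2, pl_eq_appLE s.left le_top]
      rfl
  have hgW : (⊤ : S'.left.Opens) ≤ graph (s ≫ a) ⁻¹ᵁ pullback.fst X.hom S'.hom ⁻¹ᵁ W := by
    rw [← Scheme.Hom.comp_preimage, graph_fst]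
    exact haW' S' s
  have hsect : ∀ y, pl (graph (s ≫ a)) (pullback.fst X.hom S'.hom ⁻¹ᵁ W) ⊤ (θ S' ‹_› y) =
      sect ((φ S' s).comp ψ) y := by
    intro y
    induction y with
    | zero => simp only [map_zero]
    | add x y hx hy => simp only [map_add, hx, hy]
    | tmul r c =>
      rw [hθ, pl_mul _ hgW, pl_pl _ _ le_rfl hgW, pl_pl _ _ le_top hgW, graph_fst, graph_snd,
        sect_tmul]
      congr 1
      · rw [Over.comp_left, ← pl_pl a.left s.left (haW' S (𝟙 S)) le_top, pl_eq_appLE s.left le_top,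
          pl_eq_appLE a.left (haW' S (𝟙 S))]
        rfl
      · exact rsO_self ⊤ c
  have hVaff := isAffineOpen_fst_preimage (X := X) S' hO hW eW (eS S')
  have hsF : ∀ y, sect ((φ S' s).comp ψ) (F y) = φ S' s (sect ψ y) := by
    intro y
    induction y with
    | zero => simp only [map_zero]
    | add x y hx hy => simp only [map_add, hx, hy]
    | tmul r c =>
      have h1 : F (r ⊗ₜ c) = r ⊗ₜ φ S' s c := Algebra.TensorProduct.map_tmul _ _ _ _
      rw [h1, sect_tmul, sect_tmul, map_mul]
      rfl
  have hF : F t = (coordX (k := Γ(Spec (of Fq), O)) : Γ(X.left, W)) ⊗ₜ 1 -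
      1 ⊗ₜ φ S' s (ψ (coordX (k := Γ(Spec (of Fq), O)))) := by
    simp [F, t]
  have key := locEq_of_affine hVaff (i := graph (s ≫ a)) (fun x => hgW (Set.mem_univ x)) hU
    (θ S' ‹_› (F b)) (θ S' ‹_› (F t)) (by rw [hsect, hsF, hb, map_one])
    (by
      rw [hsect, hsF]
      have : sect ψ t = 0 := by
        simp only [t]
        rw [map_sub, sect_tmul, sect_tmul, map_one, one_mul, mul_one, sub_self]
      rw [this, map_zero])
    (by
      intro y hy
      obtain ⟨y, rfl⟩ := (θ S' ‹_›).surjective y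
      rw [hsect] at hy
      obtain ⟨z, hz⟩ := exists_mul_eq_of_sect_eq_zero (φ S' s) ψ hbJ y hy
      exact ⟨θ S' ‹_› z, by rw [← map_mul, ← map_mul, hz]⟩)
    (by
      intro x hx
      obtain ⟨x, rfl⟩ := (θ S' ‹_›).surjective x
      rw [← map_mul, EmbeddingLike.map_eq_zero_iff, hF] at hx
      rw [mul_left_injective_coordX _ _ x 0 (hx.trans (mul_zero _).symm), map_zero])
  have hV : prodMap X s ⁻¹ᵁ (prodS X S).basicOpen (θ S ‹_› b) =
      (prodS X S').basicOpen (θ S' ‹_› (F b)) := by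
    rw [← hpl, basicOpen_pl _ hpre.le, hpre]
    exact (inf_eq_left.2 ((prodMap X s).preimage_mono hle)).symm
  refine key.of_eq hV _ ?_
  rw [rsO_rsO ((prodS X S').basicOpen_le _) hV.le, ← hpl, pl_rsO _ hle le_rfl, rsO_pl _ hpre.le]
  rw [hpre]
  exact (prodMap X s).preimage_mono hle

/-- The graph of a morphism to a projective scheme is closed. -/
theorem exists_graph_compl (hX : IsProjective X.hom) {S : Over (Spec (of Fq))}
    (a : S ⟶ X) : ∃ U : (prodS X S).Opens, ∀ y, y ∈ U ↔ y ∉ Set.range (graph a) := by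
  obtain ⟨n, i, hi, hX⟩ := hX
  have h1 : IsSeparated (projSpaceHom Fq (ULift.{u} (Fin (n + 1)) → Fq)) := by
    unfold projSpaceHom
    have : IsSeparated (Proj.toSpecZero (symDeg Fq (ULift.{u} (Fin (n + 1)) → Fq))) :=
      Proj.isSeparated _
    have h0 : IsSeparated (Spec.map (ofHom (algebraMap Fq
        (symDeg Fq (ULift.{u} (Fin (n + 1)) → Fq) 0)))) := inferInstance
    exact MorphismProperty.comp_mem @IsSeparated _ _ this h0
  have h2 : IsSeparated X.hom := by
    rw [← hX]
    infer_instance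
  have h3 : IsClosedImmersion (graph a ≫ pullback.snd X.hom S.hom) := by
    rw [graph_snd]
    infer_instance
  have h4 : IsClosedImmersion (graph a) :=
    MorphismProperty.of_postcomp (W := @IsClosedImmersion) (W' := @IsSeparated) _
      (pullback.snd X.hom S.hom) inferInstance h3
  exact ⟨⟨(Set.range (graph a))ᶜ, (graph a).isClosedEmbedding.isClosed_range.isOpen_compl⟩,
    fun y => Iff.rfl⟩

end Graph

/-! ### Elementary modifications along the graphs of points -/

section GraphModification

/-- A scheme over `Fq` that is the spectrum of a local Artinian ring. -/
class IsArtinPoint {Fq : Type u} [Field Fq] (S : Over (Spec (of Fq))) : Prop where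
  subsingleton : Subsingleton S.left
  nonempty : Nonempty S.left
  isAffine : IsAffine S.left
  isLocalRing : IsLocalRing Γ(S.left, ⊤)
  isArtinianRing : IsArtinianRing Γ(S.left, ⊤)

attribute [instance] IsArtinPoint.subsingleton IsArtinPoint.nonempty IsArtinPoint.isAffine
  IsArtinPoint.isLocalRing IsArtinPoint.isArtinianRing

theorem isArtinPoint_mk {Fq : Type u} [Field Fq] (A : Type u) [CommRing A] [IsLocalRing A]
    [IsArtinianRing A] (h : Spec (.of A) ⟶ Spec (of Fq)) :
    IsArtinPoint (Over.mk h) where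
  subsingleton := by
    have : Subsingleton (PrimeSpectrum A) := by
      refine ⟨fun x y => PrimeSpectrum.ext ?_⟩
      exact (IsLocalRing.eq_maximalIdeal ((IsArtinianRing.isPrime_iff_isMaximal _).1 x.isPrime)).trans
        (IsLocalRing.eq_maximalIdeal ((IsArtinianRing.isPrime_iff_isMaximal _).1 y.isPrime)).symm
    exact this
  nonempty := inferInstanceAs (Nonempty (PrimeSpectrum A))
  isAffine := inferInstanceAs (IsAffine (Spec (.of A)))
  isLocalRing :=
    (Scheme.ΓSpecIso (.of A)).commRingCatIsoToRingEquiv.symm.isLocalRing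
  isArtinianRing :=
    (Scheme.ΓSpecIso (.of A)).commRingCatIsoToRingEquiv.symm.surjective.isArtinianRing

variable {Fq : Type u} [Field Fq] {X : Over (Spec (of Fq))}

instance (E : Type u) [Field E] [Algebra Fq E] : IsArtinPoint (specE E Fq) :=
  isArtinPoint_mk E _

instance {E : Type u} [Field E] [Algebra Fq E] (A : ArtAlg E) : IsArtinPoint (specA Fq A) :=
  isArtinPoint_mk A.carrier _

theorem isPullback_prodMap {S T : Over (Spec (of Fq))} (s : T ⟶ S) :
    IsPullback (prodMap X s) (pullback.snd X.hom T.hom) (pullback.snd X.hom S.hom) s.left := by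
  refine IsPullback.of_right (h₁₂ := pullback.fst X.hom S.hom) (v₁₃ := X.hom) (h₂₂ := S.hom) ?_
    (prodMap_snd X s) (IsPullback.of_hasPullback _ _)
  rw [prodMap_fst, Over.w]
  exact IsPullback.of_hasPullback _ _

theorem isPullback_graph {S T : Over (Spec (of Fq))} (s : T ⟶ S) (a : S ⟶ X) :
    IsPullback s.left (graph (s ≫ a)) (graph a) (prodMap X s) := by
  refine IsPullback.of_bot (v₂₁ := pullback.snd X.hom T.hom) (v₂₂ := pullback.snd X.hom S.hom)
    (h₃₁ := s.left) ?_ (graph_prodMap s a).symm (isPullback_prodMap s)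
  rw [graph_snd, graph_snd]
  exact IsPullback.of_vert_isIso ⟨by simp⟩

theorem prodMap_mem_range_graph {S T : Over (Spec (of Fq))} (s : T ⟶ S) (a : S ⟶ X)
    (y : prodS X T) : prodMap X s y ∈ Set.range (graph a) ↔ y ∈ Set.range (graph (s ≫ a)) := by
  constructor
  · rintro ⟨x, hx⟩
    obtain ⟨z, -, hz⟩ := Scheme.exists_preimage_of_isPullback (isPullback_graph s a) x y hx
    exact ⟨z, hz⟩
  · rintro ⟨z, rfl⟩
    rw [← Scheme.Hom.comp_apply, graph_prodMap, Scheme.Hom.comp_apply]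
    exact ⟨_, rfl⟩

/-- A local equation of the graph of `a : S ⟶ X` near this graph, the base changes of which are
local equations of the graphs of the base changes of `a`. -/
structure GraphEq {S : Over (Spec (of Fq))} (a : S ⟶ X) where
  U : (prodS X S).Opens
  V : (prodS X S).Opens
  t : Γ(prodS X S, V)
  mem_U : ∀ y, y ∈ U ↔ y ∉ Set.range (graph a)
  locEq : ∀ (T : Over (Spec (of Fq))) [IsArtinPoint T] (s : T ⟶ S),
    LocEq (graph (s ≫ a)) (prodMap X s ⁻¹ᵁ U) (prodMap X s ⁻¹ᵁ V)
      (pl (prodMap X s) V (prodMap X s ⁻¹ᵁ V) t)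

theorem nonempty_graphEq (hX : SmoothOfRelativeDimension 1 X.hom) (hX' : IsProjective X.hom)
    {S : Over (Spec (of Fq))} [IsArtinPoint S] (a : S ⟶ X) :
    Nonempty (GraphEq a) := by
  obtain ⟨U, hU⟩ := exists_graph_compl hX' a
  obtain ⟨V, t, h⟩ := exists_locEq hX a
  refine ⟨⟨U, V, t, hU, fun T _ s => h T s _ fun y => ?_⟩⟩
  exact (hU (prodMap X s y)).trans (not_congr (prodMap_mem_range_graph s a y))

variable {S T R : Over (Spec (of Fq))} {a : S ⟶ X}

/-- The morphism `f` of sheaves on `X × T` is an elementary modification along the graph of the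
base change of `a` along `s : T ⟶ S`. -/
def IsElemAlong (q : GraphEq a) (d : ℕ) (s : T ⟶ S) {M N : (prodS X T).Modules} (f : M ⟶ N) :
    Prop :=
  IsElem (graph (s ≫ a)) (prodMap X s ⁻¹ᵁ q.U) (pl (prodMap X s) q.V (prodMap X s ⁻¹ᵁ q.V) q.t) d f

theorem IsElemAlong.baseChange {q : GraphEq a} {d : ℕ} {s : T ⟶ S} {s' : R ⟶ S}
    {M N : (prodS X T).Modules} {f : M ⟶ N} (hf : IsElemAlong q d s f)
    (hM : IsLocallyFreeOfRank M d) (r : R ⟶ T) (hr : r ≫ s = s') {M' N' : (prodS X R).Modules}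
    {f' : M' ⟶ N'} {ρ : (⟨prodS X T, M⟩ : QMod) ⟶ ⟨prodS X R, M'⟩}
    {ρ' : (⟨prodS X T, N⟩ : QMod) ⟶ ⟨prodS X R, N'⟩} (hρ : IsCart ρ) (hρ' : IsCart ρ')
    (hb : bs ρ = prodMap X r) (hb' : bs ρ' = prodMap X r) (h : vert f ≫ ρ' = ρ ≫ vert f') :
    IsElemAlong q d s' f' := by
  subst hr
  have h1 := IsElem.baseChange (graph_prodMap r (s ≫ a)) hf hM hρ hρ' hb hb' h
  have h2 := pl_pl (prodMap X s) (prodMap X r) (U := q.V) (W := prodMap X s ⁻¹ᵁ q.V)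
    (O := prodMap X r ⁻¹ᵁ prodMap X s ⁻¹ᵁ q.V) le_rfl le_rfl q.t
  unfold IsElemAlong
  rw [prodMap_comp, assoc]
  rw [h2] at h1
  exact h1

theorem isElemAlong_comp_iso {q : GraphEq a} {d : ℕ} {s : T ⟶ S} {M N P : (prodS X T).Modules}
    (j : P ⟶ M) [IsIso j] {f : M ⟶ N} (hf : IsElemAlong q d s f)
    (hM : IsLocallyFreeOfRank M d) : IsElemAlong q d s (j ≫ f) := by
  refine hf.baseChange hM (𝟙 T) (id_comp s) (ρ := vert (inv j)) (ρ' := 𝟙 _)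
    (isCart_vert_of_isIso _) (isCart_of_isIso _) (prodMap_id X T).symm (prodMap_id X T).symm ?_
  rw [← vert_comp, IsIso.inv_hom_id_assoc, comp_id]

theorem isLocallyFreeOfRank_unitMod [Subsingleton T.left] :
    IsLocallyFreeOfRank (unitMod T.left) 1 :=
  (isLocallyFreeOfRank_iff _ _).2 fun _ => ⟨⊤, _, trivial, isFrame_unit T.left⟩

theorem isElemAlong_iff [IsArtinPoint T] (q : GraphEq a) {d : ℕ} (s : T ⟶ S)
    {M N : (prodS X T).Modules} (f : M ⟶ N) (hN : IsLocallyFreeOfRank N d) :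
    IsElemAlong q d s f ↔ Mono f ∧ IsInvertibleOnGraph (s ≫ a) (cokernel f) := by
  constructor
  · intro h
    obtain ⟨O, j₀, e, b, hf⟩ := h.frame
    obtain ⟨ε, -⟩ := hf.exists_quotient (graph_snd _) (q.locEq T s) h
    exact ⟨h.mono (q.locEq T s), _, isLocallyFreeOfRank_unitMod, ⟨ε⟩⟩
  · rintro ⟨h1, L, hL, ⟨ε⟩⟩
    exact isElem_of_cokernel (graph_snd _) (q.locEq T s) f hN hL ε

theorem isShtuka_iff [Fintype Fq] [IsArtinPoint T] {a b : S ⟶ X} (qa : GraphEq a) (qb : GraphEq b)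
    {d : ℕ} (s : T ⟶ S) (D : ShtukaDiagram X T) :
    IsShtuka D d (s ≫ a) (s ≫ b) ↔ IsLocallyFreeOfRank D.F d ∧ IsLocallyFreeOfRank D.F' d ∧
      IsElemAlong qa d s D.f ∧ IsElemAlong qb d s D.g := by
  constructor
  · intro h
    exact ⟨h.1, h.2, (isElemAlong_iff qa s _ h.2).2 ⟨h.3, h.5⟩,
      (isElemAlong_iff qb s _ h.2).2 ⟨h.4, h.6⟩⟩
  · rintro ⟨h1, h2, h3, h4⟩
    have h5 := (isElemAlong_iff qa s _ h2).1 h3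
    have h6 := (isElemAlong_iff qb s _ h2).1 h4
    exact ⟨h1, h2, h5.1, h6.1, h5.2, h6.2⟩

end GraphModification

/-! ### Morphisms of shtukas as cartesian arrows -/

section ShtHom

variable {Fq : Type u} [Field Fq] [Fintype Fq] {X S T R : Over (Spec (of Fq))}

/-- The Frobenius-semilinear arrow `F ⟶ F'` of the diagram `Φ^* F ⟶ F' ⟵ F`. -/
def fl (D : ShtukaDiagram X S) : (⟨prodS X S, D.F⟩ : QMod) ⟶ ⟨prodS X S, D.F'⟩ :=
  pbArr (Phi X S) D.F ≫ vert D.f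

@[simp] theorem bs_fl (D : ShtukaDiagram X S) : bs (fl D) = Phi X S :=
  id_comp _

/-- An isomorphism `t^* D ≅ D'`, given by cartesian arrows from the sheaves of `D` to those
of `D'`. -/
structure ShtHom (t : T ⟶ S) (D : ShtukaDiagram X S) (D' : ShtukaDiagram X T) where
  ρ : (⟨prodS X S, D.F⟩ : QMod) ⟶ ⟨prodS X T, D'.F⟩
  ρ' : (⟨prodS X S, D.F'⟩ : QMod) ⟶ ⟨prodS X T, D'.F'⟩
  bs_ρ : bs ρ = prodMap X t
  bs_ρ' : bs ρ' = prodMap X t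
  cart : IsCart ρ
  cart' : IsCart ρ'
  comm_f : fl D ≫ ρ' = ρ ≫ fl D'
  comm_g : vert D.g ≫ ρ' = ρ ≫ vert D'.g

theorem pbArr_square {Y Z W T : Scheme.{u}} {f : T ⟶ Z} {g : Z ⟶ Y} {h : T ⟶ W} {k : W ⟶ Y}
    (e : f ≫ g = h ≫ k) (M : Y.Modules) :
    pbArr g M ≫ pbArr f _ ≫ vert ((pullbackComp f g ≪≫
      pullbackCongr e ≪≫ (pullbackComp h k).symm).hom.app M) =
      pbArr k M ≫ pbArr h _ := by
  have h2 := pbArr_pullbackComp f g M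
  have h3 := pbArr_pullbackCongr e M
  have h4 := pbArr_pullbackComp_inv h k M
  rw [Iso.trans_hom, Iso.trans_hom, NatTrans.comp_app, NatTrans.comp_app, Iso.symm_hom, vert_comp,
    vert_comp, ← h4, ← h3, ← h2]
  simp only [assoc]

theorem pbArr_pullbackPhi (t : T ⟶ S) (M : (prodS X S).Modules) :
    pbArr (Phi X S) M ≫ pbArr (prodMap X t) _ ≫ vert ((pullbackPhi X t).hom.app M) =
      pbArr (prodMap X t) M ≫ pbArr (Phi X T) _ :=
  pbArr_square (prodMap_Phi X t) M

/-- The arrow that corresponds to a morphism from a pullback. -/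
def toArr {Y Z : Scheme.{u}} (f : Z ⟶ Y) {M : Y.Modules} {N : Z.Modules}
    (m : (Scheme.Modules.pullback f).obj M ⟶ N) : (⟨Y, M⟩ : QMod) ⟶ ⟨Z, N⟩ :=
  pbArr f M ≫ vert m

@[simp] theorem bs_toArr {Y Z : Scheme.{u}} (f : Z ⟶ Y) {M : Y.Modules} {N : Z.Modules}
    (m : (Scheme.Modules.pullback f).obj M ⟶ N) : bs (toArr f m) = f := id_comp _

theorem isCart_toArr {Y Z : Scheme.{u}} (f : Z ⟶ Y) {M : Y.Modules} {N : Z.Modules}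
    (m : (Scheme.Modules.pullback f).obj M ⟶ N) [IsIso m] : IsCart (toArr f m) :=
  (isCart_pbArr f M).comp (isCart_vert_of_isIso m)

theorem toArr_injective {Y Z : Scheme.{u}} {f : Z ⟶ Y} {M : Y.Modules} {N : Z.Modules}
    {m m' : (Scheme.Modules.pullback f).obj M ⟶ N} (h : toArr f m = toArr f m') : m = m' :=
  pbArr_hom_ext h

theorem exists_toArr {Y Z : Scheme.{u}} {f : Z ⟶ Y} {M : Y.Modules} {N : Z.Modules}
    (w : (⟨Y, M⟩ : QMod) ⟶ ⟨Z, N⟩) (hw : bs w = f) :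
    ∃ m : (Scheme.Modules.pullback f).obj M ⟶ N, toArr f m = w :=
  exists_pbArr_comp (i := f) w hw

theorem exists_toArr_iso {Y Z : Scheme.{u}} {f : Z ⟶ Y} {M : Y.Modules} {N : Z.Modules}
    (w : (⟨Y, M⟩ : QMod) ⟶ ⟨Z, N⟩) (hw : bs w = f) (hc : IsCart w) :
    ∃ m : (Scheme.Modules.pullback f).obj M ≅ N, toArr f m.hom = w := by
  obtain ⟨m, hm⟩ := exists_toArr w hw
  have : IsIso m := by
    refine isIso_of_isCart_vert ((isCart_pbArr f M).of_comp ?_)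
    have h : pbArr f M ≫ vert m = w := hm
    rw [h]
    exact hc
  exact ⟨asIso m, hm⟩

theorem vert_comp_toArr {Y Z : Scheme.{u}} (f : Z ⟶ Y) {M M' : Y.Modules} {N : Z.Modules}
    (k : M' ⟶ M) (m : (Scheme.Modules.pullback f).obj M ⟶ N) :
    vert k ≫ toArr f m = toArr f ((Scheme.Modules.pullback f).map k ≫ m) := by
  rw [toArr, toArr, vert_comp, ← assoc, ← assoc, pbArr_map]

theorem toArr_comp_vert {Y Z : Scheme.{u}} (f : Z ⟶ Y) {M : Y.Modules} {N N' : Z.Modules}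
    (m : (Scheme.Modules.pullback f).obj M ⟶ N) (k : N ⟶ N') :
    toArr f m ≫ vert k = toArr f (m ≫ k) := by
  rw [toArr, toArr, vert_comp, assoc]

theorem comm_f_iff (t : T ⟶ S) (D : ShtukaDiagram X S) (D' : ShtukaDiagram X T)
    (m : (Scheme.Modules.pullback (prodMap X t)).obj D.F ⟶ D'.F)
    (m' : (Scheme.Modules.pullback (prodMap X t)).obj D.F' ⟶ D'.F') :
    fl D ≫ toArr _ m' = toArr _ m ≫ fl D' ↔
      (Scheme.Modules.pullback (prodMap X t)).map D.f ≫ m' =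
        (pullbackPhi X t).hom.app D.F ≫ (Scheme.Modules.pullback (Phi X T)).map m ≫ D'.f := by
  have h1 : fl D ≫ toArr _ m' = pbArr (Phi X S) D.F ≫ toArr (prodMap X t)
      ((Scheme.Modules.pullback (prodMap X t)).map D.f ≫ m') := by
    rw [fl, assoc, vert_comp_toArr]
  have h2 : toArr _ m ≫ fl D' = pbArr (Phi X S) D.F ≫ toArr (prodMap X t)
      ((pullbackPhi X t).hom.app D.F ≫ (Scheme.Modules.pullback (Phi X T)).map m ≫ D'.f) := by
    have h3 := pbArr_pullbackPhi t D.F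
    have h4 := pbArr_map (Phi X T) m
    rw [fl, toArr, toArr, assoc, vert_comp, vert_comp]
    calc _ = pbArr (prodMap X t) D.F ≫ (vert m ≫ pbArr (Phi X T) D'.F) ≫ vert D'.f := by
          simp only [assoc]
      _ = (pbArr (prodMap X t) D.F ≫ pbArr (Phi X T) _) ≫
            vert ((Scheme.Modules.pullback (Phi X T)).map m) ≫ vert D'.f := by
          rw [← h4]; simp only [assoc]
      _ = _ := by rw [← h3]; simp only [assoc]
  rw [h1, h2]
  constructor
  · intro h
    exact toArr_injective ((isCart_pbArr (Phi X S) D.F).hom_ext (by simp) h)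
  · intro h
    rw [h]

theorem comm_g_iff (t : T ⟶ S) (D : ShtukaDiagram X S) (D' : ShtukaDiagram X T)
    (m : (Scheme.Modules.pullback (prodMap X t)).obj D.F ⟶ D'.F)
    (m' : (Scheme.Modules.pullback (prodMap X t)).obj D.F' ⟶ D'.F') :
    vert D.g ≫ toArr _ m' = toArr _ m ≫ vert D'.g ↔
      (Scheme.Modules.pullback (prodMap X t)).map D.g ≫ m' = m ≫ D'.g := by
  rw [vert_comp_toArr, toArr_comp_vert]
  exact ⟨fun h => toArr_injective h, fun h => by rw [h]⟩

/-- The cartesian arrows given by an isomorphism `t^* D ≅ D'`. -/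
def PullbackIso.toShtHom {t : T ⟶ S} {D : ShtukaDiagram X S} {D' : ShtukaDiagram X T}
    (r : PullbackIso t D D') : ShtHom t D D' where
  ρ := toArr _ r.iso.hom
  ρ' := toArr _ r.iso'.hom
  bs_ρ := by simp
  bs_ρ' := by simp
  cart := isCart_toArr _ _
  cart' := isCart_toArr _ _
  comm_f := (comm_f_iff t D D' _ _).2 r.comm_f
  comm_g := (comm_g_iff t D D' _ _).2 r.comm_g

theorem ShtHom.exists_pullbackIso {t : T ⟶ S} {D : ShtukaDiagram X S} {D' : ShtukaDiagram X T}
    (p : ShtHom t D D') : ∃ r : PullbackIso t D D', r.toShtHom.ρ = p.ρ ∧ r.toShtHom.ρ' = p.ρ' := by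
  obtain ⟨m, hm⟩ := exists_toArr_iso p.ρ p.bs_ρ p.cart
  obtain ⟨m', hm'⟩ := exists_toArr_iso p.ρ' p.bs_ρ' p.cart'
  exact ⟨⟨m, m', (comm_f_iff t D D' _ _).1 (by rw [hm, hm', p.comm_f]),
    (comm_g_iff t D D' _ _).1 (by rw [hm, hm', p.comm_g])⟩, hm, hm'⟩

/-- Composition of morphisms of shtukas. -/
def ShtHom.comp {t : T ⟶ S} {r : R ⟶ T} {s : R ⟶ S} (h : r ≫ t = s) {D : ShtukaDiagram X S}
    {D' : ShtukaDiagram X T} {D'' : ShtukaDiagram X R} (p : ShtHom t D D') (p' : ShtHom r D' D'') :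
    ShtHom s D D'' where
  ρ := p.ρ ≫ p'.ρ
  ρ' := p.ρ' ≫ p'.ρ'
  bs_ρ := by rw [bs_comp, p.bs_ρ, p'.bs_ρ, ← prodMap_comp, h]
  bs_ρ' := by rw [bs_comp, p.bs_ρ', p'.bs_ρ', ← prodMap_comp, h]
  cart := p.cart.comp p'.cart
  cart' := p.cart'.comp p'.cart'
  comm_f := by rw [← assoc, p.comm_f, assoc, p'.comm_f, assoc]
  comm_g := by rw [← assoc, p.comm_g, assoc, p'.comm_g, assoc]

/-- A morphism of shtukas over `r ≫ t` factors through a morphism over `t`. -/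
theorem ShtHom.exists_factor {t : T ⟶ S} {r : R ⟶ T} {s : R ⟶ S} (h : r ≫ t = s)
    {D : ShtukaDiagram X S} {D' : ShtukaDiagram X T} {D'' : ShtukaDiagram X R} (p : ShtHom t D D')
    (k : ShtHom s D D'') : ∃ p' : ShtHom r D' D'', p.ρ ≫ p'.ρ = k.ρ ∧ p.ρ' ≫ p'.ρ' = k.ρ' := by
  obtain ⟨χ, ⟨h1, h2⟩, -⟩ := p.cart k.ρ (prodMap X r)
    (by rw [p.bs_ρ, k.bs_ρ, ← prodMap_comp, h])
  obtain ⟨χ', ⟨h1', h2'⟩, -⟩ := p.cart' k.ρ' (prodMap X r)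
    (by rw [p.bs_ρ', k.bs_ρ', ← prodMap_comp, h])
  refine ⟨⟨χ, χ', h1, h1', p.cart.of_comp (by rw [h2]; exact k.cart),
    p.cart'.of_comp (by rw [h2']; exact k.cart'), ?_, ?_⟩, h2, h2'⟩
  · refine p.cart.hom_ext ?_ ?_
    · rw [bs_comp, bs_comp, h1, h1', bs_fl, bs_fl, prodMap_Phi]
    · rw [← assoc, ← p.comm_f, assoc, h2', ← assoc, h2, k.comm_f]
  · refine p.cart.hom_ext ?_ ?_
    · rw [bs_comp, bs_comp, h1, h1', bs_vert, bs_vert, comp_id, id_comp]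
    · rw [← assoc, ← p.comm_g, assoc, h2', ← assoc, h2, k.comm_g]

/-- The pullback of a diagram. -/
theorem exists_shtHom (t : T ⟶ S) (D : ShtukaDiagram X S) :
    ∃ D' : ShtukaDiagram X T, Nonempty (ShtHom t D D') := by
  let D' : ShtukaDiagram X T :=
    ⟨(Scheme.Modules.pullback (prodMap X t)).obj D.F, (Scheme.Modules.pullback (prodMap X t)).obj D.F',
      (pullbackPhi X t).inv.app D.F ≫ (Scheme.Modules.pullback (prodMap X t)).map D.f,
      (Scheme.Modules.pullback (prodMap X t)).map D.g⟩
  refine ⟨D', ⟨PullbackIso.toShtHom ⟨Iso.refl _, Iso.refl _, ?_, ?_⟩⟩⟩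
  · simp [D']
  · simp [D']

omit [Fintype Fq] in
theorem IsCart.isLocallyFree {M : (prodS X S).Modules} {N : (prodS X T).Modules}
    {ρ : (⟨prodS X S, M⟩ : QMod) ⟶ ⟨prodS X T, N⟩} (hρ : IsCart ρ) {d : ℕ}
    (hM : IsLocallyFreeOfRank M d) : IsLocallyFreeOfRank N d := by
  rw [isLocallyFreeOfRank_iff] at hM ⊢
  intro y
  obtain ⟨U, e, hU, he⟩ := hM (bs ρ y)
  exact ⟨bs ρ ⁻¹ᵁ U, _, hU, IsFrame.cart hρ he le_rfl⟩

end ShtHom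

/-! ### Transport along the diagram of a shtuka -/

section IsoLocus

variable {Y : Scheme.{u}} {M N : Y.Modules} {m : M ⟶ N} {U : Y.Opens} {C : QMod.{u}}

theorem resArr_map (m : M ⟶ N) (U : Y.Opens) :
    resArr U.ι M ≫ vert ((Scheme.Modules.restrictFunctor U.ι).map m) = vert m ≫ resArr U.ι N := by
  have h := (Scheme.Modules.restrictAdjunction U.ι).unit.naturality m
  exact (mk_comp_vert U.ι _ _).trans
    ((congrArg (mkArr U.ι) h.symm).trans (vert_comp_mk U.ι _ _).symm)

theorem isCart_vert_resArr (h : ∀ W ≤ U, Bijective (m.app W).hom) :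
    IsCart (vert m ≫ resArr U.ι N) := by
  rw [← resArr_map]
  have h1 : IsIso ((Scheme.Modules.restrictFunctor U.ι).map m) :=
    isIso_of_bijective _ fun W =>
      h (U.ι ''ᵁ W) ((U.ι.image_le_opensRange W).trans U.opensRange_ι.le)
  exact (isCart_resArr U.ι M).comp (isCart_vert_of_isIso _)

theorem exists_lift_opens {Z : Scheme.{u}} (y : Z ⟶ Y) (hy : ∀ x, y x ∈ U) :
    ∃ y' : Z ⟶ U.toScheme, y' ≫ U.ι = y := by
  have h : Set.range y ⊆ Set.range U.ι := by
    rintro _ ⟨x, rfl⟩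
    rw [U.range_ι]
    exact hy x
  exact ⟨IsOpenImmersion.lift U.ι y h, IsOpenImmersion.lift_fac _ _ h⟩

/-- A morphism that is bijective over `U` can be inverted at points of `U`. -/
theorem existsUnique_of_bijective (h : ∀ W ≤ U, Bijective (m.app W).hom)
    (w : (⟨Y, M⟩ : QMod) ⟶ C) (hw : ∀ x, bs w x ∈ U) :
    ∃! w' : (⟨Y, N⟩ : QMod) ⟶ C, bs w' = bs w ∧ vert m ≫ w' = w := by
  obtain ⟨y, hy⟩ := exists_lift_opens (bs w) hw
  obtain ⟨k, ⟨hk1, hk2⟩, hk3⟩ := isCart_vert_resArr h w y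
    (by rw [bs_comp, bs_vert, bs_resArr]; exact (congrArg (y ≫ ·) (comp_id _)).trans hy)
  refine ⟨resArr U.ι N ≫ k, ⟨?_, by rw [← assoc, hk2]⟩, ?_⟩
  · rw [bs_comp, hk1, bs_resArr]
    exact hy
  · rintro w' ⟨h1, h2⟩
    obtain ⟨k', ⟨hk1', hk2'⟩, -⟩ := isCart_resArr U.ι N w' y (by rw [h1, bs_resArr]; exact hy)
    rw [← hk2', hk3 k' ⟨hk1', by rw [assoc, hk2', h2]⟩]

theorem isCart_vert_comp_iff (h : ∀ W ≤ U, Bijective (m.app W).hom)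
    (w : (⟨Y, N⟩ : QMod) ⟶ C) (hw : ∀ x, bs w x ∈ U) : IsCart (vert m ≫ w) ↔ IsCart w := by
  obtain ⟨y, hy⟩ := exists_lift_opens (bs w) hw
  obtain ⟨k, ⟨-, rfl⟩, -⟩ := isCart_resArr U.ι N w y (by rw [bs_resArr]; exact hy)
  rw [← assoc]
  have h1 := isCart_vert_resArr h
  have h2 := isCart_resArr U.ι N
  exact ⟨fun h3 => h2.comp (h1.of_comp h3), fun h3 => h1.comp (h2.of_comp h3)⟩

end IsoLocus

section Transport

variable {Fq : Type u} [Field Fq] [Fintype Fq] {X S T R : Over (Spec (of Fq))}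

theorem Phi_comp_PhiPow (n : ℕ) : Phi X S ≫ PhiPow X S n = PhiPow X S (n + 1) := by
  induction n with
  | zero => simp [PhiPow]
  | succ n ih =>
    rw [PhiPow, ← assoc, ih]
    rfl

theorem PhiPow_comp (m n : ℕ) : PhiPow X S m ≫ PhiPow X S n = PhiPow X S (m + n) := by
  induction n with
  | zero => exact comp_id _
  | succ n ih =>
    rw [PhiPow, ← assoc, ih]
    rfl

/-- The arrow `w` at a point `y` and the arrow `v` at the point `Φ ^ m (y)` correspond to each
other through `Φ^* F ⟶ F' ⟵ F`. -/
def Lk (D : ShtukaDiagram X S) {L : QMod.{u}} :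
    ℕ → ((⟨prodS X S, D.F⟩ : QMod) ⟶ L) → ((⟨prodS X S, D.F⟩ : QMod) ⟶ L) → Prop
  | 0, w, v => w = v
  | m + 1, w, v => ∃ w' : (⟨prodS X S, D.F'⟩ : QMod) ⟶ L, w = vert D.g ≫ w' ∧ Lk D m (fl D ≫ w') v

variable {D : ShtukaDiagram X S} {L L' : QMod.{u}} {m : ℕ}

theorem Lk.bs_eq {w v : (⟨prodS X S, D.F⟩ : QMod) ⟶ L} (h : Lk D m w v) :
    bs v = bs w ≫ PhiPow X S m := by
  induction m generalizing w with
  | zero =>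
    obtain rfl : w = v := h
    exact (comp_id _).symm
  | succ m ih =>
    obtain ⟨w', rfl, h⟩ := h
    rw [ih h, bs_comp, bs_comp, bs_fl, bs_vert, ← Phi_comp_PhiPow]
    simp only [assoc]
    rw [id_comp]

theorem Lk.comp_right {w v : (⟨prodS X S, D.F⟩ : QMod) ⟶ L} (h : Lk D m w v) (χ : L ⟶ L') :
    Lk D m (w ≫ χ) (v ≫ χ) := by
  induction m generalizing w with
  | zero => exact congrArg (· ≫ χ) (show w = v from h)
  | succ m ih =>
    obtain ⟨w', rfl, h⟩ := h
    refine ⟨w' ≫ χ, by rw [assoc], ?_⟩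
    rw [← assoc]
    exact ih h

theorem Lk.append {n : ℕ} {w v x : (⟨prodS X S, D.F⟩ : QMod) ⟶ L} (h : Lk D m w v)
    (h' : Lk D n v x) : Lk D (m + n) w x := by
  induction m generalizing w with
  | zero =>
    obtain rfl : w = v := h
    rwa [Nat.zero_add]
  | succ m ih =>
    obtain ⟨w', rfl, h⟩ := h
    rw [Nat.add_right_comm]
    exact ⟨w', rfl, ih h⟩

theorem Lk.naturality {t : T ⟶ S} {D' : ShtukaDiagram X T} (p : ShtHom t D D')
    {w v : (⟨prodS X T, D'.F⟩ : QMod) ⟶ L} (h : Lk D' m w v) : Lk D m (p.ρ ≫ w) (p.ρ ≫ v) := by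
  induction m generalizing w with
  | zero => exact congrArg (p.ρ ≫ ·) (show w = v from h)
  | succ m ih =>
    obtain ⟨w', rfl, h⟩ := h
    refine ⟨p.ρ' ≫ w', by rw [← assoc, ← assoc, p.comm_g], ?_⟩
    rw [← assoc, p.comm_f, assoc]
    exact ih h

variable {α β : S ⟶ X} (q : GraphEq α) (q' : GraphEq β)

/-- The diagram `D` over `T` is a shtuka with zero `α ∘ s` and pole `β ∘ s`. -/
structure IsSht (d : ℕ) (s : T ⟶ S) (D : ShtukaDiagram X T) : Prop where
  locallyFree : IsLocallyFreeOfRank D.F d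
  locallyFree' : IsLocallyFreeOfRank D.F' d
  elem_f : IsElemAlong q d s D.f
  elem_g : IsElemAlong q' d s D.g

variable {q q'}

theorem isShtuka_iff_isSht [IsArtinPoint T] {d : ℕ} {s : T ⟶ S} {D : ShtukaDiagram X T} :
    IsShtuka D d (s ≫ α) (s ≫ β) ↔ IsSht q q' d s D :=
  (isShtuka_iff q q' s D).trans ⟨fun h => ⟨h.1, h.2.1, h.2.2.1, h.2.2.2⟩,
    fun h => ⟨h.1, h.2, h.3, h.4⟩⟩

theorem IsSht.baseChange {d : ℕ} {s : T ⟶ S} {D : ShtukaDiagram X T} (h : IsSht q q' d s D)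
    {r : R ⟶ T} {s' : R ⟶ S} (hr : r ≫ s = s') {D' : ShtukaDiagram X R} (p : ShtHom r D D') :
    IsSht q q' d s' D' := by
  refine ⟨p.cart.isLocallyFree h.1, p.cart'.isLocallyFree h.2, ?_, ?_⟩
  · obtain ⟨χ, ⟨h1, h2⟩, -⟩ := isCart_pbArr (Phi X T) D.F (p.ρ ≫ pbArr (Phi X R) D'.F)
      (prodMap X r) (by rw [bs_comp, p.bs_ρ, bs_pbArr, bs_pbArr, prodMap_Phi])
    refine h.3.baseChange ((isCart_pbArr (Phi X T) D.F).isLocallyFree h.1) r hr (ρ := χ) (ρ' := p.ρ')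
      ?_ p.cart' h1 p.bs_ρ' ?_
    · exact (isCart_pbArr (Phi X T) D.F).of_comp (by rw [h2]; exact p.cart.comp (isCart_pbArr _ _))
    · refine (isCart_pbArr (Phi X T) D.F).hom_ext ?_ ?_
      · rw [bs_comp, bs_comp, h1, p.bs_ρ', bs_vert, bs_vert, comp_id, id_comp]
      · rw [← assoc, ← assoc, h2, assoc]
        exact p.comm_f
  · exact h.4.baseChange h.1 r hr p.cart p.cart' p.bs_ρ p.bs_ρ' p.comm_g

variable (q q') in
/-- The images of `y` under the powers of `Φ` avoid the zero and the pole. -/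
def Avoids {Z : Scheme.{u}} (y : Z ⟶ prodS X S) : Prop :=
  ∀ i x, (y ≫ PhiPow X S i) x ∈ q.U ∧ (y ≫ PhiPow X S i) x ∈ q'.U

theorem Avoids.comp_Phi {Z : Scheme.{u}} {y : Z ⟶ prodS X S} (h : Avoids q q' y) :
    Avoids q q' (y ≫ Phi X S) := by
  intro i x
  rw [assoc, Phi_comp_PhiPow]
  exact h (i + 1) x

theorem Avoids.comp {Z Z' : Scheme.{u}} {y : Z ⟶ prodS X S} (h : Avoids q q' y) (k : Z' ⟶ Z) :
    Avoids q q' (k ≫ y) := by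
  intro i x
  rw [assoc, Scheme.Hom.comp_apply]
  exact h i (k x)

theorem Avoids.mem {Z : Scheme.{u}} {s : T ⟶ S} {y : Z ⟶ prodS X T}
    (h : Avoids q q' (y ≫ prodMap X s)) (x : Z) :
    y x ∈ prodMap X s ⁻¹ᵁ q.U ∧ y x ∈ prodMap X s ⁻¹ᵁ q'.U := by
  have h1 := h 0 x
  have h2 : (y ≫ prodMap X s) ≫ PhiPow X S 0 = y ≫ prodMap X s := comp_id _
  rw [h2] at h1
  exact h1

theorem Avoids.comp_Phi' {Z : Scheme.{u}} {s : T ⟶ S} {y : Z ⟶ prodS X T}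
    (h : Avoids q q' (y ≫ prodMap X s)) : Avoids q q' ((y ≫ Phi X T) ≫ prodMap X s) := by
  rw [assoc, ← prodMap_Phi, ← assoc]
  exact h.comp_Phi

variable {d : ℕ} {s : T ⟶ S} {D : ShtukaDiagram X T}

theorem IsSht.existsUnique_g (h : IsSht q q' d s D) (w : (⟨prodS X T, D.F⟩ : QMod) ⟶ L)
    (hw : Avoids q q' (bs w ≫ prodMap X s)) :
    ∃! w' : (⟨prodS X T, D.F'⟩ : QMod) ⟶ L, bs w' = bs w ∧ vert D.g ≫ w' = w :=
  existsUnique_of_bijective h.elem_g.bij w fun x => (hw.mem x).2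

/-- The Frobenius-semilinear arrow can be inverted at points that avoid the zero. -/
theorem IsSht.existsUnique_fl (h : IsSht q q' d s D) {y : L.Y ⟶ prodS X T}
    (hy : Avoids q q' (y ≫ prodMap X s)) (v : (⟨prodS X T, D.F⟩ : QMod) ⟶ L)
    (hv : y ≫ Phi X T = bs v) :
    ∃! w' : (⟨prodS X T, D.F'⟩ : QMod) ⟶ L, bs w' = y ∧ fl D ≫ w' = v := by
  obtain ⟨k, ⟨rfl, hk2⟩, hk3⟩ := isCart_pbArr (Phi X T) D.F v y hv
  obtain ⟨w', ⟨h1, h2⟩, h3⟩ := existsUnique_of_bijective h.elem_f.bij k fun x => (hy.mem x).1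
  refine ⟨w', ⟨h1, by rw [fl, assoc, h2, hk2]⟩, ?_⟩
  rintro w'' ⟨h4, h5⟩
  refine h3 _ ⟨h4, hk3 _ ⟨?_, ?_⟩⟩
  · rw [bs_comp, h4, bs_vert]
    exact comp_id _
  · rw [← h5, fl, assoc]

theorem IsSht.isCart_fl_comp (h : IsSht q q' d s D) (w : (⟨prodS X T, D.F'⟩ : QMod) ⟶ L)
    (hw : Avoids q q' (bs w ≫ prodMap X s)) : IsCart (fl D ≫ w) ↔ IsCart w := by
  have h1 := isCart_pbArr (Phi X T) D.F
  have h2 := isCart_vert_comp_iff h.elem_f.bij w fun x => (hw.mem x).1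
  rw [fl, assoc, ← h2]
  exact ⟨fun h3 => h1.of_comp h3, fun h3 => h1.comp h3⟩

theorem IsSht.exists_lk (h : IsSht q q' d s D) (m : ℕ) (w : (⟨prodS X T, D.F⟩ : QMod) ⟶ L)
    (hw : Avoids q q' (bs w ≫ prodMap X s)) : ∃ v, Lk D m w v := by
  induction m generalizing w with
  | zero => exact ⟨w, rfl⟩
  | succ m ih =>
    obtain ⟨w', ⟨h1, h2⟩, -⟩ := h.existsUnique_g w hw
    obtain ⟨v, hv⟩ := ih (fl D ≫ w') (by
      rw [bs_comp, bs_fl, h1]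
      exact hw.comp_Phi')
    exact ⟨v, w', h2.symm, hv⟩

theorem IsSht.lk_unique (h : IsSht q q' d s D) {w v v' : (⟨prodS X T, D.F⟩ : QMod) ⟶ L}
    (hw : Avoids q q' (bs w ≫ prodMap X s)) (hv : Lk D m w v) (hv' : Lk D m w v') : v = v' := by
  induction m generalizing w with
  | zero => exact (show w = v from hv).symm.trans hv'
  | succ m ih =>
    obtain ⟨w₁, rfl, h1⟩ := hv
    obtain ⟨w₂, h2, h3⟩ := hv'
    have e : ∀ w' : (⟨prodS X T, D.F'⟩ : QMod) ⟶ L, bs (vert D.g ≫ w') = bs w' := fun w' => by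
      rw [bs_comp, bs_vert]
      exact comp_id _
    obtain rfl := (h.existsUnique_g _ hw).unique ⟨(e w₁).symm, rfl⟩
      ⟨(e w₂).symm.trans (congrArg bs h2.symm), h2.symm⟩
    rw [e] at hw
    refine ih ?_ h1 h3
    rw [bs_comp, bs_fl]
    exact hw.comp_Phi'

theorem IsSht.exists_lk_left (h : IsSht q q' d s D) (m : ℕ) {y : L.Y ⟶ prodS X T}
    (hy : Avoids q q' (y ≫ prodMap X s)) (v : (⟨prodS X T, D.F⟩ : QMod) ⟶ L)
    (hv : y ≫ PhiPow X T m = bs v) : ∃ w, bs w = y ∧ Lk D m w v := by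
  induction m generalizing y with
  | zero =>
    have : y ≫ PhiPow X T 0 = y := comp_id y
    exact ⟨v, hv.symm.trans this, rfl⟩
  | succ m ih =>
    rw [← Phi_comp_PhiPow, ← assoc] at hv
    obtain ⟨w, h1, h2⟩ := ih hy.comp_Phi' hv
    obtain ⟨w', ⟨rfl, rfl⟩, -⟩ := h.existsUnique_fl hy w h1.symm
    refine ⟨vert D.g ≫ w', ?_, w', rfl, h2⟩
    rw [bs_comp, bs_vert]
    exact comp_id _

theorem IsSht.lk_unique_left (h : IsSht q q' d s D) {w w₀ v : (⟨prodS X T, D.F⟩ : QMod) ⟶ L}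
    (hw : Avoids q q' (bs w ≫ prodMap X s)) (hb : bs w = bs w₀) (hv : Lk D m w v)
    (hv' : Lk D m w₀ v) : w = w₀ := by
  induction m generalizing w w₀ with
  | zero => exact (show w = v from hv).trans (show w₀ = v from hv').symm
  | succ m ih =>
    obtain ⟨w₁, rfl, h1⟩ := hv
    obtain ⟨w₂, rfl, h3⟩ := hv'
    have e : ∀ w' : (⟨prodS X T, D.F'⟩ : QMod) ⟶ L, bs (vert D.g ≫ w') = bs w' := fun w' => by
      rw [bs_comp, bs_vert]
      exact comp_id _
    rw [e] at hw
    rw [e, e] at hb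
    have h4 := ih (w := fl D ≫ w₁) (w₀ := fl D ≫ w₂) (by
      rw [bs_comp, bs_fl]
      exact hw.comp_Phi') (by rw [bs_comp, bs_comp, hb]) h1 h3
    rw [(h.existsUnique_fl hw (fl D ≫ w₁) (by rw [bs_comp, bs_fl])).unique ⟨rfl, rfl⟩
      ⟨hb.symm, h4.symm⟩]

theorem IsSht.isCart_iff_of_lk (h : IsSht q q' d s D) {w v : (⟨prodS X T, D.F⟩ : QMod) ⟶ L}
    (hw : Avoids q q' (bs w ≫ prodMap X s)) (hv : Lk D m w v) : IsCart w ↔ IsCart v := by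
  induction m generalizing w with
  | zero => rw [show w = v from hv]
  | succ m ih =>
    obtain ⟨w', rfl, h1⟩ := hv
    have e : bs (vert D.g ≫ w') = bs w' := by
      rw [bs_comp, bs_vert]
      exact comp_id _
    rw [e] at hw
    rw [isCart_vert_comp_iff h.elem_g.bij w' fun x => (hw.mem x).2, ← h.isCart_fl_comp w' hw]
    refine ih ?_ h1
    rw [bs_comp, bs_fl]
    exact hw.comp_Phi'

end Transport

section Comparison

variable {Fq : Type u} [Field Fq] [Fintype Fq] {X S T R : Over (Spec (of Fq))}
  {α β : S ⟶ X} {q : GraphEq α} {q' : GraphEq β} {d : ℕ} {L L' : QMod.{u}}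
  {D : ShtukaDiagram X S} {G : ShtukaDiagram X T} {c : S ⟶ T}

/-- Let `G` be a diagram over `T` and `D` its restriction to `c : S ⟶ T`. The arrow `ϑ` from `D`
and the arrow `w` from `G` correspond to each other through their images under a power
of `Φ`. -/
def Corresponds (r : ShtHom c G D) (ϑ : (⟨prodS X S, D.F⟩ : QMod) ⟶ L)
    (w : (⟨prodS X T, G.F⟩ : QMod) ⟶ L) : Prop :=
  ∃ (m : ℕ) (v : (⟨prodS X S, D.F⟩ : QMod) ⟶ L), Lk D m ϑ v ∧ Lk G m w (r.ρ ≫ v)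

theorem Corresponds.comp_right {r : ShtHom c G D} {ϑ : (⟨prodS X S, D.F⟩ : QMod) ⟶ L}
    {w : (⟨prodS X T, G.F⟩ : QMod) ⟶ L} (h : Corresponds r ϑ w) (χ : L ⟶ L') :
    Corresponds r (ϑ ≫ χ) (w ≫ χ) := by
  obtain ⟨m, v, h1, h2⟩ := h
  refine ⟨m, v ≫ χ, h1.comp_right χ, ?_⟩
  rw [← assoc]
  exact h2.comp_right χ

theorem Corresponds.naturality {H : ShtukaDiagram X R} {t : R ⟶ T} {c' : S ⟶ R} {r : ShtHom c G D}
    {r' : ShtHom c' H D} (p : ShtHom t G H) (hp : p.ρ ≫ r'.ρ = r.ρ)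
    {ϑ : (⟨prodS X S, D.F⟩ : QMod) ⟶ L} {w : (⟨prodS X R, H.F⟩ : QMod) ⟶ L}
    (h : Corresponds r' ϑ w) : Corresponds r ϑ (p.ρ ≫ w) := by
  obtain ⟨m, v, h1, h2⟩ := h
  refine ⟨m, v, h1, ?_⟩
  rw [← hp, assoc]
  exact h2.naturality p

variable {s : T ⟶ S}

theorem avoids_id {Z : Scheme.{u}} {y : Z ⟶ prodS X S} :
    Avoids q q' (y ≫ prodMap X (𝟙 S)) ↔ Avoids q q' y := by
  rw [prodMap_id, comp_id]

theorem Corresponds.unique (hG : IsSht q q' d s G) (hD : IsSht q q' d (𝟙 S) D) {r : ShtHom c G D}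
    {ϑ ϑ' : (⟨prodS X S, D.F⟩ : QMod) ⟶ L} {w : (⟨prodS X T, G.F⟩ : QMod) ⟶ L}
    (h : Corresponds r ϑ w) (h' : Corresponds r ϑ' w) (hw : Avoids q q' (bs w ≫ prodMap X s))
    (hb : bs ϑ = bs w ≫ prodMap X s) (hb' : bs ϑ' = bs w ≫ prodMap X s) : ϑ = ϑ' := by
  -- both correspondences are pushed to a common power of `Φ`
  have key : ∀ {ϑ : (⟨prodS X S, D.F⟩ : QMod) ⟶ L}, Corresponds r ϑ w → bs ϑ = bs w ≫ prodMap X s →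
      ∃ m₀, ∀ m ≥ m₀, ∃ v : (⟨prodS X S, D.F⟩ : QMod) ⟶ L, Lk D m ϑ v ∧ Lk G m w (r.ρ ≫ v) := by
    rintro ϑ ⟨m, v, h1, h2⟩ hb
    refine ⟨m, fun n hn => ?_⟩
    obtain ⟨k, rfl⟩ := Nat.exists_eq_add_of_le hn
    obtain ⟨v', hv'⟩ := hD.exists_lk k v (by
      rw [avoids_id, h1.bs_eq, hb]
      intro i x
      rw [assoc, PhiPow_comp]
      exact hw _ x)
    exact ⟨v', h1.append hv', h2.append (hv'.naturality r)⟩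
  obtain ⟨m₁, h1⟩ := key h hb
  obtain ⟨m₂, h2⟩ := key h' hb'
  obtain ⟨v₁, h3, h4⟩ := h1 (max m₁ m₂) (le_max_left _ _)
  obtain ⟨v₂, h5, h6⟩ := h2 (max m₁ m₂) (le_max_right _ _)
  have h7 := hG.lk_unique hw h4 h6
  obtain rfl : v₁ = v₂ := r.cart.hom_ext (by rw [h3.bs_eq, h5.bs_eq, hb, hb']) h7
  exact hD.lk_unique_left (avoids_id.2 (by rw [hb]; exact hw)) (hb.trans hb'.symm) h3 h5

theorem exists_corresponds (hG : IsSht q q' d s G) (hD : IsSht q q' d (𝟙 S) D) (r : ShtHom c G D)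
    {n : ℕ} (hn : PhiPow X T n = prodMap X s ≫ PhiPow X S n ≫ prodMap X c)
    (w : (⟨prodS X T, G.F⟩ : QMod) ⟶ L) (hw : Avoids q q' (bs w ≫ prodMap X s)) :
    ∃ ϑ, bs ϑ = bs w ≫ prodMap X s ∧ Corresponds r ϑ w := by
  obtain ⟨v, hv⟩ := hG.exists_lk n w hw
  obtain ⟨v', ⟨h1, rfl⟩, -⟩ := r.cart v ((bs w ≫ prodMap X s) ≫ PhiPow X S n) (by
    rw [r.bs_ρ, hv.bs_eq, hn]
    simp only [assoc])
  obtain ⟨ϑ, h2, h3⟩ := hD.exists_lk_left n (avoids_id.2 hw) v' h1.symm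
  exact ⟨ϑ, h2, n, v', h3, hv⟩

theorem Corresponds.isCart (hG : IsSht q q' d s G) (hD : IsSht q q' d (𝟙 S) D) {r : ShtHom c G D}
    {ϑ : (⟨prodS X S, D.F⟩ : QMod) ⟶ L} {w : (⟨prodS X T, G.F⟩ : QMod) ⟶ L} (h : Corresponds r ϑ w)
    (hw : Avoids q q' (bs w ≫ prodMap X s)) (hb : bs ϑ = bs w ≫ prodMap X s) (hc : IsCart w) :
    IsCart ϑ := by
  obtain ⟨m, v, h1, h2⟩ := h
  have h3 := (hG.isCart_iff_of_lk hw h2).1 hc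
  exact (hD.isCart_iff_of_lk (avoids_id.2 (by rw [hb]; exact hw)) h1).2 (r.cart.of_comp h3)

/-- The converse of `Corresponds.naturality`. -/
theorem Corresponds.of_naturality {H : ShtukaDiagram X R} {t : R ⟶ T} {c' : S ⟶ R} {s' : R ⟶ S}
    {r : ShtHom c G D} {r' : ShtHom c' H D} (hG : IsSht q q' d s G) (hD : IsSht q q' d (𝟙 S) D)
    (hH : IsSht q q' d s' H) (p : ShtHom t G H) (hp : p.ρ ≫ r'.ρ = r.ρ) (ht : t ≫ s = s')
    {n : ℕ} (hn : PhiPow X R n = prodMap X s' ≫ PhiPow X S n ≫ prodMap X c')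
    {ϑ : (⟨prodS X S, D.F⟩ : QMod) ⟶ L} {w : (⟨prodS X R, H.F⟩ : QMod) ⟶ L}
    (h : Corresponds r ϑ (p.ρ ≫ w)) (hw : Avoids q q' (bs w ≫ prodMap X s'))
    (hb : bs ϑ = bs w ≫ prodMap X s') : Corresponds r' ϑ w := by
  obtain ⟨ϑ', h1, h2⟩ := exists_corresponds hH hD r' hn w hw
  have h3 : bs (p.ρ ≫ w) ≫ prodMap X s = bs w ≫ prodMap X s' := by
    rw [bs_comp, p.bs_ρ, assoc, ← prodMap_comp, ht]
  rw [Corresponds.unique hG hD h (h2.naturality p hp) (by rw [h3]; exact hw) (by rw [h3, hb])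
    (by rw [h3, h1])]
  exact h2

end Comparison

/-! ### The comparison along the graphs -/

section FibreComparison

variable {Fq : Type u} [Field Fq] [Fintype Fq] {X S T R : Over (Spec (of Fq))}

/-- The arrow `M ⟶ (Φ^*)^n M`. -/
def tauArr : ∀ (n : ℕ) (M : (prodS X S).Modules),
    (⟨prodS X S, M⟩ : QMod) ⟶ ⟨prodS X S, (tau X S n).obj M⟩
  | 0, _ => 𝟙 _
  | n + 1, M => pbArr (Phi X S) M ≫ tauArr n ((Scheme.Modules.pullback (Phi X S)).obj M)

theorem bs_tauArr (n : ℕ) (M : (prodS X S).Modules) : bs (tauArr n M) = PhiPow X S n := by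
  induction n generalizing M with
  | zero => rfl
  | succ n ih =>
    have h : bs (tauArr (n + 1) M) = bs (tauArr n ((Scheme.Modules.pullback (Phi X S)).obj M)) ≫
      Phi X S := rfl
    rw [h, ih]
    rfl

theorem tauArr_map (n : ℕ) {M N : (prodS X S).Modules} (m : M ⟶ N) :
    tauArr n M ≫ vert ((tau X S n).map m) = vert m ≫ tauArr n N := by
  induction n generalizing M N with
  | zero =>
    have h : vert ((tau X S 0).map m) = vert m := rfl
    rw [h]
    exact (id_comp _).trans (comp_id _).symm
  | succ n ih =>
    have h : (tau X S (n + 1)).map m =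
      (tau X S n).map ((Scheme.Modules.pullback (Phi X S)).map m) := rfl
    have h1 := pbArr_map (Phi X S) m
    have h2 := ih ((Scheme.Modules.pullback (Phi X S)).map m)
    have h3 : tauArr (n + 1) M ≫ vert ((tau X S (n + 1)).map m) = pbArr (Phi X S) M ≫
        (tauArr n _ ≫ vert ((tau X S n).map ((Scheme.Modules.pullback (Phi X S)).map m))) :=
      assoc _ _ _
    have h4 : pbArr (Phi X S) M ≫ (vert ((Scheme.Modules.pullback (Phi X S)).map m) ≫ tauArr n _) =
        (vert m ≫ pbArr (Phi X S) N) ≫ tauArr n _ :=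
      (assoc _ _ _).symm.trans (congrArg (· ≫ tauArr n _) h1)
    exact h3.trans ((congrArg (pbArr (Phi X S) M ≫ ·) h2).trans (h4.trans (assoc _ _ _)))

theorem isCart_tauArr (n : ℕ) (M : (prodS X S).Modules) : IsCart (tauArr n M) := by
  induction n generalizing M with
  | zero => exact isCart_of_isIso (𝟙 _)
  | succ n ih => exact (isCart_pbArr _ _).comp (ih _)

theorem tauArr_tauIso (n : ℕ) (M : (prodS X S).Modules) :
    tauArr n M ≫ vert ((tauIso X S n).hom.app M) = pbArr (PhiPow X S n) M := by
  induction n generalizing M with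
  | zero =>
    have h := pbArr_pullbackId M
    have h1 : vert ((Scheme.Modules.pullbackId (prodS X S)).inv.app M) = pbArr (𝟙 (prodS X S)) M := by
      have h2 : vert ((Scheme.Modules.pullbackId (prodS X S)).hom.app M) ≫
          vert ((Scheme.Modules.pullbackId (prodS X S)).inv.app M) = 𝟙 _ := by
        rw [← vert_comp, Iso.hom_inv_id_app, vert_id]
      exact (id_comp _).symm.trans ((congrArg (· ≫ _) h.symm).trans
        ((assoc _ _ _).trans ((congrArg (_ ≫ ·) h2).trans (comp_id _))))
    exact (id_comp _).trans h1
  | succ n ih =>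
    have h : vert ((tauIso X S (n + 1)).hom.app M) =
      vert ((tauIso X S n).hom.app ((Scheme.Modules.pullback (Phi X S)).obj M)) ≫
        vert ((pullbackComp (PhiPow X S n) (Phi X S)).hom.app M) := vert_comp _ _
    have h1 := ih ((Scheme.Modules.pullback (Phi X S)).obj M)
    have h2 := pbArr_pullbackComp (PhiPow X S n) (Phi X S) M
    have h3 : (pbArr (Phi X S) M ≫ tauArr n _) ≫
        vert ((tauIso X S n).hom.app ((Scheme.Modules.pullback (Phi X S)).obj M)) ≫
        vert ((pullbackComp (PhiPow X S n) (Phi X S)).hom.app M) =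
        pbArr (PhiPow X S n ≫ Phi X S) M := by
      rw [← h2, ← h1]
      simp only [assoc]
    exact (congrArg (tauArr (n + 1) M ≫ ·) h).trans h3

/-- The arrow from `M` to the restriction of `(Φ^*)^n M` to the graph of `a`. -/
def kap (n : ℕ) (a : S ⟶ X) (M : (prodS X S).Modules) :
    (⟨prodS X S, M⟩ : QMod) ⟶ ⟨S.left, (fib a).obj ((tau X S n).obj M)⟩ :=
  tauArr n M ≫ pbArr (graph a) _

theorem bs_kap (n : ℕ) (a : S ⟶ X) (M : (prodS X S).Modules) :
    bs (kap n a M) = graph a ≫ PhiPow X S n := by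
  rw [kap, bs_comp, bs_tauArr, bs_pbArr]

theorem isCart_kap (n : ℕ) (a : S ⟶ X) (M : (prodS X S).Modules) : IsCart (kap n a M) :=
  (isCart_tauArr n M).comp (isCart_pbArr _ _)

theorem kap_map (n : ℕ) (a : S ⟶ X) {M N : (prodS X S).Modules} (m : M ⟶ N) :
    kap n a M ≫ vert ((fib a).map ((tau X S n).map m)) = vert m ≫ kap n a N := by
  have h := pbArr_map (graph a) ((tau X S n).map m)
  rw [kap, assoc, h, ← assoc, tauArr_map, assoc, kap]

/-- The restriction of `(Φ^*)^n f` to the graph of `a`. -/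
def fibF (D : ShtukaDiagram X S) (a : S ⟶ X) (n : ℕ) :
    (fib a).obj ((tau X S (n + 1)).obj D.F) ⟶ (fib a).obj ((tau X S n).obj D.F') :=
  (fib a).map ((tau X S n).map D.f)

theorem kap_succ (n : ℕ) (a : S ⟶ X) (D : ShtukaDiagram X S) :
    fl D ≫ kap n a D.F' = kap (n + 1) a D.F ≫ vert (fibF D a n) := by
  rw [fl, assoc, ← kap_map]
  have h : kap (n + 1) a D.F = pbArr (Phi X S) D.F ≫ kap n a _ := assoc _ _ _
  rw [h]
  exact (assoc _ _ _).symm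

variable {α β : S ⟶ X} {q : GraphEq α} {q' : GraphEq β} {d : ℕ} {s : T ⟶ S}
  {D : ShtukaDiagram X T}

theorem avoids_kap {a : T ⟶ X} (ha : Avoids q q' ((graph a ≫ Phi X T) ≫ prodMap X s)) (n : ℕ) :
    Avoids q q' ((graph a ≫ PhiPow X T (n + 1)) ≫ prodMap X s) := by
  induction n with
  | zero =>
    have : PhiPow X T 1 = Phi X T := id_comp _
    rwa [this]
  | succ n ih =>
    have := ih.comp_Phi'
    rw [assoc (graph a)] at this
    exact this

theorem IsSht.isIso_g (h : IsSht q q' d s D) {a : T ⟶ X}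
    (ha : Avoids q q' ((graph a ≫ Phi X T) ≫ prodMap X s)) (n : ℕ) :
    IsIso ((fib a).map ((tau X T (n + 1)).map D.g)) := by
  refine isIso_of_isCart_vert ((isCart_kap (n + 1) a D.F).of_comp ?_)
  rw [kap_map, isCart_vert_comp_iff h.elem_g.bij]
  · exact isCart_kap _ _ _
  · have := avoids_kap ha n
    rw [← bs_kap (n + 1) a D.F'] at this
    exact fun x => (this.mem x).2

theorem IsSht.isIso_f (h : IsSht q q' d s D) {a : T ⟶ X}
    (ha : Avoids q q' ((graph a ≫ Phi X T) ≫ prodMap X s)) (n : ℕ) :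
    IsIso (fibF D a (n + 1)) := by
  refine isIso_of_isCart_vert ((isCart_kap (n + 2) a D.F).of_comp ?_)
  rw [← kap_succ, h.isCart_fl_comp]
  · exact isCart_kap _ _ _
  · rw [bs_kap]
    exact avoids_kap ha n

theorem invOrZero_eq {Y : Scheme.{u}} {M N : Y.Modules} (m : M ⟶ N) [h : IsIso m] :
    invOrZero m = inv m := dif_pos h

theorem IsSht.lk_stepDown (h : IsSht q q' d s D) {a : T ⟶ X}
    (ha : Avoids q q' ((graph a ≫ Phi X T) ≫ prodMap X s)) (n : ℕ) :
    Lk D 1 (kap (n + 1) a D.F) (kap (n + 2) a D.F ≫ vert (stepDown D a (n + 1))) := by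
  have := h.isIso_g ha n
  refine ⟨kap (n + 1) a D.F' ≫ vert (inv ((fib a).map ((tau X T (n + 1)).map D.g))), ?_, ?_⟩
  · rw [← assoc, ← kap_map, assoc, ← vert_comp, IsIso.hom_inv_id, vert_id, comp_id]
  · have h1 : fl D ≫ kap (n + 1) a D.F' ≫ vert (inv ((fib a).map ((tau X T (n + 1)).map D.g))) =
        kap (n + 2) a D.F ≫ vert (stepDown D a (n + 1)) := by
      rw [← assoc, kap_succ, assoc, ← vert_comp]
      exact congrArg (fun k => kap (n + 2) a D.F ≫ vert (fibF D a (n + 1) ≫ k))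
        (invOrZero_eq ((fib a).map ((tau X T (n + 1)).map D.g))).symm
    exact h1

theorem IsSht.lk_stepUp (h : IsSht q q' d s D) {a : T ⟶ X}
    (ha : Avoids q q' ((graph a ≫ Phi X T) ≫ prodMap X s)) (n : ℕ) :
    Lk D 1 (kap (n + 1) a D.F ≫ vert (stepUp D a (n + 1))) (kap (n + 2) a D.F) := by
  have := h.isIso_f ha n
  refine ⟨kap (n + 1) a D.F' ≫ vert (inv (fibF D a (n + 1))), ?_, ?_⟩
  · have h1 : stepUp D a (n + 1) = (fib a).map ((tau X T (n + 1)).map D.g) ≫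
        inv (fibF D a (n + 1)) :=
      congrArg (_ ≫ ·) (invOrZero_eq (fibF D a (n + 1)))
    rw [h1, ← assoc, ← kap_map, assoc, ← vert_comp]
  · have h1 : fl D ≫ kap (n + 1) a D.F' ≫ vert (inv (fibF D a (n + 1))) =
        kap (n + 2) a D.F := by
      rw [← assoc, kap_succ, assoc, ← vert_comp, IsIso.hom_inv_id, vert_id, comp_id]
    exact h1

theorem IsSht.lk_toOne (h : IsSht q q' d s D) {a : T ⟶ X}
    (ha : Avoids q q' ((graph a ≫ Phi X T) ≫ prodMap X s)) (n : ℕ) :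
    Lk D n (kap 1 a D.F) (kap (n + 1) a D.F ≫ vert (toOne D a n)) := by
  induction n with
  | zero =>
    have h1 : kap 1 a D.F ≫ vert (toOne D a 0) = kap 1 a D.F := by
      rw [show toOne D a 0 = 𝟙 _ from rfl, vert_id, comp_id]
    exact h1.symm
  | succ n ih =>
    have h1 := (h.lk_stepDown ha n).comp_right (vert (toOne D a n))
    rw [assoc, ← vert_comp] at h1
    exact ih.append h1

theorem IsSht.lk_fromOne (h : IsSht q q' d s D) {a : T ⟶ X}
    (ha : Avoids q q' ((graph a ≫ Phi X T) ≫ prodMap X s)) (n : ℕ) :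
    Lk D n (kap 1 a D.F ≫ vert (fromOne D a n)) (kap (n + 1) a D.F) := by
  induction n with
  | zero =>
    have h1 : kap 1 a D.F ≫ vert (fromOne D a 0) = kap 1 a D.F := by
      rw [show fromOne D a 0 = 𝟙 _ from rfl, vert_id, comp_id]
    exact h1
  | succ n ih =>
    have h1 := ih.comp_right (vert (stepUp D a (n + 1)))
    rw [assoc, ← vert_comp] at h1
    exact h1.append (h.lk_stepUp ha n)

end FibreComparison

section CompareFib

variable {Fq : Type u} [Field Fq] [Fintype Fq] {E : Type u} [Field E] [Algebra Fq E]
  {X : Over (Spec (of Fq))}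

omit [Fintype Fq] in
theorem fibPullback_eq (A : ArtAlg E) (a : specE E Fq ⟶ X) : fibPullback A a =
    pullbackComp (structMor Fq A).left (graph a) ≪≫
      pullbackCongr (graph_prodMap (structMor Fq A) a).symm ≪≫
      (pullbackComp (graph (structMor Fq A ≫ a))
        (prodMap X (structMor Fq A))).symm := rfl

omit [Fintype Fq] in
theorem pbArr_fibPullback (A : ArtAlg E) (a : specE E Fq ⟶ X)
    (M : (prodS X (specE E Fq)).Modules) :
    pbArr (graph a) M ≫ pbArr (structMor Fq A).left _ ≫ vert ((fibPullback A a).hom.app M) =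
      pbArr (prodMap X (structMor Fq A)) M ≫ pbArr (graph (structMor Fq A ≫ a)) _ := by
  rw [fibPullback_eq]
  exact pbArr_square (graph_prodMap (structMor Fq A) a).symm M

theorem compareIso_eq (A : ArtAlg E) {n : ℕ} (hn : A.FrobNilpotent (Fintype.card Fq) n)
    {F : (prodS X (specE E Fq)).Modules} {G : (prodS X (specA Fq A)).Modules}
    (e : (Scheme.Modules.pullback (prodMap X (closedPt Fq A))).obj G ≅ F) :
    compareIso A hn e = (Scheme.Modules.pullback (prodMap X (structMor Fq A))).mapIso
      ((tauIso X (specE E Fq) n).app F ≪≫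
        (Scheme.Modules.pullback (PhiPow X (specE E Fq) n)).mapIso e.symm ≪≫
        (pullbackComp (PhiPow X (specE E Fq) n)
          (prodMap X (closedPt Fq A))).app G) ≪≫
    (pullbackComp (prodMap X (structMor Fq A))
      (PhiPow X (specE E Fq) n ≫ prodMap X (closedPt Fq A))).app G ≪≫
    (pullbackCongr (PhiPow_specA X A hn).symm).app G ≪≫
    ((tauIso X (specA Fq A) n).app G).symm := rfl

theorem tauArr_compareIso (A : ArtAlg E) {n : ℕ} (hn : A.FrobNilpotent (Fintype.card Fq) n)
    {F : (prodS X (specE E Fq)).Modules} {G : (prodS X (specA Fq A)).Modules}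
    (e : (Scheme.Modules.pullback (prodMap X (closedPt Fq A))).obj G ≅ F) :
    toArr _ e.hom ≫ tauArr n F ≫ pbArr (prodMap X (structMor Fq A)) _ ≫
      vert (compareIso A hn e).hom = tauArr n G := by
  let x : (tau X (specE E Fq) n).obj F ⟶ (Scheme.Modules.pullback
      (PhiPow X (specE E Fq) n ≫ prodMap X (closedPt Fq A))).obj G :=
    (tauIso X (specE E Fq) n).hom.app F ≫
      (Scheme.Modules.pullback (PhiPow X (specE E Fq) n)).map e.inv ≫
      (pullbackComp (PhiPow X (specE E Fq) n)
          (prodMap X (closedPt Fq A))).hom.app G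
  have h1 : (compareIso A hn e).hom =
      (Scheme.Modules.pullback (prodMap X (structMor Fq A))).map x ≫
      (pullbackComp (prodMap X (structMor Fq A))
        (PhiPow X (specE E Fq) n ≫ prodMap X (closedPt Fq A))).hom.app G ≫
      (pullbackCongr (PhiPow_specA X A hn).symm).hom.app G ≫
      (tauIso X (specA Fq A) n).inv.app G := by
    rw [compareIso_eq]
    simp only [x, Iso.trans_hom, Functor.mapIso_hom, Iso.app_hom, Iso.symm_hom, Iso.app_inv]
  have h2 : toArr _ e.hom ≫ tauArr n F ≫ vert x =
      pbArr (PhiPow X (specE E Fq) n ≫ prodMap X (closedPt Fq A)) G := by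
    have k1 := tauArr_tauIso n F
    have k2 := pbArr_map (PhiPow X (specE E Fq) n) e.inv
    have k3 := pbArr_pullbackComp (PhiPow X (specE E Fq) n) (prodMap X (closedPt Fq A)) G
    calc toArr _ e.hom ≫ tauArr n F ≫ vert x = toArr _ e.hom ≫
          (tauArr n F ≫ vert ((tauIso X (specE E Fq) n).hom.app F)) ≫
          vert ((Scheme.Modules.pullback (PhiPow X (specE E Fq) n)).map e.inv) ≫
          vert ((pullbackComp (PhiPow X (specE E Fq) n)
          (prodMap X (closedPt Fq A))).hom.app G) := by
            simp only [x, vert_comp, assoc]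
      _ = pbArr (prodMap X (closedPt Fq A)) G ≫ (vert e.hom ≫ vert e.inv) ≫
            pbArr (PhiPow X (specE E Fq) n) _ ≫
          vert ((pullbackComp (PhiPow X (specE E Fq) n)
          (prodMap X (closedPt Fq A))).hom.app G) := by
            rw [k1, ← assoc (pbArr _ _) (vert _), k2]
            simp only [toArr, assoc]
      _ = _ := by
            rw [← vert_comp, e.hom_inv_id, vert_id, id_comp, k3]
  have h3 := pbArr_map (prodMap X (structMor Fq A)) x
  have h4 := pbArr_pullbackComp (prodMap X (structMor Fq A))
        (PhiPow X (specE E Fq) n ≫ prodMap X (closedPt Fq A)) G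
  have h5 := pbArr_pullbackCongr (PhiPow_specA X A hn).symm G
  have h6 : pbArr (PhiPow X (specA Fq A) n) G ≫ vert ((tauIso X (specA Fq A) n).inv.app G) =
      tauArr n G := by
    rw [← tauArr_tauIso, assoc, ← vert_comp, Iso.hom_inv_id_app, vert_id, comp_id]
  rw [h1, vert_comp, vert_comp, vert_comp, ← h6, ← h5, ← h4, ← h2,
    ← assoc (pbArr (prodMap X (structMor Fq A)) _) (vert _), h3]
  simp only [assoc]

variable {α β : specE E Fq ⟶ X} {q : GraphEq α} {q' : GraphEq β} {d : ℕ}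
  {D : ShtukaDiagram X (specE E Fq)} {A : ArtAlg E}

theorem avoids_structMor {a : specE E Fq ⟶ X} (ha : Avoids q q' (graph a ≫ Phi X (specE E Fq))) :
    Avoids q q' ((graph (structMor Fq A ≫ a) ≫ Phi X (specA Fq A)) ≫ prodMap X (structMor Fq A)) := by
  rw [assoc, ← prodMap_Phi, ← assoc, graph_prodMap, assoc]
  exact ha.comp _

/-- The comparison of the fibres of `Φ^* F` and `Φ^* G` corresponds to the transport through
powers of the Frobenius. -/
theorem corresponds_compareFib {n : ℕ} (hn : A.FrobNilpotent (Fintype.card Fq) (n + 1))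
    {G : ShtukaDiagram X (specA Fq A)} (hG : IsSht q q' d (structMor Fq A) G)
    (hD : IsSht q q' d (𝟙 _) D) (r : PullbackIso (closedPt Fq A) G D) {a : specE E Fq ⟶ X}
    (ha : Avoids q q' (graph a ≫ Phi X (specE E Fq))) :
    Corresponds r.toShtHom (kap 1 a D.F ≫ toArr _ (compareFib A hn D G r a))
      (kap 1 (structMor Fq A ≫ a) G.F) := by
  have h1 := hD.lk_fromOne (avoids_id.2 ha) n
  have h2 := hG.lk_toOne (avoids_structMor ha) n
  let χ : (⟨_, (fib a).obj ((tau X (specE E Fq) (n + 1)).obj D.F)⟩ : QMod) ⟶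
      ⟨(specA Fq A).left, (fib (structMor Fq A ≫ a)).obj ((tau X (specA Fq A) 1).obj G.F)⟩ :=
    pbArr (structMor Fq A).left _ ≫
      vert ((fibPullback A a).hom.app ((tau X (specE E Fq) (n + 1)).obj D.F)) ≫
      vert ((fib (structMor Fq A ≫ a)).map (compareIso A hn r.iso).hom) ≫
      vert (toOne G (structMor Fq A ≫ a) n)
  refine ⟨n, kap (n + 1) a D.F ≫ χ, ?_, ?_⟩
  · have h3 := h1.comp_right χ
    have h4 : toArr _ (compareFib A hn D G r a) = vert (fromOne D a n) ≫ χ := by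
      rw [toArr, compareFib, vert_comp, vert_comp, vert_comp, ← assoc, pbArr_map]
      simp only [χ, assoc]
    rw [h4, ← assoc]
    exact h3
  · have h3 : r.toShtHom.ρ ≫ kap (n + 1) a D.F ≫ χ =
        kap (n + 1) (structMor Fq A ≫ a) G.F ≫ vert (toOne G (structMor Fq A ≫ a) n) := by
      have k1 := pbArr_fibPullback A a ((tau X (specE E Fq) (n + 1)).obj D.F)
      have k2 := pbArr_map (graph (structMor Fq A ≫ a)) (compareIso A hn r.iso).hom
      have k3 := tauArr_compareIso A hn r.iso
      have k4 : r.toShtHom.ρ = toArr _ r.iso.hom := rfl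
      rw [k4, kap, kap, ← k3]
      calc _ = toArr _ r.iso.hom ≫ tauArr (n + 1) D.F ≫ (pbArr (graph a) _ ≫
            pbArr (structMor Fq A).left _ ≫
            vert ((fibPullback A a).hom.app ((tau X (specE E Fq) (n + 1)).obj D.F))) ≫
            vert ((fib (structMor Fq A ≫ a)).map (compareIso A hn r.iso).hom) ≫
            vert (toOne G (structMor Fq A ≫ a) n) := by
              simp only [χ, assoc]
        _ = toArr _ r.iso.hom ≫ tauArr (n + 1) D.F ≫ pbArr (prodMap X (structMor Fq A)) _ ≫
            (pbArr (graph (structMor Fq A ≫ a)) _ ≫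
            vert ((fib (structMor Fq A ≫ a)).map (compareIso A hn r.iso).hom)) ≫
            vert (toOne G (structMor Fq A ≫ a) n) := by
              rw [k1]
              simp only [assoc]
        _ = _ := by
              rw [k2]
              simp only [assoc]
    rw [h3]
    exact h2

end CompareFib

/-! ### Points of projective spaces with values in local rings -/

section ProjectivePoints

open HomogeneousLocalization

section

variable {B : Type u} [CommRing B] {σ : Type*} [SetLike σ B] [AddSubgroupClass σ B] (𝒜 : ℕ → σ)
  [GradedRing 𝒜]

/-- The map from the degree zero part of the localization at `t` given by a homomorphism that sends
`t` to a unit. -/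
def awayLift {C : Type*} [CommRing C] (f : B →+* C) {t : B} (ht : IsUnit (f t)) :
    Away 𝒜 t →+* C :=
  (IsLocalization.Away.lift (S := Localization.Away t) t ht).comp (algebraMap (Away 𝒜 t) _)

theorem awayLift_mk {C : Type*} [CommRing C] (f : B →+* C) {t : B} (ht : IsUnit (f t)) {d : ℕ}
    (hd : t ∈ 𝒜 d) (n : ℕ) (a : B) (ha : a ∈ 𝒜 (n • d)) :
    awayLift 𝒜 f ht (Away.mk 𝒜 hd n a ha) * f t ^ n = f a := by
  have h1 : algebraMap (Away 𝒜 t) (Localization.Away t) (Away.mk 𝒜 hd n a ha) *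
      algebraMap B (Localization.Away t) (t ^ n) = algebraMap B (Localization.Away t) a := by
    rw [HomogeneousLocalization.algebraMap_apply, Away.val_mk, Localization.mk_eq_mk']
    exact IsLocalization.mk'_spec (M := Submonoid.powers t) (Localization.Away t) a ⟨t ^ n, n, rfl⟩
  have h2 := congrArg (IsLocalization.Away.lift (S := Localization.Away t) t ht) h1
  rw [map_mul, IsLocalization.Away.lift_eq, IsLocalization.Away.lift_eq, map_pow] at h2
  exact h2

/-- The morphism to `Proj` given by sections is affine if one of them is invertible. -/
theorem fromOfGlobalSections_eq {Y : Scheme.{u}} (f : B →+* Γ(Y, ⊤))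
    (hf : (HomogeneousIdeal.irrelevant 𝒜).toIdeal.map f = ⊤) {t : B} {d : ℕ} (h0 : 0 < d)
    (hd : t ∈ 𝒜 d) (ht : IsUnit (f t)) :
    Proj.fromOfGlobalSections 𝒜 f hf =
      Y.toSpecΓ ≫ Spec.map (ofHom (awayLift 𝒜 f ht)) ≫ Proj.awayι 𝒜 t hd h0 := by
  have h1 : Y.basicOpen (f t) = ⊤ := Y.basicOpen_of_isUnit ht
  have h2 : IsIso (Y.basicOpen (f t)).ι := by
    rw [h1]
    exact inferInstanceAs (IsIso (Scheme.topIso Y).hom)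
  rw [← cancel_epi (Y.basicOpen (f t)).ι]
  have h3 : (Y.basicOpen (f t)).ι ≫ Proj.fromOfGlobalSections 𝒜 f hf =
      Proj.toBasicOpenOfGlobalSections 𝒜 f rfl h0 hd ≫ (Proj.basicOpen 𝒜 t).ι :=
    (Proj.openCoverOfMapIrrelevantEqTop 𝒜 f hf).ι_glueMorphisms _ _ ⟨d, t, h0, hd⟩
  rw [h3]
  simp only [Proj.toBasicOpenOfGlobalSections, assoc, Proj.basicOpenIsoSpec_inv_ι,
    CommRingCat.ofHom_comp, Spec.map_comp, awayLift]
  simp only [← assoc]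
  congr 2
  have h4 : IsLocalization.map (M := .powers t) (T := .powers (f t)) (Localization.Away (f t)) f
      (by rw [← Submonoid.map_le_iff_le_comap, Submonoid.map_powers]) =
      (algebraMap Γ(Y, ⊤) (Localization.Away (f t))).comp
        (IsLocalization.Away.lift (S := Localization.Away t) t ht) := by
    refine IsLocalization.ringHom_ext (Submonoid.powers t) ?_
    ext x
    simp
  rw [h4, CommRingCat.ofHom_comp, Spec.map_comp]
  simp only [← assoc]
  congr 1
  simp only [assoc, basicOpenIsoSpecAway, IsOpenImmersion.isoOfRangeEq_hom_fac]
  refine (congrArg (_ ≫ ·) (morphismRestrict_ι _ _)).trans ?_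
  exact Scheme.isoOfEq_inv_ι_assoc _ _ _

end

variable {K : Type u} [Field K] {V : Type u} [AddCommGroup V] [Module K V]

theorem ι_mem_symDeg (v : V) : SymmetricAlgebra.ι K V v ∈ symDeg K V 1 := by simp [symDeg]

/-- The chart of `ℙ(V)` where `v` does not vanish. -/
def chart (v : V) :
    Spec (.of (Away (symDeg K V) (SymmetricAlgebra.ι K V v))) ⟶ projSpace K V :=
  Proj.awayι (symDeg K V) _ (ι_mem_symDeg v) one_pos

instance (v : V) : IsOpenImmersion (chart (K := K) v) :=
  inferInstanceAs (IsOpenImmersion (Proj.awayι (symDeg K V) _ (ι_mem_symDeg v) one_pos))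

theorem chart_hom (v : V) : chart (K := K) v ≫ projSpaceHom K V =
    Spec.map (ofHom ((fromZeroRingHom (symDeg K V)
      (.powers (SymmetricAlgebra.ι K V v))).comp (algebraMap K (symDeg K V 0)))) := by
  refine (Proj.awayι_toSpecZero_assoc (symDeg K V) _ _ _ _).trans ?_
  rw [← Spec.map_comp]
  rfl

variable {A : Type u} [CommRing A] [Algebra K A]

/-- The functions on the chart of `ℙ(V)` where `v` does not vanish, at the point `φ`. -/
def chartHom (φ : V →ₗ[K] A) {v : V} (hv : IsUnit (φ v)) :
    Away (symDeg K V) (SymmetricAlgebra.ι K V v) →+* A :=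
  awayLift (symDeg K V) (SymmetricAlgebra.lift φ).toRingHom
    (t := SymmetricAlgebra.ι K V v) (by
      change IsUnit (SymmetricAlgebra.lift φ (SymmetricAlgebra.ι K V v))
      rwa [SymmetricAlgebra.lift_ι_apply])

theorem chartHom_mk (φ : V →ₗ[K] A) {v : V} (hv : IsUnit (φ v)) (n : ℕ) (a) (ha) :
    chartHom φ hv (Away.mk (symDeg K V) (ι_mem_symDeg v) n a ha) * φ v ^ n =
      SymmetricAlgebra.lift φ a := by
  have h := awayLift_mk (symDeg K V) (SymmetricAlgebra.lift φ).toRingHom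
    (t := SymmetricAlgebra.ι K V v) (by
      change IsUnit (SymmetricAlgebra.lift φ (SymmetricAlgebra.ι K V v))
      rwa [SymmetricAlgebra.lift_ι_apply]) (ι_mem_symDeg v) n a ha
  have h2 : (SymmetricAlgebra.lift φ).toRingHom (SymmetricAlgebra.ι K V v) = φ v :=
    SymmetricAlgebra.lift_ι_apply φ v
  exact (congrArg (fun z => chartHom φ hv (Away.mk (symDeg K V) (ι_mem_symDeg v) n a ha) * z ^ n)
    h2.symm).trans h

theorem projPoint_eq (φ : V →ₗ[K] A) (hφ : Ideal.span (Set.range φ) = ⊤) {v : V}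
    (hv : IsUnit (φ v)) : projPoint φ hφ = Spec.map (ofHom (chartHom φ hv)) ≫ chart v := by
  have hu : IsUnit ((SymmetricAlgebra.lift φ).toRingHom (SymmetricAlgebra.ι K V v)) := by
    change IsUnit (SymmetricAlgebra.lift φ (SymmetricAlgebra.ι K V v))
    rwa [SymmetricAlgebra.lift_ι_apply]
  refine (fromOfGlobalSections_eq (symDeg K V) _ _ one_pos (ι_mem_symDeg v)
    (hu.map (Scheme.ΓSpecIso (.of A)).inv.hom)).trans ?_
  refine (assoc _ _ _).symm.trans ?_
  refine congrArg (· ≫ Proj.awayι (symDeg K V) _ (ι_mem_symDeg v) one_pos) ?_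
  have h1 : awayLift (symDeg K V) ((Scheme.ΓSpecIso (.of A)).inv.hom.comp
      (SymmetricAlgebra.lift φ).toRingHom) (hu.map (Scheme.ΓSpecIso (.of A)).inv.hom) =
      (Scheme.ΓSpecIso (.of A)).inv.hom.comp (chartHom φ hv) := by
    rw [awayLift, chartHom, awayLift, ← RingHom.comp_assoc]
    congr 1
    refine IsLocalization.ringHom_ext (Submonoid.powers (SymmetricAlgebra.ι K V v)) ?_
    ext x
    simp
  rw [h1, CommRingCat.ofHom_comp, Spec.map_comp]
  refine (assoc _ _ _).symm.trans ?_
  have h2 : (Spec (.of A)).toSpecΓ ≫ Spec.map (Scheme.ΓSpecIso (.of A)).inv = 𝟙 _ :=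
    toSpecΓ_SpecMap_ΓSpecIso_inv _
  exact (congrArg (· ≫ _) h2).trans (id_comp _)

theorem projPoint_hom (φ : V →ₗ[K] A) (hφ : Ideal.span (Set.range φ) = ⊤) :
    projPoint φ hφ ≫ projSpaceHom K V = Spec.map (ofHom (algebraMap K A)) := by
  refine (Proj.fromOfGlobalSections_toSpecZero_assoc (symDeg K V) _ _ _).trans ?_
  rw [RingHom.comp_assoc, CommRingCat.ofHom_comp, Spec.map_comp]
  have h2 : (Spec (.of A)).toSpecΓ ≫ Spec.map (Scheme.ΓSpecIso (.of A)).inv = 𝟙 _ :=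
    toSpecΓ_SpecMap_ΓSpecIso_inv _
  simp only [assoc]
  refine (assoc _ _ _).symm.trans ((congrArg (· ≫ _) h2).trans ((id_comp _).trans ?_))
  rw [← Spec.map_comp, ← CommRingCat.ofHom_comp]
  congr 2
  ext x
  exact (SymmetricAlgebra.lift φ).commutes x

theorem exists_isUnit_of_span [IsLocalRing A] (φ : V →ₗ[K] A)
    (hφ : Ideal.span (Set.range φ) = ⊤) : ∃ v, IsUnit (φ v) := by
  by_contra h
  push Not at h
  have h1 : Ideal.span (Set.range φ) ≤ IsLocalRing.maximalIdeal A := by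
    rw [Ideal.span_le]
    rintro _ ⟨v, rfl⟩
    exact h v
  rw [hφ] at h1
  exact (IsLocalRing.maximalIdeal.isMaximal A).ne_top (top_le_iff.1 h1)

theorem span_of_isUnit (φ : V →ₗ[K] A) {v : V} (hv : IsUnit (φ v)) :
    Ideal.span (Set.range φ) = ⊤ :=
  Ideal.eq_top_of_isUnit_mem _ (Ideal.subset_span ⟨v, rfl⟩) hv

/-- Points of projective space are compatible with base change. -/
theorem Spec_map_projPoint [IsLocalRing A] {B : Type u} [CommRing B] [Algebra K B] (g : A →ₐ[K] B)
    (φ : V →ₗ[K] A) (hφ : Ideal.span (Set.range φ) = ⊤) (ψ : V →ₗ[K] B)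
    (hψ : Ideal.span (Set.range ψ) = ⊤) (h : ∀ v, ψ v = g (φ v)) :
    Spec.map (ofHom g.toRingHom) ≫ projPoint φ hφ = projPoint ψ hψ := by
  obtain ⟨v, hv⟩ := exists_isUnit_of_span φ hφ
  have hv' : IsUnit (ψ v) := by
    rw [h]
    exact hv.map g
  rw [projPoint_eq φ hφ hv, projPoint_eq ψ hψ hv', ← assoc, ← Spec.map_comp,
    ← CommRingCat.ofHom_comp]
  congr 3
  rw [chartHom, chartHom, awayLift, awayLift, ← RingHom.comp_assoc]
  congr 1
  refine IsLocalization.ringHom_ext (Submonoid.powers (SymmetricAlgebra.ι K V v)) ?_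
  have h1 : SymmetricAlgebra.lift ψ = g.comp (SymmetricAlgebra.lift φ) := by
    ext w
    simp [h]
  ext x
  simp [h1]

theorem lift_smul_of_mem (φ : V →ₗ[K] A) (c : A) (ψ : V →ₗ[K] A) (h : ∀ v, ψ v = c * φ v) (n : ℕ)
    {a : SymmetricAlgebra K V} (ha : a ∈ symDeg K V n) :
    SymmetricAlgebra.lift ψ a = c ^ n * SymmetricAlgebra.lift φ a := by
  induction ha using Submodule.pow_induction_on_left' with
  | algebraMap r => simp
  | add x y i hx hy ihx ihy => rw [map_add, ihx, ihy, map_add, mul_add]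
  | mem_mul m hm i x hx ih =>
    obtain ⟨w, rfl⟩ := hm
    rw [map_mul, map_mul, ih, SymmetricAlgebra.lift_ι_apply, SymmetricAlgebra.lift_ι_apply, h,
      Nat.succ_eq_add_one]
    ring

/-- Two surjections define the same point of projective space if and only if they are
proportional. -/
theorem projPoint_eq_iff [IsLocalRing A] (φ : V →ₗ[K] A) (hφ : Ideal.span (Set.range φ) = ⊤)
    (ψ : V →ₗ[K] A) (hψ : Ideal.span (Set.range ψ) = ⊤) :
    projPoint φ hφ = projPoint ψ hψ ↔ ∃ c, IsUnit c ∧ ∀ v, ψ v = c * φ v := by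
  obtain ⟨v, hv⟩ := exists_isUnit_of_span φ hφ
  constructor
  · intro h
    have hv' : IsUnit (ψ v) := by
      have h1 := congrArg (fun k => k ⁻¹ᵁ Proj.basicOpen (symDeg K V) (SymmetricAlgebra.ι K V v)) h
      have h2 := Proj.fromOfGlobalSections_preimage_basicOpen (symDeg K V)
        ((Scheme.ΓSpecIso (.of A)).inv.hom.comp (SymmetricAlgebra.lift φ).toRingHom)
      have h3 : IsUnit (((Scheme.ΓSpecIso (.of A)).inv.hom.comp
          (SymmetricAlgebra.lift φ).toRingHom) (SymmetricAlgebra.ι K V v)) := by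
        refine IsUnit.map (Scheme.ΓSpecIso (.of A)).inv.hom ?_
        change IsUnit (SymmetricAlgebra.lift φ (SymmetricAlgebra.ι K V v))
        rwa [SymmetricAlgebra.lift_ι_apply]
      simp only [projPoint] at h1
      rw [Proj.fromOfGlobalSections_preimage_basicOpen _ _ _ one_pos (ι_mem_symDeg v),
        Proj.fromOfGlobalSections_preimage_basicOpen _ _ _ one_pos (ι_mem_symDeg v),
        Scheme.basicOpen_of_isUnit _ h3] at h1
      have h4 : IsUnit (((Scheme.ΓSpecIso (.of A)).inv.hom.comp
          (SymmetricAlgebra.lift ψ).toRingHom) (SymmetricAlgebra.ι K V v)) :=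
        (Spec (.of A)).toRingedSpace.isUnit_of_isUnit_germ ⊤ _ fun x hx =>
          ((Spec (.of A)).mem_basicOpen _ x hx).1 (h1 ▸ hx)
      have h5 := h4.map (Scheme.ΓSpecIso (.of A)).hom.hom
      have h6 : (Scheme.ΓSpecIso (.of A)).hom.hom (((Scheme.ΓSpecIso (.of A)).inv.hom.comp
          (SymmetricAlgebra.lift ψ).toRingHom) (SymmetricAlgebra.ι K V v)) =
          SymmetricAlgebra.lift ψ (SymmetricAlgebra.ι K V v) :=
        (Scheme.ΓSpecIso (.of A)).inv_hom_id_apply _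
      rwa [h6, SymmetricAlgebra.lift_ι_apply] at h5
    rw [projPoint_eq φ hφ hv, projPoint_eq ψ hψ hv', cancel_mono] at h
    have h1 : chartHom φ hv = chartHom ψ hv' := by
      have := Spec.map_injective h
      exact congrArg CommRingCat.Hom.hom this
    obtain ⟨u, hu⟩ := hv
    refine ⟨ψ v * ↑u⁻¹, hv'.mul u⁻¹.isUnit, fun w => ?_⟩
    have hw : SymmetricAlgebra.ι K V w ∈ symDeg K V (1 • 1) := ι_mem_symDeg w
    have h2 := chartHom_mk φ ⟨u, hu⟩ 1 _ hw
    have h3 := chartHom_mk ψ hv' 1 _ hw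
    rw [pow_one, SymmetricAlgebra.lift_ι_apply] at h2 h3
    rw [← h3, ← h2, h1, ← hu]
    calc _ = chartHom ψ hv' (Away.mk (symDeg K V) (ι_mem_symDeg v) 1 _ hw) * ψ v * (↑u⁻¹ * ↑u) := by
          rw [Units.inv_mul, mul_one]
      _ = _ := by ring
  · rintro ⟨c, hc, h⟩
    have hv' : IsUnit (ψ v) := by
      rw [h]
      exact hc.mul hv
    rw [projPoint_eq φ hφ hv, projPoint_eq ψ hψ hv']
    congr 3
    ext x
    obtain ⟨n, a, ha, rfl⟩ := Away.mk_surjective (symDeg K V) (ι_mem_symDeg v) x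
    have h2 := chartHom_mk φ hv n a ha
    have h3 := chartHom_mk ψ hv' n a ha
    rw [lift_smul_of_mem φ c ψ h (n • 1) ha, ← h2, h, smul_eq_mul, mul_one, mul_pow] at h3
    refine ((hc.pow n).mul (hv.pow n)).mul_right_cancel ?_
    rw [h3]
    ring

/-- Every point of projective space with values in a local algebra is given by a surjection. -/
theorem exists_projPoint [IsLocalRing A] (h : Spec (.of A) ⟶ projSpace K V)
    (hh : h ≫ projSpaceHom K V = Spec.map (ofHom (algebraMap K A))) :
    ∃ (φ : V →ₗ[K] A) (hφ : Ideal.span (Set.range φ) = ⊤), h = projPoint φ hφ := by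
  have h1 : ⨆ v, Proj.basicOpen (symDeg K V) (SymmetricAlgebra.ι K V v) = ⊤ := by
    refine Proj.iSup_basicOpen_eq_top' _ _ (fun v => ⟨1, ι_mem_symDeg v⟩) ?_
    rw [eq_top_iff]
    rintro a -
    induction a using SymmetricAlgebra.induction with
    | algebraMap r =>
      have hr : algebraMap K (SymmetricAlgebra K V) r ∈ symDeg K V 0 := by
        rw [symDeg, pow_zero]
        exact Submodule.algebraMap_mem r
      exact Subalgebra.algebraMap_mem (Algebra.adjoin (symDeg K V 0) _)
        (⟨_, hr⟩ : symDeg K V 0)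
    | ι x => exact Algebra.subset_adjoin ⟨x, rfl⟩
    | mul a b ha hb => exact mul_mem ha hb
    | add a b ha hb => exact add_mem ha hb
  -- A local scheme is mapped into one chart, the functions on which are generated by all `w / v`.
  obtain ⟨v, hv⟩ : ∃ v, h (IsLocalRing.closedPoint A) ∈
      Proj.basicOpen (symDeg K V) (SymmetricAlgebra.ι K V v) := by
    have : h (IsLocalRing.closedPoint A) ∈
        ⨆ v, Proj.basicOpen (symDeg K V) (SymmetricAlgebra.ι K V v) := by
      rw [h1]
      trivial
    exact TopologicalSpace.Opens.mem_iSup.1 this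
  have h2 : h ⁻¹ᵁ Proj.basicOpen (symDeg K V) (SymmetricAlgebra.ι K V v) = ⊤ :=
    IsLocalRing.closed_point_mem_iff.1 hv
  have h3 : Set.range h ⊆
      Set.range (chart (K := K) v) := by
    rintro _ ⟨x, rfl⟩
    have h4 : x ∈ h ⁻¹ᵁ Proj.basicOpen (symDeg K V) (SymmetricAlgebra.ι K V v) := by
      rw [h2]
      trivial
    rw [← Proj.opensRange_awayι (symDeg K V) _ (ι_mem_symDeg v) one_pos] at h4
    exact h4
  obtain ⟨g, hg⟩ := Spec.map_surjective
    (IsOpenImmersion.lift (chart (K := K) v) h h3)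
  have h4 : Spec.map g ≫ chart v = h := by
    rw [hg]
    exact IsOpenImmersion.lift_fac _ _ _
  have h5 : ∀ c : K, g.hom (fromZeroRingHom (symDeg K V) _ (algebraMap K (symDeg K V 0) c)) =
      algebraMap K A c := by
    rw [← h4, assoc, chart_hom, ← Spec.map_comp] at hh
    have := Spec.map_injective hh
    exact fun c => congrArg (fun k => k.hom c) this
  have h1' : ∀ w, SymmetricAlgebra.ι K V w ∈ symDeg K V (1 • 1) := ι_mem_symDeg
  let φ : V →ₗ[K] A :=
    { toFun := fun w => g.hom (Away.mk (symDeg K V) (ι_mem_symDeg v) 1 _ (h1' w))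
      map_add' := fun w w' => by
        rw [← map_add]
        congr 1
        ext
        rw [HomogeneousLocalization.val_add, Away.val_mk, Away.val_mk, Away.val_mk, map_add,
          Localization.add_mk_self]
      map_smul' := fun c w => by
        rw [RingHom.id_apply, Algebra.smul_def, ← h5, ← map_mul]
        congr 1
        ext
        rw [HomogeneousLocalization.val_mul, Away.val_mk, Away.val_mk, map_smul]
        have : (fromZeroRingHom (symDeg K V) (.powers (SymmetricAlgebra.ι K V v))
          (algebraMap K (symDeg K V 0) c)).val = Localization.mk
            (algebraMap K (SymmetricAlgebra K V) c) 1 := rfl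
        rw [this, Localization.mk_mul, one_mul, Algebra.smul_def] }
  have hφv : φ v = 1 := by
    refine Eq.trans ?_ g.hom.map_one
    refine congrArg g.hom ?_
    ext
    rw [Away.val_mk, HomogeneousLocalization.val_one]
    have h6 : (⟨SymmetricAlgebra.ι K V v ^ 1, 1, rfl⟩ :
        Submonoid.powers (SymmetricAlgebra.ι K V v)) = ⟨SymmetricAlgebra.ι K V v, 1, pow_one _⟩ :=
      Subtype.ext (pow_one _)
    exact (congrArg (fun k => Localization.mk (SymmetricAlgebra.ι K V v) k) h6).trans
      (Localization.mk_self (⟨SymmetricAlgebra.ι K V v, 1, pow_one _⟩ :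
        Submonoid.powers (SymmetricAlgebra.ι K V v)))
  have hv' : IsUnit (φ v) := by
    rw [hφv]
    exact isUnit_one
  refine ⟨φ, span_of_isUnit φ hv', ?_⟩
  rw [projPoint_eq φ _ hv', ← h4]
  congr 2
  ext x
  obtain ⟨n, a, ha, rfl⟩ := Away.mk_surjective (symDeg K V) (ι_mem_symDeg v) x
  have h6 := chartHom_mk φ hv' n a ha
  rw [hφv, one_pow, mul_one] at h6
  refine Eq.trans ?_ h6.symm
  have key : ∀ (n : ℕ) (a : SymmetricAlgebra K V) (_ : a ∈ symDeg K V n)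
      (ha : a ∈ symDeg K V (n • 1)),
      g.hom (Away.mk (symDeg K V) (ι_mem_symDeg v) n a ha) = SymmetricAlgebra.lift φ a := by
    intro n a hn
    induction hn using Submodule.pow_induction_on_left' with
    | algebraMap r =>
      intro ha
      rw [AlgHom.commutes, ← h5]
      refine congrArg g.hom ?_
      ext
      rw [Away.val_mk]
      exact congrArg (fun k => Localization.mk (algebraMap K (SymmetricAlgebra K V) r) k)
        (Subtype.ext (pow_zero _))
    | add x y i hx hy ihx ihy =>
      intro ha
      rw [map_add, ← ihx (by simpa using hx), ← ihy (by simpa using hy), ← map_add]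
      congr 1
      ext
      rw [HomogeneousLocalization.val_add, Away.val_mk, Away.val_mk, Away.val_mk,
        Localization.add_mk_self]
    | mem_mul m hm i x hx ih =>
      obtain ⟨w, rfl⟩ := hm
      intro ha
      rw [map_mul, ← ih (by simpa using hx), SymmetricAlgebra.lift_ι_apply]
      change _ = g.hom _ * g.hom _
      rw [← map_mul]
      congr 1
      ext
      rw [HomogeneousLocalization.val_mul, Away.val_mk, Away.val_mk, Away.val_mk,
        Localization.mk_mul]
      congr 1
      refine Subtype.ext ?_
      change _ ^ (i + 1) = _ ^ 1 * _ ^ i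
      rw [pow_add, pow_one, mul_comm]
  exact key n a (by simpa using ha) ha

end ProjectivePoints

/-! ### Lines and quotients in coordinates -/

section Coordinates

variable {E : Type u} [Field E] {A : Type u} [CommRing A] [Algebra E A] [IsLocalRing A] {d : ℕ}
  {V : Type u} [AddCommGroup V] [Module E V] (b : Module.Basis (Fin d) E V)

omit [IsLocalRing A] in
theorem isUnit_constr {c : Fin d → A} {j : Fin d} (hj : IsUnit (c j)) :
    IsUnit (b.constr E c (b j)) := by
  rwa [b.constr_basis]

theorem exists_isUnit_of_constr (φ : V →ₗ[E] A) (hφ : Ideal.span (Set.range φ) = ⊤) :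
    ∃ j, IsUnit (φ (b j)) := by
  by_contra h
  push Not at h
  obtain ⟨v, hv⟩ := exists_isUnit_of_span φ hφ
  have h1 : φ v = ∑ j, algebraMap E A (b.repr v j) * φ (b j) := by
    conv_lhs => rw [← b.sum_repr v, map_sum]
    simp [Algebra.smul_def]
  refine (IsLocalRing.mem_maximalIdeal _).1 ?_ hv
  rw [h1]
  exact Ideal.sum_mem _ fun j _ => Ideal.mul_mem_left _ _ ((IsLocalRing.mem_maximalIdeal _).2 (h j))

/-- The `A`-point of `ℙ(V)` with coordinates `c`. -/
def basisPoint (c : Fin d → A) (hc : ∃ j, IsUnit (c j)) : Spec (.of A) ⟶ projSpace E V :=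
  projPoint (b.constr E c) (span_of_isUnit _ (isUnit_constr b hc.choose_spec))

omit [IsLocalRing A] in
theorem basisPoint_hom (c : Fin d → A) (hc : ∃ j, IsUnit (c j)) :
    basisPoint b c hc ≫ projSpaceHom E V = Spec.map (ofHom (algebraMap E A)) :=
  projPoint_hom _ _

theorem basisPoint_eq_iff (c c' : Fin d → A) (hc : ∃ j, IsUnit (c j)) (hc' : ∃ j, IsUnit (c' j)) :
    basisPoint b c hc = basisPoint b c' hc' ↔ ∃ a, IsUnit a ∧ ∀ j, c' j = a * c j := by
  rw [basisPoint, basisPoint, projPoint_eq_iff]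
  refine exists_congr fun a => and_congr_right fun _ => ⟨fun h j => ?_, fun h v => ?_⟩
  · simpa only [b.constr_basis] using h (b j)
  · rw [b.constr_apply_fintype E, b.constr_apply_fintype E, Finset.mul_sum]
    refine Finset.sum_congr rfl fun j _ => ?_
    rw [h, Algebra.smul_def, Algebra.smul_def]
    ring

theorem exists_basisPoint (h : Spec (.of A) ⟶ projSpace E V)
    (hh : h ≫ projSpaceHom E V = Spec.map (ofHom (algebraMap E A))) :
    ∃ (c : Fin d → A) (hc : ∃ j, IsUnit (c j)), h = basisPoint b c hc := by
  obtain ⟨φ, hφ, rfl⟩ := exists_projPoint h hh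
  refine ⟨fun j => φ (b j), exists_isUnit_of_constr b φ hφ, ?_⟩
  have : φ = b.constr E fun j => φ (b j) := b.ext fun j => by rw [b.constr_basis]
  unfold basisPoint
  congr 1

theorem Spec_map_basisPoint {B : Type u} [CommRing B] [Algebra E B] [IsLocalRing B] (g : A →ₐ[E] B)
    (c : Fin d → A) (hc : ∃ j, IsUnit (c j)) :
    Spec.map (ofHom g.toRingHom) ≫ basisPoint b c hc =
      basisPoint b (fun j => g (c j)) (hc.imp fun _ h => h.map g) := by
  refine Spec_map_projPoint g _ _ _ _ fun v => ?_
  rw [b.constr_apply_fintype E, b.constr_apply_fintype E, map_sum]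
  simp

variable {W : Type u} [AddCommGroup W] [Module A W] (b' : Module.Basis (Fin d) A W)

/-- `W` is the scalar extension of `V`: the map `s` from `V` to `W` is semilinear and carries the
basis `b` to the basis `b'`. -/
def IsExt (s : V → W) : Prop := ∀ v, s v = ∑ j, algebraMap E A (b.repr v j) • b' j

variable {b b'} {s : V → W}

omit [IsLocalRing A] in
theorem IsExt.apply_basis (hs : IsExt b b' s) (j : Fin d) : s (b j) = b' j := by
  rw [hs, Finset.sum_eq_single j]
  · simp
  · intro k _ hk
    rw [b.repr_self, Finsupp.single_eq_of_ne hk, map_zero, zero_smul]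
  · simp

omit [IsLocalRing A] in
theorem IsExt.repr (hs : IsExt b b' s) (v : V) (j : Fin d) :
    b'.repr (s v) j = algebraMap E A (b.repr v j) := by
  rw [hs, map_sum]
  simp [Finsupp.finsetSum_apply, Finsupp.single_apply, Algebra.smul_def]

omit [IsLocalRing A] in
theorem IsExt.smul (hs : IsExt b b' s) (a : E) (v : V) : s (a • v) = algebraMap E A a • s v := by
  rw [hs, hs, Finset.smul_sum]
  simp [mul_smul]

section Line

variable {N : Type u} [AddCommGroup N] [Module E N] (x₀ : Module.Basis (Fin 1) E N)

variable (b) in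
/-- The basis of `Hom(N, V)` given by a generator of the line `N` and a basis of `V`. -/
def homBasis : Module.Basis (Fin d) E (N →ₗ[E] V) :=
  b.map (LinearEquiv.symm
    { toFun := fun u : N →ₗ[E] V => u (x₀ 0)
      map_add' := fun _ _ => rfl
      map_smul' := fun _ _ => rfl
      invFun := fun v => (x₀.coord 0).smulRight v
      left_inv := fun u => x₀.ext fun j => by simp [Subsingleton.elim j 0]
      right_inv := fun v => by simp })

theorem homBasis_repr (u : N →ₗ[E] V) (j : Fin d) :
    (homBasis b x₀).repr u j = b.repr (u (x₀ 0)) j := rfl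

theorem homBasis_apply (j : Fin d) : homBasis b x₀ j (x₀ 0) = b j := by
  refine b.repr.injective (Finsupp.ext fun k => ?_)
  rw [← homBasis_repr, Module.Basis.repr_self, Module.Basis.repr_self]

/-- A line is classified by the point the coordinates of which are those of a generator. -/
theorem classifiesLine_iff (hs : IsExt b b' s) (L : Submodule A W)
    (h : Spec (.of A) ⟶ dualProjSpace E (N →ₗ[E] V)) :
    ClassifiesLine s L h ↔ ∃ (ω : W) (hω : ∃ j, IsUnit (b'.repr ω j)),
      L = Submodule.span A {ω} ∧ h = basisPoint (homBasis b x₀).dualBasis (b'.repr ω) hω := by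
  have hspan : ∀ (w : (N →ₗ[E] V) →₀ A), Submodule.span A
      (Set.range fun x : N => w.sum fun u c => c • s (u x)) =
      Submodule.span A {w.sum fun u c => c • s (u (x₀ 0))} := by
    intro w
    refine le_antisymm (Submodule.span_le.2 ?_) (Submodule.span_mono (by
      rw [Set.singleton_subset_iff]
      exact ⟨x₀ 0, rfl⟩))
    rintro _ ⟨x, rfl⟩
    refine Submodule.mem_span_singleton.2 ⟨algebraMap E A (x₀.repr x 0), ?_⟩
    have hx : x = x₀.repr x 0 • x₀ 0 := by
      conv_lhs => rw [← x₀.sum_repr x]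
      simp
    have h1 : ∀ u : N →ₗ[E] V, s (u x) = algebraMap E A (x₀.repr x 0) • s (u (x₀ 0)) := by
      intro u
      rw [← hs.smul, ← map_smul, ← hx]
    simp only [h1, Finsupp.sum, Finset.smul_sum]
    exact Finset.sum_congr rfl fun u _ => smul_comm _ _ _
  constructor
  · rintro ⟨w, φ, hφ, h1, h2, rfl⟩
    have h3 : φ = (homBasis b x₀).dualBasis.constr E
        (b'.repr (w.sum fun u c => c • s (u (x₀ 0)))) := by
      refine (homBasis b x₀).dualBasis.ext fun j => ?_
      rw [Module.Basis.constr_basis, h1, Finsupp.sum, Finsupp.sum, map_sum, Finsupp.finsetSum_apply]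
      refine Finset.sum_congr rfl fun u _ => ?_
      rw [map_smul, Finsupp.smul_apply, hs.repr, smul_eq_mul, Module.Basis.coe_dualBasis,
        Module.Basis.coord_apply, homBasis_repr]
    refine ⟨w.sum fun u c => c • s (u (x₀ 0)), ?_, h2.symm.trans (hspan w), ?_⟩
    · obtain ⟨j, hj⟩ := exists_isUnit_of_constr (homBasis b x₀).dualBasis φ hφ
      refine ⟨j, ?_⟩
      rwa [h3, Module.Basis.constr_basis] at hj
    · unfold basisPoint
      congr 1
  · rintro ⟨ω, hω, rfl, rfl⟩
    have hinj : Injective (homBasis b x₀) := (homBasis b x₀).injective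
    let w : (N →ₗ[E] V) →₀ A := Finsupp.mapDomain (homBasis b x₀) (b'.repr ω)
    have h1 : ∀ {P : Type u} [AddCommGroup P] (f : (N →ₗ[E] V) → A →+ P),
        w.sum (fun u c => f u c) = ∑ j, f (homBasis b x₀ j) (b'.repr ω j) := by
      intro P _ f
      rw [Finsupp.sum_mapDomain_index_addMonoidHom (f := homBasis b x₀)]
      exact Finsupp.sum_fintype _ _ fun j => map_zero _
    refine ⟨w, (homBasis b x₀).dualBasis.constr E (b'.repr ω),
      span_of_isUnit _ (isUnit_constr _ hω.choose_spec), fun l => ?_, ?_, rfl⟩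
    · refine Eq.trans ?_ (h1 fun u => AddMonoidHom.mulRight (algebraMap E A (l u))).symm
      rw [Module.Basis.constr_apply_fintype]
      refine Finset.sum_congr rfl fun j _ => ?_
      have h2 : (homBasis b x₀).dualBasis.equivFun l j = l (homBasis b x₀ j) := by
        rw [Module.Basis.equivFun_apply, Module.Basis.dualBasis_repr]
      rw [h2, Algebra.smul_def, AddMonoidHom.mulRight_apply, mul_comm]
    · rw [hspan]
      congr 2
      refine (h1 fun u => (LinearMap.toSpanSingleton A W (s (u (x₀ 0)))).toAddMonoidHom).trans ?_
      refine Eq.trans ?_ (b'.sum_repr ω)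
      refine Finset.sum_congr rfl fun j _ => ?_
      rw [homBasis_apply, hs.apply_basis]
      rfl

theorem exists_classifiesLine (hs : IsExt b b' s) (x₀ : Module.Basis (Fin 1) E N) (ω : W)
    (hω : ∃ j, IsUnit (b'.repr ω j)) : ∃ h : Spec (.of A) ⟶ dualProjSpace E (N →ₗ[E] V),
      h ≫ projSpaceHom E _ = Spec.map (ofHom (algebraMap E A)) ∧
      ClassifiesLine s (Submodule.span A {ω}) h :=
  ⟨_, basisPoint_hom _ _ hω, (classifiesLine_iff x₀ hs _ _).2 ⟨ω, hω, rfl, rfl⟩⟩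

theorem exists_line (hs : IsExt b b' s) (x₀ : Module.Basis (Fin 1) E N)
    (h : Spec (.of A) ⟶ dualProjSpace E (N →ₗ[E] V))
    (hh : h ≫ projSpaceHom E _ = Spec.map (ofHom (algebraMap E A))) :
    ∃ ω : W, (∃ j, IsUnit (b'.repr ω j)) ∧ ClassifiesLine s (Submodule.span A {ω}) h := by
  obtain ⟨c, hc, rfl⟩ := exists_basisPoint (homBasis b x₀).dualBasis h hh
  obtain ⟨ω, rfl⟩ : ∃ ω, c = b'.repr ω :=
    ⟨b'.equivFun.symm c, (b'.equivFun.apply_symm_apply c).symm⟩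
  exact ⟨ω, hc, (classifiesLine_iff x₀ hs _ _).2 ⟨ω, hc, rfl, rfl⟩⟩

end Line

variable {B : Type u} [CommRing B] [Algebra E B] [IsLocalRing B] (g : A →ₐ[E] B)
  {W₁ : Type u} [AddCommGroup W₁] [Module B W₁] {b₁ : Module.Basis (Fin d) B W₁} {s₁ : V → W₁}

omit [IsLocalRing A] [IsLocalRing B] in
theorem IsExt.repr_map (hs : IsExt b b' s) (hs₁ : IsExt b b₁ s₁) (σ : W →+ W₁)
    (hσ : ∀ (a : A) (w : W), σ (a • w) = g a • σ w) (hσs : ∀ v, σ (s v) = s₁ v) (w : W)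
    (j : Fin d) : b₁.repr (σ w) j = g (b'.repr w j) := by
  conv_lhs => rw [← b'.sum_repr w, map_sum]
  have h1 : ∀ k, σ (b'.repr w k • b' k) = g (b'.repr w k) • b₁ k := fun k => by
    rw [hσ, ← hs.apply_basis, hσs, hs₁.apply_basis]
  simp only [h1, map_sum, map_smul, Module.Basis.repr_self, Finsupp.finsetSum_apply,
    Finsupp.smul_apply, Finsupp.single_apply]
  simp

/-- The points that classify lines are compatible with a scalar extension if and only if the lines
are. -/
theorem classifiesLine_compat {N : Type u} [AddCommGroup N] [Module E N]
    (x₀ : Module.Basis (Fin 1) E N) (hs : IsExt b b' s) (hs₁ : IsExt b b₁ s₁) (σ : W →+ W₁)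
    (hσ : ∀ (a : A) (w : W), σ (a • w) = g a • σ w) (hσs : ∀ v, σ (s v) = s₁ v)
    {L : Submodule A W} {L₁ : Submodule B W₁} {h : Spec (.of A) ⟶ dualProjSpace E (N →ₗ[E] V)}
    {h₁ : Spec (.of B) ⟶ dualProjSpace E (N →ₗ[E] V)} (hL : ClassifiesLine s L h)
    (hL₁ : ClassifiesLine s₁ L₁ h₁) :
    Spec.map (ofHom g.toRingHom) ≫ h = h₁ ↔ ∀ w ∈ L, σ w ∈ L₁ := by
  obtain ⟨ω, hω, rfl, rfl⟩ := (classifiesLine_iff x₀ hs _ _).1 hL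
  obtain ⟨ω₁, hω₁, rfl, rfl⟩ := (classifiesLine_iff x₀ hs₁ _ _).1 hL₁
  rw [Spec_map_basisPoint, basisPoint_eq_iff]
  have h1 := hs.repr_map g hs₁ σ hσ hσs ω
  constructor
  · rintro ⟨a, ⟨a, rfl⟩, h2⟩ w hw
    obtain ⟨c, rfl⟩ := Submodule.mem_span_singleton.1 hw
    rw [hσ]
    refine Submodule.smul_mem _ _ (Submodule.mem_span_singleton.2 ⟨↑a⁻¹, ?_⟩)
    refine b₁.repr.injective (Finsupp.ext fun j => ?_)
    rw [map_smul, Finsupp.smul_apply, h2, h1, smul_eq_mul, ← mul_assoc, Units.inv_mul, one_mul]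
  · intro h2
    obtain ⟨c, hc⟩ := Submodule.mem_span_singleton.1 (h2 ω (Submodule.mem_span_singleton_self ω))
    have h3 : ∀ j, g (b'.repr ω j) = c * b₁.repr ω₁ j := fun j => by
      rw [← h1, ← hc, map_smul, Finsupp.smul_apply, smul_eq_mul]
    obtain ⟨j, hj⟩ := hω
    have h4 : IsUnit c := by
      have := hj.map g
      rw [h3] at this
      exact isUnit_of_mul_isUnit_left this
    obtain ⟨c, rfl⟩ := h4
    refine ⟨↑c⁻¹, c⁻¹.isUnit, fun j => ?_⟩
    rw [h3, ← mul_assoc, Units.inv_mul, one_mul]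

section Quotient

variable {Q : Type u} [AddCommGroup Q] [Module A Q] (π : W →ₗ[A] Q)

omit [IsLocalRing A] in
theorem IsExt.repr_sum (hs : IsExt b b' s) (t : Q →ₗ[A] A) (w : W) :
    t (π w) = ∑ j, b'.repr w j * t (π (s (b j))) := by
  conv_lhs => rw [← b'.sum_repr w]
  rw [map_sum, map_sum]
  refine Finset.sum_congr rfl fun j _ => ?_
  rw [map_smul, map_smul, smul_eq_mul, hs.apply_basis]

/-- A quotient with coordinates `c` is classified by the point with coordinates `c`. -/
theorem classifiesQuotient_iff (hs : IsExt b b' s) (h : Spec (.of A) ⟶ projSpace E V) :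
    ClassifiesQuotient (fun v => π (s v)) h ↔ ∃ (t : Q ≃ₗ[A] A)
      (ht : ∃ j, IsUnit (t (π (s (b j))))), h = basisPoint b (fun j => t (π (s (b j)))) ht := by
  constructor
  · rintro ⟨t, φ, hφ, h1, rfl⟩
    have h3 : φ = b.constr E fun j => t (π (s (b j))) := b.ext fun j => by
      rw [b.constr_basis, h1]
    refine ⟨t, ?_, ?_⟩
    · obtain ⟨j, hj⟩ := exists_isUnit_of_constr b φ hφ
      exact ⟨j, h1 (b j) ▸ hj⟩
    · unfold basisPoint
      congr 1
  · rintro ⟨t, ht, rfl⟩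
    refine ⟨t, b.constr E fun j => t (π (s (b j))),
      span_of_isUnit _ (isUnit_constr b ht.choose_spec), fun v => ?_, rfl⟩
    have h1 := hs.repr_sum π t.toLinearMap (s v)
    simp only [LinearEquiv.coe_coe, hs.repr] at h1
    rw [h1, b.constr_apply_fintype E]
    refine Finset.sum_congr rfl fun j _ => ?_
    rw [b.equivFun_apply, Algebra.smul_def]

theorem exists_classifiesQuotient (hs : IsExt b b' s) (t : Q ≃ₗ[A] A)
    (hπ : Surjective π) : ∃ h : Spec (.of A) ⟶ projSpace E V,
      h ≫ projSpaceHom E _ = Spec.map (ofHom (algebraMap E A)) ∧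
      ClassifiesQuotient (fun v => π (s v)) h := by
  have ht : ∃ j, IsUnit (t (π (s (b j)))) := by
    by_contra hn
    push Not at hn
    obtain ⟨w, hw⟩ := hπ (t.symm 1)
    have h1 := hs.repr_sum π t.toLinearMap w
    simp only [LinearEquiv.coe_coe, hw, LinearEquiv.apply_symm_apply] at h1
    refine (IsLocalRing.mem_maximalIdeal (1 : A)).1 ?_ isUnit_one
    rw [h1]
    exact Ideal.sum_mem _ fun j _ =>
      Ideal.mul_mem_left _ _ ((IsLocalRing.mem_maximalIdeal _).2 (hn j))
  exact ⟨_, basisPoint_hom _ _ ht, (classifiesQuotient_iff π hs _).2 ⟨t, ht, rfl⟩⟩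

theorem exists_quotient_coords (hs : IsExt b b' s) (h : Spec (.of A) ⟶ projSpace E V)
    (hh : h ≫ projSpaceHom E V = Spec.map (ofHom (algebraMap E A))) :
    ∃ c : Fin d → A, (∃ j, IsUnit (c j)) ∧ ∀ {Q : Type u} [AddCommGroup Q] [Module A Q]
      (π : W →ₗ[A] Q) (t : Q ≃ₗ[A] A), (∀ j, t (π (b' j)) = c j) →
      ClassifiesQuotient (fun v => π (s v)) h := by
  obtain ⟨c, hc, rfl⟩ := exists_basisPoint b h hh
  refine ⟨c, hc, fun π t ht => (classifiesQuotient_iff π hs _).2 ?_⟩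
  obtain rfl : (fun j => t (π (s (b j)))) = c := funext fun j => by rw [hs.apply_basis, ht]
  exact ⟨t, hc, rfl⟩

variable {Q₁ : Type u} [AddCommGroup Q₁] [Module B Q₁] (π₁ : W₁ →ₗ[B] Q₁)

/-- The points that classify quotients are compatible with a scalar extension if and only if the
kernels are. -/
theorem classifiesQuotient_compat (hs : IsExt b b' s) (hs₁ : IsExt b b₁ s₁) (σ : W →+ W₁)
    (hσ : ∀ (a : A) (w : W), σ (a • w) = g a • σ w) (hσs : ∀ v, σ (s v) = s₁ v)
    {h : Spec (.of A) ⟶ projSpace E V} {h₁ : Spec (.of B) ⟶ projSpace E V}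
    (hQ : ClassifiesQuotient (fun v => π (s v)) h)
    (hQ₁ : ClassifiesQuotient (fun v => π₁ (s₁ v)) h₁) :
    Spec.map (ofHom g.toRingHom) ≫ h = h₁ ↔ ∀ w, π w = 0 → π₁ (σ w) = 0 := by
  obtain ⟨t, ht, rfl⟩ := (classifiesQuotient_iff π hs _).1 hQ
  obtain ⟨t₁, ht₁, rfl⟩ := (classifiesQuotient_iff π₁ hs₁ _).1 hQ₁
  rw [Spec_map_basisPoint, basisPoint_eq_iff]
  have h1 := fun w => hs.repr_sum π t.toLinearMap w
  have h2 := fun w => hs₁.repr_sum π₁ t₁.toLinearMap w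
  simp only [LinearEquiv.coe_coe] at h1 h2
  constructor
  · rintro ⟨a, ha, h3⟩ w hw
    refine t₁.injective ?_
    rw [map_zero, h2]
    have h4 := congrArg g (h1 w)
    rw [hw, map_zero, map_zero, map_sum] at h4
    refine Eq.trans (Finset.sum_congr rfl fun j _ => ?_)
      ((Finset.mul_sum _ _ a).symm.trans ((congrArg (a * ·) h4.symm).trans (mul_zero a)))
    rw [h3, map_mul, hs.repr_map g hs₁ σ hσ hσs]
    ring
  · intro h3
    obtain ⟨j₀, ⟨e, he⟩⟩ := ht
    have key : ∀ j, t₁ (π₁ (s₁ (b j))) =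
        t₁ (π₁ (s₁ (b j₀))) * g ↑e⁻¹ * g (t (π (s (b j)))) := by
      intro j
      have h4 : π (s (b j) - (t (π (s (b j))) * ↑e⁻¹) • s (b j₀)) = 0 := by
        refine t.injective ?_
        rw [map_sub, map_smul, map_sub, map_smul, map_zero, ← he, smul_eq_mul, mul_assoc,
          Units.inv_mul, mul_one, sub_self]
      have h5 := congrArg t₁ (h3 _ h4)
      rw [map_sub, hσ, hσs, hσs, map_sub, map_smul, map_sub, map_smul, map_zero, sub_eq_zero,
        map_mul, smul_eq_mul] at h5
      rw [h5]
      ring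
    refine ⟨t₁ (π₁ (s₁ (b j₀))) * g ↑e⁻¹, ?_, key⟩
    obtain ⟨j, hj⟩ := ht₁
    rw [key j] at hj
    exact isUnit_of_mul_isUnit_left hj

end Quotient

end Coordinates

/-! ### Global sections over affine schemes -/

section GlobalSections

variable {A B C : Type u} [CommRing A] [CommRing B] [CommRing C]

/-- The ring `A` as the ring of global functions on `Spec A`. -/
def scal : A ≃+* Γ(Spec (of A), ⊤) :=
  (Scheme.ΓSpecIso (of A)).commRingCatIsoToRingEquiv.symm

/-- The action of an arrow of sheaves of modules on global sections. -/
def glob {V : (Spec (of A)).Modules} {W : (Spec (of B)).Modules}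
    (Θ : (⟨_, V⟩ : QMod) ⟶ ⟨_, W⟩) : gsec V →+ gsec W := on Θ ⊤ ⊤

variable {V : (Spec (of A)).Modules} {W : (Spec (of B)).Modules}

/-- The elements of the module of global sections as sections of the sheaf. -/
def sec : gsec V ≃+ Γ(V, ⊤) := AddEquiv.refl Γ(V, ⊤)

theorem sec_smul (a : A) (x : gsec V) : sec (a • x) = scal a • sec x := rfl

theorem glob_vert {V' : (Spec (of A)).Modules} (m : V ⟶ V') (x : gsec V) :
    glob (vert m) x = gmap m x := on_vert_self m ⊤ x

theorem glob_id (x : gsec V) : glob (𝟙 (⟨_, V⟩ : QMod)) x = x := rs_self V ⊤ x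

theorem glob_comp {U : (Spec (of C)).Modules} (Θ : (⟨_, V⟩ : QMod) ⟶ ⟨_, W⟩)
    (Ψ : (⟨_, W⟩ : QMod) ⟶ ⟨_, U⟩) (x : gsec V) : glob (Θ ≫ Ψ) x = glob Ψ (glob Θ x) :=
  on_comp Θ Ψ ⊤ le_top le_top x

theorem pullSec_eq (t : Spec (of B) ⟶ Spec (of A)) (x : gsec V) :
    pullSec t V x = glob (pbArr t V) x :=
  (rs_self ((Scheme.Modules.pullback t).obj V) ⊤ (pullSec t V x)).symm

theorem pl_scal (g : A →+* B) (a : A) :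
    pl (Spec.map (ofHom g)) ⊤ ⊤ (scal a) = scal (g a) := by
  rw [pl_eq_appLE _ le_top]
  have h1 := congrArg (fun m => m.hom a) (Scheme.ΓSpecIso_inv_naturality (ofHom g))
  refine Eq.trans ?_ h1.symm
  rfl

theorem glob_smul (Θ : (⟨_, V⟩ : QMod) ⟶ ⟨_, W⟩) (g : A →+* B)
    (hΘ : bs Θ = Spec.map (ofHom g)) (a : A) (x : gsec V) :
    glob Θ (a • x) = g a • glob Θ x := by
  refine (on_smul Θ (U := ⊤) (W := ⊤) le_top (scal a) x).trans ?_
  have h1 : pl (bs Θ) ⊤ ⊤ (scal a) = scal (g a) := by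
    rw [hΘ]
    exact pl_scal g a
  rw [h1]
  rfl

theorem sec_gmap {V' : (Spec (of A)).Modules} (m : V ⟶ V') (x : gsec V) :
    sec (gmap m x) = (m.app ⊤).hom (sec x) := rfl

theorem sec_sum {d : ℕ} (e : Fin d → gsec V) (c : Fin d → A) :
    sec (∑ j, c j • e j) = lc V ⊤ ⊤ (fun j => sec (e j)) fun j => scal (c j) := by
  rw [map_sum]
  refine Finset.sum_congr rfl fun j _ => ?_
  rw [rs_self]
  rfl

/-- A frame is a basis of the module of global sections. -/
theorem exists_basis {d : ℕ} {e : Fin d → Γ(V, ⊤)} (he : IsFrame V ⊤ e) :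
    ∃ b : Module.Basis (Fin d) A (gsec V), ∀ j, sec (b j) = e j := by
  have h : Bijective (Fintype.linearCombination A (fun j => sec.symm (e j))) := by
    have h1 : ∀ c : Fin d → A, sec (Fintype.linearCombination A (fun j => sec.symm (e j)) c) =
        lc V ⊤ ⊤ e fun j => scal (c j) := by
      intro c
      rw [Fintype.linearCombination_apply]
      exact sec_sum _ _
    refine ⟨fun c c' hc => ?_, fun x => ?_⟩
    · have h2 := (he ⊤ le_rfl).1 (((h1 c).symm.trans (congrArg sec hc)).trans (h1 c'))
      exact funext fun j => scal.injective (congrFun h2 j)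
    · obtain ⟨c, hc⟩ := (he ⊤ le_rfl).2 (sec x)
      refine ⟨fun j => scal.symm (c j), sec.injective ((h1 _).trans ?_)⟩
      simpa only [RingEquiv.apply_symm_apply] using hc
  refine ⟨Module.Basis.ofEquivFun (LinearEquiv.ofBijective _ h).symm, fun j => ?_⟩
  have h3 : Module.Basis.ofEquivFun (LinearEquiv.ofBijective _ h).symm j = sec.symm (e j) := by
    rw [Module.Basis.coe_ofEquivFun]
    change Fintype.linearCombination A (fun j => sec.symm (e j)) (Pi.single j 1) = _
    rw [Fintype.linearCombination_apply_single, one_smul]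
  rw [h3, AddEquiv.apply_symm_apply]

theorem isFrame_of_basis [Subsingleton (Spec (of A))] {d : ℕ}
    (b : Module.Basis (Fin d) A (gsec V)) : IsFrame V ⊤ fun j => sec (b j) := by
  refine isFrame_top_of_bijective ⟨fun c c' hc => ?_, fun x => ?_⟩
  · have h1 : ∑ j, scal.symm (c j) • b j = ∑ j, scal.symm (c' j) • b j := by
      refine sec.injective ?_
      rw [sec_sum, sec_sum]
      simpa only [RingEquiv.apply_symm_apply] using hc
    have h2 := b.equivFun.symm.injective ((b.equivFun_symm_apply _).trans
      (h1.trans (b.equivFun_symm_apply _).symm))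
    exact funext fun j => scal.symm.injective (congrFun h2 j)
  · refine ⟨fun j => scal (b.repr (sec.symm x) j), ?_⟩
    rw [← sec_sum, b.sum_repr, AddEquiv.apply_symm_apply]

/-- The global sections of sheaves linked by a cartesian arrow are a scalar extension. -/
theorem exists_isExt {E : Type u} [Field E] [Algebra E A] {V : (Spec (of E)).Modules}
    {W : (Spec (of A)).Modules} {d : ℕ} (b : Module.Basis (Fin d) E (gsec V))
    (Θ : (⟨_, V⟩ : QMod) ⟶ ⟨_, W⟩) (hb : bs Θ = Spec.map (ofHom (algebraMap E A)))
    (hc : IsCart Θ) : ∃ b' : Module.Basis (Fin d) A (gsec W), IsExt b b' (glob Θ) := by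
  have hbf : IsFrame V ⊤ fun j => sec (b j) := isFrame_of_basis b
  have h1 := hbf.cart (A := ⟨_, V⟩) (B := ⟨_, W⟩) hc (W := ⊤) le_top
  obtain ⟨b', hb'⟩ := exists_basis h1
  refine ⟨b', fun v => ?_⟩
  conv_lhs => rw [← b.sum_repr v, map_sum]
  refine Finset.sum_congr rfl fun j _ => ?_
  rw [glob_smul Θ (algebraMap E A) hb]
  congr 1
  exact sec.injective (hb' j).symm

/-- A unimodular section belongs to a frame. -/
theorem exists_frame_of_unimodular [Subsingleton (Spec (of A))] {d : ℕ}
    (b : Module.Basis (Fin d) A (gsec V)) (ω : gsec V) {k : Fin d} (hk : IsUnit (b.repr ω k)) :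
    ∃ e : Fin d → Γ(V, ⊤), IsFrame V ⊤ e ∧ e k = sec ω := by
  refine ⟨_, (isFrame_of_basis b).of_matrix
    ((1 : Matrix (Fin d) (Fin d) _).updateRow k fun j => scal (b.repr ω j))
    (isUnit_det_updateRow _ k (hk.map scal)), ?_⟩
  rw [Matrix.updateRow_self, ← sec_sum, b.sum_repr]

theorem exists_isUnit_repr [IsLocalRing A] {d : ℕ} (b : Module.Basis (Fin d) A (gsec V))
    {e : Fin d → Γ(V, ⊤)} (he : IsFrame V ⊤ e) (k : Fin d) :
    ∃ j, IsUnit (b.repr (sec.symm (e k)) j) := by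
  obtain ⟨b', hb'⟩ := exists_basis he
  have h0 : b' k = sec.symm (e k) := sec.injective ((hb' k).trans (AddEquiv.apply_symm_apply _ _).symm)
  by_contra hn
  push Not at hn
  have h1 : b'.coord k (sec.symm (e k)) =
      ∑ j, b.repr (sec.symm (e k)) j * b'.coord k (b j) := by
    conv_lhs => rw [← b.sum_repr (sec.symm (e k)), map_sum]
    simp
  rw [← h0, Module.Basis.coord_apply, Module.Basis.repr_self, Finsupp.single_eq_same] at h1
  refine (IsLocalRing.mem_maximalIdeal (1 : A)).1 ?_ isUnit_one
  rw [h1, h0]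
  exact Ideal.sum_mem _ fun j _ =>
    Ideal.mul_mem_right _ _ ((IsLocalRing.mem_maximalIdeal _).2 (hn j))

variable (A) in
/-- The global sections of the structure sheaf. -/
def unitEquiv : gsec (unitMod (Spec (of A))) ≃ₗ[A] A :=
  { (sec.trans (unitSec _ ⊤)).trans scal.symm.toAddEquiv with
    map_smul' := fun a x => by
      change scal.symm (unitSec _ ⊤ (sec (a • x))) = a * scal.symm (unitSec _ ⊤ (sec x))
      rw [sec_smul, unitSec_smul, map_mul, RingEquiv.symm_apply_apply] }

theorem unitEquiv_apply (x : gsec (unitMod (Spec (of A)))) :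
    unitEquiv A x = scal.symm (unitSec _ ⊤ (sec x)) := rfl

/-- An isomorphism on global sections. -/
def gequiv {V' : (Spec (of A)).Modules} (m : V ≅ V') : gsec V ≃ₗ[A] gsec V' :=
  ((moduleSpecΓFunctor (R := of A)).mapIso m).toLinearEquiv

theorem gequiv_apply {V' : (Spec (of A)).Modules} (m : V ≅ V') (x : gsec V) :
    gequiv m x = gmap m.hom x := rfl

theorem gmap_comp {V' V'' : (Spec (of A)).Modules} (m : V ⟶ V') (n : V' ⟶ V'')
    (x : gsec V) : gmap (m ≫ n) x = gmap n (gmap m x) := rfl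

end GlobalSections

/-! ### The lines and the quotients of elementary modifications -/

section Fibres

variable {A : Type u} [CommRing A] {Y : Scheme.{u}} {i : Spec (of A) ⟶ Y}
  {U V : Y.Opens} {t : Γ(Y, V)} {d : ℕ} {M N : Y.Modules} {f : M ⟶ N} {O : Y.Opens} {j₀ : Fin d}
  {e : Fin d → Γ(M, O)} {b : Fin d → Γ(N, O)}

theorem ElemFrame.ker_eq (hl : LocEq i U V t) (hf : ElemFrame i t f O j₀ e b) :
    LinearMap.ker (gmap ((Scheme.Modules.pullback i).map f)) =
      Submodule.span A {sec.symm (ev i M O (e j₀))} := by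
  ext y
  rw [LinearMap.mem_ker, Submodule.mem_span_singleton]
  have h := hf.ker_fibre hl (sec y)
  refine Iff.trans (Iff.trans ?_ h) ?_
  · rw [← sec_gmap, map_eq_zero_iff sec sec.injective]
  · constructor
    · rintro ⟨a, ha⟩
      exact ⟨scal.symm a, sec.injective (by
        rw [sec_smul, AddEquiv.apply_symm_apply, RingEquiv.apply_symm_apply, ha])⟩
    · rintro ⟨a, rfl⟩
      exact ⟨scal a, by rw [sec_smul, AddEquiv.apply_symm_apply]⟩

/-- The kernel on the fibres of an elementary modification is a line. -/
theorem IsElem.exists_ker_eq [IsLocalRing A] (hl : LocEq i U V t) (hf : IsElem i U t d f)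
    (b' : Module.Basis (Fin d) A (gsec ((Scheme.Modules.pullback i).obj M))) :
    ∃ ω, (∃ j, IsUnit (b'.repr ω j)) ∧
      LinearMap.ker (gmap ((Scheme.Modules.pullback i).map f)) = Submodule.span A {ω} := by
  obtain ⟨O, j₀, e, b, hf⟩ := hf.frame
  exact ⟨_, exists_isUnit_repr b' (ev_frame hf.mem hf.frame_e) j₀, hf.ker_eq hl⟩

variable {p : Y ⟶ Spec (of A)} (hip : i ≫ p = 𝟙 _)
  [Subsingleton (Spec (of A))]

include hip in
/-- The cokernel on the fibres of an elementary modification is an invertible quotient. -/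
theorem IsElem.exists_coker_equiv (hl : LocEq i U V t) (hf : IsElem i U t d f) :
    Nonempty (gsec ((Scheme.Modules.pullback i).obj (cokernel f)) ≃ₗ[A] A) ∧
      Surjective (gmap ((Scheme.Modules.pullback i).map (cokernel.π f))) := by
  obtain ⟨O, j₀, e, b, hE⟩ := hf.frame
  obtain ⟨-, κ, hκ⟩ := hE.exists_quotient hip hl hf
  refine ⟨⟨(gequiv κ).trans (unitEquiv A)⟩, fun y => ?_⟩
  let w := sec.symm (ev i N O (b j₀))
  have h1 : unitEquiv A (gequiv κ (gmap ((Scheme.Modules.pullback i).map (cokernel.π f)) w)) = 1 := by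
    have h2 := hκ j₀
    rw [if_pos rfl] at h2
    rw [gequiv_apply, ← gmap_comp, unitEquiv_apply, sec_gmap, AddEquiv.apply_symm_apply, h2, map_one]
  refine ⟨unitEquiv A (gequiv κ y) • w, (gequiv κ).injective ((unitEquiv A).injective ?_)⟩
  rw [map_smul, map_smul, map_smul, h1, smul_eq_mul, mul_one]

end Fibres

/-! ### Points of the product of projective spaces -/

section Classification

instance (A : Type u) [CommRing A] [IsLocalRing A] [IsArtinianRing A] :
    Subsingleton (Spec (of A)) := by
  have : Subsingleton (PrimeSpectrum A) := by
    refine ⟨fun x y => PrimeSpectrum.ext ?_⟩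
    exact (IsLocalRing.eq_maximalIdeal ((IsArtinianRing.isPrime_iff_isMaximal _).1 x.isPrime)).trans
      (IsLocalRing.eq_maximalIdeal ((IsArtinianRing.isPrime_iff_isMaximal _).1 y.isPrime)).symm
  exact this

theorem exists_frame_of_isCart {A B : QMod.{u}} {φ : A ⟶ B} (hφ : IsCart φ) [Subsingleton B.Y]
    [Nonempty B.Y] {d : ℕ} (h : IsLocallyFreeOfRank A.M d) :
    ∃ e : Fin d → Γ(B.M, ⊤), IsFrame B.M ⊤ e := by
  rw [isLocallyFreeOfRank_iff] at h
  obtain ⟨O, e, hO, he⟩ := h (bs φ (Classical.arbitrary B.Y))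
  exact ⟨_, he.cart hφ fun x _ => by
    rw [Subsingleton.elim x (Classical.arbitrary B.Y)]
    exact hO⟩

theorem isLocallyFreeOfRank_unitMod' (Y : Scheme.{u}) : IsLocallyFreeOfRank (unitMod Y) 1 := by
  rw [isLocallyFreeOfRank_iff]
  exact fun y => ⟨⊤, _, trivial, isFrame_unit Y⟩

/-- The ideal sheaf of a section with a local equation is an invertible sheaf. -/
theorem exists_frame_ideal {T Y : Scheme.{u}} [Subsingleton T] [Nonempty T] {i : T ⟶ Y} {p : Y ⟶ T}
    (hip : i ≫ p = 𝟙 T) {U V : Y.Opens} {t : Γ(Y, V)} (hl : LocEq i U V t) :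
    ∃ e : Fin 1 → Γ((Scheme.Modules.pullback i).obj (kernel
      ((Scheme.Modules.pullbackPushforwardAdjunction i).unit.app (unitMod Y))), ⊤),
      IsFrame _ ⊤ e := by
  have hβ : IsFrame ((Scheme.Modules.pullback i).obj (unitMod Y)) ⊤
      fun j : Fin 1 => ev i (unitMod Y) ⊤ ((unitSec Y ⊤).symm 1) :=
    ev_frame (fun _ => TopologicalSpace.Opens.mem_top _) (isFrame_unit Y)
  obtain ⟨q, hq⟩ := exists_coord hβ 0
  have hqi : IsIso q := by
    refine isIso_of_bijective q fun W => ?_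
    refine hβ.bijective_app q ?_ le_top
    have : (fun j : Fin 1 => (q.app ⊤).hom (ev i (unitMod Y) ⊤ ((unitSec Y ⊤).symm 1))) =
        fun _ => (unitSec T ⊤).symm 1 := by
      funext j
      refine (unitSec T ⊤).injective ?_
      rw [hq j, if_pos (Subsingleton.elim j 0), AddEquiv.apply_symm_apply]
    rw [this]
    exact isFrame_unit T
  have hl' := exists_elemFrame_of_kernel hip (N := unitMod Y) (d := 1) (j₀ := 0)
    (f := kernel.ι ((Scheme.Modules.pullbackPushforwardAdjunction i).unit.app (unitMod Y))) hl
    (app_injective _) (isLocallyFreeOfRank_unitMod' Y) (pbArr i (unitMod Y) ≫ vert q)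
    (id_comp i) (fun W x => ?_) rfl hβ hq
  · obtain ⟨-, O, e, b, he, -⟩ := hl'
    exact ⟨_, ev_frame he.mem he.frame_e⟩
  · have h0 : on (pbArr i (unitMod Y) ≫ vert q) W (i ⁻¹ᵁ W) x =
        (q.app (i ⁻¹ᵁ W)).hom (on (pbArr i (unitMod Y)) W (i ⁻¹ᵁ W) x) :=
      (on_comp (pbArr i (unitMod Y)) (vert q) (i ⁻¹ᵁ W) le_rfl le_rfl x).trans
        (on_vert_self _ _ _)
    have h1 : (q.app (i ⁻¹ᵁ W)).hom (on (pbArr i (unitMod Y)) W (i ⁻¹ᵁ W) x) = 0 ↔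
        on (pbArr i (unitMod Y)) W (i ⁻¹ᵁ W) x = 0 :=
      map_eq_zero_iff _ (bijective_of_isIso q (i ⁻¹ᵁ W)).1
    have h2 : on (pbArr i (unitMod Y)) W (i ⁻¹ᵁ W) x =
        unpf i _ W ((((Scheme.Modules.pullbackPushforwardAdjunction i).unit.app
          (unitMod Y)).app W).hom x) := rs_self _ _ _
    rw [h0, h1, h2]
    constructor
    · exact fun h => exists_kernel_app_eq _ W x h
    · rintro ⟨y, rfl⟩
      rw [← comp_app', kernel.condition]
      rfl

variable {Fq : Type u} [Field Fq] [Fintype Fq] {E : Type u} [Field E] [Algebra Fq E]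
  {X : Over (Spec (of Fq))} {D : ShtukaDiagram X (specE E Fq)} {d : ℕ}
  {α β : specE E Fq ⟶ X}

omit [Fintype Fq] in
theorem exists_conormal_basis (q : GraphEq α) : Nonempty (Module.Basis (Fin 1) E (conormal α)) := by
  have h1 := q.locEq (specE E Fq) (𝟙 _)
  rw [id_comp] at h1
  obtain ⟨e, he⟩ := exists_frame_ideal (graph_snd α) h1
  obtain ⟨b, -⟩ := exists_basis (A := E) he
  exact ⟨b⟩

theorem exists_fibreTau_basis (hD : IsLocallyFreeOfRank D.F d) (a : specE E Fq ⟶ X) :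
    Nonempty (Module.Basis (Fin d) E (fibreTau D a)) := by
  obtain ⟨e, he⟩ := exists_frame_of_isCart (isCart_kap 1 a D.F) hD
  obtain ⟨b, -⟩ := exists_basis (A := E) he
  exact ⟨b⟩

variable {A : Type u} [CommRing A] [Algebra E A]

variable (D α β) in
/-- The fibres of `Φ^* F` at `α` and at `β` being identified, through `Θ` and `Θ'`, with those of
a sheaf `M` along the sections `i` and `k` of a scheme over `A`, the morphism `h` is given by the
upper modification `f` of `M` along `i` and the lower modification `g` of its target along `k`. -/
structure Classifies {Y : Scheme.{u}} {i k : Spec (of A) ⟶ Y} {M F F' : Y.Modules}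
    (f : M ⟶ F') (g : F ⟶ F')
    (Θ : (⟨Spec (of E), (fib α).obj ((tau X (specE E Fq) 1).obj D.F)⟩ : QMod) ⟶
      ⟨_, (Scheme.Modules.pullback i).obj M⟩)
    (Θ' : (⟨Spec (of E), (fib β).obj ((tau X (specE E Fq) 1).obj D.F)⟩ : QMod) ⟶
      ⟨_, (Scheme.Modules.pullback k).obj M⟩)
    (h : Spec (of A) ⟶ Pnat D α β) : Prop where
  hom : h ≫ PnatHom D α β = Spec.map (ofHom (algebraMap E A))
  line : ClassifiesLine (N := conormal α) (V := fibreTau D α) (glob Θ)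
    (LinearMap.ker (gmap ((Scheme.Modules.pullback i).map f))) (h ≫ pullback.fst _ _)
  quotient : ClassifiesQuotient (V := fibreTau D β)
    (fun v => gmap ((Scheme.Modules.pullback k).map (f ≫ cokernel.π g)) (glob Θ' v))
    (h ≫ pullback.snd _ _)

theorem fst_hom {h : Spec (of A) ⟶ Pnat D α β}
    (hh : h ≫ PnatHom D α β = Spec.map (ofHom (algebraMap E A))) :
    (h ≫ pullback.fst _ _) ≫ projSpaceHom E _ = Spec.map (ofHom (algebraMap E A)) := by
  rw [assoc]
  exact hh

theorem snd_hom {h : Spec (of A) ⟶ Pnat D α β}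
    (hh : h ≫ PnatHom D α β = Spec.map (ofHom (algebraMap E A))) :
    (h ≫ pullback.snd _ _) ≫ projSpaceHom E _ = Spec.map (ofHom (algebraMap E A)) := by
  rw [assoc, ← pullback.condition]
  exact hh

theorem exists_pair {h₁ : Spec (of A) ⟶ Psharp D α}
    {h₂ : Spec (of A) ⟶ Pflat D β}
    (hh₁ : h₁ ≫ projSpaceHom E _ = Spec.map (ofHom (algebraMap E A)))
    (hh₂ : h₂ ≫ projSpaceHom E _ = Spec.map (ofHom (algebraMap E A))) :
    ∃ h : Spec (of A) ⟶ Pnat D α β,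
      h ≫ PnatHom D α β = Spec.map (ofHom (algebraMap E A)) ∧
      h ≫ pullback.fst _ _ = h₁ ∧ h ≫ pullback.snd _ _ = h₂ := by
  refine ⟨pullback.lift h₁ h₂ (hh₁.trans hh₂.symm), ?_, pullback.lift_fst _ _ _,
    pullback.lift_snd _ _ _⟩
  rw [PnatHom, pullback.lift_fst_assoc]
  exact hh₁

variable [IsLocalRing A] {Y : Scheme.{u}} {i k : Spec (of A) ⟶ Y} {M F F' : Y.Modules}
  {f : M ⟶ F'} {g : F ⟶ F'}
  {Θ : (⟨Spec (of E), (fib α).obj ((tau X (specE E Fq) 1).obj D.F)⟩ : QMod) ⟶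
    ⟨_, (Scheme.Modules.pullback i).obj M⟩}
  {Θ' : (⟨Spec (of E), (fib β).obj ((tau X (specE E Fq) 1).obj D.F)⟩ : QMod) ⟶
    ⟨_, (Scheme.Modules.pullback k).obj M⟩}

/-- Modifications are classified by a point. -/
theorem exists_classifies [Subsingleton (Spec (of A))] (q : GraphEq α)
    (hD : IsLocallyFreeOfRank D.F d)
    {U V U' V' : Y.Opens} {t : Γ(Y, V)} {t' : Γ(Y, V')} (hl : LocEq i U V t)
    (hl' : LocEq k U' V' t') {p : Y ⟶ Spec (of A)} (hkp : k ≫ p = 𝟙 _)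
    (hf : IsElem i U t d f) (hg : IsElem k U' t' d g) [IsIso ((Scheme.Modules.pullback k).map f)]
    (hb : bs Θ = Spec.map (ofHom (algebraMap E A)))
    (hb' : bs Θ' = Spec.map (ofHom (algebraMap E A))) (hc : IsCart Θ)
    (hc' : IsCart Θ') : ∃ h, Classifies D α β f g Θ Θ' h := by
  obtain ⟨x₀⟩ := exists_conormal_basis q
  obtain ⟨bα⟩ := exists_fibreTau_basis hD α
  obtain ⟨bβ⟩ := exists_fibreTau_basis hD β
  obtain ⟨b₁, hs⟩ := exists_isExt bα Θ hb hc
  obtain ⟨b₂, hs'⟩ := exists_isExt bβ Θ' hb' hc'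
  obtain ⟨ω, hω, hω'⟩ := hf.exists_ker_eq hl b₁
  obtain ⟨h₁, hh₁, hL⟩ := exists_classifiesLine (N := conormal α) hs x₀ ω hω
  obtain ⟨⟨e⟩, hsurj⟩ := hg.exists_coker_equiv hkp hl'
  have hsurj' : Surjective
      (gmap ((Scheme.Modules.pullback k).map (f ≫ cokernel.π g))) := by
    rw [Functor.map_comp]
    intro y
    obtain ⟨z, hz⟩ := hsurj y
    refine ⟨gmap (inv ((Scheme.Modules.pullback k).map f)) z, ?_⟩
    rw [← gmap_comp, IsIso.inv_hom_id_assoc, hz]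
  obtain ⟨h₂, hh₂, hQ⟩ := exists_classifiesQuotient _ hs' e hsurj'
  obtain ⟨h, hh, rfl, rfl⟩ := exists_pair (D := D) (α := α) (β := β) hh₁ hh₂
  exact ⟨h, hh, by rw [hω']; exact hL, hQ⟩

variable {B : Type u} [CommRing B] [Algebra E B] [IsLocalRing B] (φ : A →ₐ[E] B)
  {Y₁ : Scheme.{u}} {i₁ k₁ : Spec (of B) ⟶ Y₁} {M₁ F₁ F₁' : Y₁.Modules}
  {f₁ : M₁ ⟶ F₁'} {g₁ : F₁ ⟶ F₁'}
  {Θ₁ : (⟨Spec (of E), (fib α).obj ((tau X (specE E Fq) 1).obj D.F)⟩ : QMod) ⟶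
    ⟨_, (Scheme.Modules.pullback i₁).obj M₁⟩}
  {Θ₁' : (⟨Spec (of E), (fib β).obj ((tau X (specE E Fq) 1).obj D.F)⟩ : QMod) ⟶
    ⟨_, (Scheme.Modules.pullback k₁).obj M₁⟩}

/-- The points that classify modifications are compatible with a scalar extension if and only if
the lines and the quotients are. -/
theorem Classifies.compat (q : GraphEq α) (hD : IsLocallyFreeOfRank D.F d)
    (hb : bs Θ = Spec.map (ofHom (algebraMap E A)))
    (hb' : bs Θ' = Spec.map (ofHom (algebraMap E A))) (hc : IsCart Θ)
    (hc' : IsCart Θ')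
    (hb₁ : bs Θ₁ = Spec.map (ofHom (algebraMap E B)))
    (hb₁' : bs Θ₁' = Spec.map (ofHom (algebraMap E B))) (hc₁ : IsCart Θ₁)
    (hc₁' : IsCart Θ₁') {h : Spec (of A) ⟶ Pnat D α β}
    {h₁ : Spec (of B) ⟶ Pnat D α β} (hh : Classifies D α β f g Θ Θ' h)
    (hh₁ : Classifies D α β f₁ g₁ Θ₁ Θ₁' h₁)
    (σ : (⟨_, (Scheme.Modules.pullback i).obj M⟩ : QMod) ⟶ ⟨_, (Scheme.Modules.pullback i₁).obj M₁⟩)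
    (σ' : (⟨_, (Scheme.Modules.pullback k).obj M⟩ : QMod) ⟶
      ⟨_, (Scheme.Modules.pullback k₁).obj M₁⟩)
    (hσ : bs σ = Spec.map (ofHom φ.toRingHom))
    (hσ' : bs σ' = Spec.map (ofHom φ.toRingHom)) (hΘ : Θ ≫ σ = Θ₁)
    (hΘ' : Θ' ≫ σ' = Θ₁') :
    Spec.map (ofHom φ.toRingHom) ≫ h = h₁ ↔
      (∀ w, gmap ((Scheme.Modules.pullback i).map f) w = 0 →
        gmap ((Scheme.Modules.pullback i₁).map f₁) (glob σ w) = 0) ∧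
      ∀ w, gmap ((Scheme.Modules.pullback k).map (f ≫ cokernel.π g)) w = 0 →
        gmap ((Scheme.Modules.pullback k₁).map (f₁ ≫ cokernel.π g₁)) (glob σ' w) = 0 := by
  obtain ⟨x₀⟩ := exists_conormal_basis q
  obtain ⟨bα⟩ := exists_fibreTau_basis hD α
  obtain ⟨bβ⟩ := exists_fibreTau_basis hD β
  obtain ⟨b₁, hs⟩ := exists_isExt bα Θ hb hc
  obtain ⟨b₂, hs'⟩ := exists_isExt bβ Θ' hb' hc'
  obtain ⟨b₃, hs₁⟩ := exists_isExt bα Θ₁ hb₁ hc₁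
  obtain ⟨b₄, hs₁'⟩ := exists_isExt bβ Θ₁' hb₁' hc₁'
  have h1 := classifiesLine_compat φ x₀ hs hs₁ (glob σ) (glob_smul σ φ.toRingHom hσ)
    (fun v => (glob_comp Θ σ v).symm.trans (by rw [hΘ])) hh.line hh₁.line
  have h2 := classifiesQuotient_compat φ (gmap ((Scheme.Modules.pullback k).map (f ≫ cokernel.π g)))
    (gmap ((Scheme.Modules.pullback k₁).map (f₁ ≫ cokernel.π g₁))) hs' hs₁' (glob σ')
    (glob_smul σ' φ.toRingHom hσ') (fun v => (glob_comp Θ' σ' v).symm.trans (by rw [hΘ']))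
    hh.quotient hh₁.quotient
  have h3 : (∀ w ∈ LinearMap.ker (gmap ((Scheme.Modules.pullback i).map f)),
      glob σ w ∈ LinearMap.ker (gmap ((Scheme.Modules.pullback i₁).map f₁))) ↔
      ∀ w, gmap ((Scheme.Modules.pullback i).map f) w = 0 →
        gmap ((Scheme.Modules.pullback i₁).map f₁) (glob σ w) = 0 := Iff.rfl
  rw [← h3, ← h1, ← h2]
  constructor
  · rintro rfl
    exact ⟨(assoc _ _ _).symm, (assoc _ _ _).symm⟩
  · rintro ⟨h4, h5⟩
    exact pullback.hom_ext ((assoc _ _ _).trans h4) ((assoc _ _ _).trans h5)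

/-- Modifications with a given classifying point. -/
theorem exists_frames_of_point [Subsingleton (Spec (of A))] (q : GraphEq α)
    (hD : IsLocallyFreeOfRank D.F d)
    (hb : bs Θ = Spec.map (ofHom (algebraMap E A)))
    (hb' : bs Θ' = Spec.map (ofHom (algebraMap E A))) (hc : IsCart Θ)
    (hc' : IsCart Θ') (h : Spec (of A) ⟶ Pnat D α β)
    (hh : h ≫ PnatHom D α β = Spec.map (ofHom (algebraMap E A))) :
    ∃ (j₀ : Fin d) (e : Fin d → Γ((Scheme.Modules.pullback i).obj M, ⊤)) (j₁ : Fin d)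
      (e' : Fin d → Γ((Scheme.Modules.pullback k).obj M, ⊤))
      (w : (Scheme.Modules.pullback k).obj M ⟶ unitMod _),
      IsFrame _ ⊤ e ∧ IsFrame _ ⊤ e' ∧
      (∀ j, unitSec _ ⊤ ((w.app ⊤).hom (e' j)) = if j = j₁ then 1 else 0) ∧
      ∀ {F F' : Y.Modules} (f : M ⟶ F') (g : F ⟶ F'),
        LinearMap.ker (gmap ((Scheme.Modules.pullback i).map f)) =
          Submodule.span A {sec.symm (e j₀)} →
        (∃ κ : (Scheme.Modules.pullback k).obj (cokernel g) ≅ unitMod _,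
          (Scheme.Modules.pullback k).map (f ≫ cokernel.π g) ≫ κ.hom = w) →
        Classifies D α β f g Θ Θ' h := by
  obtain ⟨x₀⟩ := exists_conormal_basis q
  obtain ⟨bα⟩ := exists_fibreTau_basis hD α
  obtain ⟨bβ⟩ := exists_fibreTau_basis hD β
  obtain ⟨b₁, hs⟩ := exists_isExt bα Θ hb hc
  obtain ⟨b₂, hs'⟩ := exists_isExt bβ Θ' hb' hc'
  obtain ⟨ω, ⟨j₀, hω⟩, hL⟩ := exists_line (N := conormal α) hs x₀ _ (fst_hom hh)
  obtain ⟨c, ⟨j₁, hj₁⟩, hQ⟩ := exists_quotient_coords hs' _ (snd_hom hh)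
  obtain ⟨e, he, heω⟩ := exists_frame_of_unimodular b₁ ω hω
  obtain ⟨w, hw, -⟩ := (isFrame_of_basis b₂).existsUnique_hom (unitMod _)
    fun j => (unitSec _ ⊤).symm (scal (c j))
  obtain ⟨e', he', hwe'⟩ := exists_frame_of_isUnit (isFrame_of_basis b₂) w j₁ (by
    rw [hw, AddEquiv.apply_symm_apply]
    exact hj₁.map scal)
  refine ⟨j₀, e, j₁, e', w, he, he', hwe', fun {F F'} f g hf hg => ⟨hh, ?_, ?_⟩⟩
  · rw [hf, heω, AddEquiv.symm_apply_apply]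
    exact hL
  · obtain ⟨κ, hκ⟩ := hg
    refine hQ (gmap ((Scheme.Modules.pullback k).map (f ≫ cokernel.π g)))
      ((gequiv κ).trans (unitEquiv A)) fun j => ?_
    rw [LinearEquiv.trans_apply, gequiv_apply, ← gmap_comp, hκ, unitEquiv_apply, sec_gmap, hw,
      AddEquiv.apply_symm_apply, RingEquiv.symm_apply_apply]

end Classification

/-! ### Disjointness of the graphs -/

section Disjoint

variable {Fq : Type u} [Field Fq] [Fintype Fq] {X S : Over (Spec (of Fq))}

theorem frobPow_left_apply (n : ℕ) (x : S.left) : (frobPow S n).left x = x := by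
  induction n with
  | zero => rfl
  | succ n ih =>
    rw [frobPow, Over.comp_left, Scheme.Hom.comp_apply, ih]
    rfl

/-- The power of the Frobenius of the first factor of `X × S`. -/
def PhiX (X S : Over (Spec (of Fq))) (n : ℕ) : prodS X S ⟶ prodS X S :=
  pullback.lift (pullback.fst X.hom S.hom ≫ (frobPow X n).left) (pullback.snd X.hom S.hom)
    (by rw [assoc, Over.w, pullback.condition])

theorem PhiPow_PhiX_apply (n : ℕ) (y : prodS X S) : PhiX X S n (PhiPow X S n y) = y := by
  let W : Over (Spec (of Fq)) := Over.mk (pullback.fst X.hom S.hom ≫ X.hom)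
  have h1 : PhiPow X S n ≫ PhiX X S n = (frobPow W n).left := by
    rw [PhiPow_eq]
    apply pullback.hom_ext
    · rw [assoc, PhiX, pullback.lift_fst, ← assoc, prodMap_fst]
      exact (congrArg CommaMorphism.left (frobPow_naturality
        (Over.homMk (pullback.fst X.hom S.hom) rfl : W ⟶ X) n)).symm
    · rw [assoc, PhiX, pullback.lift_snd, prodMap_snd]
      exact (congrArg CommaMorphism.left (frobPow_naturality
        (Over.homMk (pullback.snd X.hom S.hom) pullback.condition.symm : W ⟶ S) n)).symm
  rw [← Scheme.Hom.comp_apply, h1]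
  exact frobPow_left_apply (S := W) n y

theorem graph_PhiX (a : S ⟶ X) (n : ℕ) : graph a ≫ PhiX X S n = graph (a ≫ frobPow X n) := by
  apply pullback.hom_ext
  · rw [assoc, PhiX, pullback.lift_fst, ← assoc, graph_fst, graph_fst, Over.comp_left]
  · rw [assoc, PhiX, pullback.lift_snd, graph_snd, graph_snd]

variable {α β : S ⟶ X}

theorem DisjointFrobeniusGraphs.ne (h : DisjointFrobeniusGraphs α β) [Subsingleton S.left]
    {k l : Bool} {n : ℕ} (hn : (k, 0) ≠ (l, n)) (x : S.left) :
    (graph (if k then α else β) ≫ PhiPow X S n) x ∉ Set.range (graph (if l then α else β)) := by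
  rintro ⟨x', hx'⟩
  have h1 := congrArg (PhiX X S n) hx'
  rw [Scheme.Hom.comp_apply, PhiPow_PhiX_apply, ← Scheme.Hom.comp_apply, graph_PhiX] at h1
  refine Set.disjoint_left.1 (h hn) ⟨x, ?_⟩ ⟨x', h1⟩
  rw [frobPow, comp_id]

theorem DisjointFrobeniusGraphs.avoids (h : DisjointFrobeniusGraphs α β) [Subsingleton S.left]
    (q : GraphEq α) (q' : GraphEq β) :
    (Avoids q q' (graph α ≫ Phi X S) ∧ Avoids q q' (graph β ≫ Phi X S)) ∧
      ∀ x, graph β x ∈ q.U := by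
  have key : ∀ (k l : Bool) (m : ℕ) (x : S.left),
      ((graph (if k then α else β) ≫ Phi X S) ≫ PhiPow X S m) x ∉
        Set.range (graph (if l then α else β)) := by
    intro k l m x
    rw [assoc, Phi_comp_PhiPow]
    exact h.ne (by simp) x
  refine ⟨⟨fun m x => ⟨(q.mem_U _).2 (key true true m x), (q'.mem_U _).2 (key true false m x)⟩,
    fun m x => ⟨(q.mem_U _).2 (key false true m x), (q'.mem_U _).2 (key false false m x)⟩⟩,
    fun x => (q.mem_U _).2 ?_⟩
  have := h.ne (k := false) (l := true) (n := 0) (by simp) x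
  rwa [PhiPow, comp_id] at this

end Disjoint

/-! ### Comparison of the fibres -/

section Theta

theorem exists_fibre_arrow {Y Y₁ T T₁ : Scheme.{u}} {M : Y.Modules} {M₁ : Y₁.Modules}
    {i : T ⟶ Y} {i₁ : T₁ ⟶ Y₁} {P : Y₁ ⟶ Y} {τ : T₁ ⟶ T} (h : i₁ ≫ P = τ ≫ i)
    (χ : (⟨Y, M⟩ : QMod) ⟶ ⟨Y₁, M₁⟩) (hb : bs χ = P) :
    ∃ σ : (⟨T, (Scheme.Modules.pullback i).obj M⟩ : QMod) ⟶
      ⟨T₁, (Scheme.Modules.pullback i₁).obj M₁⟩,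
      bs σ = τ ∧ pbArr i M ≫ σ = χ ≫ pbArr i₁ M₁ := by
  obtain ⟨σ, ⟨h1, h2⟩, -⟩ := isCart_pbArr i M (χ ≫ pbArr i₁ M₁) τ (by
    rw [bs_comp, bs_pbArr, bs_pbArr, hb, h])
  exact ⟨σ, h1, h2⟩

/-- A morphism that corresponds to another one vanishes where the latter does. -/
theorem gmap_eq_zero_of_square {A B : Type u} [CommRing A] [CommRing B] {Y Y₁ : Scheme.{u}}
    {M N : Y.Modules} {M₁ N₁ : Y₁.Modules} {i : Spec (of A) ⟶ Y}
    {i₁ : Spec (of B) ⟶ Y₁} {m : M ⟶ N} {m₁ : M₁ ⟶ N₁} {P : Y₁ ⟶ Y}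
    {τ : Spec (of B) ⟶ Spec (of A)} (h : i₁ ≫ P = τ ≫ i)
    {χ : (⟨Y, M⟩ : QMod) ⟶ ⟨Y₁, M₁⟩} {ψ : (⟨Y, N⟩ : QMod) ⟶ ⟨Y₁, N₁⟩} (hb : bs ψ = P)
    (hs : vert m ≫ ψ = χ ≫ vert m₁)
    {σ : (⟨_, (Scheme.Modules.pullback i).obj M⟩ : QMod) ⟶
      ⟨_, (Scheme.Modules.pullback i₁).obj M₁⟩} (hbσ : bs σ = τ)
    (hσ : pbArr i M ≫ σ = χ ≫ pbArr i₁ M₁) (w : gsec ((Scheme.Modules.pullback i).obj M))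
    (hw : gmap ((Scheme.Modules.pullback i).map m) w = 0) :
    gmap ((Scheme.Modules.pullback i₁).map m₁) (glob σ w) = 0 := by
  obtain ⟨σ', hb', hσ'⟩ := exists_fibre_arrow h ψ hb
  have h1 : vert ((Scheme.Modules.pullback i).map m) ≫ σ' =
      σ ≫ vert ((Scheme.Modules.pullback i₁).map m₁) := by
    refine (isCart_pbArr i M).hom_ext ?_ ?_
    · rw [bs_comp, bs_comp, bs_vert, bs_vert, hb', hbσ]
      exact (comp_id _).trans (id_comp _).symm
    · rw [← assoc, pbArr_map, assoc, hσ', ← assoc, hs, ← assoc, hσ, assoc, assoc, pbArr_map]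
  rw [← glob_vert, ← glob_comp, ← h1, glob_comp, glob_vert, hw, map_zero]

/-- The induced arrow of cokernels. -/
theorem exists_cokernel_arrow {Y Y₁ : Scheme.{u}} {F F' : Y.Modules} {F₁ F₁' : Y₁.Modules}
    {g : F ⟶ F'} {g₁ : F₁ ⟶ F₁'} {ρ : (⟨Y, F⟩ : QMod) ⟶ ⟨Y₁, F₁⟩}
    {ρ' : (⟨Y, F'⟩ : QMod) ⟶ ⟨Y₁, F₁'⟩} (h : vert g ≫ ρ' = ρ ≫ vert g₁) :
    ∃ ρ'' : (⟨Y, cokernel g⟩ : QMod) ⟶ ⟨Y₁, cokernel g₁⟩, bs ρ'' = bs ρ' ∧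
      vert (cokernel.π g) ≫ ρ'' = ρ' ≫ vert (cokernel.π g₁) := by
  have hb : bs ρ = bs ρ' := by
    have := congrArg bs h
    rw [bs_comp, bs_comp, bs_vert, bs_vert] at this
    exact (this.symm.trans (comp_id _)).symm.trans (id_comp _) |>.symm
  obtain ⟨m, hm⟩ := exists_toArr (ρ' ≫ vert (cokernel.π g₁)) (f := bs ρ')
    ((bs_comp _ _).trans (id_comp _))
  obtain ⟨r, hr⟩ := exists_toArr ρ hb
  have h1 : (Scheme.Modules.pullback (bs ρ')).map g ≫ m = 0 := by
    have h2 : (Scheme.Modules.pullback (bs ρ')).map g ≫ m = r ≫ g₁ ≫ cokernel.π g₁ := by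
      refine toArr_injective ?_
      rw [← vert_comp_toArr, hm, ← assoc, h, assoc, ← vert_comp, ← toArr_comp_vert, hr]
    rw [h2, cokernel.condition, comp_zero]
  let adj := Scheme.Modules.pullbackPushforwardAdjunction (bs ρ')
  let n : F' ⟶ (pushforward (bs ρ')).obj (cokernel g₁) :=
    adj.unit.app F' ≫ (pushforward (bs ρ')).map m
  have hn : g ≫ n = 0 := by
    refine (assoc _ _ _).symm.trans ?_
    rw [← adj.unit_naturality, assoc, ← CategoryTheory.Functor.map_comp, h1,
      CategoryTheory.Functor.map_zero, comp_zero]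
  refine ⟨mkArr (bs ρ') (cokernel.desc g n hn), rfl, ?_⟩
  rw [vert_comp_mk, cokernel.π_desc, ← hm, toArr]
  exact (mk_comp_vert _ _ _).symm

/-- The identity of a diagram of sheaves. -/
def ShtHom.id {Fq : Type u} [Field Fq] [Fintype Fq] {X S : Over (Spec (of Fq))}
    (D : ShtukaDiagram X S) : ShtHom (𝟙 S) D D where
  ρ := 𝟙 _
  ρ' := 𝟙 _
  bs_ρ := (prodMap_id X S).symm
  bs_ρ' := (prodMap_id X S).symm
  cart := isCart_of_isIso _
  cart' := isCart_of_isIso _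
  comm_f := by rw [comp_id, id_comp]
  comm_g := by rw [comp_id, id_comp]

variable {Fq : Type u} [Field Fq] [Fintype Fq] {X S T R : Over (Spec (of Fq))}
  {α β : S ⟶ X} {q : GraphEq α} {q' : GraphEq β} {d : ℕ} {D : ShtukaDiagram X S}
  {G : ShtukaDiagram X T} {c : S ⟶ T} {s : T ⟶ S} {a : S ⟶ X} {b : T ⟶ X}

/-- The arrow `Θ` identifies the pullback of the fibre at `a` of `Φ^* F`, for the shtuka `D` over
`S`, with the fibre at `b` of the analogous sheaf of the shtuka `G` over `T`. -/
structure IsFibreComparison (s : T ⟶ S) (r : ShtHom c G D) (a : S ⟶ X) (b : T ⟶ X)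
    (Θ : (⟨S.left, (fib a).obj ((tau X S 1).obj D.F)⟩ : QMod) ⟶
      ⟨T.left, (fib b).obj ((tau X T 1).obj G.F)⟩) : Prop where
  bs_eq : bs Θ = s.left
  corresponds : Corresponds r (kap 1 a D.F ≫ Θ) (kap 1 b G.F)

variable {r : ShtHom c G D} {Θ Θ₁ : (⟨S.left, (fib a).obj ((tau X S 1).obj D.F)⟩ : QMod) ⟶
      ⟨T.left, (fib b).obj ((tau X T 1).obj G.F)⟩}

theorem kap_prodMap (h : graph b ≫ prodMap X s = s.left ≫ graph a) :
    (graph b ≫ PhiPow X T 1) ≫ prodMap X s = s.left ≫ graph a ≫ Phi X S := by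
  have h1 : PhiPow X T 1 = Phi X T := id_comp _
  rw [h1, assoc, ← prodMap_Phi, ← assoc, h, assoc]

theorem avoids_fibre (h : graph b ≫ prodMap X s = s.left ≫ graph a)
    (ha : Avoids q q' (graph a ≫ Phi X S)) :
    Avoids q q' (bs (kap 1 b G.F) ≫ prodMap X s) := by
  rw [bs_kap, kap_prodMap h]
  exact ha.comp s.left

theorem bs_kap_comp (h : graph b ≫ prodMap X s = s.left ≫ graph a) (hb : bs Θ = s.left) :
    bs (kap 1 a D.F ≫ Θ) = bs (kap 1 b G.F) ≫ prodMap X s := by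
  have h1 : PhiPow X S 1 = Phi X S := id_comp _
  rw [bs_kap, kap_prodMap h, bs_comp, hb, bs_kap, h1]

theorem IsFibreComparison.isCart (hG : IsSht q q' d s G) (hD : IsSht q q' d (𝟙 S) D)
    (h : graph b ≫ prodMap X s = s.left ≫ graph a) (ha : Avoids q q' (graph a ≫ Phi X S))
    (hΘ : IsFibreComparison s r a b Θ) : IsCart Θ :=
  (isCart_kap 1 a D.F).of_comp (hΘ.corresponds.isCart hG hD (avoids_fibre h ha)
    (bs_kap_comp h hΘ.bs_eq) (isCart_kap 1 b G.F))

theorem IsFibreComparison.unique (hG : IsSht q q' d s G) (hD : IsSht q q' d (𝟙 S) D)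
    (h : graph b ≫ prodMap X s = s.left ≫ graph a) (ha : Avoids q q' (graph a ≫ Phi X S))
    (hΘ : IsFibreComparison s r a b Θ) (hΘ₁ : IsFibreComparison s r a b Θ₁) : Θ = Θ₁ :=
  (isCart_kap 1 a D.F).hom_ext (hΘ.bs_eq.trans hΘ₁.bs_eq.symm)
    (hΘ.corresponds.unique hG hD hΘ₁.corresponds (avoids_fibre h ha)
      (bs_kap_comp h hΘ.bs_eq) (bs_kap_comp h hΘ₁.bs_eq))

theorem isFibreComparison_id : IsFibreComparison (𝟙 S) (ShtHom.id D) a a (𝟙 _) where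
  bs_eq := rfl
  corresponds := by
    rw [comp_id]
    exact ⟨0, kap 1 a D.F, rfl, (id_comp _).symm⟩

variable {H : ShtukaDiagram X R} {t : R ⟶ T} {c' : S ⟶ R} {s' : R ⟶ S} {r' : ShtHom c' H D}
  {b' : R ⟶ X}

/-- The identification of the fibres is compatible with base change. -/
theorem IsFibreComparison.naturality (hG : IsSht q q' d s G) (hD : IsSht q q' d (𝟙 S) D)
    (hH : IsSht q q' d s' H) (h : graph b' ≫ prodMap X s' = s'.left ≫ graph a)
    (ha : Avoids q q' (graph a ≫ Phi X S)) (p : ShtHom t G H) (hp : p.ρ ≫ r'.ρ = r.ρ)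
    (ht : t ≫ s = s') {n : ℕ} (hn : PhiPow X R n = prodMap X s' ≫ PhiPow X S n ≫ prodMap X c')
    (hΘ : IsFibreComparison s r a b Θ)
    {σ : (⟨T.left, (fib b).obj ((tau X T 1).obj G.F)⟩ : QMod) ⟶
      ⟨R.left, (fib b').obj ((tau X R 1).obj H.F)⟩} (hbσ : bs σ = t.left)
    (hσ : kap 1 b G.F ≫ σ = p.ρ ≫ kap 1 b' H.F) :
    IsFibreComparison s' r' a b' (Θ ≫ σ) := by
  have h1 : bs (Θ ≫ σ) = s'.left := by
    rw [bs_comp, hΘ.bs_eq, hbσ, ← ht, Over.comp_left]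
  refine ⟨h1, Corresponds.of_naturality hG hD hH p hp ht hn ?_ (avoids_fibre h ha)
    (bs_kap_comp h h1)⟩
  rw [← hσ, ← assoc]
  exact hΘ.corresponds.comp_right σ

end Theta

/-! ### The point given by the modifications in a shtuka -/

section ModificationPoint

theorem isIso_fibre_of_bijective {T Y : Scheme.{u}} {M N : Y.Modules} {m : M ⟶ N} {U : Y.Opens}
    (h : ∀ W ≤ U, Bijective (m.app W).hom) {i : T ⟶ Y} (hi : ∀ x, i x ∈ U) :
    IsIso ((Scheme.Modules.pullback i).map m) := by
  refine isIso_of_isCart_vert ((isCart_pbArr i M).of_comp ?_)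
  rw [pbArr_map, isCart_vert_comp_iff h _ hi]
  exact isCart_pbArr i N

theorem prodMap_graph_apply {Fq : Type u} [Field Fq] {X S T : Over (Spec (of Fq))}
    (s : T ⟶ S) (a : S ⟶ X) (x : T.left) :
    prodMap X s (graph (s ≫ a) x) = graph a (s.left x) := by
  rw [← Scheme.Hom.comp_apply, graph_prodMap, Scheme.Hom.comp_apply]

/-- Some power of the Frobenius kills the maximal ideal. -/
theorem ArtAlg.exists_frobNilpotent {E : Type u} [Field E] (A : ArtAlg E) {m : ℕ} (hm : 1 < m) :
    ∃ n, A.FrobNilpotent m (n + 1) := by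
  obtain ⟨n, hn⟩ := IsArtinianRing.isNilpotent_jacobson_bot (R := A.carrier)
  rw [IsLocalRing.jacobson_eq_maximalIdeal ⊥ bot_ne_top] at hn
  refine ⟨n, fun x hx => ?_⟩
  have h1 : x ^ n = 0 := by
    have := Ideal.pow_mem_pow hx n
    rwa [hn] at this
  have h2 : n ≤ m ^ (n + 1) := (Nat.lt_pow_self hm).le.trans (Nat.pow_le_pow_right (by omega) n.le_succ)
  rw [← Nat.add_sub_cancel' h2, pow_add, h1, zero_mul]

variable {Fq : Type u} [Field Fq] [Fintype Fq] {X S T : Over (Spec (of Fq))}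

/-- The morphism `Φ^* F ⟶ F'` of a shtuka, with its source written as an iterate. -/
def ftau (G : ShtukaDiagram X T) : (tau X T 1).obj G.F ⟶ G.F' := G.f

/-- The Frobenius-semilinear arrow `F ⟶ Φ^* F`. -/
def phiArr (G : ShtukaDiagram X T) : (⟨prodS X T, G.F⟩ : QMod) ⟶ ⟨prodS X T, (tau X T 1).obj G.F⟩ :=
  pbArr (Phi X T) G.F

theorem phiArr_ftau (G : ShtukaDiagram X T) : phiArr G ≫ vert (ftau G) = fl G := rfl

theorem isCart_phiArr (G : ShtukaDiagram X T) : IsCart (phiArr G) := isCart_pbArr _ _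

theorem bs_phiArr (G : ShtukaDiagram X T) : bs (phiArr G) = Phi X T := rfl

theorem kap_one (a : T ⟶ X) (G : ShtukaDiagram X T) :
    kap 1 a G.F = phiArr G ≫ pbArr (graph a) ((tau X T 1).obj G.F) := by
  have h : tauArr 1 G.F = phiArr G := comp_id _
  rw [kap, h]

/-- A morphism of shtukas over `t` induces an arrow of the sheaves `Φ^* F`. -/
theorem ShtHom.exists_tau {R : Over (Spec (of Fq))} {t : R ⟶ T} {G : ShtukaDiagram X T}
    {H : ShtukaDiagram X R} (p : ShtHom t G H) :
    ∃ χ : (⟨prodS X T, (tau X T 1).obj G.F⟩ : QMod) ⟶ ⟨prodS X R, (tau X R 1).obj H.F⟩,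
      bs χ = prodMap X t ∧ IsCart χ ∧ phiArr G ≫ χ = p.ρ ≫ phiArr H ∧
      vert (ftau G) ≫ p.ρ' = χ ≫ vert (ftau H) := by
  obtain ⟨χ, ⟨h1, h2⟩, -⟩ := isCart_phiArr G (p.ρ ≫ phiArr H) (prodMap X t) (by
    rw [bs_comp, bs_phiArr, bs_phiArr, p.bs_ρ, prodMap_Phi])
  refine ⟨χ, h1, (isCart_phiArr G).of_comp (h2 ▸ p.cart.comp (isCart_phiArr H)), h2, ?_⟩
  refine (isCart_phiArr G).hom_ext ?_ ?_
  · rw [bs_comp, bs_comp, bs_vert, bs_vert, h1, p.bs_ρ']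
    exact (comp_id _).trans (id_comp _).symm
  · rw [← assoc, phiArr_ftau, p.comm_f, ← assoc, h2, assoc, phiArr_ftau]

variable {α β : S ⟶ X}

/-- A shtuka with disjoint graphs of the Frobenius twists of the zero and of the pole. -/
structure IsDisjointSht (q : GraphEq α) (q' : GraphEq β) (d : ℕ) (D : ShtukaDiagram X S) :
    Prop where
  isSht : IsSht q q' d (𝟙 S) D
  avoids_zero : Avoids q q' (graph α ≫ Phi X S)
  avoids_pole : Avoids q q' (graph β ≫ Phi X S)
  pole_mem : ∀ x, graph β x ∈ q.U

variable {q : GraphEq α} {q' : GraphEq β} {d : ℕ} {D : ShtukaDiagram X S}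

theorem IsSht.isIso_fib {s : T ⟶ S} {G : ShtukaDiagram X T} (hG : IsSht q q' d s G)
    (hD : IsDisjointSht q q' d D) : IsIso ((fib (s ≫ β)).map (ftau G)) :=
  isIso_fibre_of_bijective hG.elem_f.bij fun x => by
    change prodMap X s (graph (s ≫ β) x) ∈ q.U
    rw [prodMap_graph_apply]
    exact hD.pole_mem _

variable {E : Type u} [Field E] [Algebra Fq E] {α β : specE E Fq ⟶ X}
  {D : ShtukaDiagram X (specE E Fq)} {q : GraphEq α} {q' : GraphEq β}
  {A : Type u} [CommRing A] [Algebra E A] {u : Spec (of A) ⟶ Spec (of Fq)}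
  {G : ShtukaDiagram X (Over.mk u)} {c : specE E Fq ⟶ Over.mk u} {r : ShtHom c G D}
  {s : Over.mk u ⟶ specE E Fq} {a b : Over.mk u ⟶ X}

/-- The morphism `h` is given by the modifications in a shtuka `G` over `Spec A` that is identified
with `D` over a point `c`. -/
def IsModif (r : ShtHom c G D) (s : Over.mk u ⟶ specE E Fq) (a b : Over.mk u ⟶ X)
    (h : Spec (of A) ⟶ Pnat D α β) : Prop :=
  ∃ Θ Θ', IsFibreComparison s r α a Θ ∧ IsFibreComparison s r β b Θ' ∧
    Classifies D α β (i := graph a) (k := graph b) (ftau G) G.g Θ Θ' h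

variable [IsLocalRing A]

theorem graph_prodMap' {Fq : Type u} [Field Fq] {X S T : Over (Spec (of Fq))}
    {s : T ⟶ S} {a : S ⟶ X} {b : T ⟶ X} (h : b = s ≫ a) :
    graph b ≫ prodMap X s = s.left ≫ graph a := by
  rw [h, graph_prodMap]

/-- Existence of the point given by the modifications. -/
theorem exists_isModif [IsArtinianRing A] (hD : IsDisjointSht q q' d D) (hG : IsSht q q' d s G)
    (ha : a = s ≫ α) (hb : b = s ≫ β)
    (hs : s.left = Spec.map (ofHom (algebraMap E A)))
    {Θ : (⟨_, (fib α).obj ((tau X _ 1).obj D.F)⟩ : QMod) ⟶ ⟨_, (fib a).obj ((tau X _ 1).obj G.F)⟩}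
    {Θ' : (⟨_, (fib β).obj ((tau X _ 1).obj D.F)⟩ : QMod) ⟶ ⟨_, (fib b).obj ((tau X _ 1).obj G.F)⟩}
    (hΘ : IsFibreComparison s r α a Θ) (hΘ' : IsFibreComparison s r β b Θ') :
    ∃ h, Classifies D α β (i := graph a) (k := graph b) (ftau G) G.g Θ Θ' h := by
  have := isArtinPoint_mk A u
  have h1 := hΘ.isCart hG hD.isSht (graph_prodMap' ha) hD.avoids_zero
  have h2 := hΘ'.isCart hG hD.isSht (graph_prodMap' hb) hD.avoids_pole
  subst ha hb
  have := hG.isIso_fib hD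
  exact exists_classifies (k := graph (s ≫ β)) q hD.isSht.locallyFree (q.locEq _ s) (q'.locEq _ s)
    (graph_snd (s ≫ β)) hG.elem_f hG.elem_g (hΘ.bs_eq.trans hs) (hΘ'.bs_eq.trans hs) h1 h2

variable {B : Type u} [CommRing B] [Algebra E B] [IsLocalRing B]
  {v : Spec (of B) ⟶ Spec (of Fq)} {H : ShtukaDiagram X (Over.mk v)}
  {c' : specE E Fq ⟶ Over.mk v} {r' : ShtHom c' H D} {s' : Over.mk v ⟶ specE E Fq}
  {a' b' : Over.mk v ⟶ X} {t : Over.mk v ⟶ Over.mk u}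

/-- The point given by the modifications is compatible with base change. -/
theorem IsModif.baseChange [IsArtinianRing B] (hD : IsDisjointSht q q' d D)
    (hG : IsSht q q' d s G) (hH : IsSht q q' d s' H) (φ : A →ₐ[E] B)
    (hφ : t.left = Spec.map (ofHom φ.toRingHom)) (ht : t ≫ s = s') (ha : a = s ≫ α)
    (hb : b = s ≫ β) (ha' : a' = s' ≫ α) (hb' : b' = s' ≫ β)
    (hs : s.left = Spec.map (ofHom (algebraMap E A)))
    (hs' : s'.left = Spec.map (ofHom (algebraMap E B))) {n : ℕ}
    (hn : PhiPow X (Over.mk v) n = prodMap X s' ≫ PhiPow X _ n ≫ prodMap X c')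
    (p : ShtHom t G H) (hp : p.ρ ≫ r'.ρ = r.ρ) {h : Spec (of A) ⟶ Pnat D α β}
    (hh : IsModif r s a b h) :
    IsModif r' s' a' b' (Spec.map (ofHom φ.toRingHom) ≫ h) := by
  obtain ⟨Θ, Θ', hΘ, hΘ', hC⟩ := hh
  have hat : graph a' ≫ prodMap X t = t.left ≫ graph a :=
    graph_prodMap' (by rw [ha, ha', ← ht, assoc])
  have hbt : graph b' ≫ prodMap X t = t.left ≫ graph b :=
    graph_prodMap' (by rw [hb, hb', ← ht, assoc])
  obtain ⟨χ, hχ, -, hχ₁, hχ₂⟩ := p.exists_tau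
  obtain ⟨σ, hbσ, hσ⟩ := exists_fibre_arrow hat χ hχ
  obtain ⟨σ', hbσ', hσ'⟩ := exists_fibre_arrow hbt χ hχ
  have hk : kap 1 a G.F ≫ σ = p.ρ ≫ kap 1 a' H.F := by
    rw [kap_one, kap_one, assoc, hσ, ← assoc, hχ₁, assoc]
  have hk' : kap 1 b G.F ≫ σ' = p.ρ ≫ kap 1 b' H.F := by
    rw [kap_one, kap_one, assoc, hσ', ← assoc, hχ₁, assoc]
  have h1 := hΘ.naturality hG hD.isSht hH (graph_prodMap' ha') hD.avoids_zero p hp ht hn hbσ hk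
  have h2 := hΘ'.naturality hG hD.isSht hH (graph_prodMap' hb') hD.avoids_pole p hp ht hn hbσ' hk'
  obtain ⟨h₁, hC₁⟩ := exists_isModif hD hH ha' hb' hs' h1 h2
  have c1 := hΘ.isCart hG hD.isSht (graph_prodMap' ha) hD.avoids_zero
  have c2 := hΘ'.isCart hG hD.isSht (graph_prodMap' hb) hD.avoids_pole
  have c3 := h1.isCart hH hD.isSht (graph_prodMap' ha') hD.avoids_zero
  have c4 := h2.isCart hH hD.isSht (graph_prodMap' hb') hD.avoids_pole
  have key := (hC.compat φ q hD.isSht.locallyFree (hΘ.bs_eq.trans hs) (hΘ'.bs_eq.trans hs) c1 c2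
    (h1.bs_eq.trans hs') (h2.bs_eq.trans hs') c3 c4 hC₁ σ σ' (hbσ.trans hφ) (hbσ'.trans hφ) rfl
    rfl).2 ?_
  · rw [key]
    exact ⟨_, _, h1, h2, hC₁⟩
  · obtain ⟨ρ'', hρ'', hρ₁⟩ := exists_cokernel_arrow p.comm_g
    refine ⟨gmap_eq_zero_of_square hat p.bs_ρ' hχ₂ hbσ hσ,
      gmap_eq_zero_of_square hbt (hρ''.trans p.bs_ρ') ?_ hbσ' hσ'⟩
    rw [vert_comp, assoc, hρ₁, ← assoc, hχ₂, assoc, vert_comp]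

/-- Uniqueness of the point given by the modifications. -/
theorem IsModif.unique (hD : IsDisjointSht q q' d D)
    (hG : IsSht q q' d s G) (ha : a = s ≫ α) (hb : b = s ≫ β)
    (hs : s.left = Spec.map (ofHom (algebraMap E A)))
    {h h' : Spec (of A) ⟶ Pnat D α β} (hh : IsModif r s a b h)
    (hh' : IsModif r s a b h') : h = h' := by
  obtain ⟨Θ, Θ', hΘ, hΘ', hC⟩ := hh
  obtain ⟨Θ₁, Θ₁', hΘ₁, hΘ₁', hC'⟩ := hh'
  obtain rfl := hΘ.unique hG hD.isSht (graph_prodMap' ha) hD.avoids_zero hΘ₁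
  obtain rfl := hΘ'.unique hG hD.isSht (graph_prodMap' hb) hD.avoids_pole hΘ₁'
  have c1 := hΘ.isCart hG hD.isSht (graph_prodMap' ha) hD.avoids_zero
  have c2 := hΘ'.isCart hG hD.isSht (graph_prodMap' hb) hD.avoids_pole
  have hid : Spec.map (ofHom (AlgHom.id E A).toRingHom) = 𝟙 (Spec (of A)) :=
    Spec.map_id _
  have key := (hC.compat (AlgHom.id E A) q hD.isSht.locallyFree (hΘ.bs_eq.trans hs)
    (hΘ'.bs_eq.trans hs) c1 c2
    (hΘ.bs_eq.trans hs) (hΘ'.bs_eq.trans hs) c1 c2 hC' (𝟙 _) (𝟙 _) hid.symm hid.symm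
    (comp_id _) (comp_id _)).2
    ⟨fun w hw => by rwa [glob_id], fun w hw => by rwa [glob_id]⟩
  rw [← key, hid, id_comp]

end ModificationPoint

/-! ### Deformations -/

section Deformations

variable {Fq : Type u} [Field Fq] [Fintype Fq] {X S T : Over (Spec (of Fq))}
  {α β : S ⟶ X} {q : GraphEq α} {q' : GraphEq β} {d : ℕ} {D : ShtukaDiagram X S}
  {G : ShtukaDiagram X T} {c : S ⟶ T} {s : T ⟶ S}

/-- An arrow from the sheaf of `G` to a sheaf `L` over a base that avoids the zero and the pole
gives an arrow from the fibre of `Φ^* F`. -/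
theorem exists_fibre_corresponds {L : QMod.{u}} (hG : IsSht q q' d s G)
    (hD : IsSht q q' d (𝟙 S) D) (r : ShtHom c G D) {n : ℕ}
    (hn : PhiPow X T n = prodMap X s ≫ PhiPow X S n ≫ prodMap X c) {a : S ⟶ X}
    (ha : Avoids q q' (graph a ≫ Phi X S)) (w : (⟨prodS X T, G.F⟩ : QMod) ⟶ L)
    (x : L.Y ⟶ S.left) (hw : bs w ≫ prodMap X s = x ≫ graph a ≫ Phi X S) :
    ∃ Θ : (⟨S.left, (fib a).obj ((tau X S 1).obj D.F)⟩ : QMod) ⟶ L, bs Θ = x ∧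
      Corresponds r (kap 1 a D.F ≫ Θ) w ∧ (IsCart w → IsCart Θ) := by
  have hav : Avoids q q' (bs w ≫ prodMap X s) := hw ▸ ha.comp x
  obtain ⟨ϑ, h1, h2⟩ := exists_corresponds hG hD r hn w hav
  have h3 : PhiPow X S 1 = Phi X S := id_comp _
  obtain ⟨Θ, ⟨h4, rfl⟩, -⟩ := isCart_kap 1 a D.F ϑ x (by rw [h1, bs_kap, hw, h3])
  exact ⟨Θ, h4, h2, fun hc => (isCart_kap 1 a D.F).of_comp (h2.isCart hG hD hav h1 hc)⟩

theorem exists_isFibreComparison (hG : IsSht q q' d s G) (hD : IsSht q q' d (𝟙 S) D)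
    (r : ShtHom c G D) {n : ℕ} (hn : PhiPow X T n = prodMap X s ≫ PhiPow X S n ≫ prodMap X c)
    {a : S ⟶ X} {b : T ⟶ X} (h : graph b ≫ prodMap X s = s.left ≫ graph a)
    (ha : Avoids q q' (graph a ≫ Phi X S)) : ∃ Θ, IsFibreComparison s r a b Θ := by
  obtain ⟨Θ, h1, h2, -⟩ := exists_fibre_corresponds hG hD r hn ha (kap 1 b G.F) s.left (by
    rw [bs_kap, kap_prodMap h])
  exact ⟨Θ, h1, h2⟩

variable {R : Over (Spec (of Fq))}

/-- An arrow to a locally free sheaf is determined by its composition with `f`. -/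
theorem IsSht.arrow_ext (hG : IsSht q q' d s G) {t : R ⟶ T} {N : (prodS X R).Modules}
    (hN : IsLocallyFreeOfRank N d) [IsArtinPoint R]
    {w w' : (⟨prodS X T, G.F'⟩ : QMod) ⟶ ⟨prodS X R, N⟩} (hw : bs w = prodMap X t)
    (hw' : bs w' = prodMap X t) (h : vert (ftau G) ≫ w = vert (ftau G) ≫ w') : w = w' := by
  obtain ⟨m, rfl⟩ := exists_toArr w hw
  obtain ⟨m', rfl⟩ := exists_toArr w' hw'
  rw [vert_comp_toArr, vert_comp_toArr] at h
  have h1 : IsElemAlong q d (t ≫ s) ((Scheme.Modules.pullback (prodMap X t)).map (ftau G)) :=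
    hG.elem_f.baseChange (f := ftau G)
      ((isCart_phiArr G).isLocallyFree (T := T) (S := T) hG.locallyFree) t rfl
      (isCart_pbArr _ _) (isCart_pbArr _ _) rfl rfl (pbArr_map _ _).symm
  exact congrArg _ (h1.hom_ext (q.locEq R (t ≫ s)) hN (toArr_injective h))

theorem IsSht.hom_ext (hG : IsSht q q' d s G) {H : ShtukaDiagram X R} {s' : R ⟶ S}
    (hH : IsSht q q' d s' H) [IsArtinPoint R] {t : R ⟶ T} {p p' : ShtHom t G H} (h : p.ρ = p'.ρ) :
    p.ρ' = p'.ρ' := by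
  refine hG.arrow_ext hH.locallyFree' p.bs_ρ' p'.bs_ρ' ((isCart_phiArr G).hom_ext ?_ ?_)
  · rw [bs_comp, bs_comp, p.bs_ρ', p'.bs_ρ']
  · rw [← assoc, ← assoc, phiArr_ftau, p.comm_f, p'.comm_f, h]

end Deformations

section Points

variable {Fq : Type u} [Field Fq] [Fintype Fq] {E : Type u} [Field E] [Algebra Fq E]
  {X : Over (Spec (of Fq))} {α β : specE E Fq ⟶ X} {q : GraphEq α} {q' : GraphEq β}
  {d : ℕ} {D : ShtukaDiagram X (specE E Fq)} {A : ArtAlg E}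

theorem isFibreComparison_compareFib {n : ℕ} (hn : A.FrobNilpotent (Fintype.card Fq) (n + 1))
    {G : ShtukaDiagram X (specA Fq A)} (hG : IsSht q q' d (structMor Fq A) G)
    (hD : IsSht q q' d (𝟙 _) D) (r : PullbackIso (closedPt Fq A) G D) {a : specE E Fq ⟶ X}
    (ha : Avoids q q' (graph a ≫ Phi X (specE E Fq))) :
    IsFibreComparison (structMor Fq A) r.toShtHom a (structMor Fq A ≫ a)
      (toArr _ (compareFib A hn D G r a)) where
  bs_eq := rfl
  corresponds := corresponds_compareFib hn hG hD r ha

omit [Fintype Fq] [Algebra Fq E] in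
theorem gmap_pullSec {B : Type u} [CommRing B]
    {t : Spec (of B) ⟶ Spec (of E)}
    {V : (Spec (of E)).Modules} {W : (Spec (of B)).Modules}
    (m : (Scheme.Modules.pullback t).obj V ⟶ W) (v : gsec V) :
    gmap m (pullSec t V v) = glob (toArr t m) v := by
  rw [toArr, glob_comp, glob_vert, pullSec_eq]

theorem Deformation.fibreMap_eq (G : Deformation D d α β A) {n : ℕ}
    (hn : A.FrobNilpotent (Fintype.card Fq) (n + 1)) (a : specE E Fq ⟶ X) :
    G.fibreMap hn a = glob (toArr (structMor Fq A).left (compareFib A hn D G.diagram G.res a)) :=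
  funext fun v => gmap_pullSec (compareFib A hn D G.diagram G.res a) v

/-- The point given by the modifications in a deformation. -/
abbrev ModifAt {G : ShtukaDiagram X (specA Fq A)} (r : ShtHom (closedPt Fq A) G D)
    (h : Spec (of A.carrier) ⟶ Pnat D α β) : Prop :=
  IsModif r (structMor Fq A) (structMor Fq A ≫ α) (structMor Fq A ≫ β) h

theorem Deformation.isModificationMorphism_iff (hD : IsDisjointSht q q' d D)
    (G : Deformation D d α β A) {n : ℕ} (hn : A.FrobNilpotent (Fintype.card Fq) (n + 1))
    (h : Spec (of A.carrier) ⟶ Pnat D α β) :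
    G.IsModificationMorphism hn h ↔ ModifAt G.res.toShtHom h := by
  have hG : IsSht q q' d (structMor Fq A) G.diagram := isShtuka_iff_isSht.1 G.isShtuka
  have h1 := isFibreComparison_compareFib hn hG hD.isSht G.res hD.avoids_zero
  have h2 := isFibreComparison_compareFib hn hG hD.isSht G.res hD.avoids_pole
  constructor
  · rintro ⟨k1, k2, k3⟩
    rw [G.fibreMap_eq] at k2
    rw [G.fibreMap_eq] at k3
    exact ⟨_, _, h1, h2, k1, k2, k3⟩
  · rintro ⟨Θ, Θ', hΘ, hΘ', hC⟩
    obtain rfl := h1.unique hG hD.isSht (graph_prodMap' rfl) hD.avoids_zero hΘ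
    obtain rfl := h2.unique hG hD.isSht (graph_prodMap' rfl) hD.avoids_pole hΘ'
    refine ⟨hC.hom, ?_, ?_⟩
    · rw [G.fibreMap_eq]
      exact hC.line
    · rw [G.fibreMap_eq]
      exact hC.quotient

theorem isModificationPoint_iff (hD : IsDisjointSht q q' d D)
    (p : Spec (of E) ⟶ Pnat D α β) :
    IsModificationPoint D α β p ↔ IsModif (ShtHom.id D) (𝟙 (specE E Fq)) α β p := by
  have hid : Spec.map (ofHom (algebraMap E E)) = 𝟙 (Spec (of E)) :=
    Spec.map_id _
  have hg : ∀ {V : (Spec (of E)).Modules}, (id : gsec V → gsec V) =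
      glob (𝟙 (⟨_, V⟩ : QMod)) := by
    intro V
    funext v
    exact (glob_id v).symm
  constructor
  · rintro ⟨k1, k2, k3⟩
    refine ⟨_, _, isFibreComparison_id, isFibreComparison_id, k1.trans hid.symm, ?_, ?_⟩
    · exact Eq.mp (congrArg (fun g => ClassifiesLine g _ _) hg) k2
    · refine Eq.mp ?_ k3
      congr 1
      funext v
      exact congrArg _ (glob_id (V := (fib β).obj ((tau X (specE E Fq) 1).obj D.F)) v).symm
  · rintro ⟨Θ, Θ', hΘ, hΘ', hC⟩
    obtain rfl := (isFibreComparison_id (D := D) (a := α)).unique hD.isSht hD.isSht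
      (graph_prodMap' (id_comp _).symm) hD.avoids_zero hΘ
    obtain rfl := (isFibreComparison_id (D := D) (a := β)).unique hD.isSht hD.isSht
      (graph_prodMap' (id_comp _).symm) hD.avoids_pole hΘ'
    refine ⟨hC.hom.trans hid, ?_, ?_⟩
    · exact Eq.mp (congrArg (fun g => ClassifiesLine g _ _) hg.symm) hC.line
    · refine Eq.mp ?_ hC.quotient
      congr 1
      funext v
      exact congrArg _ (glob_id (V := (fib β).obj ((tau X (specE E Fq) 1).obj D.F)) v)

theorem exists_modificationPoint (hD : IsDisjointSht q q' d D) :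
    ∃ p, IsModif (α := α) (β := β) (ShtHom.id D) (𝟙 (specE E Fq)) α β p := by
  obtain ⟨h, hh⟩ := exists_isModif (s := 𝟙 (specE E Fq)) (r := ShtHom.id D) hD hD.isSht
    (id_comp α).symm (id_comp β).symm (Spec.map_id _).symm isFibreComparison_id
    isFibreComparison_id
  exact ⟨h, _, _, isFibreComparison_id, isFibreComparison_id, hh⟩

theorem modificationPoint_unique (hD : IsDisjointSht q q' d D)
    {p p' : Spec (of E) ⟶ Pnat D α β}
    (h : IsModif (ShtHom.id D) (𝟙 (specE E Fq)) α β p)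
    (h' : IsModif (ShtHom.id D) (𝟙 (specE E Fq)) α β p') : p = p' :=
  h.unique hD hD.isSht (id_comp α).symm (id_comp β).symm (Spec.map_id _).symm h'

variable {G : ShtukaDiagram X (specA Fq A)} {r : ShtHom (closedPt Fq A) G D}

theorem exists_modifAt (hD : IsDisjointSht q q' d D) (hG : IsSht q q' d (structMor Fq A) G)
    (r : ShtHom (closedPt Fq A) G D) : ∃ h, ModifAt (α := α) (β := β) r h := by
  obtain ⟨n, hn⟩ := A.exists_frobNilpotent (m := Fintype.card Fq) Fintype.one_lt_card
  obtain ⟨Θ, hΘ⟩ := exists_isFibreComparison hG hD.isSht r (PhiPow_specA X A hn)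
    (graph_prodMap' (a := α) rfl) hD.avoids_zero
  obtain ⟨Θ', hΘ'⟩ := exists_isFibreComparison hG hD.isSht r (PhiPow_specA X A hn)
    (graph_prodMap' (a := β) rfl) hD.avoids_pole
  obtain ⟨h, hh⟩ := exists_isModif hD hG rfl rfl rfl hΘ hΘ'
  exact ⟨h, _, _, hΘ, hΘ', hh⟩

theorem ModifAt.unique (hD : IsDisjointSht q q' d D) (hG : IsSht q q' d (structMor Fq A) G)
    {h h' : Spec (of A.carrier) ⟶ Pnat D α β} (hh : ModifAt r h)
    (hh' : ModifAt r h') : h = h' :=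
  IsModif.unique hD hG rfl rfl rfl hh hh'

theorem ModifAt.hom {h : Spec (of A.carrier) ⟶ Pnat D α β} (hh : ModifAt r h) :
    h ≫ PnatHom D α β = Spec.map (ofHom (algebraMap E A.carrier)) := by
  obtain ⟨Θ, Θ', -, -, hC⟩ := hh
  exact hC.hom

omit [Fintype Fq] in
variable (Fq) in
theorem closedPt_structMor (A : ArtAlg E) : closedPt Fq A ≫ structMor Fq A = 𝟙 _ := by
  ext1
  rw [Over.comp_left]
  change Spec.map _ ≫ Spec.map _ = 𝟙 _
  rw [← Spec.map_comp, ← CommRingCat.ofHom_comp, ← Spec.map_id]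
  congr 1
  ext x
  exact A.aug.commutes x

/-- The restriction to the closed point of the point given by the modifications. -/
theorem ModifAt.restrict (hD : IsDisjointSht q q' d D) (hG : IsSht q q' d (structMor Fq A) G)
    {h : Spec (of A.carrier) ⟶ Pnat D α β} (hh : ModifAt r h) :
    IsModif (ShtHom.id D) (𝟙 (specE E Fq)) α β
      (Spec.map (ofHom A.aug.toRingHom) ≫ h) := by
  refine hh.baseChange hD hG hD.isSht A.aug (t := closedPt Fq A) rfl (closedPt_structMor Fq A)
    rfl rfl (id_comp α).symm (id_comp β).symm rfl (Spec.map_id _).symm (n := 0) ?_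
    r (comp_id _)
  rw [PhiPow, prodMap_id, id_comp, id_comp]

/-- The point given by the modifications is compatible with base change. -/
theorem ModifAt.map (hD : IsDisjointSht q q' d D) (hG : IsSht q q' d (structMor Fq A) G)
    {B : ArtAlg E} (φ : A ⟶ B) {H : ShtukaDiagram X (specA Fq B)}
    (hH : IsSht q q' d (structMor Fq B) H) {r' : ShtHom (closedPt Fq B) H D}
    (p : ShtHom (specMap Fq φ) G H) (hp : p.ρ ≫ r'.ρ = r.ρ)
    {h : Spec (of A.carrier) ⟶ Pnat D α β} (hh : ModifAt r h) :
    ModifAt r' (Spec.map (ofHom φ.1.toRingHom) ≫ h) := by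
  obtain ⟨n, hn⟩ := B.exists_frobNilpotent (m := Fintype.card Fq) Fintype.one_lt_card
  exact hh.baseChange hD hG hH φ.1 (t := specMap Fq φ) rfl (specMap_structMor Fq φ)
    rfl rfl rfl rfl rfl rfl (PhiPow_specA X B hn) p hp

/-- The point given by the modifications is an isomorphism invariant. -/
theorem ModifAt.of_iso (hD : IsDisjointSht q q' d D) (hG : IsSht q q' d (structMor Fq A) G)
    {H : ShtukaDiagram X (specA Fq A)} (hH : IsSht q q' d (structMor Fq A) H)
    {r' : ShtHom (closedPt Fq A) H D} (p : ShtHom (𝟙 _) G H) (hp : p.ρ ≫ r'.ρ = r.ρ)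
    {h : Spec (of A.carrier) ⟶ Pnat D α β} (hh : ModifAt r h) : ModifAt r' h := by
  obtain ⟨n, hn⟩ := A.exists_frobNilpotent (m := Fintype.card Fq) Fintype.one_lt_card
  have hid : Spec.map (ofHom (AlgHom.id E A.carrier).toRingHom) =
    𝟙 (Spec (of A.carrier)) := Spec.map_id _
  have := hh.baseChange hD hG hH (AlgHom.id E A.carrier) (t := 𝟙 (specA Fq A)) hid.symm
    (id_comp _) rfl rfl rfl rfl rfl rfl (PhiPow_specA X A hn) p hp
  rwa [hid, id_comp] at this

end Points

/-! ### The Frobenius kernel of a local Artinian algebra -/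

section FrobeniusKernel

variable {Fq : Type u} [Field Fq] [Fintype Fq]

theorem eq_frob_of_apply {R : Type u} [CommRing R]
    {h : Spec (of R) ⟶ Spec (of Fq)} (k : Over.mk h ⟶ Over.mk h)
    (g : R →+* R) (hg : ∀ x, g x = x ^ Fintype.card Fq)
    (hk : k.left = Spec.map (ofHom g)) : k = frob (Over.mk h) := by
  ext1
  have : IsAffine (Over.mk h).left := inferInstanceAs (IsAffine (Spec (.of R)))
  refine ext_of_isAffine ?_
  rw [hk]
  ext x
  obtain ⟨y, rfl⟩ := (Scheme.ΓSpecIso (.of R)).commRingCatIsoToRingEquiv.symm.surjective x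
  have h1 := congrArg (fun m => m.hom y) (Scheme.ΓSpecIso_inv_naturality (ofHom g))
  refine Eq.trans (Eq.symm h1) ?_
  change (Scheme.ΓSpecIso (.of R)).inv.hom (g y) =
    ((Scheme.ΓSpecIso (.of R)).inv.hom y) ^ Fintype.card Fq
  rw [hg, map_pow]

variable {E : Type u} [Field E] [Algebra Fq E]

/-- The scalars of an algebra over an extension of `Fq`. -/
def baseScalars (Fq : Type u) [Field Fq] {E : Type u} [Field E] [Algebra Fq E] (A : ArtAlg E) :
    Fq →+* A.carrier :=
  (algebraMap E A.carrier).comp (algebraMap Fq E)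

/-- The kernel of the Frobenius. -/
def frobKer (Fq : Type u) [Field Fq] [Fintype Fq] {E : Type u} [Field E] [Algebra Fq E]
    (A : ArtAlg E) : Ideal A.carrier :=
  RingHom.ker (qPow Fq (baseScalars Fq A))

theorem mem_frobKer {A : ArtAlg E} {x : A.carrier} :
    x ∈ frobKer Fq A ↔ x ^ Fintype.card Fq = 0 := Iff.rfl

theorem aug_eq_zero_of_mem_frobKer {A : ArtAlg E} {x : A.carrier} (hx : x ∈ frobKer Fq A) :
    A.aug x = 0 := by
  rw [mem_frobKer] at hx
  have := congrArg A.aug hx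
  rw [map_pow, map_zero] at this
  exact eq_zero_of_pow_eq_zero this

instance (A : ArtAlg E) : Nontrivial (A.carrier ⧸ frobKer Fq A) :=
  Ideal.Quotient.nontrivial_iff.2 fun h => by
    have h1 : (1 : A.carrier) ∈ frobKer Fq A := h ▸ Submodule.mem_top
    rw [mem_frobKer, one_pow] at h1
    exact one_ne_zero h1

/-- The quotient of a local Artinian algebra by the kernel of the Frobenius. -/
def frobQuot (Fq : Type u) [Field Fq] [Fintype Fq] {E : Type u} [Field E] [Algebra Fq E]
    (A : ArtAlg E) : ArtAlg E :=
  haveI : IsLocalRing (A.carrier ⧸ frobKer Fq A) :=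
    IsLocalRing.of_surjective' (Ideal.Quotient.mk _) Ideal.Quotient.mk_surjective
  { carrier := A.carrier ⧸ frobKer Fq A
    aug := Ideal.Quotient.liftₐ (frobKer Fq A) A.aug fun _ h => aug_eq_zero_of_mem_frobKer h }

variable (Fq) in
/-- The Frobenius of `A` factors, in both orders, through the quotient by its kernel, the maximal
ideal of which is killed by a smaller power of the Frobenius. -/
theorem exists_frobFactor (A : ArtAlg E) : ∃ (A₀ : ArtAlg E) (π : A ⟶ A₀)
    (ψ : specA Fq A ⟶ specA Fq A₀), specMap Fq π ≫ ψ = frob _ ∧ ψ ≫ specMap Fq π = frob _ ∧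
      ∀ n, A.FrobNilpotent (Fintype.card Fq) (n + 1) →
        A₀.FrobNilpotent (Fintype.card Fq) n := by
  let A₀ := frobQuot Fq A
  let π' : A.carrier →ₐ[E] A₀.carrier := Ideal.Quotient.mkₐ E (frobKer Fq A)
  have hπ : Surjective π' := Ideal.Quotient.mkₐ_surjective _ _
  let π : A ⟶ A₀ := ⟨π', Ideal.Quotient.liftₐ_comp _ _ _⟩
  let l : A₀.carrier →+* A.carrier :=
    Ideal.Quotient.lift (frobKer Fq A) (qPow Fq (baseScalars Fq A)) fun _ h => h
  have hl : ∀ x, l (π' x) = x ^ Fintype.card Fq := fun x => Ideal.Quotient.lift_mk _ _ _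
  let ψ : specA Fq A ⟶ specA Fq A₀ := Over.homMk (Spec.map (ofHom l)) (by
    simp only [Over.mk_hom, Over.mk_left]
    rw [← Spec.map_comp, ← Spec.map_comp, ← Spec.map_comp, ← CommRingCat.ofHom_comp,
      ← CommRingCat.ofHom_comp, ← CommRingCat.ofHom_comp]
    congr 2
    ext x
    change l (algebraMap E A₀.carrier (algebraMap Fq E x)) = algebraMap E A.carrier (algebraMap Fq E x)
    rw [← π'.commutes, hl, ← map_pow, ← map_pow, FiniteField.pow_card])
  refine ⟨A₀, π, ψ, ?_, ?_, fun n hn x hx => ?_⟩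
  · refine eq_frob_of_apply _ (π'.toRingHom.comp l) (fun x => ?_) ?_
    · obtain ⟨x, rfl⟩ := hπ x
      rw [← map_pow, ← hl]
      rfl
    · rw [CommRingCat.ofHom_comp, Spec.map_comp]
      rfl
  · refine eq_frob_of_apply _ (l.comp π'.toRingHom) hl ?_
    rw [CommRingCat.ofHom_comp, Spec.map_comp]
    rfl
  · obtain ⟨x, rfl⟩ := hπ x
    have h1 : x ∈ IsLocalRing.maximalIdeal A.carrier := fun h => hx (h.map π')
    have h2 : x ^ Fintype.card Fq ^ n ∈ frobKer Fq A := by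
      rw [mem_frobKer, ← pow_mul, ← pow_succ]
      exact hn x h1
    rw [← map_pow]
    exact Ideal.Quotient.eq_zero_iff_mem.2 h2

end FrobeniusKernel

/-! ### Trivial local Artinian algebras -/

section Trivial

variable {Fq : Type u} [Field Fq] [Fintype Fq] {E : Type u} [Field E] [Algebra Fq E]
  {X : Over (Spec (of Fq))} {α β : specE E Fq ⟶ X} {q : GraphEq α} {q' : GraphEq β}
  {d : ℕ} {D : ShtukaDiagram X (specE E Fq)} {A : ArtAlg E}

theorem structMor_closedPt (hA : A.FrobNilpotent (Fintype.card Fq) 0) :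
    structMor Fq A ≫ closedPt Fq A = 𝟙 _ := by
  have := frobPow_specA A hA
  rw [frobPow, frobPow, id_comp] at this
  exact this.symm

/-- Deformations to the base field are isomorphic. -/
theorem exists_hom_of_trivial (hA : A.FrobNilpotent (Fintype.card Fq) 0)
    {G H : ShtukaDiagram X (specA Fq A)} (r : ShtHom (closedPt Fq A) G D)
    (r' : ShtHom (closedPt Fq A) H D) : ∃ p : ShtHom (𝟙 _) G H, p.ρ ≫ r'.ρ = r.ρ := by
  obtain ⟨k, hk, -⟩ := r'.exists_factor (structMor_closedPt hA) (ShtHom.id H)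
  refine ⟨r.comp (structMor_closedPt hA) k, ?_⟩
  have h1 : k.ρ ≫ r'.ρ = 𝟙 _ := by
    refine r'.cart.hom_ext ?_ ?_
    · rw [bs_comp, k.bs_ρ, r'.bs_ρ, ← prodMap_comp, closedPt_structMor, prodMap_id]
      rfl
    · rw [← assoc, hk]
      exact (id_comp _).trans (comp_id _).symm
  refine (assoc _ _ _).trans ?_
  rw [h1, comp_id]

/-- Existence of a deformation to the base field. -/
theorem exists_deformation_of_trivial (hA : A.FrobNilpotent (Fintype.card Fq) 0)
    (hD : IsDisjointSht q q' d D) {p : Spec (of E) ⟶ Pnat D α β}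
    (hp : IsModif (ShtHom.id D) (𝟙 (specE E Fq)) α β p)
    {h : Spec (of A.carrier) ⟶ Pnat D α β}
    (hh : Spec.map (ofHom A.aug.toRingHom) ≫ h = p) :
    ∃ (G : ShtukaDiagram X (specA Fq A)) (r : ShtHom (closedPt Fq A) G D),
      IsSht q q' d (structMor Fq A) G ∧ ModifAt r h := by
  obtain ⟨G, ⟨k⟩⟩ := exists_shtHom (structMor Fq A) D
  obtain ⟨r, -⟩ := k.exists_factor (closedPt_structMor Fq A) (ShtHom.id D)
  have hG : IsSht q q' d (structMor Fq A) G := hD.isSht.baseChange (comp_id _) k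
  obtain ⟨h', hh'⟩ := exists_modifAt hD hG r
  have h1 := modificationPoint_unique hD (hh'.restrict hD hG) hp
  have h2 : Spec.map (ofHom (algebraMap E A.carrier)) ≫
      Spec.map (ofHom A.aug.toRingHom) = 𝟙 _ :=
    congrArg CommaMorphism.left (structMor_closedPt (Fq := Fq) hA)
  have h3 : h' = h := by
    rw [← id_comp h', ← id_comp h, ← h2, assoc, assoc, h1, hh]
  exact ⟨G, r, hG, h3 ▸ hh'⟩

end Trivial

/-! ### Pairs of modifications -/

section Pairs

theorem vert_cancel {Y Z : Scheme.{u}} {P : Y.Modules} {M N : Z.Modules} {m : M ⟶ N} [Mono m]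
    {w w' : (⟨Y, P⟩ : QMod) ⟶ ⟨Z, M⟩} (hb : bs w = bs w') (h : w ≫ vert m = w' ≫ vert m) :
    w = w' := by
  obtain ⟨k, hk⟩ := exists_toArr w hb
  obtain ⟨k', hk'⟩ := exists_toArr w' rfl
  have h1 : toArr (bs w') (k ≫ m) = toArr (bs w') (k' ≫ m) := by
    rw [← toArr_comp_vert, ← toArr_comp_vert, hk, hk', h]
  exact hk.symm.trans ((congrArg _ ((cancel_mono m).1 (toArr_injective h1))).trans hk')

variable {Fq : Type u} [Field Fq] [Fintype Fq] {E : Type u} [Field E] [Algebra Fq E]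
  {X : Over (Spec (of Fq))} {α β : specE E Fq ⟶ X}
  {D : ShtukaDiagram X (specE E Fq)} {q : GraphEq α} {q' : GraphEq β} {d : ℕ}
  {A : Type u} [CommRing A] [Algebra E A] [IsLocalRing A] [IsArtinianRing A]
  {u : Spec (of A) ⟶ Spec (of Fq)} {s : Over.mk u ⟶ specE E Fq}
  {M F F' M₁ F₁ F₁' : (prodS X (Over.mk u)).Modules} {f : M ⟶ F'} {g : F ⟶ F'}
  {f₁ : M₁ ⟶ F₁'} {g₁ : F₁ ⟶ F₁'}

/-- An upper modification `f` along the zero and a lower modification `g` along the pole, with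
identifications `Θ` and `Θ'` of the fibres of the source of `f` with those of `Φ^* F`. -/
structure IsMarked (q : GraphEq α) (q' : GraphEq β) (d : ℕ) (s : Over.mk u ⟶ specE E Fq)
    (f : M ⟶ F') (g : F ⟶ F')
    (Θ : (⟨_, (fib α).obj ((tau X _ 1).obj D.F)⟩ : QMod) ⟶ ⟨_, (fib (s ≫ α)).obj M⟩)
    (Θ' : (⟨_, (fib β).obj ((tau X _ 1).obj D.F)⟩ : QMod) ⟶ ⟨_, (fib (s ≫ β)).obj M⟩) : Prop where
  locallyFree : IsLocallyFreeOfRank M d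
  elem_f : IsElemAlong q d s f
  elem_g : IsElemAlong q' d s g
  bs_zero : bs Θ = s.left
  bs_pole : bs Θ' = s.left
  cart_zero : IsCart Θ
  cart_pole : IsCart Θ'

variable {Θ : (⟨_, (fib α).obj ((tau X _ 1).obj D.F)⟩ : QMod) ⟶ ⟨_, (fib (s ≫ α)).obj M⟩}
  {Θ' : (⟨_, (fib β).obj ((tau X _ 1).obj D.F)⟩ : QMod) ⟶ ⟨_, (fib (s ≫ β)).obj M⟩}
  {Θ₁ : (⟨_, (fib α).obj ((tau X _ 1).obj D.F)⟩ : QMod) ⟶ ⟨_, (fib (s ≫ α)).obj M₁⟩}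
  {Θ₁' : (⟨_, (fib β).obj ((tau X _ 1).obj D.F)⟩ : QMod) ⟶ ⟨_, (fib (s ≫ β)).obj M₁⟩}

omit [Fintype Fq] [Algebra E A] [IsLocalRing A] [IsArtinianRing A] in
theorem isIso_fib_pole (hp : ∀ x, graph β x ∈ q.U) (hf : IsElemAlong q d s f) :
    IsIso ((fib (s ≫ β)).map f) :=
  isIso_fibre_of_bijective hf.bij fun x => by
    change prodMap X s (graph (s ≫ β) x) ∈ q.U
    rw [prodMap_graph_apply]
    exact hp _

theorem IsMarked.exists_classifies (hD : IsDisjointSht q q' d D)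
    (hs : s.left = Spec.map (ofHom (algebraMap E A)))
    (h : IsMarked q q' d s f g Θ Θ') :
    ∃ x, Classifies D α β (i := graph (s ≫ α)) (k := graph (s ≫ β)) f g Θ Θ' x := by
  have := isArtinPoint_mk A u
  have := isIso_fib_pole hD.pole_mem h.elem_f
  exact Sht.exists_classifies (k := graph (s ≫ β)) q hD.isSht.locallyFree (q.locEq _ s)
    (q'.locEq _ s) (graph_snd (s ≫ β)) h.elem_f h.elem_g (h.bs_zero.trans hs) (h.bs_pole.trans hs)
    h.cart_zero h.cart_pole

/-- An isomorphism of the sources of the upper modifications that respects the identifications of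
the fibres extends to the pairs of modifications that are classified by the same point. -/
theorem IsMarked.exists_hom (hD : IsDisjointSht q q' d D)
    (hs : s.left = Spec.map (ofHom (algebraMap E A)))
    (h : IsMarked q q' d s f g Θ Θ') (h₁ : IsMarked q q' d s f₁ g₁ Θ₁ Θ₁')
    {x : Spec (of A) ⟶ Pnat D α β}
    (hx : Classifies D α β (i := graph (s ≫ α)) (k := graph (s ≫ β)) f g Θ Θ' x)
    (hx₁ : Classifies D α β (i := graph (s ≫ α)) (k := graph (s ≫ β)) f₁ g₁ Θ₁ Θ₁' x)
    (m : M ⟶ M₁) (hm : Θ ≫ vert ((fib (s ≫ α)).map m) = Θ₁)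
    (hm' : Θ' ≫ vert ((fib (s ≫ β)).map m) = Θ₁') :
    ∃ (n' : F' ⟶ F₁') (n : F ⟶ F₁), f ≫ n' = m ≫ f₁ ∧ n ≫ g₁ = g ≫ n' := by
  have := isArtinPoint_mk A u
  have hid : Spec.map (ofHom (AlgHom.id E A).toRingHom) = 𝟙 (Spec (of A)) :=
    Spec.map_id _
  obtain ⟨c1, c2⟩ := (hx.compat (AlgHom.id E A) q hD.isSht.locallyFree (h.bs_zero.trans hs)
    (h.bs_pole.trans hs) h.cart_zero h.cart_pole (h₁.bs_zero.trans hs) (h₁.bs_pole.trans hs)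
    h₁.cart_zero h₁.cart_pole hx₁ (vert ((fib (s ≫ α)).map m)) (vert ((fib (s ≫ β)).map m)) hid.symm hid.symm hm
    hm').1 (by rw [hid, id_comp])
  obtain ⟨n', hn'⟩ := h.elem_f.exists_upper (q.locEq _ s)
    (h₁.elem_f.isLocallyFree' (q.locEq _ s) h₁.locallyFree) m h₁.elem_f fun y hy =>
      (congrArg (gmap ((fib (s ≫ α)).map f₁)) (glob_vert ((fib (s ≫ α)).map m) y)).symm.trans (c1 y hy)
  have h2 := isIso_fib_pole hD.pole_mem h.elem_f
  obtain ⟨n, hn⟩ := h₁.elem_g.exists_lower (graph_snd (s ≫ β)) (q'.locEq _ s) (g ≫ n') (by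
    refine hom_eq_zero_of_top _ fun z => ?_
    obtain ⟨w, hw⟩ := (bijective_of_isIso ((fib (s ≫ β)).map f) ⊤).2
      ((((fib (s ≫ β)).map g).app ⊤).hom z)
    have h3 : gmap ((fib (s ≫ β)).map (f ≫ cokernel.π g)) w = 0 := by
      rw [CategoryTheory.Functor.map_comp]
      refine (congrArg (fun x => (((fib (s ≫ β)).map (cokernel.π g)).app ⊤).hom x) hw).trans ?_
      rw [← comp_app', ← CategoryTheory.Functor.map_comp, cokernel.condition,
        CategoryTheory.Functor.map_zero]
      rfl
    have h4 : gmap ((fib (s ≫ β)).map (f₁ ≫ cokernel.π g₁)) (gmap ((fib (s ≫ β)).map m) w) = 0 :=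
      (congrArg (gmap ((fib (s ≫ β)).map (f₁ ≫ cokernel.π g₁)))
        (glob_vert ((fib (s ≫ β)).map m) w)).symm.trans (c2 w h3)
    have e : (fib (s ≫ β)).map m ≫ (fib (s ≫ β)).map (f₁ ≫ cokernel.π g₁) =
        (fib (s ≫ β)).map f ≫ (fib (s ≫ β)).map (n' ≫ cokernel.π g₁) := by
      rw [← CategoryTheory.Functor.map_comp, ← CategoryTheory.Functor.map_comp, ← assoc, ← hn',
        assoc]
    have h5 : gmap ((fib (s ≫ β)).map f ≫ (fib (s ≫ β)).map (n' ≫ cokernel.π g₁)) w = 0 := by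
      rw [← e]
      exact h4
    rw [assoc, CategoryTheory.Functor.map_comp]
    refine Eq.trans ?_ h5
    exact congrArg (fun x => (((fib (s ≫ β)).map (n' ≫ cokernel.π g₁)).app ⊤).hom x) hw.symm)
  exact ⟨n', n, hn', hn⟩

theorem IsMarked.exists_iso (hD : IsDisjointSht q q' d D)
    (hs : s.left = Spec.map (ofHom (algebraMap E A)))
    (h : IsMarked q q' d s f g Θ Θ') (h₁ : IsMarked q q' d s f₁ g₁ Θ₁ Θ₁')
    {x : Spec (of A) ⟶ Pnat D α β}
    (hx : Classifies D α β (i := graph (s ≫ α)) (k := graph (s ≫ β)) f g Θ Θ' x)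
    (hx₁ : Classifies D α β (i := graph (s ≫ α)) (k := graph (s ≫ β)) f₁ g₁ Θ₁ Θ₁' x)
    (m : M ⟶ M₁) [IsIso m] (hm : Θ ≫ vert ((fib (s ≫ α)).map m) = Θ₁)
    (hm' : Θ' ≫ vert ((fib (s ≫ β)).map m) = Θ₁') :
    ∃ (n' : F' ⟶ F₁') (n : F ⟶ F₁), IsIso n' ∧ IsIso n ∧ f ≫ n' = m ≫ f₁ ∧ n ≫ g₁ = g ≫ n' := by
  have := isArtinPoint_mk A u
  obtain ⟨n', n, h1, h2⟩ := h.exists_hom hD hs h₁ hx hx₁ m hm hm'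
  have key : ∀ {V V' : (Spec (of E)).Modules} {N N₁ : (Spec (of A)).Modules}
      {k : N ⟶ N₁} [IsIso k] {T : (⟨_, V⟩ : QMod) ⟶ ⟨_, N⟩} {T₁ : (⟨_, V⟩ : QMod) ⟶ ⟨_, N₁⟩},
      T ≫ vert k = T₁ → T₁ ≫ vert (inv k) = T := by
    rintro V V' N N₁ k _ T _ rfl
    rw [assoc, ← vert_comp, IsIso.hom_inv_id]
    exact comp_id _
  obtain ⟨l', l, h3, h4⟩ := h₁.exists_hom hD hs h hx₁ hx (inv m)
    (by rw [CategoryTheory.Functor.map_inv]; exact key (V' := (fib α).obj ((tau X _ 1).obj D.F)) hm)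
    (by rw [CategoryTheory.Functor.map_inv]; exact key (V' := (fib α).obj ((tau X _ 1).obj D.F)) hm')
  have e1 : n' ≫ l' = 𝟙 _ := by
    refine h.elem_f.hom_ext (q.locEq _ s) (h.elem_f.isLocallyFree' (q.locEq _ s) h.locallyFree) ?_
    rw [← assoc, h1, assoc, h3, IsIso.hom_inv_id_assoc, comp_id]
  have e2 : l' ≫ n' = 𝟙 _ := by
    refine h₁.elem_f.hom_ext (q.locEq _ s)
      (h₁.elem_f.isLocallyFree' (q.locEq _ s) h₁.locallyFree) ?_
    rw [← assoc, h3, assoc, h1, IsIso.inv_hom_id_assoc, comp_id]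
  have := h.elem_g.mono (q'.locEq _ s)
  have := h₁.elem_g.mono (q'.locEq _ s)
  refine ⟨n', n, ⟨l', e1, e2⟩, ⟨l, ?_, ?_⟩, h1, h2⟩
  · rw [← cancel_mono g, assoc, h4, ← assoc, h2, assoc, e1, comp_id, id_comp]
  · rw [← cancel_mono g₁, assoc, h2, ← assoc, h4, assoc, e2, comp_id, id_comp]

variable {B : Type u} [CommRing B] [Algebra E B] [IsLocalRing B] [IsArtinianRing B]
  {v : Spec (of B) ⟶ Spec (of Fq)} {s' : Over.mk v ⟶ specE E Fq}
  {t : Over.mk v ⟶ Over.mk u}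
  {M₂ F₂ F₂' : (prodS X (Over.mk v)).Modules} {f₂ : M₂ ⟶ F₂'} {g₂ : F₂ ⟶ F₂'}

omit [Algebra E A] [Algebra E B] [IsLocalRing B] [IsArtinianRing B] in
/-- The base change of a pair of modifications. -/
theorem IsMarked.baseChange (h : IsMarked q q' d s f g Θ Θ') (ht : t ≫ s = s')
    {χ : (⟨_, M⟩ : QMod) ⟶ ⟨_, M₂⟩} {χ' : (⟨_, F'⟩ : QMod) ⟶ ⟨_, F₂'⟩}
    {χ'' : (⟨_, F⟩ : QMod) ⟶ ⟨_, F₂⟩} (hχ : IsCart χ) (hχ' : IsCart χ') (hχ'' : IsCart χ'')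
    (bχ : bs χ = prodMap X t) (bχ' : bs χ' = prodMap X t) (bχ'' : bs χ'' = prodMap X t)
    (cf : vert f ≫ χ' = χ ≫ vert f₂) (cg : vert g ≫ χ' = χ'' ≫ vert g₂)
    {σ : (⟨_, (fib (s ≫ α)).obj M⟩ : QMod) ⟶ ⟨_, (fib (s' ≫ α)).obj M₂⟩}
    {σ' : (⟨_, (fib (s ≫ β)).obj M⟩ : QMod) ⟶ ⟨_, (fib (s' ≫ β)).obj M₂⟩}
    (bσ : bs σ = t.left) (bσ' : bs σ' = t.left)
    (hσ : pbArr (graph (s ≫ α)) M ≫ σ = χ ≫ pbArr (graph (s' ≫ α)) M₂)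
    (hσ' : pbArr (graph (s ≫ β)) M ≫ σ' = χ ≫ pbArr (graph (s' ≫ β)) M₂) :
    IsMarked q q' d s' f₂ g₂ (Θ ≫ σ) (Θ' ≫ σ') := by
  have := isArtinPoint_mk A u
  have cσ : IsCart σ := (isCart_pbArr (graph (s ≫ α)) M).of_comp (hσ ▸ hχ.comp (isCart_pbArr _ _))
  have cσ' : IsCart σ' :=
    (isCart_pbArr (graph (s ≫ β)) M).of_comp (hσ' ▸ hχ.comp (isCart_pbArr _ _))
  have hF : IsLocallyFreeOfRank F d := h.elem_g.isLocallyFree (q'.locEq _ s)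
    (h.elem_f.isLocallyFree' (q.locEq _ s) h.locallyFree)
  exact
    { locallyFree := hχ.isLocallyFree h.locallyFree
      elem_f := h.elem_f.baseChange h.locallyFree t ht hχ hχ' bχ bχ' cf
      elem_g := h.elem_g.baseChange hF t ht hχ'' hχ' bχ'' bχ' cg
      bs_zero := by rw [bs_comp, h.bs_zero, bσ, ← ht, Over.comp_left]
      bs_pole := by rw [bs_comp, h.bs_pole, bσ', ← ht, Over.comp_left]
      cart_zero := h.cart_zero.comp cσ
      cart_pole := h.cart_pole.comp cσ' }

omit [IsArtinianRing A] in
/-- The point that classifies a pair of modifications is compatible with base change. -/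
theorem Classifies.baseChange (hD : IsDisjointSht q q' d D)
    (hs : s.left = Spec.map (ofHom (algebraMap E A)))
    (hs' : s'.left = Spec.map (ofHom (algebraMap E B)))
    (h : IsMarked q q' d s f g Θ Θ') (φ : A →ₐ[E] B)
    (hφ : t.left = Spec.map (ofHom φ.toRingHom)) (ht : t ≫ s = s')
    {χ : (⟨_, M⟩ : QMod) ⟶ ⟨_, M₂⟩} {χ' : (⟨_, F'⟩ : QMod) ⟶ ⟨_, F₂'⟩}
    {χ'' : (⟨_, F⟩ : QMod) ⟶ ⟨_, F₂⟩} (bχ' : bs χ' = prodMap X t)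
    (cf : vert f ≫ χ' = χ ≫ vert f₂) (cg : vert g ≫ χ' = χ'' ≫ vert g₂)
    {σ : (⟨_, (fib (s ≫ α)).obj M⟩ : QMod) ⟶ ⟨_, (fib (s' ≫ α)).obj M₂⟩}
    {σ' : (⟨_, (fib (s ≫ β)).obj M⟩ : QMod) ⟶ ⟨_, (fib (s' ≫ β)).obj M₂⟩}
    (bσ : bs σ = t.left) (bσ' : bs σ' = t.left)
    (hσ : pbArr (graph (s ≫ α)) M ≫ σ = χ ≫ pbArr (graph (s' ≫ α)) M₂)
    (hσ' : pbArr (graph (s ≫ β)) M ≫ σ' = χ ≫ pbArr (graph (s' ≫ β)) M₂)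
    (h₂ : IsMarked q q' d s' f₂ g₂ (Θ ≫ σ) (Θ' ≫ σ'))
    {x : Spec (of A) ⟶ Pnat D α β}
    (hx : Classifies D α β (i := graph (s ≫ α)) (k := graph (s ≫ β)) f g Θ Θ' x) :
    Classifies D α β (i := graph (s' ≫ α)) (k := graph (s' ≫ β)) f₂ g₂ (Θ ≫ σ) (Θ' ≫ σ')
      (Spec.map (ofHom φ.toRingHom) ≫ x) := by
  have hat : graph (s' ≫ α) ≫ prodMap X t = t.left ≫ graph (s ≫ α) :=
    graph_prodMap' (by rw [← ht, assoc])
  have hbt : graph (s' ≫ β) ≫ prodMap X t = t.left ≫ graph (s ≫ β) :=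
    graph_prodMap' (by rw [← ht, assoc])
  obtain ⟨y, hy⟩ := h₂.exists_classifies hD hs'
  have key := (hx.compat φ q hD.isSht.locallyFree (h.bs_zero.trans hs) (h.bs_pole.trans hs)
    h.cart_zero h.cart_pole (h₂.bs_zero.trans hs') (h₂.bs_pole.trans hs') h₂.cart_zero
    h₂.cart_pole hy σ σ' (bσ.trans hφ) (bσ'.trans hφ) rfl rfl).2 ?_
  · rw [key]
    exact hy
  · obtain ⟨ρ'', hρ'', hρ₁⟩ := exists_cokernel_arrow cg
    refine ⟨gmap_eq_zero_of_square hat bχ' cf bσ hσ,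
      gmap_eq_zero_of_square hbt (hρ''.trans bχ') ?_ bσ' hσ'⟩
    rw [vert_comp, assoc, hρ₁, ← assoc, cf, assoc, vert_comp]

omit [Algebra E A] [IsLocalRing A] [IsArtinianRing A] in
/-- The pair of modifications in a shtuka. -/
theorem IsSht.isMarked (hD : IsDisjointSht q q' d D) {G : ShtukaDiagram X (Over.mk u)}
    (hG : IsSht q q' d s G) {c : specE E Fq ⟶ Over.mk u} {r : ShtHom c G D}
    {Θ : (⟨_, (fib α).obj ((tau X _ 1).obj D.F)⟩ : QMod) ⟶
      ⟨_, (fib (s ≫ α)).obj ((tau X _ 1).obj G.F)⟩}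
    {Θ' : (⟨_, (fib β).obj ((tau X _ 1).obj D.F)⟩ : QMod) ⟶
      ⟨_, (fib (s ≫ β)).obj ((tau X _ 1).obj G.F)⟩}
    (h : IsFibreComparison s r α (s ≫ α) Θ) (h' : IsFibreComparison s r β (s ≫ β) Θ') :
    IsMarked q q' d s (ftau G) G.g Θ Θ' where
  locallyFree := (isCart_phiArr G).isLocallyFree (S := Over.mk u) (T := Over.mk u) hG.locallyFree
  elem_f := hG.elem_f
  elem_g := hG.elem_g
  bs_zero := h.bs_eq
  bs_pole := h'.bs_eq
  cart_zero := h.isCart hG hD.isSht (graph_prodMap' rfl) hD.avoids_zero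
  cart_pole := h'.isCart hG hD.isSht (graph_prodMap' rfl) hD.avoids_pole

end Pairs

/-! ### Uniqueness of deformations -/

section Uniqueness

variable {Fq : Type u} [Field Fq] [Fintype Fq] {E : Type u} [Field E] [Algebra Fq E]
  {X : Over (Spec (of Fq))} {α β : specE E Fq ⟶ X} {q : GraphEq α} {q' : GraphEq β}
  {d : ℕ} {D : ShtukaDiagram X (specE E Fq)} {A A₀ : ArtAlg E} {π : A ⟶ A₀}
  {ψ : specA Fq A ⟶ specA Fq A₀}

theorem structMor_frobFactor (h : ψ ≫ specMap Fq π = frob _) :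
    ψ ≫ structMor Fq A₀ = structMor Fq A ≫ frob _ := by
  rw [← specMap_structMor Fq π, ← assoc, h, frob_naturality]

theorem graph_frobFactor (h : ψ ≫ specMap Fq π = frob _) (a : specE E Fq ⟶ X) :
    (graph (structMor Fq A ≫ a) ≫ prodMap X ψ) ≫ prodMap X (structMor Fq A₀) =
      (structMor Fq A).left ≫ graph a ≫ Phi X _ := by
  rw [assoc, ← prodMap_comp, structMor_frobFactor h, prodMap_comp, ← assoc, graph_prodMap, assoc]
  rfl

variable {G : ShtukaDiagram X (specA Fq A)} {G₀ : ShtukaDiagram X (specA Fq A₀)}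

/-- As the Frobenius of `A` factors through `A₀`, the sheaf `Φ^* G` is a pullback of the
restriction of `G` to `A₀`. -/
theorem exists_frobLift (h : ψ ≫ specMap Fq π = frob _) (ρ : ShtHom (specMap Fq π) G G₀) :
    ∃ γ : (⟨prodS X (specA Fq A₀), G₀.F⟩ : QMod) ⟶
      ⟨prodS X (specA Fq A), (tau X (specA Fq A) 1).obj G.F⟩,
      bs γ = prodMap X ψ ∧ IsCart γ ∧ ρ.ρ ≫ γ = phiArr G := by
  obtain ⟨γ, ⟨h1, h2⟩, -⟩ := ρ.cart (phiArr G) (prodMap X ψ) (by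
    rw [ρ.bs_ρ, ← prodMap_comp, h, bs_phiArr, Phi])
  exact ⟨γ, h1, ρ.cart.of_comp (h2 ▸ isCart_phiArr G), h2⟩

variable {r : ShtHom (closedPt Fq A) G D} {r₀ : ShtHom (closedPt Fq A₀) G₀ D}
  {ρ : ShtHom (specMap Fq π) G G₀}
  {γ : (⟨prodS X (specA Fq A₀), G₀.F⟩ : QMod) ⟶
    ⟨prodS X (specA Fq A), (tau X (specA Fq A) 1).obj G.F⟩}

theorem isFibreComparison_of_frobLift (hρ : ρ.ρ ≫ r₀.ρ = r.ρ) (hγ : ρ.ρ ≫ γ = phiArr G)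
    {a : specE E Fq ⟶ X}
    {Θ : (⟨(specE E Fq).left, (fib a).obj ((tau X _ 1).obj D.F)⟩ : QMod) ⟶
      ⟨(specA Fq A).left, (fib (structMor Fq A ≫ a)).obj ((tau X _ 1).obj G.F)⟩}
    (hb : bs Θ = (structMor Fq A).left)
    (hΘ : Corresponds r₀ (kap 1 a D.F ≫ Θ) (γ ≫ pbArr (graph (structMor Fq A ≫ a)) _)) :
    IsFibreComparison (structMor Fq A) r a (structMor Fq A ≫ a) Θ := by
  refine ⟨hb, ?_⟩
  rw [kap_one _ G, ← hγ, assoc]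
  exact hΘ.naturality ρ hρ

theorem IsFibreComparison.corresponds_frobLift (hD : IsDisjointSht q q' d D)
    (hG : IsSht q q' d (structMor Fq A) G) (hG₀ : IsSht q q' d (structMor Fq A₀) G₀)
    (h : ψ ≫ specMap Fq π = frob _) (hρ : ρ.ρ ≫ r₀.ρ = r.ρ) (hγ : ρ.ρ ≫ γ = phiArr G)
    (bγ : bs γ = prodMap X ψ) {a : specE E Fq ⟶ X} (ha : Avoids q q' (graph a ≫ Phi X _))
    {Θ : (⟨(specE E Fq).left, (fib a).obj ((tau X _ 1).obj D.F)⟩ : QMod) ⟶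
      ⟨(specA Fq A).left, (fib (structMor Fq A ≫ a)).obj ((tau X _ 1).obj G.F)⟩}
    (hΘ : IsFibreComparison (structMor Fq A) r a (structMor Fq A ≫ a) Θ) :
    Corresponds r₀ (kap 1 a D.F ≫ Θ) (γ ≫ pbArr (graph (structMor Fq A ≫ a)) _) := by
  obtain ⟨n, hn⟩ := A₀.exists_frobNilpotent (m := Fintype.card Fq) Fintype.one_lt_card
  have h1 : bs (γ ≫ pbArr (graph (structMor Fq A ≫ a)) ((tau X (specA Fq A) 1).obj G.F)) ≫
      prodMap X (structMor Fq A₀) = (structMor Fq A).left ≫ graph a ≫ Phi X _ := by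
    rw [bs_comp, bs_pbArr, bγ, graph_frobFactor h]
  have h2 : PhiPow X (specE E Fq) 1 = Phi X _ := id_comp _
  refine Corresponds.of_naturality hG hD.isSht hG₀ ρ hρ (specMap_structMor Fq π)
    (PhiPow_specA X A₀ hn) ?_ (h1 ▸ ha.comp _) ?_
  · rw [← assoc ρ.ρ, hγ, ← kap_one]
    exact hΘ.corresponds
  · rw [h1, bs_comp, bs_kap, hΘ.bs_eq, h2]

variable {H : ShtukaDiagram X (specA Fq A)} {H₀ : ShtukaDiagram X (specA Fq A₀)}
  {r' : ShtHom (closedPt Fq A) H D} {r₀' : ShtHom (closedPt Fq A₀) H₀ D}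
  {ρ' : ShtHom (specMap Fq π) H H₀}
  {γ' : (⟨prodS X (specA Fq A₀), H₀.F⟩ : QMod) ⟶
    ⟨prodS X (specA Fq A), (tau X (specA Fq A) 1).obj H.F⟩}

/-- The identifications of the fibres are compatible with the isomorphism `m` of the sheaves
`Φ^* F` that is given by an isomorphism of the restrictions to `A₀`. -/
theorem IsFibreComparison.comp_frobLift (hD : IsDisjointSht q q' d D)
    (hG : IsSht q q' d (structMor Fq A) G) (hG₀ : IsSht q q' d (structMor Fq A₀) G₀)
    (hH₀ : IsSht q q' d (structMor Fq A₀) H₀) (h : ψ ≫ specMap Fq π = frob _)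
    (hρ : ρ.ρ ≫ r₀.ρ = r.ρ) (hρ' : ρ'.ρ ≫ r₀'.ρ = r'.ρ)
    (hγ : ρ.ρ ≫ γ = phiArr G) (hγ' : ρ'.ρ ≫ γ' = phiArr H) (bγ : bs γ = prodMap X ψ)
    (bγ' : bs γ' = prodMap X ψ) {k : ShtHom (𝟙 _) G₀ H₀} (hk : k.ρ ≫ r₀'.ρ = r₀.ρ)
    {m : (tau X (specA Fq A) 1).obj G.F ⟶ (tau X (specA Fq A) 1).obj H.F}
    (hm : γ ≫ vert m = k.ρ ≫ γ') {a : specE E Fq ⟶ X} (ha : Avoids q q' (graph a ≫ Phi X _))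
    {Θ : (⟨(specE E Fq).left, (fib a).obj ((tau X _ 1).obj D.F)⟩ : QMod) ⟶
      ⟨(specA Fq A).left, (fib (structMor Fq A ≫ a)).obj ((tau X _ 1).obj G.F)⟩}
    (hΘ : IsFibreComparison (structMor Fq A) r a (structMor Fq A ≫ a) Θ) :
    IsFibreComparison (structMor Fq A) r' a (structMor Fq A ≫ a)
      (Θ ≫ vert ((fib (structMor Fq A ≫ a)).map m)) := by
  obtain ⟨n, hn⟩ := A₀.exists_frobNilpotent (m := Fintype.card Fq) Fintype.one_lt_card
  have h1 : bs (γ' ≫ pbArr (graph (structMor Fq A ≫ a)) ((tau X (specA Fq A) 1).obj H.F)) ≫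
      prodMap X (structMor Fq A₀) = (structMor Fq A).left ≫ graph a ≫ Phi X _ := by
    rw [bs_comp, bs_pbArr, bγ', graph_frobFactor h]
  have h2 : PhiPow X (specE E Fq) 1 = Phi X _ := id_comp _
  have h3 : bs (Θ ≫ vert ((fib (structMor Fq A ≫ a)).map m)) = (structMor Fq A).left := by
    rw [bs_comp, hΘ.bs_eq]
    exact id_comp _
  refine isFibreComparison_of_frobLift hρ' hγ' h3 ?_
  refine Corresponds.of_naturality hG₀ hD.isSht hH₀ k hk (id_comp _)
    (PhiPow_specA X A₀ hn) ?_ (h1 ▸ ha.comp _) ?_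
  · rw [← assoc k.ρ, ← hm, assoc γ, ← pbArr_map, ← assoc γ, ← assoc]
    exact (hΘ.corresponds_frobLift hD hG hG₀ h hρ hγ bγ ha).comp_right _
  · rw [h1, bs_comp, bs_kap, h3, h2]

/-- Two deformations to `A` with the same modifications are isomorphic if their restrictions to
`A₀` are. -/
theorem exists_hom_of_frobFactor (hD : IsDisjointSht q q' d D) (h : ψ ≫ specMap Fq π = frob _)
    (h₀ : specMap Fq π ≫ ψ = frob _)
    (hG : IsSht q q' d (structMor Fq A) G) (hG₀ : IsSht q q' d (structMor Fq A₀) G₀)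
    (hH : IsSht q q' d (structMor Fq A) H) (hH₀ : IsSht q q' d (structMor Fq A₀) H₀)
    (hρ : ρ.ρ ≫ r₀.ρ = r.ρ) (hρ' : ρ'.ρ ≫ r₀'.ρ = r'.ρ) {k : ShtHom (𝟙 _) G₀ H₀}
    (hk : k.ρ ≫ r₀'.ρ = r₀.ρ) {x : Spec (of A.carrier) ⟶ Pnat D α β}
    (hx : ModifAt r x) (hx' : ModifAt r' x) : ∃ p : ShtHom (𝟙 _) G H, p.ρ ≫ r'.ρ = r.ρ := by
  obtain ⟨γ, bγ, cγ, hγ⟩ := exists_frobLift h ρ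
  obtain ⟨γ', bγ', cγ', hγ'⟩ := exists_frobLift h ρ'
  have bk : bs k.ρ = 𝟙 _ := k.bs_ρ.trans (prodMap_id X _)
  obtain ⟨μ, ⟨bμ, hμ⟩, -⟩ := cγ (k.ρ ≫ γ') (𝟙 _) (by
    rw [bs_comp, bγ, bγ', bk]
    exact (id_comp _).trans (comp_id _).symm)
  obtain ⟨m, rfl⟩ := exists_vert μ bμ
  have : IsIso m := isIso_of_isCart_vert (cγ.of_comp (hμ ▸ k.cart.comp cγ'))
  obtain ⟨Θ, Θ', hΘ, hΘ', hC⟩ := hx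
  obtain ⟨Θ₁, Θ₁', hΘ₁, hΘ₁', hC₁⟩ := hx'
  have e1 := (hΘ.comp_frobLift hD hG hG₀ hH₀ h hρ hρ' hγ hγ' bγ bγ' hk hμ hD.avoids_zero).unique
    hH hD.isSht (graph_prodMap' rfl) hD.avoids_zero hΘ₁
  have e2 := (hΘ'.comp_frobLift hD hG hG₀ hH₀ h hρ hρ' hγ hγ' bγ bγ' hk hμ hD.avoids_pole).unique
    hH hD.isSht (graph_prodMap' rfl) hD.avoids_pole hΘ₁'
  -- As `m` respects the lines and the quotients, it extends to the modifications.
  obtain ⟨n', n, i1, i2, hn', hn⟩ := (hG.isMarked hD hΘ hΘ').exists_iso hD rfl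
    (hH.isMarked hD hΘ₁ hΘ₁') hC hC₁ m e1 e2
  obtain ⟨χ, bχ, cχ, hχ, hχ'⟩ := ρ.exists_tau
  obtain ⟨χ₁, bχ₁, cχ₁, hχ₁, hχ₁'⟩ := ρ'.exists_tau
  obtain ⟨χ₂, bχ₂, cχ₂, hχ₂, hχ₂'⟩ := k.exists_tau
  have bψ : bs (γ ≫ χ) = bs (phiArr G₀) := by
    rw [bs_comp, bγ, bχ, ← prodMap_comp, h₀]
    rfl
  have hγχ : γ ≫ χ = phiArr G₀ := by
    refine ρ.cart.hom_ext bψ ?_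
    rw [← assoc, hγ, hχ]
  have hγχ₁ : γ' ≫ χ₁ = phiArr H₀ := by
    refine ρ'.cart.hom_ext ?_ ?_
    · rw [bs_comp, bγ', bχ₁, ← prodMap_comp, h₀]
      rfl
    · rw [← assoc, hγ', hχ₁]
  -- The restriction of `m` to `A₀` is induced by `k`.
  have hmχ : vert m ≫ χ₁ = χ ≫ χ₂ := by
    refine cγ.hom_ext ?_ ?_
    · rw [bs_comp, bs_comp, bχ₁, bχ, bχ₂, bs_vert, prodMap_id]
      exact (comp_id _).trans (id_comp _).symm
    · rw [← assoc, hμ, assoc, hγχ₁, ← assoc, hγχ, hχ₂]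
  have hA₀ : IsArtinPoint (specA Fq A₀) := inferInstance
  -- The restriction of the extension to `A₀` is `k`, so that its Frobenius pullback is `m`.
  have hn'ρ : vert n' ≫ ρ'.ρ' = ρ.ρ' ≫ k.ρ' := by
    refine hG.arrow_ext (t := specMap Fq π) hH₀.locallyFree' ?_ ?_ ?_
    · rw [bs_comp, bs_vert, ρ'.bs_ρ']
      exact comp_id _
    · rw [bs_comp, ρ.bs_ρ', k.bs_ρ', prodMap_id]
      exact id_comp _
    · rw [← assoc, ← vert_comp, hn', vert_comp, assoc, hχ₁', ← assoc, hmχ, assoc, ← hχ₂', ← assoc,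
        ← hχ', assoc]
  have := hH₀.elem_g.mono (q'.locEq _ _)
  have hnρ : vert n ≫ ρ'.ρ = ρ.ρ ≫ k.ρ := by
    refine vert_cancel (m := H₀.g) ?_ ?_
    · rw [bs_comp, bs_comp, bs_vert, ρ'.bs_ρ, ρ.bs_ρ, k.bs_ρ, prodMap_id]
      exact (comp_id _).trans (id_comp _).symm
    · rw [assoc, ← ρ'.comm_g, ← assoc, ← vert_comp, hn, vert_comp, assoc, hn'ρ, ← assoc, ρ.comm_g,
        assoc, k.comm_g, assoc]
  have hφ : phiArr G ≫ vert m = vert n ≫ phiArr H := by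
    rw [← hγ, assoc, hμ, ← assoc, ← hnρ, assoc, hγ']
  refine ⟨⟨vert n, vert n', (prodMap_id X _).symm, (prodMap_id X _).symm, isCart_vert_of_isIso n,
    isCart_vert_of_isIso n', ?_, ?_⟩, ?_⟩
  · rw [← phiArr_ftau, ← phiArr_ftau, assoc, ← vert_comp, hn', vert_comp, ← assoc, hφ, assoc]
  · rw [← vert_comp, ← hn, vert_comp]
  · change vert n ≫ r'.ρ = r.ρ
    rw [← hρ', ← assoc, hnρ, assoc, hk, hρ]

/-- A deformation is determined up to isomorphism by its modifications. -/
theorem exists_hom_of_modifAt (hD : IsDisjointSht q q' d D) (n : ℕ) :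
    ∀ (A : ArtAlg E), A.FrobNilpotent (Fintype.card Fq) n →
    ∀ (G H : ShtukaDiagram X (specA Fq A)) (r : ShtHom (closedPt Fq A) G D)
      (r' : ShtHom (closedPt Fq A) H D) (x : Spec (of A.carrier) ⟶ Pnat D α β),
      IsSht q q' d (structMor Fq A) G → IsSht q q' d (structMor Fq A) H →
      ModifAt r x → ModifAt r' x → ∃ p : ShtHom (𝟙 _) G H, p.ρ ≫ r'.ρ = r.ρ := by
  induction n with
  | zero => exact fun A hA G H r r' x _ _ _ _ => exists_hom_of_trivial hA r r'
  | succ n ih =>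
    intro A hA G H r r' x hG hH hx hx'
    obtain ⟨A₀, π, ψ, h₀, h, hA₀⟩ := exists_frobFactor Fq A
    obtain ⟨G₀, ⟨ρ⟩⟩ := exists_shtHom (specMap Fq π) G
    obtain ⟨H₀, ⟨ρ'⟩⟩ := exists_shtHom (specMap Fq π) H
    obtain ⟨r₀, hr, -⟩ := ρ.exists_factor (closedPt_specMap Fq π) r
    obtain ⟨r₀', hr', -⟩ := ρ'.exists_factor (closedPt_specMap Fq π) r'
    have hG₀ := hG.baseChange (specMap_structMor Fq π) ρ
    have hH₀ := hH.baseChange (specMap_structMor Fq π) ρ'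
    obtain ⟨k, hk⟩ := ih A₀ (hA₀ n hA) G₀ H₀ r₀ r₀' _ hG₀ hH₀ (hx.map hD hG π hG₀ ρ hr)
      (hx'.map hD hH π hH₀ ρ' hr')
    exact exists_hom_of_frobFactor hD h h₀ hG hG₀ hH hH₀ hr hr' hk hx hx'

end Uniqueness

/-! ### Existence of deformations -/

section Existence

variable {Fq : Type u} [Field Fq] [Fintype Fq] {E : Type u} [Field E] [Algebra Fq E]
  {X : Over (Spec (of Fq))} {α β : specE E Fq ⟶ X} {q : GraphEq α} {q' : GraphEq β}
  {d : ℕ} {D : ShtukaDiagram X (specE E Fq)}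

/-- Every point is given by a pair of modifications of a given sheaf. -/
theorem exists_isMarked (hD : IsDisjointSht q q' d D) {A : Type u} [CommRing A] [Algebra E A]
    [IsLocalRing A] [IsArtinianRing A] {u : Spec (of A) ⟶ Spec (of Fq)}
    {s : Over.mk u ⟶ specE E Fq} (hs : s.left = Spec.map (ofHom (algebraMap E A)))
    {M : (prodS X (Over.mk u)).Modules} (hM : IsLocallyFreeOfRank M d)
    {Θ : (⟨_, (fib α).obj ((tau X _ 1).obj D.F)⟩ : QMod) ⟶ ⟨_, (fib (s ≫ α)).obj M⟩}
    {Θ' : (⟨_, (fib β).obj ((tau X _ 1).obj D.F)⟩ : QMod) ⟶ ⟨_, (fib (s ≫ β)).obj M⟩}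
    (bΘ : bs Θ = s.left) (bΘ' : bs Θ' = s.left) (cΘ : IsCart Θ) (cΘ' : IsCart Θ')
    {x : Spec (of A) ⟶ Pnat D α β}
    (hx : x ≫ PnatHom D α β = Spec.map (ofHom (algebraMap E A))) :
    ∃ (F F' : (prodS X (Over.mk u)).Modules) (f : M ⟶ F') (g : F ⟶ F'),
      IsMarked q q' d s f g Θ Θ' ∧
        Classifies D α β (i := graph (s ≫ α)) (k := graph (s ≫ β)) f g Θ Θ' x := by
  have := isArtinPoint_mk A u
  obtain ⟨j₀, e, j₁, e', w, he, he', hw, key⟩ := exists_frames_of_point (i := graph (s ≫ α))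
    (k := graph (s ≫ β)) q hD.isSht.locallyFree (bΘ.trans hs) (bΘ'.trans hs) cΘ cΘ' x hx
  have hl := q.locEq _ s
  have hl' := q'.locEq _ s
  obtain ⟨O, b, hO, hb, hbe⟩ := exists_lift_frame (graph_snd (s ≫ α)) hM he
  have hO' : ∀ y, graph (s ≫ α) y ∈ O ⊓ prodMap X s ⁻¹ᵁ q.V := fun y => ⟨hO y, hl.mem_V y⟩
  obtain ⟨F', f, b', hf, hfe⟩ := exists_upperModification hl hM hO' inf_le_right
    (hb.rs inf_le_left) j₀
  have hker := hfe.ker_eq hl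
  rw [ev_rs inf_le_left hO', hbe] at hker
  have hfi := isIso_fib_pole hD.pole_mem hf
  have hβ := he'.iso ((fib (s ≫ β)).map f)
  obtain ⟨F, g, hg, κ, hκ⟩ := exists_lowerModification (graph_snd (s ≫ β)) hl'
    (hf.isLocallyFree' hl hM) (inv ((fib (s ≫ β)).map f) ≫ w) hβ (fun j => by
      rw [← comp_app', IsIso.hom_inv_id_assoc]
      exact hw j)
  refine ⟨F, F', f, g, ⟨hM, hf, hg, bΘ, bΘ', cΘ, cΘ'⟩, key f g hker ⟨κ, ?_⟩⟩
  rw [CategoryTheory.Functor.map_comp, assoc, hκ]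
  exact IsIso.hom_inv_id_assoc _ _

variable {A A₀ : ArtAlg E} {π : A ⟶ A₀} {ψ : specA Fq A ⟶ specA Fq A₀}
  {G₀ : ShtukaDiagram X (specA Fq A₀)} {r₀ : ShtHom (closedPt Fq A₀) G₀ D}
  {M : (prodS X (specA Fq A)).Modules}

/-- The fibre of the Frobenius pullback of a deformation to `A₀`. -/
theorem exists_fibre_frobFactor (hD : IsDisjointSht q q' d D)
    (hG₀ : IsSht q q' d (structMor Fq A₀) G₀) (r₀ : ShtHom (closedPt Fq A₀) G₀ D)
    (h : ψ ≫ specMap Fq π = frob _)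
    {γ : (⟨prodS X (specA Fq A₀), G₀.F⟩ : QMod) ⟶ ⟨prodS X (specA Fq A), M⟩} (cγ : IsCart γ)
    (bγ : bs γ = prodMap X ψ) {a : specE E Fq ⟶ X} (ha : Avoids q q' (graph a ≫ Phi X _)) :
    ∃ Θ : (⟨(specE E Fq).left, (fib a).obj ((tau X _ 1).obj D.F)⟩ : QMod) ⟶
      ⟨(specA Fq A).left, (fib (structMor Fq A ≫ a)).obj M⟩,
      bs Θ = (structMor Fq A).left ∧
      Corresponds r₀ (kap 1 a D.F ≫ Θ) (γ ≫ pbArr (graph (structMor Fq A ≫ a)) M) ∧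
      IsCart Θ := by
  obtain ⟨n, hn⟩ := A₀.exists_frobNilpotent (m := Fintype.card Fq) Fintype.one_lt_card
  obtain ⟨Θ, h1, h2, h3⟩ := exists_fibre_corresponds hG₀ hD.isSht r₀ (PhiPow_specA X A₀ hn) ha
    (γ ≫ pbArr (graph (structMor Fq A ≫ a)) M) (structMor Fq A).left (by
      rw [bs_comp, bs_pbArr, bγ, graph_frobFactor h])
  exact ⟨Θ, h1, h2, h3 (cγ.comp (isCart_pbArr _ _))⟩

/-- The restriction to `A₀` of the identification of the fibres of the Frobenius pullback of a
deformation to `A₀`. -/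
theorem isFibreComparison_frobFactor
    {γ : (⟨prodS X (specA Fq A₀), G₀.F⟩ : QMod) ⟶ ⟨prodS X (specA Fq A), M⟩}
    {μ : (⟨prodS X (specA Fq A), M⟩ : QMod) ⟶ ⟨prodS X (specA Fq A₀), (tau X _ 1).obj G₀.F⟩}
    (hμ : γ ≫ μ = phiArr G₀) {a : specE E Fq ⟶ X}
    {Θ : (⟨(specE E Fq).left, (fib a).obj ((tau X _ 1).obj D.F)⟩ : QMod) ⟶
      ⟨(specA Fq A).left, (fib (structMor Fq A ≫ a)).obj M⟩}
    (bΘ : bs Θ = (structMor Fq A).left)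
    (hΘ : Corresponds r₀ (kap 1 a D.F ≫ Θ) (γ ≫ pbArr (graph (structMor Fq A ≫ a)) M))
    {σ : (⟨(specA Fq A).left, (fib (structMor Fq A ≫ a)).obj M⟩ : QMod) ⟶
      ⟨(specA Fq A₀).left, (fib (structMor Fq A₀ ≫ a)).obj ((tau X _ 1).obj G₀.F)⟩}
    (bσ : bs σ = (specMap Fq π).left)
    (hσ : pbArr (graph (structMor Fq A ≫ a)) M ≫ σ = μ ≫ pbArr (graph (structMor Fq A₀ ≫ a)) _) :
    IsFibreComparison (structMor Fq A₀) r₀ a (structMor Fq A₀ ≫ a) (Θ ≫ σ) where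
  bs_eq := by rw [bs_comp, bΘ, bσ, ← specMap_structMor Fq π, Over.comp_left]
  corresponds := by
    rw [kap_one _ G₀, ← hμ, assoc γ, ← hσ, ← assoc γ, ← assoc]
    exact hΘ.comp_right σ

/-- A shtuka over `A` is obtained from a pair of modifications of the Frobenius pullback `M` of a
deformation to `A₀`, if the restriction to `A₀` of the pair is the given deformation. -/
theorem exists_modifAt_of_pair (hD : IsDisjointSht q q' d D)
    {γ : (⟨prodS X (specA Fq A₀), G₀.F⟩ : QMod) ⟶ ⟨prodS X (specA Fq A), M⟩}
    {μ : (⟨prodS X (specA Fq A), M⟩ : QMod) ⟶ ⟨prodS X (specA Fq A₀), (tau X _ 1).obj G₀.F⟩}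
    (hμ : γ ≫ μ = phiArr G₀) {G : ShtukaDiagram X (specA Fq A)} {f : M ⟶ G.F'}
    {Θ : (⟨_, (fib α).obj ((tau X _ 1).obj D.F)⟩ : QMod) ⟶ ⟨_, (fib (structMor Fq A ≫ α)).obj M⟩}
    {Θ' : (⟨_, (fib β).obj ((tau X _ 1).obj D.F)⟩ : QMod) ⟶ ⟨_, (fib (structMor Fq A ≫ β)).obj M⟩}
    (hfg : IsMarked q q' d (structMor Fq A) f G.g Θ Θ')
    (hΘ : Corresponds r₀ (kap 1 α D.F ≫ Θ) (γ ≫ pbArr (graph (structMor Fq A ≫ α)) M))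
    (hΘ' : Corresponds r₀ (kap 1 β D.F ≫ Θ') (γ ≫ pbArr (graph (structMor Fq A ≫ β)) M))
    {x : Spec (of A.carrier) ⟶ Pnat D α β}
    (hC : Classifies D α β (i := graph (structMor Fq A ≫ α)) (k := graph (structMor Fq A ≫ β))
      f G.g Θ Θ' x)
    {ρ : (⟨prodS X (specA Fq A), G.F⟩ : QMod) ⟶ ⟨prodS X (specA Fq A₀), G₀.F⟩}
    {ρ' : (⟨prodS X (specA Fq A), G.F'⟩ : QMod) ⟶ ⟨prodS X (specA Fq A₀), G₀.F'⟩}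
    (bρ : bs ρ = prodMap X (specMap Fq π)) (bρ' : bs ρ' = prodMap X (specMap Fq π))
    (cρ : IsCart ρ) (cρ' : IsCart ρ') (hf' : vert f ≫ ρ' = μ ≫ vert (ftau G₀))
    (hg' : vert G.g ≫ ρ' = ρ ≫ vert G₀.g) (j : (tau X (specA Fq A) 1).obj G.F ≅ M)
    (hj : ftau G = j.hom ≫ f) (hφ : phiArr G ≫ vert j.hom = ρ ≫ γ) :
    ∃ r : ShtHom (closedPt Fq A) G D, IsSht q q' d (structMor Fq A) G ∧ ModifAt r x := by
  have hF' : IsLocallyFreeOfRank G.F' d := hfg.elem_f.isLocallyFree' (q.locEq _ _) hfg.locallyFree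
  have hG : IsSht q q' d (structMor Fq A) G := by
    refine ⟨hfg.elem_g.isLocallyFree (q'.locEq _ _) hF', hF', ?_, hfg.elem_g⟩
    change IsElemAlong q d (structMor Fq A) (ftau G)
    rw [hj]
    exact isElemAlong_comp_iso j.hom hfg.elem_f hfg.locallyFree
  let p : ShtHom (specMap Fq π) G G₀ :=
    { ρ := ρ
      ρ' := ρ'
      bs_ρ := bρ
      bs_ρ' := bρ'
      cart := cρ
      cart' := cρ'
      comm_f := by
        rw [← phiArr_ftau, hj, vert_comp, ← assoc, hφ, assoc, hf', ← assoc, assoc ρ, hμ, assoc,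
          phiArr_ftau]
      comm_g := hg' }
  let r : ShtHom (closedPt Fq A) G D := p.comp (closedPt_specMap Fq π) r₀
  -- The identifications of the fibres, transported along `j`.
  have hcmp : ∀ {a : specE E Fq ⟶ X}
      {T : (⟨(specE E Fq).left, (fib a).obj ((tau X _ 1).obj D.F)⟩ : QMod) ⟶
        ⟨(specA Fq A).left, (fib (structMor Fq A ≫ a)).obj M⟩}
      (_ : bs T = (structMor Fq A).left)
      (_ : Corresponds r₀ (kap 1 a D.F ≫ T) (γ ≫ pbArr (graph (structMor Fq A ≫ a)) M)),
      IsFibreComparison (structMor Fq A) r a (structMor Fq A ≫ a)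
        (T ≫ vert ((fib (structMor Fq A ≫ a)).map j.inv)) := by
    intro a T bT hT
    refine ⟨(bs_comp _ _).trans ((id_comp _).trans bT), ?_⟩
    have h1 := (hT.naturality p (r := r) rfl).comp_right
      (vert ((fib (structMor Fq A ≫ a)).map j.inv))
    have h2 : (ρ ≫ γ ≫ pbArr (graph (structMor Fq A ≫ a)) M) ≫
        vert ((fib (structMor Fq A ≫ a)).map j.inv) = kap 1 (structMor Fq A ≫ a) G.F := by
      have h3 : vert j.hom ≫ vert j.inv = 𝟙 _ := by
        rw [← vert_comp, j.hom_inv_id]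
        rfl
      rw [kap_one _ G, ← assoc ρ, ← hφ, assoc, pbArr_map, assoc, ← assoc (vert j.hom), h3, id_comp]
    have h4 := h1
    rw [assoc] at h4
    exact Eq.mp (congrArg (Corresponds r _) h2) h4
  have k1 := hcmp hfg.bs_zero hΘ
  have k2 := hcmp hfg.bs_pole hΘ'
  have hid : Spec.map (ofHom (AlgHom.id E A.carrier).toRingHom) =
    𝟙 (Spec (of A.carrier)) := Spec.map_id _
  have hCG := Classifies.baseChange hD rfl rfl hfg (AlgHom.id E A.carrier) (t := 𝟙 (specA Fq A))
    hid.symm (id_comp _) (χ := vert j.inv) (χ' := 𝟙 _) (χ'' := 𝟙 _)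
    (prodMap_id X _).symm (f₂ := ftau G) (g₂ := G.g) (by
      refine (comp_id _).trans ?_
      rw [← vert_comp, hj, j.inv_hom_id_assoc])
    ((comp_id _).trans (id_comp _).symm) rfl rfl
    (pbArr_map _ _) (pbArr_map _ _) (hG.isMarked hD k1 k2) hC
  rw [hid, id_comp] at hCG
  exact ⟨r, hG, _, _, k1, k2, hCG⟩

/-- A deformation to `A₀` extends to a deformation to `A` with given modifications. -/
theorem exists_deformation_of_frobFactor (hD : IsDisjointSht q q' d D)
    (h : ψ ≫ specMap Fq π = frob _) (h₀ : specMap Fq π ≫ ψ = frob _)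
    (hG₀ : IsSht q q' d (structMor Fq A₀) G₀)
    {x : Spec (of A.carrier) ⟶ Pnat D α β}
    (hx : x ≫ PnatHom D α β = Spec.map (ofHom (algebraMap E A.carrier)))
    (hx₀ : ModifAt r₀ (Spec.map (ofHom π.1.toRingHom) ≫ x)) :
    ∃ (G : ShtukaDiagram X (specA Fq A)) (r : ShtHom (closedPt Fq A) G D),
      IsSht q q' d (structMor Fq A) G ∧ ModifAt r x := by
  let M : (prodS X (specA Fq A)).Modules := (Scheme.Modules.pullback (prodMap X ψ)).obj G₀.F
  let γ : (⟨prodS X (specA Fq A₀), G₀.F⟩ : QMod) ⟶ ⟨prodS X (specA Fq A), M⟩ := pbArr _ _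
  have cγ : IsCart γ := isCart_pbArr _ _
  have bγ : bs γ = prodMap X ψ := rfl
  have hM : IsLocallyFreeOfRank M d :=
    cγ.isLocallyFree (S := specA Fq A₀) (T := specA Fq A) hG₀.locallyFree
  obtain ⟨Θ, bΘ, hΘ, cΘ⟩ := exists_fibre_frobFactor hD hG₀ r₀ h cγ bγ hD.avoids_zero
  obtain ⟨Θ', bΘ', hΘ', cΘ'⟩ := exists_fibre_frobFactor hD hG₀ r₀ h cγ bγ hD.avoids_pole
  obtain ⟨F, F', f, g, hfg, hC⟩ := exists_isMarked hD rfl hM bΘ bΘ' cΘ cΘ' hx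
  -- The restriction of `M` to `A₀` is `Φ^* G₀`.
  obtain ⟨μ, ⟨bμ, hμ⟩, -⟩ := cγ (phiArr G₀) (prodMap X (specMap Fq π)) (by
    rw [bγ, ← prodMap_comp, h₀]
    rfl)
  have cμ : IsCart μ := cγ.of_comp (hμ ▸ isCart_phiArr G₀)
  obtain ⟨m, hm⟩ := exists_toArr_iso μ bμ cμ
  let P := prodMap X (specMap Fq π)
  have hgr : ∀ a : specE E Fq ⟶ X, graph (structMor Fq A₀ ≫ a) ≫ prodMap X (specMap Fq π) =
      (specMap Fq π).left ≫ graph (structMor Fq A ≫ a) := fun a =>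
    graph_prodMap' (by rw [← specMap_structMor Fq π, assoc])
  obtain ⟨σ, bσ, hσ⟩ := exists_fibre_arrow (hgr α) (pbArr P M) rfl
  obtain ⟨σ', bσ', hσ'⟩ := exists_fibre_arrow (hgr β) (pbArr P M) rfl
  have hfg₁ : IsMarked q q' d (structMor Fq A₀) ((Scheme.Modules.pullback P).map f)
      ((Scheme.Modules.pullback P).map g) (Θ ≫ σ) (Θ' ≫ σ') :=
    hfg.baseChange (specMap_structMor Fq π) (isCart_pbArr P M) (isCart_pbArr P F')
      (isCart_pbArr P F) rfl rfl rfl (pbArr_map _ _).symm (pbArr_map _ _).symm bσ bσ' hσ hσ'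
  have hC₁ := Classifies.baseChange hD rfl rfl hfg π.1 (t := specMap Fq π) rfl
    (specMap_structMor Fq π) rfl (pbArr_map P f).symm (pbArr_map P g).symm bσ bσ' hσ hσ' hfg₁ hC
  obtain ⟨Θ₀, Θ₀', hΘ₀, hΘ₀', hC₀⟩ := hx₀
  have key : ∀ (a : specE E Fq ⟶ X)
      (τ : (⟨_, (fib (structMor Fq A ≫ a)).obj M⟩ : QMod) ⟶
        ⟨_, (fib (structMor Fq A₀ ≫ a)).obj ((Scheme.Modules.pullback P).obj M)⟩),
      pbArr (graph (structMor Fq A ≫ a)) M ≫ τ = pbArr P M ≫ pbArr _ _ →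
      pbArr (graph (structMor Fq A ≫ a)) M ≫ τ ≫ vert ((fib (structMor Fq A₀ ≫ a)).map m.hom) =
        μ ≫ pbArr (graph (structMor Fq A₀ ≫ a)) _ := by
    intro a τ hτ
    rw [← assoc, hτ, assoc, pbArr_map, ← assoc]
    exact congrArg (· ≫ _) hm
  -- Over `A₀` the identifications of the fibres are those of `G₀`, so that the restriction of the
  -- pair is isomorphic to the pair of modifications in `G₀`.
  have e1 := (isFibreComparison_frobFactor hμ bΘ hΘ
    (σ := σ ≫ vert ((fib (structMor Fq A₀ ≫ α)).map m.hom))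
    ((bs_comp _ _).trans ((id_comp _).trans bσ)) (key α σ hσ)).unique hG₀ hD.isSht
    (graph_prodMap' rfl) hD.avoids_zero hΘ₀
  have e2 := (isFibreComparison_frobFactor hμ bΘ' hΘ'
    (σ := σ' ≫ vert ((fib (structMor Fq A₀ ≫ β)).map m.hom))
    ((bs_comp _ _).trans ((id_comp _).trans bσ')) (key β σ' hσ')).unique hG₀ hD.isSht
    (graph_prodMap' rfl) hD.avoids_pole hΘ₀'
  obtain ⟨n', n, i1, i2, hn', hn⟩ := hfg₁.exists_iso hD rfl (hG₀.isMarked hD hΘ₀ hΘ₀') hC₁ hC₀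
    m.hom ((assoc _ _ _).trans e1) ((assoc _ _ _).trans e2)
  let ρ : (⟨_, F⟩ : QMod) ⟶ ⟨_, G₀.F⟩ := toArr P n
  let ρ' : (⟨_, F'⟩ : QMod) ⟶ ⟨_, G₀.F'⟩ := toArr P n'
  have cρ : IsCart ρ := isCart_toArr P n
  have cρ' : IsCart ρ' := isCart_toArr P n'
  have hf' : vert f ≫ ρ' = μ ≫ vert (ftau G₀) := by
    rw [vert_comp_toArr, hn', ← hm, toArr_comp_vert]
  have hg' : vert g ≫ ρ' = ρ ≫ vert G₀.g := by
    rw [vert_comp_toArr, toArr_comp_vert, hn]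
  -- As the Frobenius of `A` factors through `A₀`, the sheaf `M` is `Φ^* F`.
  obtain ⟨j, hj⟩ := exists_toArr_iso (f := Phi X (specA Fq A)) (ρ ≫ γ) (by
    rw [bs_comp, bγ, Phi, ← h, prodMap_comp]
    rfl) (cρ.comp cγ)
  obtain ⟨r, hG, hr⟩ := exists_modifAt_of_pair (G := ⟨F, F', j.hom ≫ f, g⟩) hD hμ hfg hΘ hΘ' hC rfl
    rfl cρ cρ' hf' hg' j rfl hj
  exact ⟨_, r, hG, hr⟩

/-- Every point with the given restriction to the closed point is given by the modifications in a
deformation. -/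
theorem exists_deformation (hD : IsDisjointSht q q' d D)
    {p : Spec (of E) ⟶ Pnat D α β}
    (hp : IsModif (ShtHom.id D) (𝟙 (specE E Fq)) α β p) (n : ℕ) :
    ∀ (A : ArtAlg E), A.FrobNilpotent (Fintype.card Fq) n →
    ∀ x : Spec (of A.carrier) ⟶ Pnat D α β,
      x ≫ PnatHom D α β = Spec.map (ofHom (algebraMap E A.carrier)) →
      Spec.map (ofHom A.aug.toRingHom) ≫ x = p →
      ∃ (G : ShtukaDiagram X (specA Fq A)) (r : ShtHom (closedPt Fq A) G D),
        IsSht q q' d (structMor Fq A) G ∧ ModifAt r x := by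
  induction n with
  | zero => exact fun A hA x _ hx => exists_deformation_of_trivial hA hD hp hx
  | succ n ih =>
    intro A hA x hx hxp
    obtain ⟨A₀, π, ψ, h₀, h, hA₀⟩ := exists_frobFactor Fq A
    let y : PointsAt D α β p A := ⟨x, hx, hxp⟩
    obtain ⟨G₀, r₀, hG₀, hr₀⟩ := ih A₀ (hA₀ n hA) (y.map π).1 (y.map π).2.1 (y.map π).2.2
    exact exists_deformation_of_frobFactor hD h h₀ hG₀ hx hr₀

end Existence

/-! ### Isomorphism classes of deformations -/

section Classes

variable {Fq : Type u} [Field Fq] [Fintype Fq] {E : Type u} [Field E] [Algebra Fq E]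
  {X : Over (Spec (of Fq))} {α β : specE E Fq ⟶ X} {q : GraphEq α} {q' : GraphEq β}
  {d : ℕ} {D : ShtukaDiagram X (specE E Fq)} {A B : ArtAlg E}

theorem Deformation.isSht (G : Deformation D d α β A) : IsSht q q' d (structMor Fq A) G.diagram :=
  isShtuka_iff_isSht.1 G.isShtuka

theorem Deformation.IsIsomorphic.exists_shtHom {G H : Deformation D d α β A} (h : G.IsIsomorphic H) :
    ∃ p : ShtHom (𝟙 _) G.diagram H.diagram, p.ρ ≫ H.res.toShtHom.ρ = G.res.toShtHom.ρ := by
  obtain ⟨m, m', h1, h2, h3, -⟩ := h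
  refine ⟨⟨vert m.hom, vert m'.hom, (prodMap_id X _).symm, (prodMap_id X _).symm,
    isCart_vert_of_isIso _, isCart_vert_of_isIso _, ?_, ?_⟩, ?_⟩
  · change toArr _ _ ≫ _ = _ ≫ toArr _ _
    rw [toArr_comp_vert, vert_comp_toArr, h1]
  · rw [← vert_comp, ← vert_comp, h2]
  · change vert m.hom ≫ toArr _ _ = toArr _ _
    rw [vert_comp_toArr, h3]

theorem ShtHom.comp_res {G : Deformation D d α β A} {H : Deformation D d α β B}
    {t : specA Fq B ⟶ specA Fq A} (ht : closedPt Fq B ≫ t = closedPt Fq A) (hD : IsDisjointSht q q' d D)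
    (p : ShtHom t G.diagram H.diagram) (h : p.ρ ≫ H.res.toShtHom.ρ = G.res.toShtHom.ρ) :
    p.ρ' ≫ H.res.toShtHom.ρ' = G.res.toShtHom.ρ' :=
  (G.isSht (q := q) (q' := q')).hom_ext hD.isSht (p := p.comp ht H.res.toShtHom) h

theorem Deformation.isIsomorphic_of_shtHom (hD : IsDisjointSht q q' d D)
    {G H : Deformation D d α β A} (p : ShtHom (𝟙 _) G.diagram H.diagram)
    (h : p.ρ ≫ H.res.toShtHom.ρ = G.res.toShtHom.ρ) : G.IsIsomorphic H := by
  have h' := p.comp_res (comp_id _) hD h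
  obtain ⟨m, hm⟩ := exists_vert p.ρ (p.bs_ρ.trans (prodMap_id X _))
  obtain ⟨m', hm'⟩ := exists_vert p.ρ' (p.bs_ρ'.trans (prodMap_id X _))
  have : IsIso m := isIso_of_isCart_vert (hm ▸ p.cart)
  have : IsIso m' := isIso_of_isCart_vert (hm' ▸ p.cart')
  have c1 := p.comm_f
  have c2 := p.comm_g
  rw [← hm, ← hm'] at c1 c2
  rw [← hm] at h
  rw [← hm'] at h'
  refine ⟨asIso m, asIso m', ?_, ?_, ?_, ?_⟩
  · change toArr _ _ ≫ _ = _ ≫ toArr _ _ at c1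
    rw [toArr_comp_vert, vert_comp_toArr] at c1
    exact (toArr_injective c1).symm
  · rw [← vert_comp, ← vert_comp] at c2
    exact (vert_injective c2).symm
  · change vert m ≫ toArr _ _ = toArr _ _ at h
    rw [vert_comp_toArr] at h
    exact toArr_injective h
  · change vert m' ≫ toArr _ _ = toArr _ _ at h'
    rw [vert_comp_toArr] at h'
    exact toArr_injective h'

theorem toArr_comp_iff {Y Z T : Scheme.{u}} {f : T ⟶ Z} {g : Z ⟶ Y} {h : T ⟶ Y} (e : f ≫ g = h)
    {F : Scheme.Modules.pullback g ⋙ Scheme.Modules.pullback f ≅ Scheme.Modules.pullback h}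
    (hF : F = pullbackComp f g ≪≫ pullbackCongr e) {M : Y.Modules}
    {M' : Z.Modules} {N : T.Modules} (m : (Scheme.Modules.pullback g).obj M ⟶ M')
    (k : (Scheme.Modules.pullback h).obj M ⟶ N) (l : (Scheme.Modules.pullback f).obj M' ⟶ N) :
    (Scheme.Modules.pullback f).map m ≫ l = F.hom.app M ≫ k ↔
      toArr _ m ≫ toArr _ l = toArr _ k := by
  have h1 : pbArr g M ≫ pbArr f _ ≫ vert (F.hom.app M) = pbArr h M := by
    have h2 := pbArr_pullbackComp f g M
    have h3 := pbArr_pullbackCongr e M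
    rw [hF, Iso.trans_hom, NatTrans.comp_app, vert_comp, ← h3, ← h2]
    simp only [assoc]
  have h4 : toArr _ k = pbArr g M ≫ pbArr f _ ≫ vert (F.hom.app M ≫ k) := by
    rw [toArr, ← h1, vert_comp]
    simp only [assoc]
  have h5 : toArr _ m ≫ toArr _ l =
      pbArr g M ≫ pbArr f _ ≫ vert ((Scheme.Modules.pullback f).map m ≫ l) := by
    rw [toArr, assoc, vert_comp_toArr, toArr]
  rw [h4, h5]
  exact ⟨fun h => by rw [h], fun h => toArr_injective ((isCart_pbArr _ _).hom_ext rfl h)⟩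

omit [Fintype Fq] in
theorem pullbackClosedPt_eq (φ : A ⟶ B)
    (e : prodMap X (closedPt Fq B) ≫ prodMap X (specMap Fq φ) = prodMap X (closedPt Fq A)) :
    pullbackClosedPt X φ = pullbackComp _ _ ≪≫ pullbackCongr e :=
  rfl

omit [Fintype Fq] in
theorem toArr_pullbackClosedPt (φ : A ⟶ B) {M : (prodS X (specA Fq A)).Modules}
    {M' : (prodS X (specA Fq B)).Modules} {N : (prodS X (specE E Fq)).Modules}
    (m : (Scheme.Modules.pullback (prodMap X (specMap Fq φ))).obj M ⟶ M')
    (k : (Scheme.Modules.pullback (prodMap X (closedPt Fq A))).obj M ⟶ N)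
    (l : (Scheme.Modules.pullback (prodMap X (closedPt Fq B))).obj M' ⟶ N) :
    (Scheme.Modules.pullback (prodMap X (closedPt Fq B))).map m ≫ l =
      (pullbackClosedPt X φ).hom.app M ≫ k ↔ toArr _ m ≫ toArr _ l = toArr _ k :=
  toArr_comp_iff (by rw [← prodMap_comp, closedPt_specMap]) (pullbackClosedPt_eq φ _) m k l

theorem Deformation.isBaseChange_iff (hD : IsDisjointSht q q' d D) (φ : A ⟶ B)
    {G : Deformation D d α β A} {H : Deformation D d α β B} :
    G.IsBaseChange φ H ↔ ∃ p : ShtHom (specMap Fq φ) G.diagram H.diagram,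
      p.ρ ≫ H.res.toShtHom.ρ = G.res.toShtHom.ρ := by
  constructor
  · rintro ⟨r, h, -⟩
    exact ⟨r.toShtHom, (toArr_pullbackClosedPt φ _ _ _).1 h⟩
  · rintro ⟨p, h⟩
    have h' := p.comp_res (closedPt_specMap Fq φ) hD h
    obtain ⟨r, h1, h2⟩ := p.exists_pullbackIso
    rw [← h1] at h
    rw [← h2] at h'
    exact ⟨r, (toArr_pullbackClosedPt φ _ _ _).2 h, (toArr_pullbackClosedPt φ _ _ _).2 h'⟩

theorem Deformation.exists_isBaseChange (hD : IsDisjointSht q q' d D) (φ : A ⟶ B)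
    (G : Deformation D d α β A) : ∃ H : Deformation D d α β B, G.IsBaseChange φ H := by
  obtain ⟨H, ⟨p⟩⟩ := exists_shtHom (specMap Fq φ) G.diagram
  obtain ⟨k, hk, -⟩ := p.exists_factor (closedPt_specMap Fq φ) G.res.toShtHom
  obtain ⟨r, hr, -⟩ := k.exists_pullbackIso
  have hH : IsSht q q' d (structMor Fq B) H := G.isSht.baseChange (specMap_structMor Fq φ) p
  exact ⟨⟨H, isShtuka_iff_isSht.2 hH, r⟩, (Deformation.isBaseChange_iff hD φ).2 ⟨p, hr ▸ hk⟩⟩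

/-- The point given by the modifications in a deformation specializes to that of the shtuka. -/
theorem exists_pointsAt (hD : IsDisjointSht q q' d D) {p : Spec (of E) ⟶ Pnat D α β}
    (hp : IsModif (ShtHom.id D) (𝟙 (specE E Fq)) α β p) (G : Deformation D d α β A) :
    ∃ x : PointsAt D α β p A, ModifAt G.res.toShtHom x.1 := by
  obtain ⟨x, hx⟩ := exists_modifAt hD G.isSht G.res.toShtHom
  exact ⟨⟨x, hx.hom, modificationPoint_unique hD (hx.restrict hD G.isSht) hp⟩, hx⟩

/-- Deformations over `A` are classified by the points of `P^♮` that specialize to `p`. -/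
theorem exists_classEquiv (hD : IsDisjointSht q q' d D)
    {p : Spec (of E) ⟶ Pnat D α β}
    (hp : IsModif (ShtHom.id D) (𝟙 (specE E Fq)) α β p) (A : ArtAlg E) :
    ∃ c : DeformationClass D d α β A ≃ PointsAt D α β p A,
      ∀ G : Deformation D d α β A, ModifAt G.res.toShtHom (c G.cls).1 := by
  obtain ⟨n, hn⟩ := A.exists_frobNilpotent (m := Fintype.card Fq) Fintype.one_lt_card
  choose x hx using exists_pointsAt (d := d) (A := A) hD hp
  let c : DeformationClass D d α β A → PointsAt D α β p A := Quotient.lift x fun G H h => by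
    obtain ⟨k, hk⟩ := h.exists_shtHom
    exact Subtype.ext (((hx G).of_iso hD G.isSht H.isSht k hk).unique hD H.isSht (hx H))
  refine ⟨Equiv.ofBijective c ⟨?_, fun y => ?_⟩, hx⟩
  · rintro ⟨G⟩ ⟨H⟩ h
    have h' : x G = x H := h
    obtain ⟨k, hk⟩ := exists_hom_of_modifAt hD _ A hn _ _ G.res.toShtHom H.res.toShtHom _ G.isSht
      H.isSht (hx G) (h' ▸ hx H)
    exact Quotient.sound (Deformation.isIsomorphic_of_shtHom hD k hk)
  · obtain ⟨G, r, hG, hr⟩ := exists_deformation hD hp _ A hn y.1 y.2.1 y.2.2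
    obtain ⟨r', h, -⟩ := r.exists_pullbackIso
    let G' : Deformation D d α β A := ⟨G, isShtuka_iff_isSht.2 hG, r'⟩
    refine ⟨G'.cls, Subtype.ext ((hx G').unique hD hG ?_)⟩
    exact hr.of_iso hD hG hG (ShtHom.id G) (h ▸ id_comp _)

end Classes

end Sht

end

theorem mainTheorem5 {Fq : Type u} [Field Fq] [Fintype Fq]
    (X : Over (Spec (CommRingCat.of Fq)))
    (hsmooth : SmoothOfRelativeDimension 1 X.hom) (hproj : Sht.IsProjective X.hom)
    (hconn : GeometricallyConnected X.hom)
    {E : Type u} [Field E] [Algebra Fq E] (α β : Sht.specE E Fq ⟶ X)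
    (hαβ : Sht.DisjointFrobeniusGraphs α β)
    (d : ℕ) (D : Sht.ShtukaDiagram X (Sht.specE E Fq)) (hD : Sht.IsShtuka D d α β) :
    -- the `E`-point `p` of `P^♮` given by the modifications in the shtuka `D`
    ∃ p : Spec (CommRingCat.of E) ⟶ Sht.Pnat D α β,
      (∀ p' : Spec (CommRingCat.of E) ⟶ Sht.Pnat D α β,
        Sht.IsModificationPoint D α β p' ↔ p' = p) ∧
      -- the functor `G₁` of isomorphism classes of deformations, with base change
      ∃ (G₁ : Sht.ArtAlg E ⥤ Type (u + 1))
        (c : ∀ A : Sht.ArtAlg E, Sht.DeformationClass D d α β A ≃ G₁.obj A),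
        (∀ (A B : Sht.ArtAlg E) (φ : A ⟶ B) (G : Sht.Deformation D d α β A),
          (∃ H : Sht.Deformation D d α β B, G.IsBaseChange φ H) ∧
          ∀ H : Sht.Deformation D d α β B, G.IsBaseChange φ H →
            G₁.map φ (c A G.cls) = c B H.cls) ∧
        -- the isomorphism `ξ` given by the modifications in a deformation
        ∃ ξ : G₁ ≅ Sht.pointFunctor D α β p ⋙ uliftFunctor.{u + 1, u},
          ∀ (A : Sht.ArtAlg E) (G : Sht.Deformation D d α β A) (n : ℕ)
            (hn : A.FrobNilpotent (Fintype.card Fq) (n + 1))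
            (h : Spec (CommRingCat.of A.carrier) ⟶ Sht.Pnat D α β),
            G.IsModificationMorphism hn h ↔ (ξ.hom.app A (c A G.cls)).down.1 = h := by
  obtain ⟨q⟩ := Sht.nonempty_graphEq hsmooth hproj α
  obtain ⟨q'⟩ := Sht.nonempty_graphEq hsmooth hproj β
  obtain ⟨⟨h1, h2⟩, h3⟩ := hαβ.avoids q q'
  have hD : Sht.IsDisjointSht q q' d D :=
    ⟨Sht.isShtuka_iff_isSht.1 (by rwa [Category.id_comp, Category.id_comp]), h1, h2, h3⟩
  obtain ⟨p, hp⟩ := Sht.exists_modificationPoint hD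
  choose c hc using Sht.exists_classEquiv hD hp
  -- `G₁` is the functor of points, the classification being used to identify its values.
  refine ⟨p, fun p' => (Sht.isModificationPoint_iff hD p').trans
    ⟨fun h => Sht.modificationPoint_unique hD h hp, fun h => h ▸ hp⟩,
    Sht.pointFunctor D α β p ⋙ uliftFunctor.{u + 1, u}, fun A => (c A).trans Equiv.ulift.symm,
    fun A B φ G => ⟨G.exists_isBaseChange hD φ, fun H h => ?_⟩, Iso.refl _, fun A G n hn h => ?_⟩
  · obtain ⟨k, hk⟩ := (Sht.Deformation.isBaseChange_iff hD φ).1 h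
    exact congrArg ULift.up (Subtype.ext
      (((hc A G).map hD G.isSht φ H.isSht k hk).unique hD H.isSht (hc B H)))
  · exact (G.isModificationMorphism_iff hD hn h).trans
      ⟨fun h => (hc A G).unique hD G.isSht h, fun h => h ▸ hc A G⟩
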